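/- Let $k$ be a field, $H$ a Hopf algebra over $k$ with comultiplication $\Delta(h)=h_1\otimes h_2$, counit $\epsilon$ and antipode $S$, and let $A$ be a nonzero $H$-module algebra, that is, a $k$-algebra with a left $H$-module structure such that $h(ab)=(h_1a)(h_2b)$ and $h1=\epsilon(h)1$. Let $\Lambda=A\sharp H$ be the smash product: the space $A\otimes H$ with multiplication $(a\otimes h)(b\otimes l)=a(h_1b)\otimes h_2l$. For a $k$-algebra $B$ put $B^e=B\otimes_k B^{\rm op}$; $B$ is *homologically smooth* if it has a finite resolution by finitely generated projective $B^e$-modules, and it *has Van den Bergh duality of dimension $m$* if moreover ${\rm Ext}^i_{B^e}(B,B^e)=0$ for $i\ne m$ and the $B$-bimodule ${\rm Ext}^m_{B^e}(B,B^e)$ is invertible. Assume that $S$ is invertible and that $A$ and $H$ are homologically smooth. Then the following assertions are equivalent: (i) $A$ and $H$ both have Van den Bergh duality; (ii) $\Lambda$ has Van den Bergh duality. When these conditions are satisfied and $n$, $d$ are the dimensions of $A$ and $H$, then $\Lambda$ has Van den Bergh duality of dimension $n+d$, and there is an isomorphism of $\Lambda$-bimodules $${\rm Ext}^{n+d}_{\Lambda^e}(\Lambda,\Lambda^e)\simeq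 {\rm Ext}^n_{A^e}(A,A^e)\,\sharp\,{}^{\sigma}H,\qquad \sigma=(S^{-2}\circ\Xi^r_{\int_\ell})^{-1},$$ where: * ${\rm Ext}^d_H({}_Hk,H)$ is one-dimensional (and ${\rm Ext}^i_H({}_Hk,H)=0$ for $i\neq d$), $\int_\ell\colon H\to k$ is the algebra homomorphism such that the right $H$-module structure of ${\rm Ext}^d_H({}_Hk,H)$ is $e\cdot h=\int_\ell(h)e$, and $\Xi^r_{\int_\ell}(h)=h_1\int_\ell(h_2)$; the map $S^{-2}\circ\Xi^r_{\int_\ell}$ is an algebra automorphism of $H$, with inverse $\sigma$, and $\Delta(\sigma(h))=S^2(h_1)\otimes\sigma(h_2)$; * $D={\rm Ext}^n_{A^e}(A,A^e)$ is a left $H$-module such that $h\rightharpoonup(ad)=(h_1a)(h_2\rightharpoonup d)$ and $h\rightharpoonup(da)=(h_1\rightharpoonup d)(S^2(h_2)a)$. This $H$-action is induced by the action $(h\rightharpoonup f)(p)=(S^2(h_3)\otimes h_1)\,f(S(h_2)p)$ on ${\rm Hom}_{A^e}(P,A^e)$, for every resolution $P\to A$ by projective $A^e$-modules $P_i$ with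 left $H$-module structures such that $h(apb)=(h_1a)(h_2p)(h_3b)$ and such that the differentials and the augmentation are $H$-linear; here $H\otimes H$ acts factorwise on $A\otimes A^{\rm op}$, and such resolutions exist; * $D\,\sharp\,{}^{\sigma}H$ is the space $D\otimes H$ with $a(d\otimes l)b=ad(l_1b)\otimes l_2$ and $h(d\otimes l)h'=(h_1\rightharpoonup d)\otimes\sigma(h_2)lh'$ for $a,b\in A$, $h,h'\in H$. -/

import Mathlib

open CategoryTheory Coalgebra WithConv TensorProduct
open scoped ModuleCat

universe u

noncomputable section

namespace SmashDuality

section Bimodules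
variable (k A : Type u) [Field k] [Ring A] [Algebra k A]

/-- The enveloping algebra `A^e = A ⊗ A^op`. -/
abbrev Env : Type u := A ⊗[k] Aᵐᵒᵖ

/-- `A`-bimodules (over which `k` acts centrally), as left `A^e`-modules:
`(a ⊗ op b) • x = a x b`. -/
abbrev Bimod : Type (u + 1) := ModuleCat.{u} (Env k A)

variable {k A}

/-- Left multiplication `x ↦ a x` on a bimodule. -/
def lact (D : Bimod k A) : A →ₐ[k] Module.End k D :=
  (Algebra.lsmul k k D : Env k A →ₐ[k] Module.End k D).comp Algebra.TensorProduct.includeLeft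

/-- Right multiplication `x ↦ x b` on a bimodule, for `op b` in `A^op`. -/
def ract (D : Bimod k A) : Aᵐᵒᵖ →ₐ[k] Module.End k D :=
  (Algebra.lsmul k k D : Env k A →ₐ[k] Module.End k D).comp Algebra.TensorProduct.includeRight

/-- The bimodule on `V` given by commuting left and right multiplications. -/
def mkBimod (V : Type u) [AddCommGroup V] [Module k V]
    (l : A →ₐ[k] Module.End k V) (r : Aᵐᵒᵖ →ₐ[k] Module.End k V)
    (comm : ∀ a b, Commute (l a) (r b)) : Bimod k A :=
  letI : Module (Env k A) V := Module.compHom V (Algebra.TensorProduct.lift l r comm).toRingHom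
  ModuleCat.of (Env k A) V

lemma lact_ract_commute (D : Bimod k A) (a : A) (b : Aᵐᵒᵖ) : Commute (lact D a) (ract D b) := by
  have h : Commute (a ⊗ₜ[k] (1 : Aᵐᵒᵖ)) ((1 : A) ⊗ₜ[k] b) := by
    simp [Commute, SemiconjBy]
  exact h.map (Algebra.lsmul k k D : Env k A →ₐ[k] Module.End k D)

variable (k A) in
/-- `A` as a bimodule over itself. -/
def selfBimod : Bimod k A :=
  letI : Module (Env k A) A := Module.compHom A (AlgHom.mulLeftRight k A).toRingHom
  ModuleCat.of (Env k A) A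

/-- `D ⊗_k D'` with `a (x ⊗ y) b = a x ⊗ y b`. -/
def outerTensor (D D' : Bimod k A) : Bimod k A :=
  mkBimod (D ⊗[k] D')
    ((Module.End.rTensorAlgHom k D D').comp (lact D))
    ((Module.End.lTensorAlgHom k D' D).comp (ract D'))
    (fun a b => by
      refine TensorProduct.ext' fun x y => ?_
      rfl)

/-- The sub-bimodule of `D ⊗_k D'` spanned by the `x a ⊗ y - x ⊗ a y`. -/
def balancing (D D' : Bimod k A) : Submodule (Env k A) (outerTensor D D') :=
  Submodule.span (Env k A) (Set.range fun t : D × A × D' =>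
    (ract D (MulOpposite.op t.2.1) t.1 ⊗ₜ[k] t.2.2 - t.1 ⊗ₜ[k] lact D' t.2.1 t.2.2 : D ⊗[k] D'))

/-- The tensor product `D ⊗_A D'` of bimodules. -/
def tensorBimod (D D' : Bimod k A) : Bimod k A :=
  ModuleCat.of (Env k A) (outerTensor D D' ⧸ balancing D D')

/-- `D` is invertible: `D ⊗_A D' ≅ A` and `D' ⊗_A D ≅ A` as bimodules for some bimodule `D'`. -/
def IsInvertible (D : Bimod k A) : Prop :=
  ∃ D' : Bimod k A, Nonempty (tensorBimod D D' ≅ selfBimod k A) ∧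
    Nonempty (tensorBimod D' D ≅ selfBimod k A)
end Bimodules

section RightExt
variable {R : Type u} [Ring R]

/-- Right multiplication `x ↦ x r` on the left module `R`. -/
def rightMul (r : R) : ModuleCat.of R R ⟶ ModuleCat.of R R :=
  ModuleCat.ofHom (LinearMap.toSpanSingleton R R r)

/-- `Ext^n_R(M, R)` for a left module `M`; a right `R`-module, through right multiplication on the
coefficient module `R`. -/
def RightExt (M : ModuleCat.{u} R) (n : ℕ) : Type u :=
  Abelian.Ext M (ModuleCat.of R R) n

instance (M : ModuleCat.{u} R) (n : ℕ) : AddCommGroup (RightExt M n) :=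
  inferInstanceAs (AddCommGroup (Abelian.Ext M (ModuleCat.of R R) n))

open Abelian in
instance (M : ModuleCat.{u} R) (n : ℕ) : Module Rᵐᵒᵖ (RightExt M n) where
  smul r e := Ext.comp (show Ext _ _ n from e) (Ext.mk₀ (rightMul r.unop)) (add_zero n)
  one_smul e := by
    have : rightMul (1 : R) = 𝟙 _ := by
      ext; simp [rightMul]
    change Ext.comp _ (Ext.mk₀ (rightMul (1 : R))) _ = _
    rw [this]; exact Ext.comp_mk₀_id _
  mul_smul r s e := by
    have : rightMul (s.unop * r.unop) = rightMul s.unop ≫ rightMul r.unop := by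
      ext; simp [rightMul]
    change Ext.comp _ (Ext.mk₀ (rightMul (s.unop * r.unop))) _ = Ext.comp (Ext.comp _ _ _) _ _
    rw [this, ← Ext.mk₀_comp_mk₀, Ext.comp_assoc_of_third_deg_zero]
  smul_zero r := Ext.zero_comp ..
  smul_add r e e' := Ext.add_comp ..
  add_smul r s e := by
    have : rightMul (r.unop + s.unop) = rightMul r.unop + rightMul s.unop := by
      ext; simp [rightMul]
    change Ext.comp _ (Ext.mk₀ (rightMul (r.unop + s.unop))) _ = _
    rw [this, Ext.mk₀_add, Ext.comp_add]; rfl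
  zero_smul e := by
    have : rightMul (0 : R) = 0 := by
      ext; simp [rightMul]
    change Ext.comp _ (Ext.mk₀ (rightMul (0 : R))) _ = _
    rw [this, Ext.mk₀_zero, Ext.comp_zero]; rfl
end RightExt

section Duality
variable (k A : Type u) [Field k] [Ring A] [Algebra k A]

/-- The isomorphism `A^e ≃ (A^e)^op`, `a ⊗ op b ↦ op (b ⊗ op a)`. -/
def envFlip : Env k A ≃ₐ[k] (Env k A)ᵐᵒᵖ :=
  ((Algebra.TensorProduct.comm k A Aᵐᵒᵖ).trans
    (Algebra.TensorProduct.congr AlgEquiv.refl (AlgEquiv.opOp k A))).trans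
    (Algebra.TensorProduct.opAlgEquiv k k A Aᵐᵒᵖ)

lemma envFlip_tmul (a b : A) : envFlip k A (a ⊗ₜ MulOpposite.op b) =
   MulOpposite.op (b ⊗ₜ MulOpposite.op a) := by
  simp [envFlip]

/-- The bimodule `Ext^n_{A^e}(A, A^e)`: its right `A^e`-module structure, read as a left one.  For a
cocycle `f`, this is `(a f b) x = f x * (b ⊗ op a)`, that is, the inner bimodule structure of `A^e`. -/
def ExtBimod (n : ℕ) : Bimod k A :=
  letI : Module (Env k A) (RightExt (selfBimod k A) n) :=
    Module.compHom _ (envFlip k A).toAlgHom.toRingHom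
  ModuleCat.of (Env k A) (RightExt (selfBimod k A) n)

/-- `A` has a finite resolution by finitely generated projective `A^e`-modules. -/
def HomologicallySmooth : Prop :=
  ∃ P : ProjectiveResolution (selfBimod k A),
    (∀ i, Module.Finite (Env k A) (P.complex.X i)) ∧
    ∃ n : ℕ, ∀ i, n < i → Limits.IsZero (P.complex.X i)

/-- Van den Bergh duality of dimension `n`. -/
structure HasVanDenBerghDuality (n : ℕ) : Prop where
  smooth : HomologicallySmooth k A
  vanishing : ∀ i, i ≠ n → Subsingleton (ExtBimod k A i)
  invertible : IsInvertible (ExtBimod k A n)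
end Duality

section Hopf
variable (k H A : Type u) [Field k] [Ring H] [HopfAlgebra k H] [Ring A] [Algebra k A]

/-- An `H`-module algebra structure on `A`: a left `H`-module structure such that
`h 1 = ε(h) 1` and `h (a b) = (h₁ a) (h₂ b)`. -/
structure HopfAction where
  act : H →ₐ[k] Module.End k A
  act_one : ∀ h : H, act h 1 = algebraMap k A (counit h)
  act_mul : ∀ (h : H) (a b : A), act h (a * b) =
    LinearMap.mul' k A (TensorProduct.map (act.toLinearMap.flip a) (act.toLinearMap.flip b)
      (comul h))

variable {k H A} (α : HopfAction k H A)

/-- The map `h ↦ h a`. -/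
def HopfAction.on (a : A) : H →ₗ[k] A := α.act.toLinearMap.flip a

@[simp] lemma HopfAction.on_apply (a : A) (h : H) : α.on a h = α.act h a := rfl

section Covariant
variable {V : Type u} [AddCommGroup V] [Module k V]

/-- Left multiplications `L` by `A` and an action `ρ` of `H` on `V` satisfy `h (a v) = (h₁ a) (h₂ v)`. -/
def Covariant (L : A →ₐ[k] Module.End k V) (ρ : H →ₐ[k] Module.End k V) : Prop :=
  ∀ h a, ρ h * L a = LinearMap.mul' k (Module.End k V)
    (TensorProduct.map (L.toLinearMap ∘ₗ α.on a) ρ.toLinearMap (comul h))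

lemma Covariant.conv {α : HopfAction k H A} {L : A →ₐ[k] Module.End k V}
    {ρ : H →ₐ[k] Module.End k V} (hc : Covariant α L ρ) (a : A) :
    toConv (LinearMap.mulRight k (L a) ∘ₗ ρ.toLinearMap) =
      toConv (L.toLinearMap ∘ₗ α.on a) * toConv ρ.toLinearMap := by
  refine WithConv.ext (LinearMap.ext fun h => ?_)
  exact hc h a

lemma covariant_self : Covariant α (Algebra.lmul k A) α.act := by
  intro h a
  ext b
  simp only [Module.End.mul_apply]
  change α.act h (a * b) = _
  rw [α.act_mul, ← (ℛ k h).eq]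
  simp [Module.End.mul_apply]

variable {W : Type u} [AddCommGroup W] [Module k W]

/-- The diagonal action of `H` on `V ⊗ W`: `h (v ⊗ w) = h₁ v ⊗ h₂ w`. -/
def diagRep (ρ : H →ₐ[k] Module.End k V) (g : H →ₐ[k] Module.End k W) :
    H →ₐ[k] Module.End k (V ⊗[k] W) :=
  (Module.endTensorEndAlgHom (R := k) (S := k) (A := k)).comp
    ((Algebra.TensorProduct.map ρ g).comp (Bialgebra.comulAlgHom k H))

/-- The action of `A` on the left factor of `V ⊗ W`. -/
def leftRep (W : Type u) [AddCommGroup W] [Module k W] (L : A →ₐ[k] Module.End k V) :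
    A →ₐ[k] Module.End k (V ⊗[k] W) :=
  (Module.End.rTensorAlgHom k V W).comp L

@[simp] lemma leftRep_tmul (L : A →ₐ[k] Module.End k V) (a : A) (x : V) (y : W) :
    leftRep W L a (x ⊗ₜ[k] y) = L a x ⊗ₜ[k] y := rfl

lemma diagRep_eq (ρ : H →ₐ[k] Module.End k V) (g : H →ₐ[k] Module.End k W) (h : H) :
    diagRep ρ g h = ∑ i ∈ (ℛ k h).index,
      TensorProduct.map (ρ ((ℛ k h).left i)) (g ((ℛ k h).right i)) := by
  simp only [diagRep, AlgHom.comp_apply, Bialgebra.comulAlgHom_apply]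
  conv_lhs => rw [← (ℛ k h).eq]
  simp only [map_sum]
  rfl

lemma covariant_diag {L : A →ₐ[k] Module.End k V} {ρ : H →ₐ[k] Module.End k V}
    (hc : Covariant α L ρ) (g : H →ₐ[k] Module.End k W) :
    Covariant α (leftRep W L) (diagRep ρ g) := by
  set P : H →ₗ[k] Module.End k (V ⊗[k] W) :=
    (leftRep W (A := Module.End k V) (AlgHom.id k _)).toLinearMap ∘ₗ ρ.toLinearMap with hP
  set G : H →ₗ[k] Module.End k (V ⊗[k] W) :=
    (Module.End.lTensorAlgHom k W V).toLinearMap ∘ₗ g.toLinearMap with hG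
  have e1 : toConv (diagRep ρ g).toLinearMap = toConv P * toConv G := by
    refine WithConv.ext (LinearMap.ext fun h => ?_)
    change diagRep ρ g h = (toConv P * toConv G) h
    rw [(ℛ k h).convMul_apply, diagRep_eq]
    refine Finset.sum_congr rfl fun i _ => ?_
    exact TensorProduct.ext' fun x y => rfl
  have e2 : ∀ a, toConv (LinearMap.mulRight k (leftRep W L a) ∘ₗ P) =
      toConv ((leftRep W L).toLinearMap ∘ₗ α.on a) * toConv P := by
    intro a
    have := congrArg (fun f => toConv
      ((leftRep W (A := Module.End k V) (AlgHom.id k _)).toLinearMap ∘ₗ f.ofConv)) (hc.conv a)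
    simp only [LinearMap.algHom_comp_convMul_distrib] at this
    rw [WithConv.toConv_ofConv] at this
    refine Eq.trans ?_ this
    refine WithConv.ext (LinearMap.ext fun h => ?_)
    exact TensorProduct.ext' fun x y => rfl
  intro h a
  have e3 : toConv (LinearMap.mulRight k (leftRep W L a) ∘ₗ (diagRep ρ g).toLinearMap) =
      toConv (LinearMap.mulRight k (leftRep W L a) ∘ₗ P) * toConv G := by
    refine WithConv.ext (LinearMap.ext fun h => ?_)
    change diagRep ρ g h * leftRep W L a = (_ * toConv G : WithConv (H →ₗ[k] _)) h
    rw [(ℛ k h).convMul_apply]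
    have e1' := (congrArg (fun f => f h * leftRep W L a) e1)
    simp only [(ℛ k h).convMul_apply] at e1'
    refine Eq.trans e1' ?_
    rw [Finset.sum_mul]
    refine Finset.sum_congr rfl fun i _ => ?_
    change P _ * G _ * _ = P _ * _ * G _
    rw [mul_assoc, mul_assoc]
    congr 1
    exact TensorProduct.ext' fun x y => rfl
  rw [e2, mul_assoc, ← e1] at e3
  exact congrArg (fun f => f h) e3

/-- `a ⊗ h` acts on `V` as the composite of `a` and `h`. -/
def smashRep (L : A →ₐ[k] Module.End k V) (ρ : H →ₐ[k] Module.End k V) :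
    A ⊗[k] H →ₗ[k] Module.End k V :=
  TensorProduct.lift ((LinearMap.mul k (Module.End k V)).compl₁₂ L.toLinearMap ρ.toLinearMap)

@[simp] lemma smashRep_tmul (L : A →ₐ[k] Module.End k V) (ρ : H →ₐ[k] Module.End k V) (a h) :
    smashRep L ρ (a ⊗ₜ h) = L a * ρ h := rfl

/-- The multiplication `(a ⊗ h) (b ⊗ l) = a (h₁ b) ⊗ h₂ l`; the explicit formula is `smashMul_tmul`. -/
def smashMul : A ⊗[k] H →ₗ[k] A ⊗[k] H →ₗ[k] A ⊗[k] H :=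
  smashRep (leftRep H (Algebra.lmul k A)) (diagRep α.act (Algebra.lmul k H))

lemma smashMul_tmul (a b : A) (h l : H) : smashMul α (a ⊗ₜ h) (b ⊗ₜ l) =
    TensorProduct.map (LinearMap.mulLeft k a ∘ₗ α.on b) (LinearMap.mulRight k l) (comul h) := by
  simp only [smashMul, smashRep_tmul, Module.End.mul_apply, diagRep_eq]
  conv_rhs => rw [← (ℛ k h).eq]
  simp [LinearMap.sum_apply]

lemma smashRep_mul {L : A →ₐ[k] Module.End k V} {ρ : H →ₐ[k] Module.End k V}
    (hc : Covariant α L ρ) (x y : A ⊗[k] H) :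
    smashRep L ρ (smashMul α x y) = smashRep L ρ x * smashRep L ρ y := by
  induction x using TensorProduct.induction_on with
  | zero => simp
  | add x x' h h' => simp [add_mul, h, h']
  | tmul a h =>
    induction y using TensorProduct.induction_on with
    | zero => simp
    | add x x' h h' => simp [mul_add, h, h']
    | tmul b l =>
      have := hc h b
      rw [smashMul_tmul, smashRep_tmul, smashRep_tmul, mul_assoc, ← mul_assoc (ρ h), this,
        ← (ℛ k h).eq]
      simp [Finset.mul_sum, Finset.sum_mul, mul_assoc]
end Covariant

/-- The smash product `A ♯ H`: the space `A ⊗ H` with multiplication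
`(a ⊗ h) (b ⊗ l) = a (h₁ b) ⊗ h₂ l`. -/
def Smash (_α : HopfAction k H A) : Type u := A ⊗[k] H

namespace Smash
instance : AddCommGroup (Smash α) := inferInstanceAs (AddCommGroup (A ⊗[k] H))
instance : Module k (Smash α) := inferInstanceAs (Module k (A ⊗[k] H))

/-- The underlying vector space. -/
def equiv : Smash α ≃ₗ[k] A ⊗[k] H := LinearEquiv.refl k (A ⊗[k] H)

lemma covariant_mul :
    Covariant α (leftRep H (Algebra.lmul k A)) (diagRep α.act (Algebra.lmul k H)) :=
  covariant_diag α (covariant_self α) _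

lemma smashMul_assoc (x y z : A ⊗[k] H) :
    smashMul α (smashMul α x y) z = smashMul α x (smashMul α y z) :=
  congrArg (fun f => f z) (smashRep_mul α (covariant_mul α) x y)

lemma one_smashMul (x : A ⊗[k] H) : smashMul α ((1 : A) ⊗ₜ[k] (1 : H)) x = x := by
  simp [smashMul]

lemma smashMul_one (x : A ⊗[k] H) : smashMul α x ((1 : A) ⊗ₜ[k] (1 : H)) = x := by
  induction x using TensorProduct.induction_on with
  | zero => simp
  | add x y hx hy => simp [hx, hy]
  | tmul a h =>
    rw [smashMul_tmul, ← (ℛ k h).eq]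
    conv_rhs => rw [← sum_counit_smul (ℛ k h)]
    simp [α.act_one, tmul_sum, Algebra.algebraMap_eq_smul_one, smul_tmul']

instance : Ring (Smash α) where
  __ := (inferInstance : AddCommGroup (Smash α))
  mul x y := smashMul α x y
  one := (1 : A) ⊗ₜ[k] (1 : H)
  mul_assoc := smashMul_assoc α
  one_mul := one_smashMul α
  mul_one := smashMul_one α
  left_distrib x y z := map_add (smashMul α x) y z
  right_distrib x y z := LinearMap.map_add₂ (smashMul α) x y z
  zero_mul x := LinearMap.map_zero₂ (smashMul α) x
  mul_zero x := map_zero (smashMul α x)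

instance : Algebra k (Smash α) :=
  Algebra.ofModule (fun c x y => LinearMap.map_smul₂ (smashMul α) c x y)
    (fun c x y => map_smul (smashMul α x) c y)

/-- A covariant pair of actions is an action of `A ♯ H`. -/
def rep {V : Type u} [AddCommGroup V] [Module k V]
    (L : A →ₐ[k] Module.End k V) (ρ : H →ₐ[k] Module.End k V) (hc : Covariant α L ρ) :
    Smash α →ₐ[k] Module.End k V :=
  AlgHom.ofLinearMap (show A ⊗[k] H →ₗ[k] Module.End k V from smashRep L ρ)
    (by change smashRep L ρ (1 ⊗ₜ 1) = 1; simp) (smashRep_mul α hc)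
end Smash

section AntipodeLemmas
open HopfAlgebra

lemma conv_antipode_left {B : Type u} [Ring B] [Algebra k B] (f : H →ₐ[k] B) :
    toConv (f.toLinearMap ∘ₗ antipode k) * toConv f.toLinearMap = 1 := by
  have := congrArg (fun g => toConv (f.toLinearMap ∘ₗ g.ofConv))
    (LinearMap.antipode_mul_id (R := k) (C := H))
  simp only [LinearMap.algHom_comp_convMul_distrib] at this
  rw [WithConv.toConv_ofConv] at this
  refine Eq.trans this ?_
  refine WithConv.ext (LinearMap.ext fun h => ?_)
  exact f.commutes _

lemma conv_antipode_right {B : Type u} [Ring B] [Algebra k B] (f : H →ₐ[k] B) :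
    toConv f.toLinearMap * toConv (f.toLinearMap ∘ₗ antipode k) = 1 := by
  have := congrArg (fun g => toConv (f.toLinearMap ∘ₗ g.ofConv))
    (LinearMap.id_mul_antipode (R := k) (C := H))
  simp only [LinearMap.algHom_comp_convMul_distrib] at this
  rw [WithConv.toConv_ofConv] at this
  refine Eq.trans this ?_
  refine WithConv.ext (LinearMap.ext fun h => ?_)
  exact f.commutes _

lemma comul_antipode (h : H) : comul (antipode k h) =
    TensorProduct.map (antipode k) (antipode k) (TensorProduct.comm k H H (comul h)) := by
  set i1 : H →ₐ[k] H ⊗[k] H := Algebra.TensorProduct.includeLeft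
  set i2 : H →ₐ[k] H ⊗[k] H := Algebra.TensorProduct.includeRight
  have e1 : toConv (comul : H →ₗ[k] H ⊗[k] H) = toConv i1.toLinearMap * toConv i2.toLinearMap := by
    refine WithConv.ext (LinearMap.ext fun h => ?_)
    change comul h = (toConv i1.toLinearMap * toConv i2.toLinearMap) h
    rw [(ℛ k h).convMul_apply]
    conv_lhs => rw [← (ℛ k h).eq]
    simp [i1, i2]
  have e2 : toConv (TensorProduct.map (antipode k) (antipode k) ∘ₗ
      (TensorProduct.comm k H H).toLinearMap ∘ₗ (comul : H →ₗ[k] H ⊗[k] H)) =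
      toConv (i2.toLinearMap ∘ₗ antipode k) * toConv (i1.toLinearMap ∘ₗ antipode k) := by
    refine WithConv.ext (LinearMap.ext fun h => ?_)
    change _ = (toConv (i2.toLinearMap ∘ₗ antipode k) * toConv (i1.toLinearMap ∘ₗ antipode k)) h
    rw [(ℛ k h).convMul_apply]
    simp only [LinearMap.comp_apply]
    conv_lhs => rw [← (ℛ k h).eq]
    simp [i1, i2]
  have e3 := left_inv_eq_right_inv (a := toConv (comul : H →ₗ[k] H ⊗[k] H))
    (b := toConv (TensorProduct.map (antipode k) (antipode k) ∘ₗ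
      (TensorProduct.comm k H H).toLinearMap ∘ₗ (comul : H →ₗ[k] H ⊗[k] H)))
    (c := toConv (comul ∘ₗ antipode k))
    (by rw [e1, e2, mul_assoc, ← mul_assoc (toConv (i1.toLinearMap ∘ₗ antipode k)),
          conv_antipode_left, one_mul, conv_antipode_left])
    (LinearMap.comul_right_inv)
  exact (congrArg (fun f => f h) e3).symm

lemma Covariant.antipode {α : HopfAction k H A} {V : Type u} [AddCommGroup V] [Module k V]
    {L : A →ₐ[k] Module.End k V} {ρ : H →ₐ[k] Module.End k V} (hc : Covariant α L ρ) (a : A) :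
    toConv (ρ.toLinearMap ∘ₗ HopfAlgebra.antipode k) * toConv (L.toLinearMap ∘ₗ α.on a) =
      toConv (LinearMap.mulLeft k (L a) ∘ₗ ρ.toLinearMap ∘ₗ HopfAlgebra.antipode k) := by
  have e1 : toConv (ρ.toLinearMap ∘ₗ HopfAlgebra.antipode k) *
      toConv (LinearMap.mulRight k (L a) ∘ₗ ρ.toLinearMap) =
      toConv (LinearMap.mulRight k (L a) ∘ₗ
        (1 : WithConv (H →ₗ[k] Module.End k V)).ofConv) := by
    rw [← conv_antipode_left ρ]
    refine WithConv.ext (LinearMap.ext fun h => ?_)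
    change (_ * _ : WithConv (H →ₗ[k] Module.End k V)) h =
      (_ * _ : WithConv (H →ₗ[k] Module.End k V)) h * L a
    rw [(ℛ k h).convMul_apply, (ℛ k h).convMul_apply, Finset.sum_mul]
    refine Finset.sum_congr rfl fun i _ => ?_
    simp [mul_assoc]
  have e2 : toConv (ρ.toLinearMap ∘ₗ HopfAlgebra.antipode k) * toConv (L.toLinearMap ∘ₗ α.on a) =
      toConv (LinearMap.mulRight k (L a) ∘ₗ
        (1 : WithConv (H →ₗ[k] Module.End k V)).ofConv) *
      toConv (ρ.toLinearMap ∘ₗ HopfAlgebra.antipode k) := by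
    rw [← e1, hc.conv, mul_assoc, mul_assoc, conv_antipode_right, mul_one]
  rw [e2]
  have e3 : toConv (LinearMap.mulRight k (L a) ∘ₗ
        (1 : WithConv (H →ₗ[k] Module.End k V)).ofConv) *
      toConv (ρ.toLinearMap ∘ₗ HopfAlgebra.antipode k) =
      toConv (LinearMap.mulLeft k (L a) ∘ₗ (1 * toConv
        (ρ.toLinearMap ∘ₗ HopfAlgebra.antipode k)).ofConv) := by
    refine WithConv.ext (LinearMap.ext fun h => ?_)
    change (_ * _ : WithConv (H →ₗ[k] Module.End k V)) h =
      L a * (_ * _ : WithConv (H →ₗ[k] Module.End k V)) h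
    rw [(ℛ k h).convMul_apply, (ℛ k h).convMul_apply, Finset.mul_sum]
    refine Finset.sum_congr rfl fun i _ => ?_
    change algebraMap k _ _ * L a * _ = L a * (algebraMap k _ _ * _)
    rw [← mul_assoc, Algebra.commutes]
  rw [e3, one_mul]
end AntipodeLemmas

section Equivariant

variable (k H) in
/-- `S²`. -/
def antipodeSq : H →ₗ[k] H := HopfAlgebra.antipode k ∘ₗ HopfAlgebra.antipode k

/-- `a ↦ op a`. -/
def opLin : A →ₗ[k] Aᵐᵒᵖ := (MulOpposite.opLinearEquiv k).toLinearMap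

/-- An `H`-equivariant structure of type `τ` on the `A`-bimodule `D`: an `H`-module structure with
`h (a x) = (h₁ a) (h₂ x)` and `h (x b) = (h₁ x) (τ(h₂) b)`.  For `τ = id` these are the
`H`-equivariant bimodules, for `τ = S²` the `H_{S²}`-equivariant ones. -/
structure EquivariantStr (τ : H →ₗ[k] H) (D : Bimod k A) where
  act : H →ₐ[k] Module.End k D
  act_left : Covariant α (lact D) act
  act_right : ∀ (h : H) (b : A), act h * ract D (MulOpposite.op b) =
    LinearMap.mul' k (Module.End k D)
      (TensorProduct.map ((ract D).toLinearMap ∘ₗ opLin ∘ₗ α.on b ∘ₗ τ) act.toLinearMap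
        (TensorProduct.comm k H H (comul h)))

variable (H) in
/-- `d, a ⊗ h ↦ d a ⊗ h`. -/
def pushRight (D : Bimod k A) : D →ₗ[k] A ⊗[k] H →ₗ[k] D ⊗[k] H :=
  LinearMap.rTensorHom H ∘ₗ ((ract D).toLinearMap ∘ₗ opLin).flip

@[simp] lemma pushRight_tmul (D : Bimod k A) (d : D) (a : A) (h : H) :
    pushRight H D d (a ⊗ₜ h) = ract D (MulOpposite.op a) d ⊗ₜ[k] h := rfl

/-- Right multiplication on `D ⊗ H` by `b ⊗ k`: `(d ⊗ l) (b ⊗ k) = d (l₁ b) ⊗ l₂ k`. -/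
def twistRightFun (D : Bimod k A) (y : A ⊗[k] H) : D ⊗[k] H →ₗ[k] D ⊗[k] H :=
  TensorProduct.lift ((pushRight H D).compl₂
    ((smashMul α).flip y ∘ₗ TensorProduct.mk k A H 1))

@[simp] lemma twistRightFun_tmul (D : Bimod k A) (y : A ⊗[k] H) (d : D) (l : H) :
    twistRightFun α D y (d ⊗ₜ l) = pushRight H D d (smashMul α (1 ⊗ₜ l) y) := rfl

lemma smashMul_tmul_eq (a : A) (h : H) : smashMul α (a ⊗ₜ h) =
    leftRep H (Algebra.lmul k A) a * diagRep α.act (Algebra.lmul k H) h := rfl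

lemma smashMul_one_tmul (h : H) : smashMul α (1 ⊗ₜ h) = diagRep α.act (Algebra.lmul k H) h := by
  rw [smashMul_tmul_eq, map_one, one_mul]

lemma pushRight_ract (D : Bimod k A) (d : D) (a : A) (v : A ⊗[k] H) :
    pushRight H D (ract D (MulOpposite.op a) d) v =
      pushRight H D d (leftRep H (Algebra.lmul k A) a v) := by
  induction v using TensorProduct.induction_on with
  | zero => simp
  | add x y hx hy => simp [hx, hy]
  | tmul b h => simp [MulOpposite.op_mul]

lemma twistRightFun_push (D : Bimod k A) (y w : A ⊗[k] H) (d : D) :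
    twistRightFun α D y (pushRight H D d w) = pushRight H D d (smashMul α w y) := by
  induction w using TensorProduct.induction_on with
  | zero => simp
  | add x y hx hy => simp [hx, hy]
  | tmul b h =>
    rw [pushRight_tmul, twistRightFun_tmul, pushRight_ract, smashMul_one_tmul, smashMul_tmul_eq]
    rfl

lemma twistRightFun_add (D : Bimod k A) (x y : A ⊗[k] H) :
    twistRightFun α D (x + y) = twistRightFun α D x + twistRightFun α D y :=
  TensorProduct.ext' fun d l => by simp

lemma twistRightFun_smul (D : Bimod k A) (c : k) (x : A ⊗[k] H) :
    twistRightFun α D (c • x) = c • twistRightFun α D x :=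
  TensorProduct.ext' fun d l => by simp

lemma twistRightFun_one (D : Bimod k A) :
    twistRightFun α D ((1 : A) ⊗ₜ[k] (1 : H)) = LinearMap.id :=
  TensorProduct.ext' fun d l => by
    rw [twistRightFun_tmul, Smash.smashMul_one]; simp

lemma twistRightFun_mul (D : Bimod k A) (x y : A ⊗[k] H) :
    twistRightFun α D (smashMul α y x) = twistRightFun α D x ∘ₗ twistRightFun α D y :=
  TensorProduct.ext' fun d l => by
    rw [LinearMap.comp_apply, twistRightFun_tmul, twistRightFun_tmul, twistRightFun_push,
      Smash.smashMul_assoc]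

/-- The right action of `A ♯ H` on `D ⊗ H`: `(d ⊗ l) (b ⊗ k) = d (l₁ b) ⊗ l₂ k`. -/
def twistRight (D : Bimod k A) : (Smash α)ᵐᵒᵖ →ₐ[k] Module.End k (D ⊗[k] H) :=
  AlgHom.ofLinearMap
    { toFun := fun y => twistRightFun α D (Smash.equiv α y.unop)
      map_add' := fun _ _ => twistRightFun_add α D _ _
      map_smul' := fun _ _ => twistRightFun_smul α D _ _ }
    (twistRightFun_one α D)
    (fun _ _ => twistRightFun_mul α D _ _)

/-- `Δ(σ(h)) = S²(h₁) ⊗ σ(h₂)`. -/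
def IsTwist (σ : H ≃ₐ[k] H) : Prop :=
  ∀ h, comul (σ h) = TensorProduct.map (antipodeSq k H) σ.toLinearMap (comul h)

lemma leftRep_push (D : Bimod k A) (a : A) (d : D) (v : A ⊗[k] H) :
    leftRep H (lact D) a (pushRight H D d v) = pushRight H D (lact D a d) v := by
  induction v using TensorProduct.induction_on with
  | zero => simp
  | add x y hx hy => simp [hx, hy]
  | tmul b h =>
    simp only [pushRight_tmul, leftRep_tmul]
    congr 1
    exact congrArg (fun f => f d) (lact_ract_commute D a (MulOpposite.op b)).eq

variable {α} {D : Bimod k A}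

lemma diagRep_push (β : EquivariantStr α (antipodeSq k H) D) (σ : H ≃ₐ[k] H) (hσ : IsTwist σ)
    (h : H) (d : D) (v : A ⊗[k] H) :
    diagRep β.act ((Algebra.lmul k H).comp σ.toAlgHom) h (pushRight H D d v) =
      ∑ i ∈ (ℛ k h).index, pushRight H D (β.act ((ℛ k h).left i) d)
        (smashMul α (1 ⊗ₜ σ ((ℛ k h).right i)) v) := by
  induction v using TensorProduct.induction_on with
  | zero => simp
  | add x y hx hy => simp [hx, hy, Finset.sum_add_distrib]
  | tmul b l =>
    let Θ : H ⊗[k] (H ⊗[k] H) →ₗ[k] D ⊗[k] H :=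
      TensorProduct.map
        (TensorProduct.lift ((((ract D).toLinearMap ∘ₗ opLin ∘ₗ α.on b ∘ₗ antipodeSq k H).flip).compl₁₂
          (β.act.toLinearMap.flip d) LinearMap.id))
        (LinearMap.mulRight k l ∘ₗ σ.toLinearMap) ∘ₗ (TensorProduct.assoc k H H H).symm.toLinearMap
    have hΘ : ∀ p q s, Θ (p ⊗ₜ (q ⊗ₜ s)) =
      ract D (MulOpposite.op (α.act (antipodeSq k H q) b)) (β.act p d) ⊗ₜ[k] (σ s * l) :=
      fun p q s => rfl
    have key := congrArg Θ (sum_tmul_tmul_eq (ℛ k h) (fun i => ℛ k ((ℛ k h).left i))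
      (fun i => ℛ k ((ℛ k h).right i)))
    simp only [map_sum, hΘ] at key
    refine Eq.trans ?_ (key.trans ?_)
    · rw [diagRep_eq, LinearMap.sum_apply]
      refine Finset.sum_congr rfl fun i _ => ?_
      rw [pushRight_tmul, TensorProduct.map_tmul]
      have := congrArg (fun f => f d) (β.act_right ((ℛ k h).left i) b)
      simp only [Module.End.mul_apply] at this
      rw [this, ← (ℛ k ((ℛ k h).left i)).eq]
      simp only [map_sum, TensorProduct.comm_tmul, TensorProduct.map_tmul, LinearMap.mul'_apply,
        LinearMap.sum_apply, TensorProduct.sum_tmul]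
      rfl
    · refine Finset.sum_congr rfl fun i _ => ?_
      rw [smashMul_tmul, hσ]
      conv_rhs => rw [← (ℛ k ((ℛ k h).right i)).eq]
      simp only [map_sum, TensorProduct.map_tmul, pushRight_tmul]
      refine Finset.sum_congr rfl fun j _ => ?_
      simp

lemma leftRep_twistRightFun (D : Bimod k A) (a : A) (y : A ⊗[k] H) :
    Commute (leftRep H (lact D) a) (twistRightFun α D y) :=
  TensorProduct.ext' fun d l => by
    rw [Module.End.mul_apply, Module.End.mul_apply, leftRep_tmul, twistRightFun_tmul,
      twistRightFun_tmul, leftRep_push]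

lemma diagRep_twistRightFun (β : EquivariantStr α (antipodeSq k H) D) (σ : H ≃ₐ[k] H)
    (hσ : IsTwist σ) (h : H) (y : A ⊗[k] H) :
    Commute (diagRep β.act ((Algebra.lmul k H).comp σ.toAlgHom) h) (twistRightFun α D y) :=
  TensorProduct.ext' fun d l => by
    rw [Module.End.mul_apply, Module.End.mul_apply, twistRightFun_tmul, diagRep_push β σ hσ,
      diagRep_eq, LinearMap.sum_apply, map_sum]
    refine Finset.sum_congr rfl fun i _ => ?_
    rw [TensorProduct.map_tmul, twistRightFun_tmul]
    change _ = pushRight H D _ (smashMul α (1 ⊗ₜ (σ _ * l)) _)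
    rw [smashMul_one_tmul, smashMul_one_tmul, smashMul_one_tmul, map_mul]
    rfl

lemma smashRep_twistRightFun (β : EquivariantStr α (antipodeSq k H) D) (σ : H ≃ₐ[k] H)
    (hσ : IsTwist σ) (x y : A ⊗[k] H) :
    Commute (smashRep (leftRep H (lact D)) (diagRep β.act ((Algebra.lmul k H).comp σ.toAlgHom)) x)
      (twistRightFun α D y) := by
  induction x using TensorProduct.induction_on with
  | zero => simp
  | add x y hx hy => rw [map_add]; exact hx.add_left hy
  | tmul a h =>
    exact (leftRep_twistRightFun D a y).mul_left (diagRep_twistRightFun β σ hσ h y)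

/-- The `A ♯ H`-bimodule `D ♯ ^σH`: the space `D ⊗ H` with
`a (d ⊗ l) b = a d (l₁ b) ⊗ l₂` and `h (d ⊗ l) k = h₁ d ⊗ σ(h₂) l k`. -/
def smashTwist (β : EquivariantStr α (antipodeSq k H) D) (σ : H ≃ₐ[k] H) (hσ : IsTwist σ) :
    Bimod k (Smash α) :=
  mkBimod (D ⊗[k] H)
    (Smash.rep α (leftRep H (lact D)) (diagRep β.act ((Algebra.lmul k H).comp σ.toAlgHom))
      (covariant_diag α β.act_left _))
    (twistRight α D)
    (fun x y => smashRep_twistRightFun β σ hσ x (Smash.equiv α y.unop))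
end Equivariant
end Hopf
section HActSec
variable {k H A : Type u} [Field k] [Ring H] [HopfAlgebra k H] [Ring A] [Algebra k A]
variable (α : HopfAction k H A)

/-- `h` acting on the left factor of `A^e`: `a ⊗ b ↦ h a ⊗ b`. -/
def actFst : H →ₗ[k] Module.End k (Env k A) :=
  LinearMap.rTensorHom Aᵐᵒᵖ ∘ₗ α.act.toLinearMap

lemma actFst_tmul (h : H) (a b : A) : actFst α h (a ⊗ₜ[k] MulOpposite.op b) =
    α.act h a ⊗ₜ[k] MulOpposite.op b := rfl

/-- `h` acting on the right factor of `A^e`: `a ⊗ b ↦ a ⊗ h b`. -/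
def actSnd : H →ₗ[k] Module.End k (Env k A) :=
  LinearMap.lTensorHom A ∘ₗ
    (LinearEquiv.conj (MulOpposite.opLinearEquiv k : A ≃ₗ[k] Aᵐᵒᵖ)).toLinearMap ∘ₗ
      α.act.toLinearMap

lemma actSnd_tmul (h : H) (a b : A) : actSnd α h (a ⊗ₜ[k] MulOpposite.op b) =
    a ⊗ₜ[k] MulOpposite.op (α.act h b) := rfl

variable {α} {P : Bimod k A}

/-- A morphism of bimodules as a `k`-linear map. -/
def toLin (f : P ⟶ ModuleCat.of (Env k A) (Env k A)) : P →ₗ[k] Env k A where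
  toFun x := f.hom x
  map_add' x y := map_add f.hom x y
  map_smul' c x := by
    change f.hom (c • x) = c • f.hom x
    rw [← algebraMap_smul (Env k A) c x, map_smul, ← algebraMap_smul (Env k A) c]

open LinearMap in
/-- The action of `H` on maps `f` from an equivariant bimodule `P` to `A^e`:
`(h f) p = (S²(h₃) ⊗ h₁) (f (S(h₂) p))`, with `H` acting on each factor of `A^e = A ⊗ A^op`;
spelled out in `homAct_eq`. -/
def homAct (γ : EquivariantStr α LinearMap.id P) : H →ₗ[k] Module.End k (P →ₗ[k] Env k A) :=
  (toConv (llcomp k P (Env k A) (Env k A) ∘ₗ actSnd α) *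
    (toConv ((llcomp k P P (Env k A)).flip ∘ₗ γ.act.toLinearMap ∘ₗ HopfAlgebra.antipode k) *
    toConv (llcomp k P (Env k A) (Env k A) ∘ₗ actFst α ∘ₗ antipodeSq k H))).ofConv

lemma homAct_eq (γ : EquivariantStr α LinearMap.id P) (h : H) (f : P →ₗ[k] Env k A) (p : P) :
    homAct γ h f p = ∑ i ∈ (ℛ k h).index, ∑ j ∈ (ℛ k ((ℛ k h).right i)).index,
      actSnd α ((ℛ k h).left i)
      (actFst α (antipodeSq k H ((ℛ k ((ℛ k h).right i)).right j)) (f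
      (γ.act (HopfAlgebra.antipode k ((ℛ k ((ℛ k h).right i)).left j)) p))) := by
  change (_ * (_ * _) : WithConv (H →ₗ[k] Module.End k (P →ₗ[k] Env k A))) h f p = _
  rw [(ℛ k h).convMul_apply, LinearMap.sum_apply, LinearMap.sum_apply]
  refine Finset.sum_congr rfl fun i _ => ?_
  rw [(ℛ k _).convMul_apply, Finset.mul_sum, LinearMap.sum_apply, LinearMap.sum_apply]
  rfl
end HActSec
section CanonSec
variable {k H A : Type u} [Field k] [Ring H] [HopfAlgebra k H] [Ring A] [Algebra k A]
variable (α : HopfAction k H A)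

variable (k A) in
/-- The underlying space of the bimodule `A` is `A`. -/
def ofSelf : selfBimod k A → A := fun x => x

/-- A resolution of the bimodule `A` by `H`-equivariant bimodules which are projective as
`A^e`-modules, with `H`-linear differentials and augmentation. -/
structure EquivariantResolution where
  res : ProjectiveResolution (selfBimod k A)
  str : ∀ i, EquivariantStr α LinearMap.id (res.complex.X i)
  d_act : ∀ i j h x, (res.complex.d i j).hom ((str i).act h x) =
    (str j).act h ((res.complex.d i j).hom x)
  aug_act : ∀ h x, ofSelf k A ((res.π.f 0 ≫ (HomologicalComplex.singleObjXSelf _ 0 _).hom).hom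
    ((str 0).act h x)) =
      α.act h (ofSelf k A ((res.π.f 0 ≫ (HomologicalComplex.singleObjXSelf _ 0 _).hom).hom x))

variable {α}

/-- The class in `Ext^n_{A^e}(A, A^e)` of a cocycle. -/
def extClass (R : ProjectiveResolution (selfBimod k A)) (n : ℕ)
    (f : R.complex.X n ⟶ ModuleCat.of (Env k A) (Env k A))
    (hf : R.complex.d (n + 1) n ≫ f = 0) : ExtBimod k A n :=
  R.extMk f (n + 1) rfl hf

/-- The `H`-action on `Ext^n_{A^e}(A, A^e)` is the one induced, in every `H`-equivariant resolution
`P` of `A`, by the action of `H` on the complex `Hom_{A^e}(P, A^e)`. -/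
def EquivariantStr.IsCanonical {n : ℕ}
    (β : EquivariantStr α (antipodeSq k H) (ExtBimod k A n)) : Prop :=
  ∀ (R : EquivariantResolution α) (h : H)
    (f : R.res.complex.X n ⟶ ModuleCat.of (Env k A) (Env k A))
    (hf : R.res.complex.d (n + 1) n ≫ f = 0),
    ∃ (g : R.res.complex.X n ⟶ ModuleCat.of (Env k A) (Env k A))
      (hg : R.res.complex.d (n + 1) n ≫ g = 0),
      toLin g = homAct (R.str n) h (toLin f) ∧
      β.act h (extClass R.res n f hf) = extClass R.res n g hg

variable (k H) in
/-- The trivial left `H`-module `k`, on which `h` acts as `ε(h)`. -/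
def trivialModule : ModuleCat.{u} H :=
  letI : Module H k := Module.compHom k (Bialgebra.counitAlgHom k H).toRingHom
  ModuleCat.of H k

/-- `Ext^i_H(k, H)` is zero for `i ≠ d` and one-dimensional for `i = d`, and `π` is the character by
which `H` acts on `Ext^d_H(k, H)` on the right: `e h = π(h) e`.  So `π` is the left homological
integral of `H`. -/
structure IsLeftHomologicalIntegral (d : ℕ) (π : H →ₐ[k] k) : Prop where
  vanishing : ∀ i, i ≠ d → Subsingleton (RightExt (trivialModule k H) i)
  one_dim : ∃ e : RightExt (trivialModule k H) d, e ≠ 0 ∧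
    ∀ x : RightExt (trivialModule k H) d, ∃ c : k, x = MulOpposite.op (algebraMap k H c) • e
  character : ∀ (h : H) (e : RightExt (trivialModule k H) d),
    MulOpposite.op h • e = MulOpposite.op (algebraMap k H (π h)) • e

lemma commute_ofId (π : H →ₐ[k] k) (x y : H) :
    Commute (AlgHom.id k H x) ((Algebra.ofId k H).comp π y) :=
  (Algebra.commutes (π y) x).symm

/-- The right winding endomorphism `Ξ^r_π`: `h ↦ h₁ π(h₂)`; see `rightWinding_eq`. -/
def rightWinding (π : H →ₐ[k] k) : H →ₐ[k] H :=
  (Algebra.TensorProduct.lift (AlgHom.id k H) ((Algebra.ofId k H).comp π)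
    (commute_ofId π)).comp (Bialgebra.comulAlgHom k H)

lemma rightWinding_eq (π : H →ₐ[k] k) (h : H) :
    rightWinding π h = ∑ i ∈ (ℛ k h).index, π ((ℛ k h).right i) • (ℛ k h).left i := by
  simp only [rightWinding, AlgHom.comp_apply, Bialgebra.comulAlgHom_apply]
  conv_lhs => rw [← (ℛ k h).eq]
  rw [map_sum]
  refine Finset.sum_congr rfl fun i _ => ?_
  rw [Algebra.TensorProduct.lift_tmul, Algebra.smul_def, Algebra.commutes]
  rfl
end CanonSec

end SmashDuality

end

open SmashDuality

/-!
Write `Λ = A ♯ H`, with its subalgebras `i : A → Λ` and `j : H → Λ`; multiplication identifies both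
`A ⊗ H` and, since the antipode `S` is bijective, `H ⊗ A` with `Λ` (`SmashPair`). Taking `A = k`
makes `H` itself a smash product, so that one argument serves `Λ` and `H`.

**Two exact functors.** There is an exact functor `F` from left `H`-modules to `Λ`-bimodules, with
underlying space `Λ ⊗ K`, which preserves projectives and takes the trivial module `k` to `Λ`
(`trivialIso`). Induction `G` from `A`-bimodules to `Λ`-bimodules is exact as well, and `G(A)` is
`F(H)`. An algebra is homologically smooth exactly when it lies in the thick closure of its
enveloping algebra (`homologicallySmooth_iff`), and if `H` is smooth then `k` lies in the thick
closure of `H` (`thickClosure_trivialModule`). No smoothness of `Λ` has to be assumed: `F` and `G`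
carry these facts to `Λ`.

**Products.** Composing classes of `Ext_H(k, H)`, transported by `F`, with classes of
`Ext_{A^e}(A, A^e)`, transported by `G`, gives products
`Ext^p_H(k, H) ⊗ Ext^q_{A^e}(A, A^e) ⊗ H → Ext^{p+q}_{Λ^e}(Λ, Λ^e)`. A product with fixed classes that
is bijective for a generator is bijective on its thick closure, by the five lemma
(`cupTot_bijective`, `cupTensor_graded`). With the generators `A^e` and `H`, all products are
injective (`prodMap_injective`), a nonzero `Ext^n_{Λ^e}(Λ, Λ^e)` comes from nonzero factors
(`exists_nontrivial`), and when `Ext_{A^e}(A, A^e)` lies in one degree the products are bijective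
(`prodMap_bijective`).

**The `H`-action.** `H` acts on the classes of `Ext^q(F(H), Λ^e)` by `⋆`, which combines the two
actions of `H` on `Λ^e` with the right multiplications of `F(H)`. Computed on cocycles of an
equivariant resolution of `A`, it restricts to the action of `H` on `D = Ext^q_{A^e}(A, A^e)`, with
the twist by `S²` (`exists_equivariantStr`); such resolutions exist because every equivariant
bimodule is covered by a free one, with an equivariant kernel (`exists_equivariantResolution`). The
resulting formula for left multiplication by `j(h)` on products (`lj_prodMap`) says that, once
`Ext_H(k, H)` is spanned by a class in degree `d` on which `H` acts by a character,
`Ext^{n+d}_{Λ^e}(Λ, Λ^e)` is `D ♯ ^σH` (`isTwistedInduction`, `IsTwistedInduction.nonempty_iso`).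

**Invertibility.** A bimodule is invertible if and only if it is a progenerator as a right module
with endomorphisms given by left multiplications (`isInvertible_iff_isMorita`). In this form the
property passes from `D` to `D ♯ ^σH` and back (`IsTwistedInduction.isMorita`,
`IsTwistedInduction.isMorita_of_isMorita`), by taking coordinates in `H` in the decompositions
`Λ = H ⊗ A` and `D ♯ ^σH = H ⊗ D`.

**The converse.** If `Λ` has duality of dimension `m`, then `Ext^m_{Λ^e}(Λ, Λ^e)` is nonzero, so some
`Ext^p_H(k, H)` and `Ext^q_{A^e}(A, A^e)` with `p + q = m` are nonzero. By injectivity of the products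
all other degrees vanish, since a nonzero factor in another degree would give a nonzero product in a
degree other than `m`. Put `E = Ext^p_H(k, H)`, so that `Ext^m_{Λ^e}(Λ, Λ^e) = E ⊗ D ⊗ H`. For a linear
endomorphism `f` of `E`, the map `f ⊗ id` commutes with the right multiplications, so it is a left
multiplication by invertibility. But left multiplications take `e ⊗ x ⊗ 1` to `e ⊗ y` for some `y`
once the right factor `H` is absorbed into `E` (`exists_absorb`). Hence `f(e)` is a multiple of `e`
for all `f`, and `E` is one-dimensional (`exists_eq_smul`). So `Ext^m_{Λ^e}(Λ, Λ^e)` is `D ♯ ^σH`, and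
the invertibility of `D` follows.

For `A = k` the equivalence reads: `H` has duality if and only if `Ext_H(k, H)` is one-dimensional (`hasVanDenBerghDuality_iff_integral`).
-/

noncomputable section

/-! ### Exact functors and cocycles representing `Ext` classes -/

section ExtMkMap
namespace CategoryTheory.ProjectiveResolution
open CochainComplex HomComplex Localization Limits Abelian

universe w w' v v' u'

variable {C : Type u} [Category.{v} C] [Abelian C] [HasExt.{w} C]
  {D : Type u'} [Category.{v'} D] [Abelian D] [HasExt.{w'} D]
  (F : C ⥤ D) [F.Additive] [PreservesFiniteLimits F] [PreservesFiniteColimits F]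
  [F.PreservesProjectiveObjects]
  {X Y : C} (R : ProjectiveResolution X)

/-- The terms of `F(R)`, extended by zero to a cochain complex, are the images under `F` of those
of `R`. -/
def mapXIso (i : ℤ) :
    F.obj (R.cochainComplex.X i) ≅ (F.mapProjectiveResolution R).cochainComplex.X i :=
  if h : i ≤ 0 then
    F.mapIso (R.cochainComplexXIso i i.natAbs (by lia)) ≪≫
      ((F.mapProjectiveResolution R).cochainComplexXIso i i.natAbs (by lia)).symm
  else
    IsZero.iso (F.map_isZero (CochainComplex.isZero_of_isStrictlyLE _ 0 _ (by lia)))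
      (CochainComplex.isZero_of_isStrictlyLE _ 0 _ (by lia))

lemma mapXIso_hom (i : ℤ) (n : ℕ) (h : -n = i) :
    (mapXIso F R i).hom = F.map (R.cochainComplexXIso i n h).hom ≫
      ((F.mapProjectiveResolution R).cochainComplexXIso i n h).inv := by
  obtain rfl : n = i.natAbs := by lia
  rw [mapXIso, dif_pos (by lia)]
  rfl

lemma map_conj_comp_map_conj {C D : Type*} [Category* C] [Category* D] (F : C ⥤ D) {P A' B' B : C} {Y Z : D}
    (a : P ⟶ A') (d : A' ⟶ B') (b : B ≅ B') (c : F.obj B' ⟶ Y) (z : Z ≅ F.obj A') :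
    (F.map a ≫ z.inv) ≫ z.hom ≫ F.map d ≫ c =
      (F.map a ≫ F.map d ≫ F.map b.inv) ≫ F.map b.hom ≫ c := by
  have : F.map b.inv ≫ F.map b.hom = 𝟙 _ := by rw [← F.map_comp, b.inv_hom_id, F.map_id]
  simp only [Category.assoc, Iso.inv_hom_id_assoc, reassoc_of% this]

lemma map_inv_comp_map_comp {C D : Type*} [Category* C] [Category* D] (F : C ⥤ D) {A B W V : C} {X Z : D}
    (a : X ⟶ F.obj B) (b : A ≅ B) (f : B ⟶ W) (c : V ≅ W) (z : F.obj W ⟶ Z) :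
    (a ≫ F.map b.inv) ≫ F.map (b.hom ≫ f ≫ c.inv) ≫ 𝟙 _ ≫ F.map c.hom ≫ z = a ≫ F.map f ≫ z := by
  simp only [Category.assoc, Category.id_comp, ← F.map_comp_assoc]
  simp

lemma map_inv_comp_map_hom {C D : Type*} [Category* C] [Category* D] (F : C ⥤ D) {A B W V : C} {X Z : D}
    (a : X ⟶ F.obj B) (b : A ≅ B) (f : B ⟶ W) (c : V ≅ W) (z : F.obj W ⟶ Z) :
    (a ≫ F.map b.inv) ≫ F.map (b.hom ≫ f ≫ c.inv) ≫ F.map c.hom ≫ z =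
      a ≫ (F.map f ≫ 𝟙 _) ≫ z := by
  rw [Category.comp_id, ← map_inv_comp_map_comp F a b f c z, Category.id_comp]

lemma mapSingle_hom_app_f {C D : Type*} [Category* C] [Category* D] [Abelian C] [Abelian D] (F : C ⥤ D)
   [F.Additive] (Y : C) (i : ℤ) (hi : i = 0) :
    ((F.mapCochainComplexSingleFunctor 0).hom.app Y).f i =
     F.map (HomologicalComplex.singleObjXIsoOfEq (.up ℤ) 0 Y i hi).hom ≫
      (HomologicalComplex.singleObjXIsoOfEq (.up ℤ) 0 (F.obj Y) i hi).inv := by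
  subst hi
  exact HomologicalComplex.singleMapHomologicalComplex_hom_app_self ..

lemma shift_toSingleMk_f {C : Type*} [Category* C] [Abelian C] (K : CochainComplex C ℤ)
    {Y : C} {n : ℕ} (f : K.X (-n) ⟶ Y) (h : -(n : ℤ) + n = 0) (m : ℤ) (hm : m + 1 = -n)
    (hf : K.d m (-n) ≫ f = 0) :
    (Cocycle.equivHomShift.symm (Cocycle.toSingleMk f h m hm hf)).f (-n) =
     f ≫ (HomologicalComplex.singleObjXIsoOfEq (.up ℤ) 0 Y (-(n : ℤ) + n) h).inv := by
  have h1 : (Cocycle.equivHomShift.symm (Cocycle.toSingleMk f h m hm hf)).f (-n) =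
      ((Cochain.toSingleMk f h).rightShift (n : ℤ) 0 (zero_add _)).v (-n) (-n) (add_zero _) := by
    simp [Cocycle.equivHomShift_symm_apply, Cocycle.toSingleMk]
    rfl
  rw [h1, Cochain.rightShift_v _ _ _ _ _ _ _ 0 h, Cochain.toSingleMk_v]
  refine (Category.assoc _ _ _).trans (congrArg (fun t => f ≫ t) ?_)
  have h2 : (((singleFunctor C 0).obj Y).shiftFunctorObjXIso (n : ℤ) (-n : ℤ) 0 h.symm).inv =
    eqToHom (congrArg ((HomologicalComplex.single C (.up ℤ) 0).obj Y).X h.symm) := by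
      simp [CochainComplex.shiftFunctorObjXIso, HomologicalComplex.XIsoOfEq]
      rfl
  refine (congrArg (fun t => (HomologicalComplex.singleObjXSelf (.up ℤ) 0 Y).inv ≫ t) h2).trans ?_
  have h3 : ∀ i (h : i = (0 : ℤ)),
      (HomologicalComplex.singleObjXSelf (.up ℤ) 0 Y).inv ≫ eqToHom (congrArg
        ((HomologicalComplex.single C (.up ℤ) 0).obj Y).X h.symm) =
      (HomologicalComplex.singleObjXIsoOfEq (.up ℤ) 0 Y i h).inv := by
    rintro i rfl
    simp [HomologicalComplex.singleObjXSelf]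
  exact h3 _ h

/-- Extending a resolution by zero to a cochain complex commutes with applying `F`. -/
def mapCochainIso :
    (F.mapHomologicalComplex (ComplexShape.up ℤ)).obj R.cochainComplex ≅
      (F.mapProjectiveResolution R).cochainComplex :=
  HomologicalComplex.Hom.isoOfComponents (fun i => mapXIso F R i) (by
    intro i j hij
    by_cases hj : j ≤ 0
    · obtain ⟨m, rfl⟩ := Int.exists_eq_neg_ofNat hj
      obtain ⟨n, rfl⟩ := Int.exists_eq_neg_ofNat (a := i) (by simp at hij; lia)
      rw [mapXIso_hom F R _ n rfl, mapXIso_hom F R _ m rfl,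
        cochainComplex_d _ _ _ n m rfl rfl]
      have hd : (F.mapProjectiveResolution R).complex.d n m = F.map (R.complex.d n m) := rfl
      simp only [Category.assoc, Iso.inv_hom_id_assoc, hd, Functor.mapHomologicalComplex_obj_d,
        cochainComplex_d R _ _ n m rfl rfl, Functor.map_comp]
      exact map_conj_comp_map_conj F _ _ _ _ _
    · exact IsZero.eq_of_tgt (CochainComplex.isZero_of_isStrictlyLE _ 0 _ (by lia)) _ _)

lemma mapCochainIso_inv_f (i : ℤ) : (mapCochainIso F R).inv.f i = (mapXIso F R i).inv := rfl

lemma mapXIso_inv (i : ℤ) (n : ℕ) (h : -n = i) :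
    (mapXIso F R i).inv = ((F.mapProjectiveResolution R).cochainComplexXIso i n h).hom ≫
       F.map (R.cochainComplexXIso i n h).inv := by
  obtain rfl : n = i.natAbs := by lia
  rw [mapXIso, dif_pos (by lia)]
  rfl

lemma mapCochainIso_inv_π' : (mapCochainIso F R).inv ≫
    (F.mapHomologicalComplex (ComplexShape.up ℤ)).map R.π' ≫
      ((F.mapCochainComplexSingleFunctor 0).app X).hom = (F.mapProjectiveResolution R).π' := by
  apply HomologicalComplex.to_single_hom_ext
  simp [mapCochainIso_inv_f, mapXIso_inv F R 0 0 rfl, π'_f_zero]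
  refine Eq.trans (congrArg (fun t => (((F.mapProjectiveResolution R).cochainComplexXIso 0 0 rfl).hom ≫
    F.map (R.cochainComplexXIso 0 0 rfl).inv) ≫ F.map ((R.cochainComplexXIso 0 0 rfl).hom ≫
      R.π.f 0 ≫ (HomologicalComplex.singleObjXSelf (ComplexShape.up ℤ) 0 X).inv) ≫ t)
    (mapSingle_hom_app_f F X 0 rfl)) ?_
  exact map_inv_comp_map_hom F _ _ _ (HomologicalComplex.singleObjXSelf (ComplexShape.up ℤ) 0 X) _

lemma conj_comp_eq_zero {C : Type*} [Category C] [Preadditive C] {P A' B' B Y: C}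
    (a : P ⟶ A') (d : A' ⟶ B') (b : B ≅ B') (c : B' ⟶ Y) (h : d ≫ c = 0) :
    (a ≫ d ≫ b.inv) ≫ b.hom ≫ c = 0 := by
  simp [h]

variable {X Y : C} (R : ProjectiveResolution X) in
/-- The morphism to `Y[n]` given by an `n`-cocycle `f` of `Hom(R, Y)`. -/
def cocycleHom {n : ℕ} (f : R.complex.X n ⟶ Y) (m : ℕ) (hm : n + 1 = m)
    (hf : R.complex.d m n ≫ f = 0) :
    R.cochainComplex ⟶ ((singleFunctor C 0).obj Y)⟦(n : ℤ)⟧ :=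
  Cocycle.equivHomShift.symm
      (Cocycle.toSingleMk ((R.cochainComplexXIso (-n) n rfl).hom ≫ f) (by simp)
      (-m) (by lia) (by
        rw [cochainComplex_d _ _ _ m n rfl rfl]
        exact conj_comp_eq_zero _ _ _ _ hf))

variable {X Y : C} (R : ProjectiveResolution X) in
lemma cocycleHom_f {n : ℕ} (f : R.complex.X n ⟶ Y) (m : ℕ) (hm : n + 1 = m)
    (hf : R.complex.d m n ≫ f = 0) : (cocycleHom R f m hm hf).f (-n) =
      (R.cochainComplexXIso (-n) n rfl).hom ≫ f ≫
        (HomologicalComplex.singleObjXIsoOfEq (.up ℤ) 0 Y (-(n : ℤ) + n) (by simp)).inv :=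
  (shift_toSingleMk_f _ _ _ _ _ _).trans (Category.assoc _ _ _)

lemma precomp_extMk {n : ℕ} (f : R.complex.X n ⟶ Y) (m : ℕ) (hm : n + 1 = m)
    (hf : R.complex.d m n ≫ f = 0) :
    (SmallShiftedHom.mk₀ _ 0 rfl R.π').comp (R.extMk f m hm hf) (add_zero _) =
     SmallShiftedHom.mk _ (cocycleHom R f m hm hf) := by
  exact Equiv.apply_symm_apply (SmallShiftedHom.precompEquiv R.π' _) _

lemma map_cocycle {n : ℕ} (f : R.complex.X n ⟶ Y) (m : ℕ) (hm : n + 1 = m)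
    (hf : R.complex.d m n ≫ f = 0) : (F.mapProjectiveResolution R).complex.d m n ≫ F.map f = 0 :=
  (F.map_comp (R.complex.d m n) f).symm.trans (by rw [hf]; exact F.map_zero _ _)

instance : HasSmallLocalizedShiftedHom.{w'} (HomologicalComplex.quasiIso D (ComplexShape.up ℤ)) ℤ
    (F.mapProjectiveResolution R).cochainComplex ((F ⋙ singleFunctor D 0).obj Y) :=
  inferInstanceAs (HasSmallLocalizedShiftedHom.{w'}
    (HomologicalComplex.quasiIso D (ComplexShape.up ℤ)) ℤ
    (F.mapProjectiveResolution R).cochainComplex ((singleFunctor D 0).obj (F.obj Y)))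

instance : HasSmallLocalizedShiftedHom.{w'} (HomologicalComplex.quasiIso D (ComplexShape.up ℤ)) ℤ
    ((F ⋙ singleFunctor D 0).obj X) ((F ⋙ singleFunctor D 0).obj Y) :=
  inferInstanceAs (HasSmallLocalizedShiftedHom.{w'}
    (HomologicalComplex.quasiIso D (ComplexShape.up ℤ)) ℤ
    ((singleFunctor D 0).obj (F.obj X)) ((singleFunctor D 0).obj (F.obj Y)))

lemma cocycleHom_map {n : ℕ} (f : R.complex.X n ⟶ Y) (m : ℕ) (hm : n + 1 = m)
    (hf : R.complex.d m n ≫ f = 0) :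
    (mapCochainIso F R).inv ≫ (F.mapHomologicalComplex (ComplexShape.up ℤ)).map
      (cocycleHom R f m hm hf) ≫
      ((F.mapHomologicalComplex (ComplexShape.up ℤ)).commShiftIso (n : ℤ)).hom.app _ ≫
      ((F.mapCochainComplexSingleFunctor 0).hom.app Y)⟦(n : ℤ)⟧' =
    cocycleHom (F.mapProjectiveResolution R) (F.map f) m hm (map_cocycle F R f m hm hf) := by
  ext i
  by_cases hi : i = -n
  · subst hi
    have e1 : (((F.mapHomologicalComplex (ComplexShape.up ℤ)).commShiftIso (n : ℤ)).hom.app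
        ((singleFunctor C 0).obj Y)).f (-n : ℤ) = 𝟙 _ :=
      F.mapHomologicalComplex_commShiftIso_hom_app_f _ _ _
    simp only [HomologicalComplex.comp_f, Functor.mapHomologicalComplex_map_f, cocycleHom_f]
    rw [e1]
    have e2 : (((F.mapCochainComplexSingleFunctor 0).hom.app Y)⟦(n : ℤ)⟧').f (-n) =
      ((F.mapCochainComplexSingleFunctor 0).hom.app Y).f (-n + n) := rfl
    rw [e2, mapSingle_hom_app_f F Y _ (by simp), mapCochainIso_inv_f, mapXIso_inv F R (-n) n rfl]
    exact (map_inv_comp_map_comp F _ _ _ _ _).trans (cocycleHom_f _ _ _ _ _).symm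
  · refine IsZero.eq_of_tgt (HomologicalComplex.isZero_single_obj_X (.up ℤ) 0 _ _ ?_) _ _
    change i + n ≠ 0
    lia

lemma extMk_map {n : ℕ} (f : R.complex.X n ⟶ Y) (m : ℕ) (hm : n + 1 = m)
    (hf : R.complex.d m n ≫ f = 0) :
    (R.extMk f m hm hf).mapExactFunctor F =
      (F.mapProjectiveResolution R).extMk (F.map f) m hm (map_cocycle F R f m hm hf) := by
  let RF := F.mapProjectiveResolution R
  apply (SmallShiftedHom.precompEquiv.{w'} (Z := (singleFunctor D 0).obj (F.obj Y)) (a := (n:ℤ)) RF.π' (by rw [HomologicalComplex.mem_quasiIso_iff]; infer_instance)).injective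
  refine Eq.trans ?_ (precomp_extMk RF _ _ _ _).symm
  have h := congrArg ((F.mapHomologicalComplexUpToQuasiIsoLocalizerMorphism
    (ComplexShape.up ℤ)).smallShiftedHomMap (mapCochainIso F R)
      ((F.mapCochainComplexSingleFunctor 0).app Y)) (precomp_extMk R f m hm hf)
  have h2 := LocalizerMorphism.smallShiftedHomMap_comp (F.mapHomologicalComplexUpToQuasiIsoLocalizerMorphism
    (ComplexShape.up ℤ)) (mapCochainIso F R) ((F.mapCochainComplexSingleFunctor 0).app X)
    ((F.mapCochainComplexSingleFunctor 0).app Y) (SmallShiftedHom.mk₀ _ (0:ℤ) rfl R.π') (R.extMk f m hm hf) (add_zero _)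
  have h1 := LocalizerMorphism.smallShiftedHomMap_mk₀ (F.mapHomologicalComplexUpToQuasiIsoLocalizerMorphism
    (ComplexShape.up ℤ)) (mapCochainIso F R) ((F.mapCochainComplexSingleFunctor 0).app X) (0 : ℤ) rfl R.π'
  have hmk := LocalizerMorphism.smallShiftedHomMap_mk (F.mapHomologicalComplexUpToQuasiIsoLocalizerMorphism
    (ComplexShape.up ℤ)) (mapCochainIso F R)
      ((F.mapCochainComplexSingleFunctor 0).app Y) (cocycleHom R f m hm hf)
  have h3 := h2.symm.trans (h.trans hmk)
  erw [h1] at h3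
  refine Eq.trans ?_ (h3.trans ?_)
  · exact congrArg (fun p => (SmallShiftedHom.mk₀ _ 0 rfl p).comp
      ((F.mapHomologicalComplexUpToQuasiIsoLocalizerMorphism
        (ComplexShape.up ℤ)).smallShiftedHomMap ((F.mapCochainComplexSingleFunctor 0).app X)
        ((F.mapCochainComplexSingleFunctor 0).app Y) (R.extMk f m hm hf)) (add_zero _))
      (mapCochainIso_inv_π' F R).symm
  · congr 1
    refine Eq.trans ?_ (cocycleHom_map F R f m hm hf)
    rw [ShiftedHom.mk₀_comp, ShiftedHom.comp_mk₀]
    simp only [ShiftedHom.map, Category.assoc]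
    rfl
end CategoryTheory.ProjectiveResolution
end ExtMkMap

/-! ### Thick closures and cup products with classes of several degrees -/

namespace SmashDuality
section TotalExt
open Abelian Limits

universe w w' v v' u'

/-- The smallest class of objects that contains `G` and is closed under retracts, extensions and
cokernels of monomorphisms. -/
inductive ThickClosure {C : Type u} [Category.{v} C] [Abelian C] (G : C) : C → Prop
  | base : ThickClosure G G
  | retract {X Y : C} (r : Retract X Y) : ThickClosure G Y → ThickClosure G X
  | ext₂ {S : ShortComplex C} (hS : S.ShortExact) :
      ThickClosure G S.X₁ → ThickClosure G S.X₃ → ThickClosure G S.X₂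
  | ext₃ {S : ShortComplex C} (hS : S.ShortExact) :
      ThickClosure G S.X₁ → ThickClosure G S.X₂ → ThickClosure G S.X₃

variable {C : Type u} [Category.{v} C] [Abelian C] [HasExt.{w} C]
  {D : Type u'} [Category.{v'} D] [Abelian D] [HasExt.{w'} D]

/-- The group of families `(x_{j,p})` of elements `x_{j,p} ∈ Ext^p(M, N)`, almost all zero. -/
abbrev TotExt (J : Type*) [DecidableEq J] (M N : C) : Type _ :=
  DirectSum (J × ℕ) (fun t => Ext M N t.2)

namespace TotExt
variable {J : Type*} [DecidableEq J] {M M' M'' N : C}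

/-- The family with a single component. -/
def single (j : J) (p : ℕ) : Ext M N p →+ TotExt J M N :=
  DirectSum.of (fun t : J × ℕ => Ext M N t.2) (j, p)

lemma single_apply_self (j : J) (p : ℕ) (x : Ext M N p) : single j p x (j, p) = x :=
  DirectSum.of_eq_same _ _

lemma single_apply_ne {j j' : J} {p p' : ℕ} (h : (j, p) ≠ (j', p')) (x : Ext M N p) :
    single j p x (j', p') = 0 :=
  DirectSum.of_eq_of_ne _ _ _ (Ne.symm h)

lemma hom_ext {B : Type*} [AddCommMonoid B] {f g : TotExt J M N →+ B}
    (h : ∀ j p (x : Ext M N p), f (single j p x) = g (single j p x)) : f = g :=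
  DirectSum.addHom_ext fun t x => h t.1 t.2 x

lemma mem_of_components (K : AddSubgroup (TotExt J M N)) (x : TotExt J M N)
    (h : ∀ j p, single j p (x (j, p)) ∈ K) : x ∈ K := by
  classical
  rw [← DirectSum.sum_support_of x]
  exact AddSubgroup.sum_mem _ fun t _ => h t.1 t.2

/-- Composition with a class `φ ∈ Ext^q(M', M)`, componentwise. -/
def pre {q : ℕ} (φ : Ext M' M q) : TotExt J M N →+ TotExt J M' N :=
  DirectSum.toAddMonoid fun t => (single t.1 (q + t.2)).comp (φ.precomp N rfl)

lemma pre_single {q : ℕ} (φ : Ext M' M q) (j : J) {p n : ℕ} (h : q + p = n) (x : Ext M N p) :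
    pre φ (single j p x) = single j n (φ.comp x h) := by
  subst h
  exact DirectSum.toAddMonoid_of _ _ _

lemma pre_apply {q : ℕ} (φ : Ext M' M q) (x : TotExt J M N) (j : J) {p n : ℕ} (h : q + p = n) :
    pre φ x (j, n) = φ.comp (x (j, p)) h := by
  have h2 : ((DFinsupp.evalAddMonoidHom (j, n)).comp (pre φ) : TotExt J M N →+ Ext M' N n) =
      (φ.precomp N h).comp (DFinsupp.evalAddMonoidHom (j, p)) := by
    refine hom_ext fun j' p' x => ?_
    change pre φ (single j' p' x) (j, n) = φ.comp (single j' p' x (j, p)) h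
    rw [pre_single φ j' rfl]
    by_cases hh : (j', p') = (j, p)
    · obtain ⟨rfl, rfl⟩ := Prod.mk.inj hh
      subst h
      rw [single_apply_self, single_apply_self]
    · rw [single_apply_ne hh, Ext.comp_zero, single_apply_ne]
      intro h3
      obtain ⟨rfl, h4⟩ := Prod.mk.inj h3
      exact hh (by rw [show p' = p by lia])
  exact DFunLike.congr_fun h2 x

lemma pre_comp_pre {q r n : ℕ} (φ : Ext M'' M' q) (ψ : Ext M' M r) (h : q + r = n)
    (x : TotExt J M N) : pre φ (pre ψ x) = pre (φ.comp ψ h) x := by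
  refine DFunLike.congr_fun (f := (pre φ).comp (pre ψ)) (hom_ext fun j p x => ?_) x
  change pre φ (pre ψ (single j p x)) = _
  subst h
  rw [pre_single ψ j rfl, pre_single φ j (add_assoc q r p).symm, pre_single _ j rfl, Ext.comp_assoc]
  lia

lemma pre_id (x : TotExt J M N) : pre (Ext.mk₀ (𝟙 M)) x = x := by
  refine DFunLike.congr_fun (g := AddMonoidHom.id _) (hom_ext fun j p x => ?_) x
  rw [pre_single _ j (zero_add p), Ext.mk₀_id_comp]
  rfl

lemma pre_zero {q : ℕ} (x : TotExt J M N) : pre (0 : Ext M' M q) x = 0 := by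
  refine DFunLike.congr_fun (g := 0) (hom_ext fun j p x => ?_) x
  rw [pre_single _ j rfl, Ext.zero_comp, map_zero]
  rfl

lemma exact_pre {q r : ℕ} (φ : Ext M'' M' q) (ψ : Ext M' M r) (h : φ.comp ψ rfl = 0)
    (ex : ∀ (p : ℕ) (x : Ext M' N p), φ.comp x rfl = 0 →
      x = 0 ∨ ∃ (p' : ℕ) (hp : r + p' = p) (y : Ext M N p'), ψ.comp y hp = x) :
    Function.Exact (pre (J := J) (N := N) ψ) (pre φ) := by
  intro x
  constructor
  · intro hx
    refine mem_of_components (AddMonoidHom.range (pre ψ)) x fun j p => ?_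
    obtain h0 | ⟨p', hp, y, hy⟩ := ex p (x (j, p)) (by rw [← pre_apply φ x j rfl, hx]; rfl)
    · rw [h0, map_zero]
      exact zero_mem _
    exact ⟨single j p' y, by rw [pre_single ψ j hp, hy]⟩
  · rintro ⟨y, rfl⟩
    rw [pre_comp_pre φ ψ rfl, h, pre_zero]

section
variable {S : ShortComplex C} (hS : S.ShortExact)
include hS

lemma exact_pre₂ : Function.Exact (pre (J := J) (N := N) (Ext.mk₀ S.g)) (pre (Ext.mk₀ S.f)) := by
  refine exact_pre _ _ (by rw [Ext.mk₀_comp_mk₀, S.zero, Ext.mk₀_zero]) fun p x hx => ?_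
  obtain ⟨y, hy⟩ := Ext.contravariant_sequence_exact₂ hS N x (by
    have h := congrArg (single () (0 + p)) hx
    rw [← pre_single _ _ rfl, pre_single _ _ (zero_add p), map_zero] at h
    rw [← single_apply_self () p (Ext.comp _ _ _), h]
    rfl)
  exact .inr ⟨p, zero_add p, y, hy⟩

lemma exact_pre₁ : Function.Exact (pre (J := J) (N := N) (Ext.mk₀ S.f)) (pre hS.extClass) := by
  refine exact_pre _ _ hS.extClass_comp fun p x hx => ?_
  obtain ⟨y, hy⟩ := Ext.contravariant_sequence_exact₁ hS N x rfl hx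
  exact .inr ⟨p, zero_add p, y, hy⟩

lemma exact_pre₃ : Function.Exact (pre (J := J) (N := N) hS.extClass) (pre (Ext.mk₀ S.g)) := by
  refine exact_pre _ _ hS.comp_extClass fun p x hx => ?_
  have hx' : (Ext.mk₀ S.g).comp x (zero_add p) = 0 := by
    have h := congrArg (single () (0 + p)) hx
    rw [← pre_single _ _ rfl, pre_single _ _ (zero_add p), map_zero] at h
    rw [← single_apply_self () p (Ext.comp _ _ _), h]
    rfl
  rcases p with _ | p
  · have := hS.epi_g
    obtain ⟨y, rfl⟩ := (Ext.mk₀_bijective _ _).2 x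
    rw [Ext.mk₀_comp_mk₀, Ext.mk₀_eq_zero_iff, ← Limits.comp_zero (f := S.g), cancel_epi] at hx'
    exact .inl (by rw [hx', Ext.mk₀_zero])
  · obtain ⟨y, hy⟩ := Ext.contravariant_sequence_exact₃ hS N x hx' (add_comm 1 p)
    exact .inr ⟨p, add_comm 1 p, y, hy⟩
end

section
variable {A B E : C} (f : A ⟶ B) (g : B ⟶ E) (w : f ≫ g = 0)
  (hS : (ShortComplex.mk f g w).ShortExact)
include hS

lemma exact_pre_mk₂ : Function.Exact (pre (J := J) (N := N) (Ext.mk₀ g)) (pre (Ext.mk₀ f)) := by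
  have := exact_pre₂ (J := J) (N := N) hS
  dsimp only at this
  exact this

lemma exact_pre_mk₁ : Function.Exact (pre (J := J) (N := N) (Ext.mk₀ f)) (pre hS.extClass) :=
  exact_pre₁ hS

lemma exact_pre_mk₃ : Function.Exact (pre (J := J) (N := N) hS.extClass) (pre (Ext.mk₀ g)) :=
  exact_pre₃ hS
end
end TotExt

section Cup
open TotExt
variable (F : C ⥤ D) [F.Additive] [PreservesFiniteLimits F] [PreservesFiniteColimits F]
  {J : Type*} [DecidableEq J] {N : C} {N' : D} (q : J → ℕ) (w : ∀ j, Ext (F.obj N) N' (q j))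

/-- The sum of the maps `Ext^p(M, N) → Ext^{p + q_j}(F M, N')`, `x ↦ F(x) w_j`. -/
def cupTot (M : C) : TotExt J M N →+ TotExt Unit (F.obj M) N' :=
  DirectSum.toAddMonoid fun t => (single () (t.2 + q t.1)).comp
    (((w t.1).postcomp (F.obj M) rfl).comp (F.mapExtAddHom M N t.2))

lemma cupTot_single (M : C) (j : J) {p n : ℕ} (h : p + q j = n) (x : Ext M N p) :
    cupTot F q w M (single j p x) = single () n ((x.mapExactFunctor F).comp (w j) h) := by
  subst h
  exact DirectSum.toAddMonoid_of _ _ _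

lemma cupTot_pre {M M' : C} {r : ℕ} (φ : Ext M' M r) (x : TotExt J M N) :
    cupTot F q w M' (pre φ x) = pre (φ.mapExactFunctor F) (cupTot F q w M x) := by
  refine DFunLike.congr_fun (f := (cupTot F q w M').comp (pre φ))
    (g := (pre (φ.mapExactFunctor F)).comp (cupTot F q w M)) (hom_ext fun j p x => ?_) x
  change cupTot F q w M' (pre φ (single j p x)) =
    pre (φ.mapExactFunctor F) (cupTot F q w M (single j p x))
  rw [pre_single φ j rfl, cupTot_single F q w M' j (add_assoc r p (q j)), cupTot_single F q w M j rfl,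
    pre_single _ _ rfl, Ext.mapExactFunctor_comp, Ext.comp_assoc]
  lia

lemma cupTot_mk₀ {M M' : C} (f : M' ⟶ M) :
    (pre (Ext.mk₀ (F.map f))).comp (cupTot F q w M) = (cupTot F q w M').comp (pre (Ext.mk₀ f)) := by
  rw [← Ext.mapExactFunctor_mk₀]
  exact AddMonoidHom.ext fun x => (cupTot_pre F q w _ x).symm

section
variable {S : ShortComplex C} (hS : S.ShortExact)
include hS

lemma shortExact_map : (ShortComplex.mk (F.map S.f) (F.map S.g)
    (S.map F).zero).ShortExact := hS.map_of_exact F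

lemma exact_pre_map₂ : Function.Exact
    (pre (J := Unit) (N := N') (Ext.mk₀ (F.map S.g))) (pre (Ext.mk₀ (F.map S.f))) :=
  exact_pre_mk₂ _ _ _ (shortExact_map F hS)

lemma mapExactFunctor_extClass' :
    hS.extClass.mapExactFunctor F = (shortExact_map F hS).extClass :=
  Ext.mapExactFunctor_extClass F hS

lemma exact_pre_map₁ : Function.Exact
    (pre (J := Unit) (N := N') (Ext.mk₀ (F.map S.f))) (pre (hS.extClass.mapExactFunctor F)) := by
  rw [mapExactFunctor_extClass' F hS]
  exact exact_pre_mk₁ _ _ _ (shortExact_map F hS)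

lemma exact_pre_map₃ : Function.Exact
    (pre (J := Unit) (N := N') (hS.extClass.mapExactFunctor F)) (pre (Ext.mk₀ (F.map S.g))) := by
  rw [mapExactFunctor_extClass' F hS]
  exact exact_pre_mk₃ _ _ _ (shortExact_map F hS)

end

lemma cupTot_comp {M M' : C} {r : ℕ} (φ : Ext M' M r) :
    (pre (φ.mapExactFunctor F)).comp (cupTot F q w M) = (cupTot F q w M').comp (pre φ) :=
  AddMonoidHom.ext fun x => (cupTot_pre F q w _ x).symm

/-- If the cup product with the classes `w_j` is bijective for a generator, then so it is for all
objects of its thick closure. -/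
theorem cupTot_bijective {G M : C} (hG : Function.Bijective (cupTot F q w G))
    (hM : ThickClosure G M) : Function.Bijective (cupTot F q w M) := by
  induction hM with
  | base => exact hG
  | @retract X Y r _ ih =>
    have h1 (x : TotExt J X N) : pre (Ext.mk₀ r.i) (pre (Ext.mk₀ r.r) x) = x := by
      rw [pre_comp_pre _ _ rfl, Ext.mk₀_comp_mk₀, r.retract, pre_id]
    have h2 (x : TotExt Unit (F.obj X) N') :
        pre ((Ext.mk₀ r.i).mapExactFunctor F) (pre ((Ext.mk₀ r.r).mapExactFunctor F) x) = x := by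
      rw [pre_comp_pre _ _ (zero_add 0), ← Ext.mapExactFunctor_comp, Ext.mk₀_comp_mk₀, r.retract,
        Ext.mapExactFunctor_mk₀, F.map_id, pre_id]
    constructor
    · intro x y hxy
      have := congrArg (pre ((Ext.mk₀ r.r).mapExactFunctor F)) hxy
      rw [← cupTot_pre, ← cupTot_pre] at this
      rw [← h1 x, ih.1 this, h1]
    · intro y
      obtain ⟨x, hx⟩ := ih.2 (pre ((Ext.mk₀ r.r).mapExactFunctor F) y)
      exact ⟨pre (Ext.mk₀ r.i) x, by rw [cupTot_pre, hx, h2]⟩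
  | @ext₂ S hS _ _ ih₁ ih₃ =>
    exact AddMonoidHom.bijective_of_surjective_of_bijective_of_bijective_of_injective
      _ _ _ _ _ _ _ _ (cupTot F q w S.X₁) (cupTot F q w S.X₃) (cupTot F q w S.X₂)
      (cupTot F q w S.X₁) (cupTot F q w S.X₃)
      (cupTot_comp F q w hS.extClass) (cupTot_mk₀ F q w S.g) (cupTot_mk₀ F q w S.f)
      (cupTot_comp F q w hS.extClass) (exact_pre₃ hS) (exact_pre₂ hS) (exact_pre₁ hS)
      (exact_pre_map₃ F hS) (exact_pre_map₂ F hS) (exact_pre_map₁ F hS) ih₁.2 ih₃ ih₁ ih₃.1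
  | @ext₃ S hS _ _ ih₁ ih₂ =>
    exact AddMonoidHom.bijective_of_surjective_of_bijective_of_bijective_of_injective
      _ _ _ _ _ _ _ _ (cupTot F q w S.X₂) (cupTot F q w S.X₁) (cupTot F q w S.X₃)
      (cupTot F q w S.X₂) (cupTot F q w S.X₁)
      (cupTot_mk₀ F q w S.f) (cupTot_comp F q w hS.extClass) (cupTot_mk₀ F q w S.g)
      (cupTot_mk₀ F q w S.f) (exact_pre₁ hS) (exact_pre₃ hS) (exact_pre₂ hS)
      (exact_pre_map₁ F hS) (exact_pre_map₃ F hS) (exact_pre_map₂ F hS) ih₂.2 ih₁ ih₂ ih₁.1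

end Cup
end TotalExt
end SmashDuality

/-! ### Resolutions assembled from short exact sequences -/

namespace SmashDuality
section Syzygies
open Limits

universe v
variable {C : Type*} [Category.{v} C] [Abelian C]

/-- Short exact sequences `0 → Z (n + 1) → P n → Z n → 0` with `P n` projective. -/
structure SyzygySequence (Z P : ℕ → C) where
  ι : ∀ n, Z (n + 1) ⟶ P n
  p : ∀ n, P n ⟶ Z n
  w : ∀ n, ι n ≫ p n = 0
  shortExact : ∀ n, (ShortComplex.mk (ι n) (p n) (w n)).ShortExact
  proj : ∀ n, Projective (P n)

namespace SyzygySequence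
variable {Z P : ℕ → C} (s : SyzygySequence Z P)

/-- The spliced complex. -/
def complex : ChainComplex C ℕ :=
  ChainComplex.of P (fun n => s.p (n + 1) ≫ s.ι n) (fun n => by
    rw [Category.assoc, ← Category.assoc (s.ι _), s.w, zero_comp, comp_zero])

lemma complex_d (n : ℕ) : s.complex.d (n + 1) n = s.p (n + 1) ≫ s.ι n :=
  ChainComplex.of_d P (fun n => s.p (n + 1) ≫ s.ι n) n

lemma exact_comp {A A' B C' D : C} {i : A ⟶ B} {p : B ⟶ C'} {w : i ≫ p = 0}
    (h : (ShortComplex.mk i p w).ShortExact) (e : A' ⟶ A) [Epi e] (m : C' ⟶ D) [Mono m]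
    (w' : (e ≫ i) ≫ p ≫ m = 0) : (ShortComplex.mk (e ≫ i) (p ≫ m) w').Exact := by
  let α : ShortComplex.mk (e ≫ i) (p ≫ m) w' ⟶
    ShortComplex.mk i (p ≫ m) (by rw [← Category.assoc, w, zero_comp]) :=
    { τ₁ := e
      τ₂ := 𝟙 _
      τ₃ := 𝟙 _ }
  let β : ShortComplex.mk i p w ⟶
    ShortComplex.mk i (p ≫ m) (by rw [← Category.assoc, w, zero_comp]) :=
    { τ₁ := 𝟙 _
      τ₂ := 𝟙 _
      τ₃ := m }
  have h1 : Epi α.τ₁ := ‹_›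
  have h2 : IsIso α.τ₂ := inferInstanceAs (IsIso (𝟙 _))
  have h3 : Mono α.τ₃ := inferInstanceAs (Mono (𝟙 _))
  have h1' : Epi β.τ₁ := inferInstanceAs (Epi (𝟙 _))
  have h2' : IsIso β.τ₂ := inferInstanceAs (IsIso (𝟙 _))
  have h3' : Mono β.τ₃ := ‹_›
  rw [ShortComplex.exact_iff_of_epi_of_isIso_of_mono α,
    ← ShortComplex.exact_iff_of_epi_of_isIso_of_mono β]
  exact h.exact

instance (n : ℕ) : Mono (s.ι n) := (s.shortExact n).mono_f
instance (n : ℕ) : Epi (s.p n) := (s.shortExact n).epi_g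

lemma complex_exactAt_succ (n : ℕ) : s.complex.ExactAt (n + 1) := by
  rw [HomologicalComplex.exactAt_iff' _ (n + 1 + 1) (n + 1) n (by simp) (by simp)]
  have := exact_comp (s.shortExact (n + 1)) (s.p (n + 2)) (s.ι n) (by
    rw [Category.assoc, ← Category.assoc (s.ι _), s.w, zero_comp, comp_zero])
  refine (ShortComplex.exact_iff_of_iso ?_).1 this
  exact ShortComplex.isoMk (Iso.refl _) (Iso.refl _) (Iso.refl _)
    ((Category.id_comp _).trans ((s.complex_d _).trans (Category.comp_id _).symm))
    ((Category.id_comp _).trans ((s.complex_d _).trans (Category.comp_id _).symm))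

lemma p_ι_p : (s.p 1 ≫ s.ι 0) ≫ s.p 0 = 0 := by rw [Category.assoc, s.w, comp_zero]

lemma d_p : s.complex.d 1 0 ≫ s.p 0 = 0 :=
  (congrArg (fun t => t ≫ s.p 0) (s.complex_d 0)).trans s.p_ι_p

lemma augmentation_f_zero :
    ((ChainComplex.toSingle₀Equiv s.complex (Z 0)).symm ⟨s.p 0, s.d_p⟩).f 0 = s.p 0 :=
  ChainComplex.toSingle₀Equiv_symm_apply_f_zero (C := s.complex) (s.p 0) s.d_p

/-- The spliced complex, as a projective resolution of `Z 0`. -/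
def resolution : ProjectiveResolution (Z 0) where
  complex := s.complex
  projective := s.proj
  π := (ChainComplex.toSingle₀Equiv _ _).symm ⟨s.p 0, s.d_p⟩
  quasiIso := ⟨fun n => by
    cases n
    · rw [ChainComplex.quasiIsoAt₀_iff, ShortComplex.quasiIso_iff_of_zeros']
      · have := exact_comp (s.shortExact 0) (s.p 1) (𝟙 _) (by
          rw [Category.comp_id, Category.assoc, s.w, comp_zero])
        refine (ShortComplex.exact_and_epi_g_iff_of_iso ?_).2 ⟨this, by dsimp; infer_instance⟩
        exact ShortComplex.isoMk (Iso.refl _) (Iso.refl _) (Iso.refl _)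
          ((Category.id_comp _).trans ((s.complex_d 0).symm.trans (Category.comp_id _).symm))
          ((Category.id_comp _).trans ((Category.comp_id _).trans
            (s.augmentation_f_zero.symm.trans (Category.comp_id _).symm)))
      all_goals rfl
    · rw [quasiIsoAt_iff_exactAt']
      · exact s.complex_exactAt_succ _
      · apply ChainComplex.exactAt_succ_single_obj⟩

end SyzygySequence
end Syzygies

section Perfect
variable {R : Type u} [Ring R]

/-- `M` has a resolution by finitely generated projective modules up to degree `n`. -/
def FinitelyPresentedUpTo : ℕ → ∀ (M : Type u) [AddCommGroup M] [Module R M], Prop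
  | 0, M, _, _ => Module.Finite R M
  | n + 1, M, _, _ => ∃ (P : Type u) (_ : AddCommGroup P) (_ : Module R P) (p : P →ₗ[R] M),
      Module.Finite R P ∧ Module.Projective R P ∧ Function.Surjective p ∧
        FinitelyPresentedUpTo n (LinearMap.ker p)

namespace FinitelyPresentedUpTo
variable {M N : Type u} [AddCommGroup M] [Module R M] [AddCommGroup N] [Module R N]

lemma of_equiv {n : ℕ} (h : FinitelyPresentedUpTo (R := R) n M) (e : M ≃ₗ[R] N) :
    FinitelyPresentedUpTo (R := R) n N := by
  cases n with
  | zero => exact @Module.Finite.equiv R M N _ _ _ _ _ h e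
  | succ n =>
    obtain ⟨P, _, _, p, h1, h2, h3, h4⟩ := h
    refine ⟨P, _, _, e.toLinearMap ∘ₗ p, h1, h2, e.surjective.comp h3, ?_⟩
    rwa [LinearEquiv.ker_comp]

lemma pred {n : ℕ} (h : FinitelyPresentedUpTo (R := R) (n + 1) M) :
    FinitelyPresentedUpTo (R := R) n M := by
  induction n generalizing M with
  | zero =>
    obtain ⟨P, _, _, p, h1, h2, h3, h4⟩ := h
    exact Module.Finite.of_surjective p h3
  | succ n ih =>
    obtain ⟨P, _, _, p, h1, h2, h3, h4⟩ := h
    exact ⟨P, _, _, p, h1, h2, h3, ih h4⟩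

lemma of_projective (n : ℕ) [Module.Finite R M] [Module.Projective R M] :
    FinitelyPresentedUpTo (R := R) n M := by
  induction n generalizing M with
  | zero => assumption
  | succ n ih =>
    refine ⟨M, _, _, LinearMap.id, ‹_›, ‹_›, Function.surjective_id, ?_⟩
    rw [LinearMap.ker_id]
    exact ih

/-- Finite presentation up to degree `n` passes to extensions. -/
def ExtensionClosed (R : Type u) [Ring R] (n : ℕ) : Prop :=
  ∀ (M N : Type u) [AddCommGroup M] [Module R M] [AddCommGroup N] [Module R N] (g : M →ₗ[R] N),
    Function.Surjective g → FinitelyPresentedUpTo (R := R) n (LinearMap.ker g) →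
    FinitelyPresentedUpTo (R := R) n N → FinitelyPresentedUpTo (R := R) n M

lemma quotient_of_extensionClosed {n : ℕ} (hn : ExtensionClosed R n) (g : M →ₗ[R] N)
    (hg : Function.Surjective g) (hK : FinitelyPresentedUpTo (R := R) n (LinearMap.ker g))
    (hM : FinitelyPresentedUpTo (R := R) (n + 1) M) :
    FinitelyPresentedUpTo (R := R) (n + 1) N := by
  obtain ⟨P, _, _, p, h1, h2, h3, h4⟩ := hM
  refine ⟨P, _, _, g ∘ₗ p, h1, h2, hg.comp h3, ?_⟩
  let q : LinearMap.ker (g ∘ₗ p) →ₗ[R] LinearMap.ker g :=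
    (p ∘ₗ (LinearMap.ker (g ∘ₗ p)).subtype).codRestrict _ fun x => x.2
  refine hn _ _ q ?_ ?_ hK
  · rintro ⟨y, hy⟩
    obtain ⟨x, rfl⟩ := h3 y
    exact ⟨⟨x, hy⟩, rfl⟩
  · refine h4.of_equiv (LinearEquiv.ofBijective
      ((LinearMap.codRestrict _ (LinearMap.ker p).subtype fun x => ?_).codRestrict
        (LinearMap.ker q) fun x => ?_) ⟨?_, ?_⟩)
    · change g (p x) = 0
      rw [LinearMap.mem_ker.1 x.2, map_zero]
    · exact Subtype.ext x.2
    · intro x y h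
      exact Subtype.ext (congrArg (fun z => z.1.1) h)
    · rintro ⟨⟨x, hx⟩, hx'⟩
      exact ⟨⟨x, congrArg Subtype.val hx'⟩, rfl⟩

lemma extensionClosed (n : ℕ) : ExtensionClosed R n := by
  induction n with
  | zero =>
    intro M N _ _ _ _ g hg h1 h2
    have : Module.Finite R (LinearMap.ker g) := h1
    have : Module.Finite R N := h2
    have : Module.Finite R (M ⧸ LinearMap.ker g) :=
      Module.Finite.equiv (LinearMap.quotKerEquivOfSurjective g hg).symm
    exact Module.Finite.of_submodule_quotient (LinearMap.ker g)
  | succ n ih =>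
    intro M N _ _ _ _ g hg h1 h2
    obtain ⟨P, _, _, p, h3, h4, h5, h6⟩ := h1
    obtain ⟨Q, _, _, q, k3, k4, k5, k6⟩ := h2
    obtain ⟨s, hs⟩ := Module.projective_lifting_property g q hg
    have hs' : ∀ x, g (s x) = q x := fun x => LinearMap.congr_fun hs x
    -- `N` is covered by `ker g × Q`, and the kernel of that cover is `ker q`
    refine quotient_of_extensionClosed ih
      (LinearMap.coprod (LinearMap.ker g).subtype s) ?_ ?_
      (⟨P × Q, inferInstance, inferInstance, p.prodMap LinearMap.id, inferInstance, inferInstance,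
        h5.prodMap Function.surjective_id, ?_⟩)
    · intro m
      obtain ⟨x, hx⟩ := k5 (g m)
      exact ⟨(⟨m - s x, by simp [hs', hx]⟩, x), by simp⟩
    · refine k6.of_equiv (LinearEquiv.ofBijective (LinearMap.codRestrict _
        (LinearMap.prod (LinearMap.codRestrict _ (-s ∘ₗ (LinearMap.ker q).subtype) fun x => ?_)
          (LinearMap.ker q).subtype) fun x => ?_) ⟨?_, ?_⟩)
      · simp [hs']
      · exact neg_add_cancel (s x.1)
      · intro x y h
        exact Subtype.ext (congrArg (fun z => z.1.2) h)
      · rintro ⟨⟨⟨m, hm⟩, x⟩, hx⟩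
        have hx2 : m + s x = 0 := hx
        refine ⟨⟨x, ?_⟩, ?_⟩
        · have := congrArg g hx2
          rw [map_add, LinearMap.mem_ker.1 hm, hs'] at this
          simpa using this
        · refine Subtype.ext (Prod.ext (Subtype.ext ?_) rfl)
          exact (eq_neg_of_add_eq_zero_left hx2).symm
    · refine h6.of_equiv (LinearEquiv.ofBijective (LinearMap.codRestrict _
        (LinearMap.prod (LinearMap.ker p).subtype 0) fun x => ?_) ⟨?_, ?_⟩)
      · simp
      · intro x y h
        exact Subtype.ext (congrArg (fun z => z.1.1) h)
      · rintro ⟨⟨x, y⟩, hx⟩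
        obtain ⟨hx1, hx2⟩ := Prod.mk.inj (LinearMap.mem_ker.1 hx)
        exact ⟨⟨x, hx1⟩, Subtype.ext (Prod.ext rfl hx2.symm)⟩

lemma quotient {n : ℕ} (g : M →ₗ[R] N)
    (hg : Function.Surjective g) (hK : FinitelyPresentedUpTo (R := R) n (LinearMap.ker g))
    (hM : FinitelyPresentedUpTo (R := R) (n + 1) M) :
    FinitelyPresentedUpTo (R := R) (n + 1) N :=
  quotient_of_extensionClosed (extensionClosed n) g hg hK hM

lemma retract {n : ℕ} (i : N →ₗ[R] M) (r : M →ₗ[R] N) (h : ∀ x, r (i x) = x)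
    (hM : FinitelyPresentedUpTo (R := R) n M) : FinitelyPresentedUpTo (R := R) n N := by
  induction n generalizing N with
  | zero =>
    have : Module.Finite R M := hM
    exact Module.Finite.of_surjective r fun x => ⟨i x, h x⟩
  | succ n ih =>
    refine quotient r (fun x => ⟨i x, h x⟩) ?_ hM
    refine ih (LinearMap.ker r).subtype
      ((LinearMap.id - i ∘ₗ r).codRestrict _ fun x => by simp [h]) (fun x => ?_) hM.pred
    refine Subtype.ext ?_
    simp [LinearMap.mem_ker.1 x.2]

end FinitelyPresentedUpTo

/-- A short exact sequence identifies its first term with a kernel. -/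
def kerEquiv {S : ShortComplex (ModuleCat.{u} R)} (hS : S.ShortExact) :
    S.X₁ ≃ₗ[R] LinearMap.ker S.g.hom :=
  LinearEquiv.ofBijective (S.f.hom.codRestrict _ fun x => S.moduleCat_zero_apply x) (by
    constructor
    · intro x y h
      exact hS.moduleCat_injective_f (congrArg Subtype.val h)
    · rintro ⟨y, hy⟩
      obtain ⟨x, hx⟩ := (S.moduleCat_exact_iff.1 hS.exact) y hy
      exact ⟨x, Subtype.ext hx⟩)

namespace ThickClosure

lemma finitelyPresentedUpTo {M : ModuleCat.{u} R} (h : ThickClosure (ModuleCat.of R R) M) (n : ℕ) :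
    FinitelyPresentedUpTo (R := R) n M := by
  induction h generalizing n with
  | base => exact FinitelyPresentedUpTo.of_projective n
  | retract r _ ih =>
    exact (ih n).retract r.i.hom r.r.hom fun x => ConcreteCategory.congr_hom r.retract x
  | ext₂ hS _ _ ih₁ ih₃ =>
    exact FinitelyPresentedUpTo.extensionClosed n _ _ _ hS.moduleCat_surjective_g
      ((ih₁ n).of_equiv (kerEquiv hS)) (ih₃ n)
  | ext₃ hS _ _ ih₁ ih₂ =>
    exact (FinitelyPresentedUpTo.quotient _ hS.moduleCat_surjective_g
      ((ih₁ n).of_equiv (kerEquiv hS)) (ih₂ (n + 1))).pred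

lemma exists_hasProjectiveDimensionLT {M : ModuleCat.{u} R}
    (h : ThickClosure (ModuleCat.of R R) M) : ∃ n, HasProjectiveDimensionLT M n := by
  induction h with
  | base => exact ⟨1, (projective_iff_hasProjectiveDimensionLT_one).1 inferInstance⟩
  | retract r _ ih =>
    obtain ⟨n, hn⟩ := ih
    exact ⟨n, r.hasProjectiveDimensionLT n⟩
  | ext₂ hS _ _ ih₁ ih₃ =>
    obtain ⟨n, hn⟩ := ih₁
    obtain ⟨m, hm⟩ := ih₃
    exact ⟨max n m, hS.hasProjectiveDimensionLT_X₂ _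
      (hasProjectiveDimensionLT_of_ge _ n _ (le_max_left _ _))
      (hasProjectiveDimensionLT_of_ge _ m _ (le_max_right _ _))⟩
  | ext₃ hS _ _ ih₁ ih₂ =>
    obtain ⟨n, hn⟩ := ih₁
    obtain ⟨m, hm⟩ := ih₂
    exact ⟨max n m + 1, hS.hasProjectiveDimensionLT_X₃ _
      (hasProjectiveDimensionLT_of_ge _ n _ (le_max_left _ _))
      (hasProjectiveDimensionLT_of_ge _ m _ (by lia))⟩

end ThickClosure

/-- `M` has a resolution of length less than `n` by finitely generated projective modules. -/
def FiniteResolution : ℕ → ModuleCat.{u} R → Prop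
  | 0, M => Limits.IsZero M
  | n + 1, M => ∃ (K P : ModuleCat.{u} R) (i : K ⟶ P) (p : P ⟶ M) (w : i ≫ p = 0),
      (ShortComplex.mk i p w).ShortExact ∧ Module.Finite R P ∧ Projective P ∧ FiniteResolution n K

lemma FinitelyPresentedUpTo.finiteResolution {n : ℕ} {M : ModuleCat.{u} R}
    (h : FinitelyPresentedUpTo (R := R) n M) (hd : HasProjectiveDimensionLT M (n + 1)) :
    FiniteResolution (n + 1) M := by
  induction n generalizing M with
  | zero =>
    have : Projective M := (projective_iff_hasProjectiveDimensionLT_one).2 hd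
    refine ⟨ModuleCat.of R PUnit, M, 0, 𝟙 M, by simp, ?_, h, this,
      ModuleCat.isZero_of_subsingleton _⟩
    refine ModuleCat.shortComplex_shortExact _ ?_ (fun x y _ => Subsingleton.elim _ _)
      Function.surjective_id
    intro x
    constructor
    · intro hx
      exact ⟨0, hx.symm⟩
    · rintro ⟨y, rfl⟩
      rfl
  | succ n ih =>
    obtain ⟨P, _, _, p, h1, h2, h3, h4⟩ := h
    have hS := LinearMap.shortExact_shortComplexKer h3
    have hP : Projective (ModuleCat.of R P) := inferInstance
    refine ⟨_, _, _, _, _, hS, h1, hP, ih h4 ?_⟩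
    exact (hS.hasProjectiveDimensionLT_X₃_iff n hP).1 hd

/-- The first step of a resolution of length less than `n`. -/
structure ResolutionStep (n : ℕ) (M : ModuleCat.{u} R) where
  K : ModuleCat.{u} R
  P : ModuleCat.{u} R
  i : K ⟶ P
  p : P ⟶ M
  w : i ≫ p = 0
  shortExact : (ShortComplex.mk i p w).ShortExact
  finite : Module.Finite R P
  proj : Projective P
  next : FiniteResolution (n - 1) K
  isZero : n = 0 → Limits.IsZero P

lemma FiniteResolution.nonempty_step {n : ℕ} {M : ModuleCat.{u} R} (h : FiniteResolution n M) :
    Nonempty (ResolutionStep n M) := by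
  cases n with
  | zero =>
    have h' : Limits.IsZero M := h
    have : Subsingleton M := ModuleCat.subsingleton_of_isZero h'
    refine ⟨⟨M, M, 0, 𝟙 M, by simp, ?_, inferInstance, ?_, h', fun _ => h'⟩⟩
    · refine ModuleCat.shortComplex_shortExact _ ?_ (fun x y _ => Subsingleton.elim _ _)
        Function.surjective_id
      intro x
      exact ⟨fun _ => ⟨0, Subsingleton.elim _ _⟩, fun _ => Subsingleton.elim _ _⟩
    · have : Module.Projective R M := Module.Projective.of_basis (Module.Basis.empty (ι := Empty) M)
      infer_instance
  | succ n =>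
    obtain ⟨K, P, i, p, w, h1, h2, h3, h4⟩ := h
    exact ⟨⟨K, P, i, p, w, h1, h2, h3, h4, by lia⟩⟩

/-- A module with a finite resolution, together with a bound for the length. -/
structure ResolvedModule (R : Type u) [Ring R] where
  n : ℕ
  M : ModuleCat.{u} R
  resolution : FiniteResolution n M

namespace ResolvedModule

/-- The chosen first step. -/
def step (s : ResolvedModule R) : ResolutionStep s.n s.M := s.resolution.nonempty_step.some

/-- Iterated syzygies. -/
def syzygy (s : ResolvedModule R) : ℕ → ResolvedModule R
  | 0 => s
  | n + 1 => ⟨(syzygy s n).n - 1, (syzygy s n).step.K, (syzygy s n).step.next⟩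

lemma syzygy_n (s : ResolvedModule R) (n : ℕ) : (s.syzygy n).n = s.n - n := by
  induction n with
  | zero => rfl
  | succ n ih =>
    change (syzygy s n).n - 1 = _
    rw [ih]
    lia

/-- The short exact sequences between iterated syzygies. -/
def syzygySequence (s : ResolvedModule R) :
    SyzygySequence (fun n => (s.syzygy n).M) (fun n => (s.syzygy n).step.P) where
  ι n := (s.syzygy n).step.i
  p n := (s.syzygy n).step.p
  w n := (s.syzygy n).step.w
  shortExact n := (s.syzygy n).step.shortExact
  proj n := (s.syzygy n).step.proj

end ResolvedModule

/-- A module in the thick closure of the ring has a finite resolution by finitely generated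
projective modules. -/
lemma ThickClosure.exists_resolution {M : ModuleCat.{u} R}
    (h : ThickClosure (ModuleCat.of R R) M) :
    ∃ P : ProjectiveResolution M, (∀ i, Module.Finite R (P.complex.X i)) ∧
      ∃ n : ℕ, ∀ i, n < i → Limits.IsZero (P.complex.X i) := by
  obtain ⟨n, hn⟩ := h.exists_hasProjectiveDimensionLT
  let s : ResolvedModule R := ⟨n + 1, M, (h.finitelyPresentedUpTo n).finiteResolution
    (hasProjectiveDimensionLT_of_ge _ n _ (by lia))⟩
  refine ⟨s.syzygySequence.resolution, fun i => (s.syzygy i).step.finite, n, fun i hi =>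
    (s.syzygy i).step.isZero ?_⟩
  rw [s.syzygy_n]
  change n + 1 - i = 0
  lia

lemma thickClosure_of_iso {G X Y : ModuleCat.{u} R} (e : X ≅ Y) (h : ThickClosure G X) :
    ThickClosure G Y :=
  .retract (.ofIso e.symm) h

lemma thickClosure_of_isZero {G X : ModuleCat.{u} R} (h : Limits.IsZero X) : ThickClosure G X :=
  .retract ⟨0, 0, h.eq_of_src _ _⟩ .base

lemma thickClosure_fin (n : ℕ) :
    ThickClosure (ModuleCat.of R R) (ModuleCat.of R (ULift.{u} (Fin n) → R)) := by
  induction n with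
  | zero => exact thickClosure_of_isZero (ModuleCat.isZero_of_subsingleton _)
  | succ n ih =>
    let f : (ULift.{u} (Fin n) → R) →ₗ[R] (ULift.{u} (Fin (n + 1)) → R) :=
      LinearMap.pi fun i => Fin.cases 0 (fun j => LinearMap.proj ⟨j⟩) i.down
    let g : (ULift.{u} (Fin (n + 1)) → R) →ₗ[R] R := LinearMap.proj ⟨0⟩
    refine ThickClosure.ext₂ (S := ModuleCat.shortComplexOfCompEqZero f g ?_)
      (ModuleCat.shortComplex_shortExact _ ?_ ?_ ?_) ih .base
    · ext x; rfl
    · intro x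
      constructor
      · intro hx
        refine ⟨fun i => x ⟨i.down.succ⟩, funext fun ⟨i⟩ => ?_⟩
        induction i using Fin.cases with
        | zero => exact Eq.symm hx
        | succ j => rfl
      · rintro ⟨y, rfl⟩
        rfl
    · intro x y h
      exact funext fun ⟨i⟩ => congrFun h ⟨i.succ⟩
    · intro r
      exact ⟨fun _ => r, rfl⟩

lemma thickClosure_of_finite_projective (P : ModuleCat.{u} R) [Module.Finite R P]
    [hP : Projective P] : ThickClosure (ModuleCat.of R R) P := by
  obtain ⟨n, f, hf⟩ := Module.Finite.exists_fin' R P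
  let e : (ULift.{u} (Fin n) → R) ≃ₗ[R] (Fin n → R) := LinearEquiv.funCongrLeft R R Equiv.ulift.symm
  let g : ModuleCat.of R (ULift.{u} (Fin n) → R) ⟶ P := ModuleCat.ofHom (f ∘ₗ e.toLinearMap)
  have : Epi g := (ModuleCat.epi_iff_surjective _).2 (hf.comp e.surjective)
  exact .retract ⟨Projective.factorThru (𝟙 P) g, g, Projective.factorThru_comp _ _⟩
    (thickClosure_fin n)

/-- An object with a finite resolution by finitely generated projective modules lies in the thick
closure of the ring. -/
lemma thickClosure_of_resolution {M : ModuleCat.{u} R} (P : ProjectiveResolution M)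
    (hP : ∀ i, Module.Finite R (P.complex.X i)) (n : ℕ)
    (hn : ∀ i, n < i → Limits.IsZero (P.complex.X i)) : ThickClosure (ModuleCat.of R R) M := by
  have h1 (i : ℕ) : ThickClosure (ModuleCat.of R R) (P.complex.X i) :=
    thickClosure_of_finite_projective _
  have step {X Y Z : ModuleCat.{u} R} (f : X ⟶ Y) (g : Y ⟶ Z) (w : f ≫ g = 0)
      (hex : (ShortComplex.mk f g w).Exact) (hX : ThickClosure (ModuleCat.of R R) X)
      (hK : ThickClosure (ModuleCat.of R R) (ModuleCat.of R (LinearMap.ker f.hom))) :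
      ThickClosure (ModuleCat.of R R) (ModuleCat.of R (LinearMap.ker g.hom)) := by
    rw [ShortComplex.moduleCat_exact_iff] at hex
    let q := f.hom.codRestrict (LinearMap.ker g.hom) (fun x => ConcreteCategory.congr_hom w x)
    have hq : Function.Surjective q := by
      rintro ⟨y, hy⟩
      obtain ⟨x, hx⟩ := hex y hy
      exact ⟨x, Subtype.ext hx⟩
    refine .ext₃ (LinearMap.shortExact_shortComplexKer hq) ?_ hX
    refine thickClosure_of_iso (LinearEquiv.toModuleIso ?_) hK
    exact LinearEquiv.ofEq _ _ (LinearMap.ker_codRestrict _ _ _).symm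
  have h2 : ∀ j i, n < i + j → ThickClosure (ModuleCat.of R R)
      (ModuleCat.of R (LinearMap.ker (P.complex.d (i + 1) i).hom)) := by
    intro j
    induction j with
    | zero =>
      intro i hi
      have := ModuleCat.subsingleton_of_isZero (hn (i + 1) (by lia))
      exact thickClosure_of_isZero (ModuleCat.isZero_of_subsingleton _)
    | succ j ih =>
      intro i hi
      exact step _ _ _ (P.exact_succ i) (h1 _) (ih (i + 1) (by lia))
  have h3 : Function.Surjective (P.π.f 0).hom := by
    have : Epi (P.π.f 0) := inferInstance
    exact (ModuleCat.epi_iff_surjective _).1 this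
  refine thickClosure_of_iso (HomologicalComplex.singleObjXSelf (.down ℕ) 0 M) ?_
  exact .ext₃ (LinearMap.shortExact_shortComplexKer h3)
    (step _ _ _ P.exact₀ (h1 1) (h2 (n + 1) 0 (by lia))) (h1 0)

end Perfect

/-- A finite resolution by finitely generated projective bimodules exists if and only if the
diagonal bimodule lies in the thick closure of the enveloping algebra. -/
lemma homologicallySmooth_iff {k A : Type u} [Field k] [Ring A] [Algebra k A] :
    HomologicallySmooth k A ↔ ThickClosure (ModuleCat.of (Env k A) (Env k A)) (selfBimod k A) :=
  ⟨fun ⟨P, h, n, hn⟩ => thickClosure_of_resolution P h n hn, fun h => h.exists_resolution⟩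

end SmashDuality

/-! ### Exact functors given by tensoring the underlying space -/

namespace SmashDuality
section TensorFunctors
variable {k R S : Type u} [Field k] [Ring R] [Algebra k R] [Ring S] [Algebra k S]

/-- A morphism of modules from an additive map. -/
def mkHom {R : Type u} [Ring R] {M N : ModuleCat.{u} R} (f : M →+ N)
    (h : ∀ (r : R) x, f (r • x) = r • f x) : M ⟶ N :=
  ConcreteCategory.ofHom { f with map_smul' := h }

/-- The module on `V` given by an action. -/
def mkMod (V : Type u) [AddCommGroup V] [Module k V] (act : S →ₐ[k] Module.End k V) :
    ModuleCat.{u} S :=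
  letI : Module S V := Module.compHom V act.toRingHom
  ModuleCat.of S V

/-- Elements of `V` as elements of the module on `V`. -/
def toMod {V : Type u} [AddCommGroup V] [Module k V] (act : S →ₐ[k] Module.End k V) :
    V ≃+ mkMod V act := AddEquiv.refl V

lemma smul_toMod {V : Type u} [AddCommGroup V] [Module k V] (act : S →ₐ[k] Module.End k V)
    (s : S) (v : V) : s • toMod act v = toMod act (act s v) := rfl

lemma algebraMap_smul_toMod {V : Type u} [AddCommGroup V] [Module k V]
    (act : S →ₐ[k] Module.End k V) (c : k) (v : V) : c • toMod act v = toMod act (c • v) := by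
  rw [← algebraMap_smul S c (toMod act v), smul_toMod, AlgHom.commutes]
  rfl

/-- A family of `S`-module structures on the spaces `U ⊗ M`, natural in the `R`-module `M`. -/
structure TensorAction (k R S : Type u) [Field k] [Ring R] [Algebra k R] [Ring S] [Algebra k S]
    (U : Type u) [AddCommGroup U] [Module k U] where
  act : ∀ M : ModuleCat.{u} R, S →ₐ[k] Module.End k (U ⊗[k] M)
  nat : ∀ {M N : ModuleCat.{u} R} (f : M ⟶ N) (s : S) (x : U ⊗[k] M),
    LinearMap.lTensor U (f.hom.restrictScalars k) (act M s x) =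
      act N s (LinearMap.lTensor U (f.hom.restrictScalars k) x)

variable {U : Type u} [AddCommGroup U] [Module k U] (T : TensorAction k R S U)

/-- The functor `M ↦ U ⊗ M`. -/
def TensorAction.functor : ModuleCat.{u} R ⥤ ModuleCat.{u} S where
  obj M := mkMod (U ⊗[k] M) (T.act M)
  map {M N} f := mkHom ((toMod (T.act N)).toAddMonoidHom.comp
    ((LinearMap.lTensor U (f.hom.restrictScalars k)).toAddMonoidHom.comp
      (toMod (T.act M)).symm.toAddMonoidHom)) fun s x => T.nat f s x
  map_id M := by
    ext x
    exact LinearMap.congr_fun (LinearMap.lTensor_id U M) x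
  map_comp f g := by
    ext x
    exact LinearMap.congr_fun (LinearMap.lTensor_comp U (g.hom.restrictScalars k)
      (f.hom.restrictScalars k)) x

instance : T.functor.Additive where
  map_add {M N f g} := by
    ext x
    exact LinearMap.congr_fun (LinearMap.lTensor_add U (f.hom.restrictScalars k)
      (g.hom.restrictScalars k)) x

lemma TensorAction.map_exact (X : ShortComplex (ModuleCat.{u} R)) (hX : X.Exact) :
    (X.map T.functor).Exact := by
  rw [ShortComplex.ShortExact.moduleCat_exact_iff_function_exact] at hX ⊢
  exact Module.Flat.lTensor_exact (R := k) U (f := X.f.hom.restrictScalars k)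
    (g := X.g.hom.restrictScalars k) hX

instance : T.functor.PreservesHomology := (T.functor.exact_tfae.out 1 2 :).1 T.map_exact

instance : Limits.PreservesFiniteLimits T.functor :=
  ((T.functor.exact_tfae.out 1 3 :).1 T.map_exact).1

instance : Limits.PreservesFiniteColimits T.functor :=
  ((T.functor.exact_tfae.out 1 3 :).1 T.map_exact).2

end TensorFunctors

section Induction
variable (k : Type u) {R S : Type u} [Field k] [Ring R] [Algebra k R] [Ring S] [Algebra k S]
  (U : Type u) [AddCommGroup U] [Module k U]

/-- An algebra homomorphism `φ : R → S` such that `S` is free as a right `R`-module, with a space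
of generators `u : U → S`. -/
structure FreeExtension (R S : Type u) [Ring R] [Algebra k R] [Ring S] [Algebra k S] where
  φ : R →ₐ[k] S
  u : U →ₗ[k] S
  bijective : Function.Bijective
    (TensorProduct.lift ((LinearMap.mul k S).compl₁₂ u φ.toLinearMap) : U ⊗[k] R →ₗ[k] S)

lemma semilinear_smul {M : ModuleCat.{u} R} {N : ModuleCat.{u} S} {φ : R →ₐ[k] S} (g : M →+ N)
    (hg : ∀ (r : R) m, g (r • m) = φ r • g m) (c : k) (m : M) : g (c • m) = c • g m := by
  rw [← algebraMap_smul R c m, hg, AlgHom.commutes, algebraMap_smul]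

variable {k U}
namespace FreeExtension
variable (E : FreeExtension k U R S)

/-- `x ⊗ r ↦ u(x) φ(r)`. -/
def μ : U ⊗[k] R ≃ₗ[k] S := LinearEquiv.ofBijective _ E.bijective

lemma μ_tmul (x : U) (r : R) : E.μ (x ⊗ₜ r) = E.u x * E.φ r := rfl

/-- The class of `s ⊗ m` in `U ⊗ M`, the space underlying `S ⊗_R M`. -/
def cls (M : ModuleCat.{u} R) : S →ₗ[k] M →ₗ[k] U ⊗[k] M :=
  TensorProduct.lift ((LinearMap.llcomp k M M (U ⊗[k] M)).compl₁₂ (TensorProduct.mk k U M)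
    (Algebra.lsmul k k M).toLinearMap) ∘ₗ E.μ.symm.toLinearMap

variable (M : ModuleCat.{u} R)

lemma cls_u_mul (x : U) (r : R) (m : M) : E.cls M (E.u x * E.φ r) m = x ⊗ₜ (r • m) := by
  simp only [cls, LinearMap.comp_apply, LinearEquiv.coe_coe]
  rw [← E.μ_tmul, LinearEquiv.symm_apply_apply]
  rfl

lemma cls_u (x : U) (m : M) : E.cls M (E.u x) m = x ⊗ₜ m := by
  have := E.cls_u_mul M x 1 m
  rwa [map_one, mul_one, one_smul] at this

variable {M} in
lemma cls_mul (s : S) (r : R) (m : M) : E.cls M (s * E.φ r) m = E.cls M s (r • m) := by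
  obtain ⟨t, rfl⟩ := E.μ.surjective s
  induction t using TensorProduct.induction_on with
  | zero => simp
  | add x y hx hy => rw [map_add, add_mul, map_add, map_add, LinearMap.add_apply,
      LinearMap.add_apply, hx, hy]
  | tmul x r' => rw [μ_tmul, mul_assoc, ← map_mul, cls_u_mul, cls_u_mul, mul_smul]

/-- Left multiplication on `S ⊗_R M`. -/
def actLin (s : S) : U ⊗[k] M →ₗ[k] U ⊗[k] M :=
  TensorProduct.lift (E.cls M ∘ₗ LinearMap.mulLeft k s ∘ₗ E.u)

variable {M} in
lemma actLin_cls (s s' : S) (m : M) : E.actLin M s (E.cls M s' m) = E.cls M (s * s') m := by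
  obtain ⟨t, rfl⟩ := E.μ.surjective s'
  induction t using TensorProduct.induction_on with
  | zero => simp
  | add x y hx hy => rw [map_add, mul_add, map_add, map_add, LinearMap.add_apply,
      LinearMap.add_apply, map_add, hx, hy]
  | tmul x r =>
    rw [μ_tmul, cls_u_mul, ← mul_assoc, cls_mul]
    rfl

lemma lin_ext {N : Type*} [AddCommGroup N] [Module k N] {f g : U ⊗[k] M →ₗ[k] N}
    (h : ∀ s m, f (E.cls M s m) = g (E.cls M s m)) : f = g :=
  TensorProduct.ext' fun x m => by rw [← E.cls_u]; exact h _ _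

variable {M} in
lemma lTensor_cls {N : ModuleCat.{u} R} (f : M ⟶ N) (s : S) (m : M) :
    LinearMap.lTensor U (f.hom.restrictScalars k) (E.cls M s m) = E.cls N s (f.hom m) := by
  obtain ⟨t, rfl⟩ := E.μ.surjective s
  induction t using TensorProduct.induction_on with
  | zero => simp
  | add x y hx hy => rw [map_add, map_add, map_add, LinearMap.add_apply, LinearMap.add_apply,
      map_add, hx, hy]
  | tmul x r =>
    rw [μ_tmul, cls_u_mul, cls_u_mul, LinearMap.lTensor_tmul]
    congr 1
    exact map_smul f.hom r m

/-- The functor `M ↦ S ⊗_R M`. -/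
def tensorAction : TensorAction k R S U where
  act M := AlgHom.ofLinearMap
    { toFun := fun s => E.actLin M s
      map_add' := fun s t => E.lin_ext M fun s' m => by
        rw [LinearMap.add_apply, actLin_cls, actLin_cls, actLin_cls, add_mul, map_add,
          LinearMap.add_apply]
      map_smul' := fun c s => E.lin_ext M fun s' m => by
        rw [LinearMap.smul_apply, actLin_cls, actLin_cls, smul_mul_assoc, map_smul,
          LinearMap.smul_apply]
        rfl }
    (E.lin_ext M fun s m => (E.actLin_cls _ _ _).trans (by rw [one_mul]; rfl))
    (fun s t => E.lin_ext M fun s' m => by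
      refine (E.actLin_cls _ _ _).trans ?_
      rw [mul_assoc]
      exact ((congrArg _ (E.actLin_cls _ _ _)).trans (E.actLin_cls _ _ _)).symm)
  nat {M N} f s x := by
    refine LinearMap.congr_fun
      (f := LinearMap.lTensor U (f.hom.restrictScalars k) ∘ₗ E.actLin M s)
      (g := E.actLin N s ∘ₗ LinearMap.lTensor U (f.hom.restrictScalars k)) ?_ x
    refine E.lin_ext M fun s' m => ?_
    simp only [LinearMap.comp_apply, actLin_cls, lTensor_cls]

/-- The induction functor `M ↦ S ⊗_R M`. -/
abbrev ind : ModuleCat.{u} R ⥤ ModuleCat.{u} S := E.tensorAction.functor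

/-- The unit `m ↦ 1 ⊗ m`. -/
def η : M →+ E.ind.obj M := (toMod (E.tensorAction.act M)).toAddMonoidHom.comp
  (E.cls M 1).toAddMonoidHom

variable {M}

lemma smul_η (s : S) (m : M) : s • E.η M m = toMod (E.tensorAction.act M) (E.cls M s m) := by
  change toMod (E.tensorAction.act M) (E.actLin M s (E.cls M 1 m)) = _
  rw [actLin_cls, mul_one]

lemma η_smul (r : R) (m : M) : E.η M (r • m) = E.φ r • E.η M m := by
  rw [smul_η, ← one_mul (E.φ r), cls_mul]
  rfl

lemma toMod_tmul (x : U) (m : M) : toMod (E.tensorAction.act M) (x ⊗ₜ m) = E.u x • E.η M m := by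
  rw [smul_η, cls_u]

lemma ind_induction {p : E.ind.obj M → Prop} (x : E.ind.obj M)
    (h : ∀ x m, p (E.u x • E.η M m)) (h0 : p 0) (hadd : ∀ x y, p x → p y → p (x + y)) : p x := by
  obtain ⟨t, rfl⟩ := (toMod (E.tensorAction.act M)).surjective x
  induction t using TensorProduct.induction_on with
  | zero => rwa [map_zero]
  | add x y hx hy => rw [map_add]; exact hadd _ _ hx hy
  | tmul x m => rw [toMod_tmul]; exact h x m

lemma addHom_ext {N : Type*} [AddCommGroup N] {f g : E.ind.obj M →+ N}
    (h : ∀ x m, f (E.u x • E.η M m) = g (E.u x • E.η M m)) : f = g :=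
  AddMonoidHom.ext fun x => E.ind_induction (p := fun x => f x = g x) x h (by rw [map_zero, map_zero]) fun x y hx hy => by rw [map_add, map_add, hx, hy]

lemma hom_ext {N : ModuleCat.{u} S} {f g : E.ind.obj M ⟶ N}
    (h : ∀ m, f.hom (E.η M m) = g.hom (E.η M m)) : f = g := by
  ext x
  refine E.ind_induction (p := fun x => f.hom x = g.hom x) x (fun x m => ?_) (by simp)
    fun x y hx hy => by rw [map_add, map_add, hx, hy]
  rw [map_smul, map_smul, h]

lemma map_η {N : ModuleCat.{u} R} (f : M ⟶ N) (m : M) :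
    (E.ind.map f).hom (E.η M m) = E.η N (f.hom m) := by
  exact congrArg (toMod (E.tensorAction.act N)) (E.lTensor_cls f 1 m)

section Lift
variable {N : ModuleCat.{u} S} (g : M →+ N) (hg : ∀ (r : R) m, g (r • m) = E.φ r • g m)
include hg

/-- The linear map underlying the extension of a `φ`-semilinear map. -/
def liftLin : U ⊗[k] M →ₗ[k] N :=
  TensorProduct.lift ((Algebra.lsmul k k N).toLinearMap.compl₁₂ E.u
    { g with map_smul' := semilinear_smul k g hg })

lemma liftLin_cls (s : S) (m : M) : E.liftLin g hg (E.cls M s m) = s • g m := by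
  obtain ⟨t, rfl⟩ := E.μ.surjective s
  induction t using TensorProduct.induction_on with
  | zero => simp
  | add x y hx hy => rw [map_add, map_add, LinearMap.add_apply, map_add, hx, hy, add_smul]
  | tmul x r =>
    rw [μ_tmul, cls_u_mul, mul_smul, ← hg]
    rfl

/-- The extension of a `φ`-semilinear map to the induced module. -/
def lift : E.ind.obj M ⟶ N :=
  mkHom ((E.liftLin g hg).toAddMonoidHom.comp (toMod (E.tensorAction.act M)).symm.toAddMonoidHom)
    fun s x => by
      refine LinearMap.congr_fun (f := E.liftLin g hg ∘ₗ E.actLin M s)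
        (g := Algebra.lsmul k k N s ∘ₗ E.liftLin g hg) (E.lin_ext M fun s' m => ?_) x
      simp only [LinearMap.comp_apply]
      rw [actLin_cls, liftLin_cls, liftLin_cls, mul_smul]
      rfl

lemma lift_η (m : M) : (E.lift g hg).hom (E.η M m) = g m :=
  (E.liftLin_cls g hg 1 m).trans (one_smul _ _)
end Lift

instance : E.ind.PreservesProjectiveObjects where
  projective_obj {P} hP := ⟨fun {N X} f e he => by
    let φ' := E.φ.toRingHom
    let e' : (ModuleCat.restrictScalars φ').obj N ⟶ (ModuleCat.restrictScalars φ').obj X :=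
      (ModuleCat.restrictScalars φ').map e
    let f' : P ⟶ (ModuleCat.restrictScalars φ').obj X :=
      mkHom (N := (ModuleCat.restrictScalars φ').obj X) (f.hom.toAddMonoidHom.comp (E.η P))
        fun r m => (congrArg f.hom (E.η_smul r m)).trans (map_smul f.hom _ _)
    have he' : Epi e' := (ModuleCat.epi_iff_surjective e').2 ((ModuleCat.epi_iff_surjective e).1 he)
    let g := Projective.factorThru f' e'
    have hg : g ≫ e' = f' := Projective.factorThru_comp _ _
    refine ⟨E.lift (N := N) g.hom.toAddMonoidHom (fun r m => map_smul g.hom r m),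
      E.hom_ext fun m => ?_⟩
    exact (congrArg e.hom (E.lift_η _ _ m)).trans (ConcreteCategory.congr_hom hg m)⟩

end FreeExtension
end Induction
end SmashDuality

/-! ### Convolution along a bilinear map -/

namespace SmashDuality
section Convolution
variable {k H : Type u} [Field k] [Ring H] [HopfAlgebra k H]
  {X Y Z V W X' Y' Z' : Type*} [AddCommGroup X] [Module k X] [AddCommGroup Y] [Module k Y]
  [AddCommGroup Z] [Module k Z] [AddCommGroup V] [Module k V] [AddCommGroup W] [Module k W]
  [AddCommGroup X'] [Module k X'] [AddCommGroup Y'] [Module k Y'] [AddCommGroup Z'] [Module k Z']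

/-- The convolution `h ↦ B (f h₁) (g h₂)` of two linear maps on `H` along a bilinear map `B`. -/
def cv (B : X →ₗ[k] Y →ₗ[k] Z) (f : H →ₗ[k] X) (g : H →ₗ[k] Y) : H →ₗ[k] Z :=
  TensorProduct.lift (B.compl₁₂ f g) ∘ₗ comul

lemma cv_apply (B : X →ₗ[k] Y →ₗ[k] Z) (f : H →ₗ[k] X) (g : H →ₗ[k] Y) (h : H) :
    cv B f g h = ∑ i ∈ (ℛ k h).index, B (f ((ℛ k h).left i)) (g ((ℛ k h).right i)) := by
  rw [cv, LinearMap.comp_apply]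
  conv_lhs => rw [← (ℛ k h).eq]
  simp

lemma cv_eq_lift (B : X →ₗ[k] Y →ₗ[k] Z) (f : H →ₗ[k] X) (g : H →ₗ[k] Y) (h : H) :
    cv B f g h = TensorProduct.lift (B.compl₁₂ f g) (comul h) := rfl

lemma cv_mul {B : Type*} [Ring B] [Algebra k B] (f g : H →ₗ[k] B) :
    cv (LinearMap.mul k B) f g = (toConv f * toConv g).ofConv := by
  ext h
  rw [cv_apply]
  exact ((ℛ k h).convMul_apply _ _).symm

lemma cv_congr {B : X →ₗ[k] Y →ₗ[k] Z} {f : H →ₗ[k] X} {g : H →ₗ[k] Y}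
    {B' : X' →ₗ[k] Y' →ₗ[k] Z'} {f' : H →ₗ[k] X'} {g' : H →ₗ[k] Y'} (T : Z →ₗ[k] W)
    (T' : Z' →ₗ[k] W) (h : ∀ u v, T (B (f u) (g v)) = T' (B' (f' u) (g' v))) (x : H) :
    T (cv B f g x) = T' (cv B' f' g' x) := by
  rw [cv_apply, cv_apply, map_sum, map_sum]
  exact Finset.sum_congr rfl fun i _ => h _ _

lemma map_cv {B : X →ₗ[k] Y →ₗ[k] Z} {f : H →ₗ[k] X} {g : H →ₗ[k] Y}
    {B' : X' →ₗ[k] Y' →ₗ[k] W} {f' : H →ₗ[k] X'} {g' : H →ₗ[k] Y'} (T : Z →ₗ[k] W)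
    (h : ∀ u v, T (B (f u) (g v)) = B' (f' u) (g' v)) (x : H) :
    T (cv B f g x) = cv B' f' g' x :=
  cv_congr T LinearMap.id h x

lemma cv_ext {B : X →ₗ[k] Y →ₗ[k] W} {f : H →ₗ[k] X} {g : H →ₗ[k] Y}
    {B' : X' →ₗ[k] Y' →ₗ[k] W} {f' : H →ₗ[k] X'} {g' : H →ₗ[k] Y'}
    (h : ∀ u v, B (f u) (g v) = B' (f' u) (g' v)) : cv B f g = cv B' f' g' :=
  LinearMap.ext fun x => cv_congr LinearMap.id LinearMap.id h x

lemma cv_assoc {B : V →ₗ[k] Z →ₗ[k] W} {B' : X →ₗ[k] Y →ₗ[k] V} {C : X →ₗ[k] Z' →ₗ[k] W}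
    {C' : Y →ₗ[k] Z →ₗ[k] Z'} {f : H →ₗ[k] X} {g : H →ₗ[k] Y} {l : H →ₗ[k] Z}
    (h : ∀ x y z, B (B' (f x) (g y)) (l z) = C (f x) (C' (g y) (l z))) :
    cv B (cv B' f g) l = cv C f (cv C' g l) := by
  ext x
  have key := congrArg (TensorProduct.lift (C.compl₁₂ f (TensorProduct.lift (C'.compl₁₂ g l))))
    (sum_tmul_tmul_eq (ℛ k x) (fun i => ℛ k ((ℛ k x).left i)) (fun i => ℛ k ((ℛ k x).right i)))
  simp only [map_sum, TensorProduct.lift.tmul, LinearMap.compl₁₂_apply] at key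
  simp only [cv_apply, map_sum, LinearMap.sum_apply, h, key]

lemma cv_counit_left (B : X →ₗ[k] Y →ₗ[k] Z) (x : X) (g : H →ₗ[k] Y) (h : H) :
    cv B (LinearMap.toSpanSingleton k X x ∘ₗ counit) g h = B x (g h) := by
  rw [cv_apply]
  conv_rhs => rw [← sum_counit_smul (ℛ k h)]
  simp

lemma cv_counit_right (B : X →ₗ[k] Y →ₗ[k] Z) (f : H →ₗ[k] X) (y : Y) (h : H) :
    cv B f (LinearMap.toSpanSingleton k Y y ∘ₗ counit) h = B (f h) y := by
  have := congrArg (TensorProduct.lift ((LinearMap.lsmul k Z).flip ∘ₗ (B.flip y ∘ₗ f)))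
    (sum_tmul_counit_eq (R := k) (ℛ k h))
  simp only [map_sum, TensorProduct.lift.tmul] at this
  rw [cv_apply]
  refine Eq.trans (Finset.sum_congr rfl fun i _ => ?_) (this.trans (one_smul k _))
  exact map_smul (B (f ((ℛ k h).left i))) _ y

lemma cv_comp {B : X →ₗ[k] Y →ₗ[k] Z} {f : H →ₗ[k] X} {g : H →ₗ[k] Y} {s t r : H →ₗ[k] H} {h : H}
    (hs : comul (s h) = TensorProduct.map t r (comul h)) :
    cv B f g (s h) = cv B (f ∘ₗ t) (g ∘ₗ r) h := by
  rw [cv_eq_lift, hs, cv_eq_lift, ← LinearMap.comp_apply]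
  congr 1
  exact TensorProduct.ext' fun _ _ => rfl

lemma cv_antipode (B : X →ₗ[k] Y →ₗ[k] Z) (f : H →ₗ[k] X) (g : H →ₗ[k] Y) (h : H) :
    cv B f g (HopfAlgebra.antipode k h) =
      cv B.flip (g ∘ₗ HopfAlgebra.antipode k) (f ∘ₗ HopfAlgebra.antipode k) h := by
  rw [cv_eq_lift, comul_antipode, cv_eq_lift]
  exact LinearMap.congr_fun (f := TensorProduct.lift (B.compl₁₂ f g) ∘ₗ
    TensorProduct.map (HopfAlgebra.antipode k) (HopfAlgebra.antipode k) ∘ₗ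
      (TensorProduct.comm k H H).toLinearMap)
    (g := TensorProduct.lift (B.flip.compl₁₂ (g ∘ₗ HopfAlgebra.antipode k)
      (f ∘ₗ HopfAlgebra.antipode k)))
    (TensorProduct.ext' fun _ _ => rfl) (comul h)

lemma comul_antipodeSq (h : H) : comul (antipodeSq k H h) =
    TensorProduct.map (antipodeSq k H) (antipodeSq k H) (comul h) := by
  rw [antipodeSq, LinearMap.comp_apply, comul_antipode, comul_antipode]
  generalize comul (R := k) h = t
  induction t using TensorProduct.induction_on with
  | zero => simp
  | add x y hx hy => simp only [map_add, hx, hy]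
  | tmul x y => rfl

lemma cv_antipodeSq (B : X →ₗ[k] Y →ₗ[k] Z) (f : H →ₗ[k] X) (g : H →ₗ[k] Y) (h : H) :
    cv B f g (antipodeSq k H h) = cv B (f ∘ₗ antipodeSq k H) (g ∘ₗ antipodeSq k H) h :=
  cv_comp (comul_antipodeSq h)

/-- `S²` is an algebra endomorphism. -/
def antipodeSqHom : H →ₐ[k] H := AlgHom.ofLinearMap (antipodeSq k H) (by simp [antipodeSq])
  (fun x y => by simp [antipodeSq, HopfAlgebra.antipode_mul_antidistrib])

/-- The unit of convolution with values in `B`. -/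
def cunit (B : Type*) [Ring B] [Algebra k B] : H →ₗ[k] B :=
  LinearMap.toSpanSingleton k B 1 ∘ₗ counit

lemma cunit_apply {B : Type*} [Ring B] [Algebra k B] (h : H) :
    cunit (k := k) B h = counit (R := k) h • (1 : B) := rfl

section AntipodeIdentities
variable {B : Type*} [Ring B] [Algebra k B]
open HopfAlgebra

lemma cv_antipode_mul (f : H →ₐ[k] B) :
    cv (LinearMap.mul k B) (f.toLinearMap ∘ₗ antipode k) f.toLinearMap = cunit B := by
  ext h
  have := congrArg f (sum_antipode_mul_eq_smul (R := k) (ℛ k h))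
  simpa [cv_apply, cunit_apply] using this

lemma cv_mul_antipode (f : H →ₐ[k] B) :
    cv (LinearMap.mul k B) f.toLinearMap (f.toLinearMap ∘ₗ antipode k) = cunit B := by
  ext h
  have := congrArg f (sum_mul_antipode_eq_smul (R := k) (ℛ k h))
  simpa [cv_apply, cunit_apply] using this

variable (hS : Function.Bijective (antipode k (A := H)))

/-- The inverse of the antipode. -/
def antipodeInv : H →ₗ[k] H := (LinearEquiv.ofBijective (antipode k (A := H)) hS).symm.toLinearMap

lemma antipode_antipodeInv (h : H) : antipode k (antipodeInv hS h) = h :=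
  (LinearEquiv.ofBijective (antipode k (A := H)) hS).apply_symm_apply h

lemma cv_antipodeInv_mul (f : H →ₐ[k] B) :
    cv (LinearMap.mul k B).flip f.toLinearMap (f.toLinearMap ∘ₗ antipodeInv hS) = cunit B := by
  ext h
  have h1 : cv (LinearMap.mul k H).flip LinearMap.id (antipodeInv hS) h =
      counit (R := k) h • (1 : H) := by
    apply hS.1
    rw [map_cv (B' := LinearMap.mul k H) (f' := antipode k) (g' := LinearMap.id) (antipode k)
      (fun u v => by simp [antipode_mul_antidistrib, antipode_antipodeInv])]
    have := sum_antipode_mul_eq_smul (R := k) (ℛ k h)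
    simpa [cv_apply] using this
  have h2 := congrArg f h1
  rw [← AlgHom.toLinearMap_apply, map_cv (B' := (LinearMap.mul k B).flip) (f' := f.toLinearMap)
    (g' := f.toLinearMap ∘ₗ antipodeInv hS) f.toLinearMap (fun u v => by simp)] at h2
  simpa [cunit_apply] using h2

lemma cv_mul_antipodeInv (f : H →ₐ[k] B) :
    cv (LinearMap.mul k B).flip (f.toLinearMap ∘ₗ antipodeInv hS) f.toLinearMap = cunit B := by
  ext h
  have h1 : cv (LinearMap.mul k H).flip (antipodeInv hS) LinearMap.id h =
      counit (R := k) h • (1 : H) := by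
    apply hS.1
    rw [map_cv (B' := LinearMap.mul k H) (f' := LinearMap.id) (g' := antipode k) (antipode k)
      (fun u v => by simp [antipode_mul_antidistrib, antipode_antipodeInv])]
    have := sum_mul_antipode_eq_smul (R := k) (ℛ k h)
    simpa [cv_apply] using this
  have h2 := congrArg f h1
  rw [← AlgHom.toLinearMap_apply, map_cv (B' := (LinearMap.mul k B).flip)
    (f' := f.toLinearMap ∘ₗ antipodeInv hS)
    (g' := f.toLinearMap) f.toLinearMap (fun u v => by simp)] at h2
  simpa [cunit_apply] using h2
end AntipodeIdentities

section Twists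
variable {M : Type*} [AddCommGroup M] [Module k M]

/-- `m ⊗ h ↦ u(h₁) m ⊗ h₂`. -/
def twistL (u : H →ₗ[k] Module.End k M) : M ⊗[k] H →ₗ[k] M ⊗[k] H :=
  TensorProduct.lift
    { toFun := fun m => cv (TensorProduct.mk k M H) (u.flip m) LinearMap.id
      map_add' := fun x y => by ext h; simp [cv_apply, TensorProduct.add_tmul, Finset.sum_add_distrib]
      map_smul' := fun c x => by ext h; simp [cv_apply, TensorProduct.smul_tmul', Finset.smul_sum] }

/-- `m ⊗ h ↦ u(h₂) m ⊗ h₁`. -/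
def twistR (u : H →ₗ[k] Module.End k M) : M ⊗[k] H →ₗ[k] M ⊗[k] H :=
  TensorProduct.lift
    { toFun := fun m => cv (TensorProduct.mk k M H).flip LinearMap.id (u.flip m)
      map_add' := fun x y => by ext h; simp [cv_apply, TensorProduct.add_tmul, Finset.sum_add_distrib]
      map_smul' := fun c x => by ext h; simp [cv_apply, TensorProduct.smul_tmul', Finset.smul_sum] }

lemma twistL_tmul (u : H →ₗ[k] Module.End k M) (m : M) (h : H) :
    twistL u (m ⊗ₜ h) = cv (TensorProduct.mk k M H) (u.flip m) LinearMap.id h := rfl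

lemma twistR_tmul (u : H →ₗ[k] Module.End k M) (m : M) (h : H) :
    twistR u (m ⊗ₜ h) = cv (TensorProduct.mk k M H).flip LinearMap.id (u.flip m) h := rfl

lemma twistL_twistL {u v : H →ₗ[k] Module.End k M}
    (huv : cv (LinearMap.mul k (Module.End k M)).flip u v = cunit _) (x : M ⊗[k] H) :
    twistL v (twistL u x) = x := by
  refine LinearMap.congr_fun (f := twistL v ∘ₗ twistL u) (g := LinearMap.id)
    (TensorProduct.ext' fun m h => ?_) x
  let C : M →ₗ[k] Module.End k M ⊗[k] H →ₗ[k] M ⊗[k] H :=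
    (LinearMap.rTensorHom H ∘ₗ (LinearMap.applyₗ (R := k) (M := M) (M₂ := M)))
  change twistL v (twistL u (m ⊗ₜ h)) = m ⊗ₜ h
  rw [twistL_tmul, map_cv (B' := C) (f' := u.flip m)
    (g' := cv (TensorProduct.mk k (Module.End k M) H) v LinearMap.id) (twistL v)]
  · have h1 : cv C (u.flip m) (cv (TensorProduct.mk k (Module.End k M) H) v LinearMap.id) =
      cv (TensorProduct.mk k M H) (cv (LinearMap.id (R := k) (M := M →ₗ[k] M)).flip (u.flip m) v)
        LinearMap.id := (cv_assoc fun x y z => rfl).symm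
    have h2 : cv (LinearMap.id (R := k) (M := M →ₗ[k] M)).flip (u.flip m) v =
        LinearMap.toSpanSingleton k M m ∘ₗ counit := by
      ext h
      have := LinearMap.congr_fun (LinearMap.congr_fun huv h) m
      refine Eq.trans ?_ (this.trans ?_)
      · simp [cv_apply, LinearMap.sum_apply]
      · simp [cunit_apply]
    rw [h1, h2, cv_counit_left]
    rfl
  · intro x y
    change twistL v (u x m ⊗ₜ y) = C (u x m) _
    rw [twistL_tmul]
    exact (map_cv (C (u x m)) (fun u v => rfl) y).symm

lemma twistR_twistR {u v : H →ₗ[k] Module.End k M}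
    (huv : cv (LinearMap.mul k (Module.End k M)) u v = cunit _) (x : M ⊗[k] H) :
    twistR u (twistR v x) = x := by
  refine LinearMap.congr_fun (f := twistR u ∘ₗ twistR v) (g := LinearMap.id)
    (TensorProduct.ext' fun m h => ?_) x
  let C : (Module.End k M ⊗[k] H) →ₗ[k] M →ₗ[k] M ⊗[k] H :=
    (LinearMap.rTensorHom H ∘ₗ (LinearMap.applyₗ (R := k) (M := M) (M₂ := M))).flip
  change twistR u (twistR v (m ⊗ₜ h)) = m ⊗ₜ h
  rw [twistR_tmul, map_cv (B' := C) (g' := v.flip m)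
    (f' := cv (TensorProduct.mk k (Module.End k M) H).flip LinearMap.id u) (twistR u)]
  · have h1 : cv C (cv (TensorProduct.mk k (Module.End k M) H).flip LinearMap.id u) (v.flip m) =
      cv (TensorProduct.mk k M H).flip LinearMap.id
       (cv (LinearMap.id (R := k) (M := M →ₗ[k] M)) u (v.flip m)) := cv_assoc fun x y z => rfl
    have h2 : cv (LinearMap.id (R := k) (M := M →ₗ[k] M)) u (v.flip m) =
        LinearMap.toSpanSingleton k M m ∘ₗ counit := by
      ext h
      have := LinearMap.congr_fun (LinearMap.congr_fun huv h) m
      refine Eq.trans ?_ (this.trans ?_)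
      · simp [cv_apply, LinearMap.sum_apply]
      · simp [cunit_apply]
    rw [h1, h2, cv_counit_right]
    rfl
  · intro x y
    change twistR u (v y m ⊗ₜ x) = C _ (v y m)
    rw [twistR_tmul]
    exact (map_cv (C.flip (v y m)) (fun u v => rfl) x).symm

/-- For an action `ρ`, the map `m ⊗ h ↦ h₂ m ⊗ h₁` is bijective. -/
lemma twistR_bijective (ρ : H →ₐ[k] Module.End k M) : Function.Bijective (twistR ρ.toLinearMap) :=
  Function.bijective_iff_has_inverse.2 ⟨_, twistR_twistR (cv_antipode_mul ρ),
    twistR_twistR (cv_mul_antipode ρ)⟩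

/-- For an action `ρ` and a bijective antipode, the map `m ⊗ h ↦ h₁ m ⊗ h₂` is bijective. -/
lemma twistL_bijective (hS : Function.Bijective (HopfAlgebra.antipode k (A := H)))
    (ρ : H →ₐ[k] Module.End k M) : Function.Bijective (twistL ρ.toLinearMap) :=
  Function.bijective_iff_has_inverse.2 ⟨_, twistL_twistL (cv_antipodeInv_mul hS ρ),
    twistL_twistL (cv_mul_antipodeInv hS ρ)⟩
end Twists

end Convolution
end SmashDuality

/-! ### Smash products, presented by their two subalgebras -/

namespace SmashDuality
section SmashPairs
variable {k H A : Type u} [Field k] [Ring H] [HopfAlgebra k H] [Ring A] [Algebra k A]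

/-- A presentation of an algebra `Λ` as the smash product of `A` and `H`: homomorphisms
`i : A → Λ` and `j : H → Λ` with `j(h) i(b) = i(h₁ b) j(h₂)`, such that `a ⊗ h ↦ i(a) j(h)` is
bijective.  Besides `A ♯ H`, this covers `H` as the smash product of `k` and `H`. -/
structure SmashPair (α : HopfAction k H A) (Λ : Type u) [Ring Λ] [Algebra k Λ] where
  i : A →ₐ[k] Λ
  j : H →ₐ[k] Λ
  comm : ∀ h b, j h * i b = cv (LinearMap.mul k Λ) (i.toLinearMap ∘ₗ α.on b) j.toLinearMap h
  bijective : Function.Bijective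
    (TensorProduct.lift ((LinearMap.mul k Λ).compl₁₂ i.toLinearMap j.toLinearMap) :
      A ⊗[k] H →ₗ[k] Λ)

namespace SmashPair
variable {α : HopfAction k H A} {Λ : Type u} [Ring Λ] [Algebra k Λ] (P : SmashPair α Λ)

/-- `a ⊗ h ↦ i(a) j(h)`. -/
def μ : A ⊗[k] H ≃ₗ[k] Λ := LinearEquiv.ofBijective _ P.bijective

lemma μ_tmul (a : A) (h : H) : P.μ (a ⊗ₜ h) = P.i a * P.j h := rfl

lemma induction {p : Λ → Prop} (x : Λ) (h : ∀ a h, p (P.i a * P.j h)) (h0 : p 0)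
    (hadd : ∀ x y, p x → p y → p (x + y)) : p x := by
  obtain ⟨t, rfl⟩ := P.μ.surjective x
  induction t using TensorProduct.induction_on with
  | zero => rwa [map_zero]
  | add x y hx hy => rw [map_add]; exact hadd _ _ hx hy
  | tmul a l => exact h a l

lemma env_induction {p : Env k Λ → Prop} (x : Env k Λ) (hi : ∀ a, p (P.i a ⊗ₜ 1))
    (hj : ∀ h, p (P.j h ⊗ₜ 1)) (hr : ∀ l : Λᵐᵒᵖ, p (1 ⊗ₜ l)) (h0 : p 0)
    (hadd : ∀ x y, p x → p y → p (x + y)) (hmul : ∀ x y, p x → p y → p (x * y)) : p x := by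
  induction x using TensorProduct.induction_on with
  | zero => exact h0
  | add x y hx hy => exact hadd _ _ hx hy
  | tmul x y =>
    have : (x ⊗ₜ y : Env k Λ) = (x ⊗ₜ 1) * (1 ⊗ₜ y) := by simp
    rw [this]
    refine hmul _ _ ?_ (hr y)
    refine P.induction (p := fun x => p (x ⊗ₜ 1)) x (fun a h => ?_) (by rwa [TensorProduct.zero_tmul])
      fun x y hx hy => by rw [TensorProduct.add_tmul]; exact hadd _ _ hx hy
    have : ((P.i a * P.j h) ⊗ₜ 1 : Env k Λ) = (P.i a ⊗ₜ 1) * (P.j h ⊗ₜ 1) := by simp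
    rw [this]
    exact hmul _ _ (hi a) (hj h)

section Relations
open HopfAlgebra

lemma conv_comm (b : A) : toConv (LinearMap.mulRight k (P.i b) ∘ₗ P.j.toLinearMap) =
    toConv (P.i.toLinearMap ∘ₗ α.on b) * toConv P.j.toLinearMap := by
  refine WithConv.ext (LinearMap.ext fun h => ?_)
  refine (P.comm h b).trans ?_
  rw [cv_mul]

lemma conv_mulRight {B : Type u} [Ring B] [Algebra k B] (f g : H →ₗ[k] B) (x : B) :
    toConv (LinearMap.mulRight k x ∘ₗ f) * toConv g =
      toConv f * toConv (LinearMap.mulLeft k x ∘ₗ g) := by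
  refine WithConv.ext (LinearMap.ext fun h => ?_)
  change (_ * _ : WithConv (H →ₗ[k] B)) h = (_ * _ : WithConv (H →ₗ[k] B)) h
  rw [(ℛ k h).convMul_apply, (ℛ k h).convMul_apply]
  exact Finset.sum_congr rfl fun i _ => mul_assoc _ _ _

/-- `i(b) j(S(v)) = j(S(v₁)) i(v₂ b)`. -/
lemma mul_antipode (v : H) (b : A) : P.i b * P.j (antipode k v) =
    cv (LinearMap.mul k Λ) (P.j.toLinearMap ∘ₗ antipode k) (P.i.toLinearMap ∘ₗ α.on b) v := by
  have h : toConv (LinearMap.mulLeft k (P.i b) ∘ₗ P.j.toLinearMap ∘ₗ antipode k) =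
      toConv (P.j.toLinearMap ∘ₗ antipode k) * toConv (P.i.toLinearMap ∘ₗ α.on b) := by
    rw [← mul_one (toConv (P.i.toLinearMap ∘ₗ α.on b)), ← conv_antipode_right P.j, ← mul_assoc,
      ← mul_assoc, mul_assoc (toConv (P.j.toLinearMap ∘ₗ antipode k)), ← P.conv_comm, mul_assoc,
      conv_mulRight, ← mul_assoc, conv_antipode_left, one_mul]
  rw [cv_mul]
  exact congrArg (fun f => f v) h

/-- `j(v₁) i(b) j(S(v₂)) = i(v b)`. -/
lemma conjugation (v : H) (b : A) : cv (LinearMap.mul k Λ) P.j.toLinearMap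
    (LinearMap.mulLeft k (P.i b) ∘ₗ P.j.toLinearMap ∘ₗ antipode k) v = P.i (α.act v b) := by
  have h : toConv P.j.toLinearMap * toConv (LinearMap.mulLeft k (P.i b) ∘ₗ P.j.toLinearMap ∘ₗ antipode k) =
      toConv (P.i.toLinearMap ∘ₗ α.on b) := by
    rw [← conv_mulRight, P.conv_comm, mul_assoc, conv_antipode_right, mul_one]
  rw [cv_mul]
  exact congrArg (fun f => f v) h

end Relations

lemma covariant_lmul : Covariant α ((Algebra.lmul k Λ).comp P.i) ((Algebra.lmul k Λ).comp P.j) := by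
  intro h b
  ext x
  change P.j h * (P.i b * x) = _
  rw [← mul_assoc, P.comm, cv_apply, ← (ℛ k h).eq]
  simp [Finset.sum_mul, mul_assoc]

lemma smashRep_apply (t : A ⊗[k] H) (x : Λ) :
    smashRep ((Algebra.lmul k Λ).comp P.i) ((Algebra.lmul k Λ).comp P.j) t x = P.μ t * x := by
  induction t using TensorProduct.induction_on with
  | zero => simp
  | add x y hx hy => rw [map_add, map_add, add_mul, LinearMap.add_apply, hx, hy]
  | tmul a h => exact (mul_assoc _ _ _).symm

/-- The isomorphism `A ♯ H ≃ Λ`. -/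
def algEquiv : Smash α ≃ₐ[k] Λ :=
  AlgEquiv.ofLinearEquiv ((Smash.equiv α).trans P.μ)
    (by
      change P.μ (1 ⊗ₜ 1) = 1
      rw [μ_tmul, map_one, map_one, mul_one])
    (fun x y => by
      have := congrArg (fun f : Module.End k Λ => f 1) (smashRep_mul α P.covariant_lmul (Smash.equiv α x) (Smash.equiv α y))
      simp only [Module.End.mul_apply, smashRep_apply, mul_one] at this
      exact this)

variable {V : Type u} [AddCommGroup V] [Module k V]
  {L : A →ₐ[k] Module.End k V} {ρ : H →ₐ[k] Module.End k V}

/-- The action of `Λ` given by a covariant pair of actions. -/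
def rep (hc : Covariant α L ρ) : Λ →ₐ[k] Module.End k V :=
  (Smash.rep α L ρ hc).comp P.algEquiv.symm.toAlgHom

lemma rep_mul (hc : Covariant α L ρ) (a : A) (h : H) : P.rep hc (P.i a * P.j h) = L a * ρ h := by
  have : P.algEquiv.symm (P.i a * P.j h) = (Smash.equiv α).symm (a ⊗ₜ[k] h) :=
    P.algEquiv.symm_apply_apply ((Smash.equiv α).symm (a ⊗ₜ[k] h))
  change Smash.rep α L ρ hc (P.algEquiv.symm _) = _
  rw [this]
  rfl

lemma rep_i (hc : Covariant α L ρ) (a : A) : P.rep hc (P.i a) = L a := by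
  rw [← mul_one (P.i a), ← map_one P.j, rep_mul, map_one, mul_one]

lemma rep_j (hc : Covariant α L ρ) (h : H) : P.rep hc (P.j h) = ρ h := by
  rw [← one_mul (P.j h), ← map_one P.i, rep_mul, map_one, one_mul]

variable (α) in
/-- The smash product `A ♯ H` itself. -/
def smash : SmashPair α (Smash α) where
  i := AlgHom.ofLinearMap (show A →ₗ[k] A ⊗[k] H from (TensorProduct.mk k A H).flip 1) rfl
    (fun a b => by
      refine Eq.symm (Eq.trans (smashMul_tmul α a b 1 1) ?_)
      rw [Bialgebra.comul_one]
      simp [Algebra.TensorProduct.one_def]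
      rfl)
  j := AlgHom.ofLinearMap (show H →ₗ[k] A ⊗[k] H from TensorProduct.mk k A H 1) rfl
    (fun g h => by
      refine Eq.symm (Eq.trans (smashMul_tmul α 1 1 g h) ?_)
      rw [← (ℛ k g).eq]
      conv_rhs => rw [← sum_counit_smul (ℛ k g)]
      simp only [map_sum, TensorProduct.map_tmul, LinearMap.comp_apply, LinearMap.mulLeft_apply,
        HopfAction.on_apply, α.act_one, one_mul, LinearMap.mulRight_apply, Finset.sum_mul,
        smul_mul_assoc, map_smul]
      refine Eq.trans ?_ (map_sum (TensorProduct.mk k A H 1) _ _).symm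
      refine Finset.sum_congr rfl fun i _ => ?_
      rw [Algebra.algebraMap_eq_smul_one, ← smul_tmul']
      exact (map_smul (TensorProduct.mk k A H 1) _ _).symm)
  comm h b := by
    rw [cv_apply]
    refine Eq.trans (smashMul_tmul α 1 b h 1) ?_
    have := congrArg (TensorProduct.map (LinearMap.mulLeft k (1 : A) ∘ₗ α.on b)
      (LinearMap.mulRight k (1 : H))) (ℛ k h).eq
    rw [map_sum] at this
    refine this.symm.trans ?_
    refine @Finset.sum_congr _ (A ⊗[k] H) _ _ _ _ _ rfl fun i _ => Eq.symm (Eq.trans (smashMul_tmul α _ 1 1 _) ?_)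
    rw [Bialgebra.comul_one]
    simp [Algebra.TensorProduct.one_def]
  bijective := by
    convert (Smash.equiv α).symm.bijective using 1
    refine congrArg DFunLike.coe (a₁ := (TensorProduct.lift _ : A ⊗[k] H →ₗ[k] Smash α))
      (a₂ := (Smash.equiv α).symm.toLinearMap) ?_
    refine TensorProduct.ext' fun a h => Eq.trans (smashMul_tmul α a 1 1 h) ?_
    rw [Bialgebra.comul_one]
    simp [Algebra.TensorProduct.one_def]
    rfl

end SmashPair

variable (k H) in
/-- The trivial action of `H` on `k`. -/
def trivialAction : HopfAction k H k where
  act := (Algebra.lmul k k).comp (Bialgebra.counitAlgHom k H)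
  act_one h := by simp
  act_mul h a b := by
    rw [← (ℛ k h).eq]
    conv_lhs => rw [← sum_counit_smul (ℛ k h)]
    simp only [map_sum, map_smul, LinearMap.sum_apply, TensorProduct.map_tmul,
      LinearMap.mul'_apply, LinearMap.smul_apply]
    refine Finset.sum_congr rfl fun i _ => ?_
    change counit (R := k) ((ℛ k h).left i) * (counit (R := k) ((ℛ k h).right i) * (a * b)) =
      (counit (R := k) ((ℛ k h).left i) * a) * (counit (R := k) ((ℛ k h).right i) * b)
    ring

variable (k H) in
/-- `H` as the smash product of `k` and `H`. -/
def SmashPair.trivial : SmashPair (trivialAction k H) H where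
  i := Algebra.ofId k H
  j := AlgHom.id k H
  comm h b := by
    rw [cv_apply]
    conv_lhs => rw [← sum_counit_smul (ℛ k h)]
    simp [trivialAction, Algebra.ofId_apply, Algebra.algebraMap_eq_smul_one, Finset.smul_sum, smul_smul, mul_comm]
  bijective := by
    convert (TensorProduct.lid k H).bijective using 1
    refine congrArg DFunLike.coe (a₁ := (TensorProduct.lift _ : k ⊗[k] H →ₗ[k] H))
      (a₂ := (TensorProduct.lid k H).toLinearMap) ?_
    refine TensorProduct.ext' fun a h => ?_
    simp [Algebra.ofId_apply, Algebra.smul_def]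
end SmashPairs
end SmashDuality

/-! ### The functors attached to a smash product -/

namespace SmashDuality
section SmashFunctors
variable {k H A : Type u} [Field k] [Ring H] [HopfAlgebra k H] [Ring A] [Algebra k A]

section Bimodules
variable {B : Type u} [Ring B] [Algebra k B]

/-- Elements of `B` as elements of the bimodule `B`. -/
def toSelf (B : Type u) [Ring B] [Algebra k B] : B ≃+ selfBimod k B := AddEquiv.refl B

lemma smul_toSelf (a b x : B) : (a ⊗ₜ MulOpposite.op b : Env k B) • toSelf (k := k) B x =
    toSelf B (a * x * b) :=
  AlgHom.mulLeftRight_apply k B a (MulOpposite.op b) x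

lemma lact_apply (D : Bimod k B) (a : B) (x : D) :
    lact D a x = (a ⊗ₜ 1 : Env k B) • x := rfl

lemma ract_apply (D : Bimod k B) (b : Bᵐᵒᵖ) (x : D) :
    ract D b x = (1 ⊗ₜ b : Env k B) • x := rfl

lemma tmul_smul_eq (D : Bimod k B) (a : B) (b : Bᵐᵒᵖ) (x : D) :
    (a ⊗ₜ b : Env k B) • x = lact D a (ract D b x) := by
  rw [lact_apply, ract_apply, ← mul_smul]
  simp

end Bimodules

namespace SmashPair
open MulOpposite
variable {α : HopfAction k H A} {Λ : Type u} [Ring Λ] [Algebra k Λ] (P : SmashPair α Λ)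
  (hS : Function.Bijective (HopfAlgebra.antipode k (A := H)))

/-- `h ⊗ a ↦ j(h) i(a)`. -/
def ν : H ⊗[k] A ≃ₗ[k] Λ := (TensorProduct.comm k H A).trans
  ((LinearEquiv.ofBijective _ (twistL_bijective hS α.act)).trans P.μ)

lemma ν_tmul (h : H) (a : A) : P.ν hS (h ⊗ₜ a) = P.j h * P.i a := by
  change P.μ (twistL α.act.toLinearMap (a ⊗ₜ h)) = _
  rw [P.comm, twistL_tmul]
  exact map_cv P.μ.toLinearMap (fun _ _ => rfl) h

/-- `x ⊗ op b ↦ op (i(b) j(x))`. -/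
def opμ : H ⊗[k] Aᵐᵒᵖ ≃ₗ[k] Λᵐᵒᵖ :=
  (TensorProduct.congr (LinearEquiv.refl k H) (opLinearEquiv k (M := A)).symm).trans
  ((TensorProduct.comm k H A).trans (P.μ.trans (opLinearEquiv k)))

/-- `op b ⊗ x ↦ op (j(x) i(b))`. -/
def opν : Aᵐᵒᵖ ⊗[k] H ≃ₗ[k] Λᵐᵒᵖ :=
  (TensorProduct.congr (opLinearEquiv k (M := A)).symm (LinearEquiv.refl k H)).trans
  ((TensorProduct.comm k A H).trans ((P.ν hS).trans (opLinearEquiv k)))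

lemma opν_tmul (x : H) (b : A) : P.opν hS (op b ⊗ₜ x) = op (P.j x * P.i b) :=
  congrArg op (P.ν_tmul hS x b)

/-- The enveloping algebra of `Λ` is free as a right module over that of `A`. -/
def env : FreeExtension k (H ⊗[k] H) (Env k A) (Env k Λ) where
  φ := Algebra.TensorProduct.map P.i (AlgHom.op P.i)
  u := TensorProduct.map P.j.toLinearMap (opLin ∘ₗ P.j.toLinearMap)
  bijective := by
    convert ((TensorProduct.tensorTensorTensorComm k H H A Aᵐᵒᵖ).trans
      (TensorProduct.congr (P.ν hS) P.opμ)).bijective using 1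
    refine congrArg DFunLike.coe (a₁ := TensorProduct.lift ((LinearMap.mul k (Env k Λ)).compl₁₂
      (TensorProduct.map P.j.toLinearMap (opLin ∘ₗ P.j.toLinearMap))
      (Algebra.TensorProduct.map P.i (AlgHom.op P.i)).toLinearMap)) (a₂ := ((TensorProduct.tensorTensorTensorComm k H H A Aᵐᵒᵖ).trans
        (TensorProduct.congr (P.ν hS) P.opμ)).toLinearMap) ?_
    refine TensorProduct.ext_fourfold' fun x y a b => ?_
    change (P.j x ⊗ₜ op (P.j y) : Env k Λ) * (P.i a ⊗ₜ op (P.i b.unop) : Env k Λ) =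
      P.ν hS (x ⊗ₜ a) ⊗ₜ[k] P.opμ (y ⊗ₜ b)
    rw [ν_tmul, Algebra.TensorProduct.tmul_mul_tmul, ← op_mul]
    rfl

lemma φ_tmul (a b : A) : (P.env hS).φ (a ⊗ₜ op b) = P.i a ⊗ₜ op (P.i b) := rfl

lemma u_tmul (x y : H) : (P.env hS).u (x ⊗ₜ y) = P.j x ⊗ₜ op (P.j y) := rfl

lemma φ_injective : Function.Injective (P.env hS).φ := by
  intro x y h
  have : (1 ⊗ₜ 1 : H ⊗[k] H) ⊗ₜ[k] x = (1 ⊗ₜ 1 : H ⊗[k] H) ⊗ₜ[k] y := by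
    apply (P.env hS).μ.injective
    rw [FreeExtension.μ_tmul, FreeExtension.μ_tmul, h]
  by_cases hH : Subsingleton H
  · have h1 : ∀ t : Env k A, t = 0 := fun t => by
      have : (1 : k) = 0 := by
        rw [← Bialgebra.counit_one (R := k) (A := H), Subsingleton.elim (1 : H) 0, map_zero]
      rw [← one_smul k t, this, zero_smul]
    rw [h1 x, h1 y]
  · have h2 := congrArg (TensorProduct.lift (LinearMap.lsmul k (Env k A) ∘ₗ
      LinearMap.mul' k k ∘ₗ TensorProduct.map counit counit)) this
    simpa using h2

/-- The map `z ⊗ (y ⊗ x) ↦ φ(z) (j(y) ⊗ op j(x))`: the enveloping algebra of `Λ` is also free as a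
left module over that of `A`. -/
def envν : Env k A ⊗[k] (H ⊗[k] H) ≃ₗ[k] Env k Λ :=
  (TensorProduct.tensorTensorTensorComm k A Aᵐᵒᵖ H H).trans (TensorProduct.congr P.μ (P.opν hS))

lemma envν_tmul (z : Env k A) (y x : H) :
    P.envν hS (z ⊗ₜ (y ⊗ₜ x)) = (P.env hS).φ z * (P.j y ⊗ₜ op (P.j x)) := by
  induction z using TensorProduct.induction_on with
  | zero => simp
  | add z w hz hw => rw [TensorProduct.add_tmul, map_add, hz, hw, map_add, add_mul]
  | tmul a b =>
    change P.μ (a ⊗ₜ y) ⊗ₜ P.opν hS (op b.unop ⊗ₜ x) = _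
    rw [opν_tmul]
    change _ = (P.i a ⊗ₜ op (P.i b.unop)) * (P.j y ⊗ₜ op (P.j x))
    rw [Algebra.TensorProduct.tmul_mul_tmul, ← op_mul]
    rfl

/-- Induction of bimodules from `A` to `Λ`. -/
abbrev G : Bimod k A ⥤ Bimod k Λ := (P.env hS).ind

/-- `φ`, as a map of modules. -/
def φMod : ModuleCat.of (Env k A) (Env k A) →+ ModuleCat.of (Env k Λ) (Env k Λ) :=
  (P.env hS).φ.toRingHom.toAddMonoidHom

lemma φMod_smul (r : Env k A) (z : ModuleCat.of (Env k A) (Env k A)) :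
    P.φMod hS (r • z) = (P.env hS).φ r • P.φMod hS z := map_mul (P.env hS).φ r z

/-- The canonical map from the bimodule induced from `A^e` to `Λ^e`. -/
def κ : (P.G hS).obj (ModuleCat.of (Env k A) (Env k A)) ⟶ ModuleCat.of (Env k Λ) (Env k Λ) :=
  (P.env hS).lift (P.φMod hS) (P.φMod_smul hS)

lemma κ_η (z : ModuleCat.of (Env k A) (Env k A)) :
    (P.κ hS).hom ((P.env hS).η _ z) = P.φMod hS z :=
  (P.env hS).lift_η (P.φMod hS) (P.φMod_smul hS) z

/-- Right multiplications on `Λ ⊗ K`. -/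
def rightRep (K : Type u) [AddCommGroup K] [Module k K] :
    Λᵐᵒᵖ →ₐ[k] Module.End k (Λ ⊗[k] K) :=
  (Module.End.rTensorAlgHom k Λ K).comp (Algebra.lsmul k k Λ)

lemma rightRep_tmul (K : Type u) [AddCommGroup K] [Module k K] (l x : Λ) (y : K) :
    rightRep K (op l) (x ⊗ₜ y) = (x * l) ⊗ₜ[k] y := rfl

/-- The left action of `Λ` on `Λ ⊗ K`, diagonal on `H`. -/
def leftDiag (K : ModuleCat.{u} H) : Λ →ₐ[k] Module.End k (Λ ⊗[k] K) :=
  P.rep (covariant_diag α P.covariant_lmul (Algebra.lsmul k k K))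

lemma leftDiag_i (K : ModuleCat.{u} H) (a : A) (x : Λ) (y : K) :
    P.leftDiag K (P.i a) (x ⊗ₜ y) = (P.i a * x) ⊗ₜ y := by
  rw [leftDiag, rep_i]
  rfl

lemma leftDiag_j (K : ModuleCat.{u} H) (h : H) (x : Λ) (y : K) : P.leftDiag K (P.j h) (x ⊗ₜ y) =
    cv (TensorProduct.mk k Λ K) (LinearMap.mulRight k x ∘ₗ P.j.toLinearMap)
      ((Algebra.lsmul k k K).toLinearMap.flip y) h := by
  rw [leftDiag, rep_j, diagRep_eq, LinearMap.sum_apply, cv_apply]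
  rfl

lemma leftDiag_commute (K : ModuleCat.{u} H) (x : Λ) (y : Λᵐᵒᵖ) :
    Commute (P.leftDiag K x) (rightRep K y) := by
  refine P.induction (p := fun x => Commute (P.leftDiag K x) (rightRep K y)) x (fun a h => ?_)
    (by rw [map_zero]; exact Commute.zero_left _)
    (fun x y hx hy => by rw [map_add]; exact hx.add_left hy)
  rw [map_mul]
  refine Commute.mul_left ?_ ?_
  · refine TensorProduct.ext' fun v w => ?_
    change P.leftDiag K (P.i a) ((v * y.unop) ⊗ₜ w) =
      rightRep K (op y.unop) (P.leftDiag K (P.i a) (v ⊗ₜ w))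
    rw [leftDiag_i, leftDiag_i, rightRep_tmul, mul_assoc]
  · refine TensorProduct.ext' fun v w => ?_
    change P.leftDiag K (P.j h) ((v * y.unop) ⊗ₜ w) =
      rightRep K (op y.unop) (P.leftDiag K (P.j h) (v ⊗ₜ w))
    rw [leftDiag_j, leftDiag_j]
    refine (map_cv (rightRep K (op y.unop)) (fun g g' => ?_) h).symm
    exact congrArg (· ⊗ₜ[k] (g' • w : K)) (mul_assoc (P.j g) v y.unop)

/-- The `Λ`-bimodules `Λ ⊗ K`, for `H`-modules `K`, with `A` acting on the left of `Λ`, `H`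
diagonally, and `Λ` on the right of `Λ`. -/
def diagAction : TensorAction k H (Env k Λ) Λ where
  act K := Algebra.TensorProduct.lift (P.leftDiag K) (rightRep K) (P.leftDiag_commute K)
  nat {K K'} f s x := by
    revert x
    refine P.env_induction (p := fun s => ∀ x,
      LinearMap.lTensor Λ (f.hom.restrictScalars k) (Algebra.TensorProduct.lift (P.leftDiag K)
        (rightRep K) (P.leftDiag_commute K) s x) =
      Algebra.TensorProduct.lift (P.leftDiag K') (rightRep K') (P.leftDiag_commute K') s
        (LinearMap.lTensor Λ (f.hom.restrictScalars k) x)) s (fun a x => ?_) (fun h x => ?_) (fun l x => ?_)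
      (by simp) (fun s t hs ht x => ?_) (fun s t hs ht x => ?_)
    · rw [Algebra.TensorProduct.lift_tmul, Algebra.TensorProduct.lift_tmul, map_one, mul_one,
        map_one, mul_one]
      refine LinearMap.congr_fun (f := LinearMap.lTensor Λ (f.hom.restrictScalars k) ∘ₗ
        P.leftDiag K (P.i a)) (g := P.leftDiag K' (P.i a) ∘ₗ
          LinearMap.lTensor Λ (f.hom.restrictScalars k)) (TensorProduct.ext' fun v w => ?_) x
      simp only [LinearMap.comp_apply, LinearMap.lTensor_tmul, leftDiag_i]
    · rw [Algebra.TensorProduct.lift_tmul, Algebra.TensorProduct.lift_tmul, map_one, mul_one,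
        map_one, mul_one]
      refine LinearMap.congr_fun (f := LinearMap.lTensor Λ (f.hom.restrictScalars k) ∘ₗ
        P.leftDiag K (P.j h)) (g := P.leftDiag K' (P.j h) ∘ₗ
          LinearMap.lTensor Λ (f.hom.restrictScalars k)) (TensorProduct.ext' fun v w => ?_) x
      simp only [LinearMap.comp_apply, LinearMap.lTensor_tmul, leftDiag_j]
      refine map_cv _ (fun g g' => ?_) h
      exact congrArg (_ ⊗ₜ[k] ·) (map_smul f.hom g' w)
    · rw [Algebra.TensorProduct.lift_tmul, Algebra.TensorProduct.lift_tmul, map_one, one_mul,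
        map_one, one_mul]
      exact LinearMap.congr_fun (f := LinearMap.lTensor Λ (f.hom.restrictScalars k) ∘ₗ
        rightRep K l) (g := rightRep K' l ∘ₗ
          LinearMap.lTensor Λ (f.hom.restrictScalars k)) (TensorProduct.ext' fun v w => rfl) x
    · rw [map_add, map_add, LinearMap.add_apply, map_add, LinearMap.add_apply, hs, ht]
    · rw [map_mul, map_mul, Module.End.mul_apply, Module.End.mul_apply, hs, ht]

/-- The functor `K ↦ Λ ⊗ K`. -/
abbrev F : ModuleCat.{u} H ⥤ Bimod k Λ := P.diagAction.functor

/-- `x ⊗ y` as an element of `Λ ⊗ K`. -/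
def toF (K : ModuleCat.{u} H) : Λ ⊗[k] K ≃+ P.F.obj K := toMod (P.diagAction.act K)

lemma smul_toF (K : ModuleCat.{u} H) (s : Env k Λ) (x : Λ ⊗[k] K) : s • P.toF K x =
    P.toF K (Algebra.TensorProduct.lift (P.leftDiag K) (rightRep K) (P.leftDiag_commute K) s x) :=
  rfl

lemma i_smul_toF (K : ModuleCat.{u} H) (a : A) (x : Λ) (y : K) :
    (P.i a ⊗ₜ 1 : Env k Λ) • P.toF K (x ⊗ₜ y) = P.toF K ((P.i a * x) ⊗ₜ y) := by
  rw [smul_toF, ← leftDiag_i]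
  refine congrArg _ (LinearMap.congr_fun (Algebra.TensorProduct.lift_tmul _ _ _ _ _) _ |>.trans ?_)
  rw [map_one, mul_one]

lemma j_smul_toF (K : ModuleCat.{u} H) (h : H) (x : Λ) (y : K) :
    (P.j h ⊗ₜ 1 : Env k Λ) • P.toF K (x ⊗ₜ y) = P.toF K (cv (TensorProduct.mk k Λ K)
      (LinearMap.mulRight k x ∘ₗ P.j.toLinearMap)
      ((Algebra.lsmul k k K).toLinearMap.flip y) h) := by
  rw [smul_toF, ← leftDiag_j]
  refine congrArg _ (LinearMap.congr_fun (Algebra.TensorProduct.lift_tmul _ _ _ _ _) _ |>.trans ?_)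
  rw [map_one, mul_one]

lemma op_smul_toF (K : ModuleCat.{u} H) (l x : Λ) (y : K) :
    (1 ⊗ₜ op l : Env k Λ) • P.toF K (x ⊗ₜ y) = P.toF K ((x * l) ⊗ₜ y) := by
  rw [smul_toF]
  refine congrArg _ (LinearMap.congr_fun (Algebra.TensorProduct.lift_tmul _ _ _ _ _) _ |>.trans ?_)
  rw [map_one, one_mul]
  rfl

lemma map_toF {K K' : ModuleCat.{u} H} (f : K ⟶ K') (x : Λ) (y : K) :
    (P.F.map f).hom (P.toF K (x ⊗ₜ y)) = P.toF K' (x ⊗ₜ f.hom y) := rfl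

lemma toF_algebraMap_smul (K : ModuleCat.{u} H) (c : k) (x : Λ ⊗[k] K) :
    (algebraMap k (Env k Λ) c) • P.toF K x = P.toF K (c • x) := by
  rw [smul_toF, AlgHom.commutes]
  rfl

end SmashPair
end SmashFunctors
end SmashDuality

/-! ### Comparison of the two functors, and the twisting endomorphisms of induced bimodules -/

namespace SmashDuality
section Comparison
variable {k H A : Type u} [Field k] [Ring H] [HopfAlgebra k H] [Ring A] [Algebra k A]

/-- An additive equivalence with a module, as a `k`-linear one. -/
def linOfMod {R V : Type u} [Ring R] [Algebra k R] [AddCommGroup V] [Module k V]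
    (M : ModuleCat.{u} R) (f : V ≃+ M) (h : ∀ (c : k) v, f (c • v) = algebraMap k R c • f v) :
    V ≃ₗ[k] M := f.toLinearEquiv h

/-- An isomorphism of modules from an additive equivalence. -/
def mkIso {R : Type u} [Ring R] {M N : ModuleCat.{u} R} (f : M ≃+ N)
    (h : ∀ (r : R) x, f (r • x) = r • f x) : M ≅ N :=
  LinearEquiv.toModuleIso { f with map_smul' := h }

lemma isIso_of_bijective {R : Type u} [Ring R] {M N : ModuleCat.{u} R} (f : M ⟶ N)
    (hf : Function.Bijective f.hom) : IsIso f :=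
  (LinearEquiv.ofBijective f.hom hf).toModuleIso.isIso_hom

variable (k) in
/-- `B ≃ B`, as a `k`-linear map to the bimodule. -/
def toSelfLin (B : Type u) [Ring B] [Algebra k B] : B ≃ₗ[k] selfBimod k B :=
  linOfMod (selfBimod k B) (toSelf B) fun c x => by
    change _ = (algebraMap k B c ⊗ₜ MulOpposite.op 1 : Env k B) • toSelf B x
    rw [smul_toSelf, mul_one, Algebra.smul_def]

/-- The left module `R`. -/
def regular (R : Type u) [Ring R] : ModuleCat.{u} R := ModuleCat.of R R

/-- Right multiplication on the left module `R`. -/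
def rMul {R : Type u} [Ring R] (r : R) : regular R ⟶ regular R := rightMul r

variable (k) in
/-- `R ≃ R`, as a `k`-linear map to the module. -/
def toRegLin (R : Type u) [Ring R] [Algebra k R] : R ≃ₗ[k] regular R :=
  linOfMod (regular R) (AddEquiv.refl R) fun c x => Algebra.smul_def c x

lemma rMul_toRegLin {R : Type u} [Ring R] [Algebra k R] (r x : R) :
    (rMul r).hom (toRegLin k R x) = toRegLin k R (x * r) := rfl

variable (k H) in
/-- `k ≃ k`, as a `k`-linear map to the trivial module. -/
def toTrivLin : k ≃ₗ[k] trivialModule k H :=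
  linOfMod (trivialModule k H) (AddEquiv.refl k) fun c x => by
    change c * x = counit (R := k) (algebraMap k H c) * x
    rw [Bialgebra.counit_algebraMap]

lemma smul_toTrivLin (h : H) (c : k) :
    h • toTrivLin k H c = toTrivLin k H (counit (R := k) h * c) := rfl

/-- Evaluation of endomorphisms. -/
abbrev ev (k V : Type*) [Field k] [AddCommGroup V] [Module k V] : Module.End k V →ₗ[k] V →ₗ[k] V :=
  LinearMap.id

namespace EquivariantStr
variable {α : HopfAction k H A} {τ : H →ₗ[k] H} {M : Bimod k A} (γ : EquivariantStr α τ M)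

lemma act_lact (h : H) (a : A) (x : M) : γ.act h (lact M a x) =
    cv (ev k M) ((lact M).toLinearMap ∘ₗ α.on a) (γ.act.toLinearMap.flip x) h := by
  have := congrArg (fun f : Module.End k M => f x) (γ.act_left h a)
  simp only [Module.End.mul_apply] at this
  rw [this, cv_apply, ← (ℛ k h).eq]
  simp [LinearMap.sum_apply]

lemma act_ract (h : H) (b : A) (x : M) : γ.act h (ract M (MulOpposite.op b) x) =
    cv (ev k M).flip (γ.act.toLinearMap.flip x) ((ract M).toLinearMap ∘ₗ opLin ∘ₗ α.on b ∘ₗ τ) h := by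
  have := congrArg (fun f : Module.End k M => f x) (γ.act_right h b)
  simp only [Module.End.mul_apply] at this
  rw [this, cv_apply, ← (ℛ k h).eq]
  simp [LinearMap.sum_apply]

end EquivariantStr

variable (α : HopfAction k H A) in
/-- `A` as an equivariant bimodule. -/
def selfStr : EquivariantStr α LinearMap.id (selfBimod k A) where
  act := (LinearEquiv.conjAlgEquiv k (toSelfLin k A)).toAlgHom.comp α.act
  act_left h a := by
    refine LinearMap.ext fun x => ?_
    obtain ⟨x, rfl⟩ := (toSelfLin k A).surjective x
    have e1 : ∀ c y, lact (selfBimod k A) c (toSelfLin k A y) = toSelfLin k A (c * y) := fun c y =>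
      (smul_toSelf c 1 y).trans (by rw [mul_one]; rfl)
    have e2 : ∀ h y, (LinearEquiv.conjAlgEquiv k (toSelfLin k A)) (α.act h) (toSelfLin k A y) =
      toSelfLin k A (α.act h y) := fun h y => rfl
    refine (congrArg _ (e1 a x)).trans ((e2 _ _).trans ?_)
    refine (congrArg (toSelfLin k A) (α.act_mul h a x)).trans ?_
    rw [← (ℛ k h).eq]
    simp only [map_sum, TensorProduct.map_tmul, LinearMap.mul'_apply, LinearMap.sum_apply,
      Module.End.mul_apply]
    refine Finset.sum_congr rfl fun i _ => ?_
    exact (e1 _ _).symm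
  act_right h b := by
    refine LinearMap.ext fun x => ?_
    obtain ⟨x, rfl⟩ := (toSelfLin k A).surjective x
    have e1 : ∀ c y, ract (selfBimod k A) (MulOpposite.op c) (toSelfLin k A y) =
      toSelfLin k A (y * c) := fun c y => (smul_toSelf 1 c y).trans (by rw [one_mul]; rfl)
    have e2 : ∀ h y, (LinearEquiv.conjAlgEquiv k (toSelfLin k A)) (α.act h) (toSelfLin k A y) =
      toSelfLin k A (α.act h y) := fun h y => rfl
    refine (congrArg _ (e1 b x)).trans ((e2 _ _).trans ?_)
    refine (congrArg (toSelfLin k A) (α.act_mul h x b)).trans ?_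
    rw [← (ℛ k h).eq]
    simp only [map_sum, TensorProduct.map_tmul, LinearMap.mul'_apply, LinearMap.sum_apply,
      Module.End.mul_apply, TensorProduct.comm_tmul]
    refine Finset.sum_congr rfl fun i _ => ?_
    exact (e1 _ _).symm

/-- The unit of induction, as a linear map. -/
def FreeExtension.ηLin {R S U : Type u} [Ring R] [Algebra k R] [Ring S] [Algebra k S]
    [AddCommGroup U] [Module k U] (E : FreeExtension k U R S) (M : ModuleCat.{u} R) :
    M →ₗ[k] E.ind.obj M :=
  { E.η M with map_smul' := semilinear_smul k (E.η M) fun r m => E.η_smul r m }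

/-- A morphism of modules, as a linear map. -/
def homLin (k : Type u) [Field k] {R : Type u} [Ring R] [Algebra k R] {M N : ModuleCat.{u} R} (f : M ⟶ N) :
    M →ₗ[k] N := f.hom.restrictScalars k

lemma homLin_lact {B : Type u} [Ring B] [Algebra k B] {M N : Bimod k B} (f : M ⟶ N) (b : B) (x : M) :
    homLin k f (lact M b x) = lact N b (homLin k f x) := map_smul f.hom _ x

lemma homLin_ract {B : Type u} [Ring B] [Algebra k B] {M N : Bimod k B} (f : M ⟶ N) (b : Bᵐᵒᵖ)
    (x : M) : homLin k f (ract M b x) = ract N b (homLin k f x) := map_smul f.hom _ x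

lemma lact_ract {B : Type u} [Ring B] [Algebra k B] (M : Bimod k B) (a : B) (b : Bᵐᵒᵖ) (x : M) :
    lact M a (ract M b x) = ract M b (lact M a x) :=
  congrArg (fun f : Module.End k M => f x) (lact_ract_commute M a b).eq

namespace SmashPair
open MulOpposite HopfAlgebra
variable {α : HopfAction k H A} {Λ : Type u} [Ring Λ] [Algebra k Λ] (P : SmashPair α Λ)
  (hS : Function.Bijective (HopfAlgebra.antipode k (A := H)))

lemma map_env_smul {M N : Bimod k Λ} (f : M →+ N)
    (hi : ∀ a x, f (lact M (P.i a) x) = lact N (P.i a) (f x))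
    (hj : ∀ h x, f (lact M (P.j h) x) = lact N (P.j h) (f x))
    (hr : ∀ l x, f (ract M (op l) x) = ract N (op l) (f x)) (s : Env k Λ) (x : M) :
    f (s • x) = s • f x := by
  revert x
  refine P.env_induction (p := fun s => ∀ x, f (s • x) = s • f x) s hi hj (fun l => hr l.unop)
    (fun x => ((congrArg f (zero_smul (Env k Λ) x)).trans (map_zero f)).trans
      (zero_smul (Env k Λ) (f x)).symm) (fun s t hs ht x => ?_)
    (fun s t hs ht x => ?_)
  · rw [add_smul, map_add, hs, ht, add_smul]
  · rw [mul_smul, hs, ht, mul_smul]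

lemma lact_i_toF (K : ModuleCat.{u} H) (a : A) (x : Λ) (y : K) :
    lact (P.F.obj K) (P.i a) (P.toF K (x ⊗ₜ y)) = P.toF K ((P.i a * x) ⊗ₜ y) := P.i_smul_toF K a x y

lemma lact_j_toF (K : ModuleCat.{u} H) (h : H) (x : Λ) (y : K) :
    lact (P.F.obj K) (P.j h) (P.toF K (x ⊗ₜ y)) = P.toF K (cv (TensorProduct.mk k Λ K)
      (LinearMap.mulRight k x ∘ₗ P.j.toLinearMap)
      ((Algebra.lsmul k k K).toLinearMap.flip y) h) := P.j_smul_toF K h x y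

lemma ract_toF (K : ModuleCat.{u} H) (l x : Λ) (y : K) :
    ract (P.F.obj K) (op l) (P.toF K (x ⊗ₜ y)) = P.toF K ((x * l) ⊗ₜ y) := P.op_smul_toF K l x y

lemma map_F_smul {K : ModuleCat.{u} H} {N : Bimod k Λ} (f : P.F.obj K →+ N)
    (hi : ∀ a x y, f (P.toF K ((P.i a * x) ⊗ₜ y)) = lact N (P.i a) (f (P.toF K (x ⊗ₜ y))))
    (hj : ∀ h x y, f (lact _ (P.j h) (P.toF K (x ⊗ₜ y))) = lact N (P.j h) (f (P.toF K (x ⊗ₜ y))))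
    (hr : ∀ l x y, f (P.toF K ((x * l) ⊗ₜ y)) = ract N (op l) (f (P.toF K (x ⊗ₜ y))))
    (s : Env k Λ) (x : P.F.obj K) : f (s • x) = s • f x := by
  have key : ∀ {f g : P.F.obj K →+ N}, (∀ x y, f (P.toF K (x ⊗ₜ y)) = g (P.toF K (x ⊗ₜ y))) →
      ∀ x, f x = g x := fun {f g} h x => by
    obtain ⟨t, rfl⟩ := (P.toF K).surjective x
    induction t using TensorProduct.induction_on with
    | zero => rw [map_zero, map_zero, map_zero]
    | add x y hx hy => rw [map_add, map_add, map_add, hx, hy]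
    | tmul x y => exact h x y
  refine P.map_env_smul f (fun a => ?_) (fun h => ?_) (fun l => ?_) s x
  · refine key (f := f.comp (lact _ (P.i a)).toAddMonoidHom)
      (g := (lact N (P.i a)).toAddMonoidHom.comp f) fun x y => ?_
    exact (congrArg f (P.lact_i_toF K a x y)).trans (hi a x y)
  · exact key (f := f.comp (lact _ (P.j h)).toAddMonoidHom)
      (g := (lact N (P.j h)).toAddMonoidHom.comp f) fun x y => hj h x y
  · refine key (f := f.comp (ract _ (op l)).toAddMonoidHom)
      (g := (ract N (op l)).toAddMonoidHom.comp f) fun x y => ?_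
    exact (congrArg f (P.ract_toF K l x y)).trans (hr l x y)

/-- The underlying equivalence of `trivialIso`. -/
def trivialEquiv : P.F.obj (trivialModule k H) ≃+ selfBimod k Λ :=
  ((P.toF (trivialModule k H)).symm.trans ((TensorProduct.congr (LinearEquiv.refl k Λ)
    (toTrivLin k H).symm).trans (TensorProduct.rid k Λ)).toAddEquiv).trans (toSelf Λ)

lemma trivialEquiv_toF (x : Λ) (c : k) :
    P.trivialEquiv (P.toF (trivialModule k H) (x ⊗ₜ toTrivLin k H c)) = toSelf Λ (c • x) := rfl

/-- The functor `F` sends the trivial module to the bimodule `Λ`. -/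
def trivialIso : P.F.obj (trivialModule k H) ≅ selfBimod k Λ :=
  mkIso P.trivialEquiv (P.map_F_smul P.trivialEquiv.toAddMonoidHom
    (fun a x c => by
      obtain ⟨c, rfl⟩ := (toTrivLin k H).surjective c
      change P.trivialEquiv _ = lact _ _ (P.trivialEquiv _)
      rw [trivialEquiv_toF, trivialEquiv_toF]
      refine Eq.symm ((smul_toSelf (P.i a) 1 (c • x)).trans (congrArg (toSelf Λ) ?_))
      rw [mul_one, mul_smul_comm])
    (fun h x c => by
      obtain ⟨c, rfl⟩ := (toTrivLin k H).surjective c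
      change P.trivialEquiv _ = lact _ _ (P.trivialEquiv _)
      rw [lact_j_toF, trivialEquiv_toF]
      refine Eq.trans ?_ (Eq.symm ((smul_toSelf (P.j h) 1 (c • x)).trans (by rw [mul_one])))
      have e : cv (TensorProduct.mk k Λ (trivialModule k H))
          (LinearMap.mulRight k x ∘ₗ P.j.toLinearMap)
          ((Algebra.lsmul k k (trivialModule k H)).toLinearMap.flip (toTrivLin k H c)) h =
          (P.j h * x) ⊗ₜ toTrivLin k H c := by
        refine Eq.trans ?_ (cv_counit_right (TensorProduct.mk k Λ (trivialModule k H))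
          (LinearMap.mulRight k x ∘ₗ P.j.toLinearMap) (toTrivLin k H c) h)
        congr 2
        ext g
        change g • toTrivLin k H c = counit (R := k) g • toTrivLin k H c
        rw [smul_toTrivLin, ← map_smul, smul_eq_mul]
      rw [e, trivialEquiv_toF, mul_smul_comm])
    (fun l x c => by
      obtain ⟨c, rfl⟩ := (toTrivLin k H).surjective c
      change P.trivialEquiv _ = ract _ _ (P.trivialEquiv _)
      rw [trivialEquiv_toF, trivialEquiv_toF]
      refine Eq.symm ((smul_toSelf 1 l (c • x)).trans (congrArg (toSelf Λ) ?_))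
      rw [one_mul, smul_mul_assoc]))

/-- `a ↦ i(a) ⊗ 1`. -/
def ζ₀ : selfBimod k A →+ P.F.obj (regular H) :=
  (P.toF _).toAddMonoidHom.comp (((TensorProduct.mk k Λ (regular H)).flip (toRegLin k H 1) ∘ₗ
    P.i.toLinearMap ∘ₗ (toSelfLin k A).symm.toLinearMap).toAddMonoidHom)

lemma ζ₀_toSelf (a : A) : P.ζ₀ (toSelf A a) = P.toF _ (P.i a ⊗ₜ toRegLin k H 1) := rfl

lemma ζ₀_smul (r : Env k A) (a : selfBimod k A) : P.ζ₀ (r • a) = (P.env hS).φ r • P.ζ₀ a := by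
  obtain ⟨a, rfl⟩ := (toSelf A).surjective a
  induction r using TensorProduct.induction_on with
  | zero =>
    refine ((congrArg P.ζ₀ (zero_smul (Env k A) _)).trans (map_zero P.ζ₀)).trans ?_
    exact ((congrArg (fun r : Env k Λ => r • P.ζ₀ (toSelf A a)) (map_zero (P.env hS).φ)).trans
      (zero_smul (Env k Λ) (A := P.F.obj (regular H)) (P.ζ₀ (toSelf A a)))).symm
  | add r s hr hs => rw [add_smul, map_add, hr, hs, map_add, add_smul]
  | tmul x y =>
    change P.ζ₀ ((x ⊗ₜ op y.unop : Env k A) • toSelf A a) =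
      (P.i x ⊗ₜ op (P.i y.unop) : Env k Λ) • _
    rw [smul_toSelf, ζ₀_toSelf, ζ₀_toSelf, tmul_smul_eq, ract_toF, lact_i_toF, map_mul, map_mul,
      mul_assoc]

/-- The isomorphism from the bimodule induced from `A` to `F(H)`, with `a ↦ i(a) ⊗ 1`. -/
def ζ : (P.G hS).obj (selfBimod k A) ⟶ P.F.obj (regular H) :=
  (P.env hS).lift P.ζ₀ (P.ζ₀_smul hS)

lemma ζ_η (a : A) : (P.ζ hS).hom ((P.env hS).η _ (toSelf A a)) =
    P.toF _ (P.i a ⊗ₜ toRegLin k H 1) :=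
  ((P.env hS).lift_η P.ζ₀ (P.ζ₀_smul hS) _).trans (P.ζ₀_toSelf a)

instance : IsIso (P.ζ hS) := by
  apply isIso_of_bijective
  let e : (H ⊗[k] H) ⊗[k] selfBimod k A ≃ₗ[k] Λ ⊗[k] regular H :=
    ((TensorProduct.congr (LinearEquiv.refl k (H ⊗[k] H)) (toSelfLin k A).symm).trans
    ((TensorProduct.assoc k H H A).trans ((TensorProduct.comm k H (H ⊗[k] A)).trans
    ((TensorProduct.congr ((TensorProduct.comm k H A).trans P.μ) (LinearEquiv.refl k H)).trans
    ((LinearEquiv.ofBijective _ (twistL_bijective hS ((Algebra.lmul k Λ).comp P.j))).trans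
    (TensorProduct.congr (LinearEquiv.refl k Λ) (toRegLin k H)))))))
  have he : ∀ x y a, e ((x ⊗ₜ y) ⊗ₜ toSelfLin k A a) = TensorProduct.congr (LinearEquiv.refl k Λ) (toRegLin k H)
      (twistL ((Algebra.lmul k Λ).comp P.j).toLinearMap ((P.i a * P.j y) ⊗ₜ x)) := fun x y a => rfl
  refine (congrArg Function.Bijective ?_).mpr
    ((toMod ((P.env hS).tensorAction.act (selfBimod k A))).symm.trans
      (e.toAddEquiv.trans (P.toF (regular H)))).bijective
  refine congrArg DFunLike.coe (a₁ := (P.ζ hS).hom.toAddMonoidHom)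
    (a₂ := ((toMod ((P.env hS).tensorAction.act (selfBimod k A))).symm.trans
    (e.toAddEquiv.trans (P.toF (regular H)))).toAddMonoidHom) ?_
  refine (P.env hS).addHom_ext fun t a => ?_
  obtain ⟨a, rfl⟩ := (toSelfLin k A).surjective a
  change (P.ζ hS).hom ((P.env hS).u t • (P.env hS).η _ (toSelf A a)) =
    (P.toF (regular H)) (e ((toMod ((P.env hS).tensorAction.act (selfBimod k A))).symm
      ((P.env hS).u t • (P.env hS).η _ (toSelf A a))))
  rw [map_smul, ζ_η, ← FreeExtension.toMod_tmul, AddEquiv.symm_apply_apply]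
  induction t using TensorProduct.induction_on with
  | zero =>
    rw [map_zero, TensorProduct.zero_tmul, map_zero, map_zero]
    exact zero_smul (Env k Λ) (A := P.F.obj (regular H)) _
  | add x y hx hy => rw [map_add, add_smul, hx, hy, TensorProduct.add_tmul, map_add, map_add]
  | tmul x y =>
    rw [u_tmul, tmul_smul_eq, ract_toF, lact_j_toF]
    congr 1
    refine Eq.trans ?_ (he x y a).symm
    rw [twistL_tmul]
    exact (map_cv _ (fun g h => congrArg (fun y => (P.j g * (P.i a * P.j _)) ⊗ₜ[k] toRegLin k H y)
      (mul_one h).symm) x).symm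

end SmashPair
end Comparison
end SmashDuality

/-! ### The right action of `H` on induced bimodules -/

namespace SmashDuality
section InducedAction
open MulOpposite HopfAlgebra
variable {k H A : Type u} [Field k] [Ring H] [HopfAlgebra k H] [Ring A] [Algebra k A]
  {α : HopfAction k H A} {Λ : Type u} [Ring Λ] [Algebra k Λ] (P : SmashPair α Λ)
  (hS : Function.Bijective (HopfAlgebra.antipode k (A := H)))

lemma cv_add_right {X Y Z : Type*} [AddCommGroup X] [Module k X] [AddCommGroup Y] [Module k Y]
    [AddCommGroup Z] [Module k Z] (B : X →ₗ[k] Y →ₗ[k] Z) (f : H →ₗ[k] X) (g g' : H →ₗ[k] Y) (h : H) :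
    cv B f (g + g') h = cv B f g h + cv B f g' h := by
  rw [cv_apply, cv_apply, cv_apply, ← Finset.sum_add_distrib]
  exact Finset.sum_congr rfl fun i _ => map_add _ _ _

lemma cv_add_left {X Y Z : Type*} [AddCommGroup X] [Module k X] [AddCommGroup Y] [Module k Y]
    [AddCommGroup Z] [Module k Z] (B : X →ₗ[k] Y →ₗ[k] Z) (f f' : H →ₗ[k] X) (g : H →ₗ[k] Y) (h : H) :
    cv B (f + f') g h = cv B f g h + cv B f' g h := by
  rw [cv_apply, cv_apply, cv_apply, ← Finset.sum_add_distrib]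
  exact Finset.sum_congr rfl fun i _ => LinearMap.map_add₂ _ _ _ _

lemma antipode_mul_flip {B : Type u} [Ring B] [Algebra k B] (f : H →ₐ[k] B) :
    cv (LinearMap.mul k B).flip (f.toLinearMap ∘ₗ antipode k)
      (f.toLinearMap ∘ₗ antipodeSq k H) = cunit B := by
  ext v
  refine (cv_antipode (LinearMap.mul k B) (f.toLinearMap ∘ₗ antipode k) f.toLinearMap v).symm.trans ?_
  rw [cv_antipode_mul, cunit_apply, cunit_apply, counit_antipode]

lemma map_cv_mul_flip {B C : Type u} [Ring B] [Algebra k B] [Ring C] [Algebra k C] (f : B →ₐ[k] C)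
    (p q : H →ₗ[k] B) (w : H) : f (cv (LinearMap.mul k B).flip p q w) =
      cv (LinearMap.mul k C).flip (f.toLinearMap ∘ₗ p) (f.toLinearMap ∘ₗ q) w :=
  map_cv f.toLinearMap (fun u v => map_mul f (q v) (p u)) w

lemma ract_cv_mul_flip {B : Type u} [Ring B] [Algebra k B] (N : Bimod k B) (p q : H →ₗ[k] B) (w : H) :
    ract N (op (cv (LinearMap.mul k B).flip p q w)) = cv (LinearMap.mul k (Module.End k N))
      ((ract N).toLinearMap ∘ₗ opLin ∘ₗ p) ((ract N).toLinearMap ∘ₗ opLin ∘ₗ q) w :=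
  map_cv ((ract N).toLinearMap ∘ₗ opLin) (fun u v => map_mul (ract N) (op (p u)) (op (q v))) w

namespace SmashPair

/-- `i(a) j(S²(v)) = j(S²(v₂)) i(S(v₁) a)`. -/
lemma mul_antipodeSq (a : A) (v : H) : cv (LinearMap.mul k Λ).flip (P.i.toLinearMap ∘ₗ α.on a ∘ₗ antipode k)
      (P.j.toLinearMap ∘ₗ antipodeSq k H) v = P.i a * P.j (antipodeSq k H v) := by
  refine Eq.trans ?_ (P.mul_antipode (antipode k v) a).symm
  rw [cv_antipode]
  rfl

/-- `j(S(v)) i(b) = i(S(v₂) b) j(S(v₁))`. -/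
lemma antipode_mul (b : A) (v : H) : cv (LinearMap.mul k Λ).flip (P.j.toLinearMap ∘ₗ antipode k)
    (P.i.toLinearMap ∘ₗ α.on b ∘ₗ antipode k) v = P.j (antipode k v) * P.i b := by
  rw [P.comm, cv_antipode]
  rfl

variable {M : Bimod k A} (γ : EquivariantStr α LinearMap.id M)

/-- The left multiplications `j(S²(v))` on a `Λ`-bimodule. -/
abbrev lSq (N : Bimod k Λ) : H →ₗ[k] Module.End k N :=
  (lact N).toLinearMap ∘ₗ P.j.toLinearMap ∘ₗ antipodeSq k H

/-- The right multiplications `j(S(v))` on a `Λ`-bimodule. -/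
abbrev rS (N : Bimod k Λ) : H →ₗ[k] Module.End k N :=
  (ract N).toLinearMap ∘ₗ opLin ∘ₗ P.j.toLinearMap ∘ₗ antipode k

/-- The map `v ↦ 1 ⊗ S(v) m` to the induced bimodule. -/
def ηS (m : M) : H →ₗ[k] (P.G hS).obj M :=
  (P.env hS).ηLin M ∘ₗ γ.act.toLinearMap.flip m ∘ₗ antipode k

/-- `v ↦ S²(v₂) (1 ⊗ S(v₁) m)`. -/
def chi (m : M) : H →ₗ[k] (P.G hS).obj M :=
  cv (ev k ((P.G hS).obj M)).flip (P.ηS hS γ m) (P.lSq ((P.G hS).obj M))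

/-- `v ↦ S²(v₃) (1 ⊗ S(v₂) m) S(v₁)`. -/
def rho (m : M) : H →ₗ[k] (P.G hS).obj M :=
  cv (ev k ((P.G hS).obj M)) (P.rS ((P.G hS).obj M)) (P.chi hS γ m)

lemma η_lact (a : A) (m : M) : (P.env hS).ηLin M (lact M a m) =
    lact ((P.G hS).obj M) (P.i a) ((P.env hS).ηLin M m) := by
  refine ((P.env hS).η_smul (a ⊗ₜ 1) m).trans ?_
  change ((P.i a ⊗ₜ op (P.i 1)) : Env k Λ) • (P.env hS).η M m = _
  rw [map_one]
  rfl

lemma η_ract (b : A) (m : M) : (P.env hS).ηLin M (ract M (op b) m) =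
    ract ((P.G hS).obj M) (op (P.i b)) ((P.env hS).ηLin M m) := by
  refine ((P.env hS).η_smul (1 ⊗ₜ op b) m).trans ?_
  change ((P.i 1 ⊗ₜ op (P.i b)) : Env k Λ) • (P.env hS).η M m = _
  rw [map_one]
  rfl

lemma ηS_lact (a : A) (m : M) : P.ηS hS γ (lact M a m) =
    cv (ev k ((P.G hS).obj M)).flip (P.ηS hS γ m)
      ((lact ((P.G hS).obj M)).toLinearMap ∘ₗ P.i.toLinearMap ∘ₗ α.on a ∘ₗ antipode k) := by
  ext v
  change (P.env hS).ηLin M (γ.act (antipode k v) (lact M a m)) = _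
  rw [γ.act_lact, cv_antipode]
  exact map_cv _ (fun x y => P.η_lact hS _ _) v

lemma ηS_ract (b : A) (m : M) : P.ηS hS γ (ract M (op b) m) =
    cv (ev k ((P.G hS).obj M)) ((ract ((P.G hS).obj M)).toLinearMap ∘ₗ opLin ∘ₗ
      P.i.toLinearMap ∘ₗ α.on b ∘ₗ antipode k) (P.ηS hS γ m) := by
  ext v
  change (P.env hS).ηLin M (γ.act (antipode k v) (ract M (op b) m)) = _
  rw [γ.act_ract, cv_antipode]
  exact map_cv _ (fun x y => P.η_ract hS _ _) v

lemma chi_lact (a : A) (m : M) (v : H) : P.chi hS γ (lact M a m) v =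
    lact ((P.G hS).obj M) (P.i a) (P.chi hS γ m v) := by
  rw [chi, ηS_lact, cv_assoc (C := (ev k ((P.G hS).obj M)).flip)
    (C' := (LinearMap.mul k (Module.End k ((P.G hS).obj M))).flip) (fun x y z => rfl)]
  refine Eq.symm ((map_cv (B' := (ev k ((P.G hS).obj M)).flip) (f' := P.ηS hS γ m)
    (g' := LinearMap.mulLeft k (lact ((P.G hS).obj M) (P.i a)) ∘ₗ P.lSq ((P.G hS).obj M))
    (lact ((P.G hS).obj M) (P.i a)) (fun x y => rfl) v).trans ?_)
  congr 2
  ext w : 1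
  change lact _ (P.i a) * lact _ (P.j (antipodeSq k H w)) = _
  rw [← map_mul, ← mul_antipodeSq]
  exact map_cv_mul_flip (lact ((P.G hS).obj M)) _ _ w

lemma chi_ract (b : A) (m : M) : P.chi hS γ (ract M (op b) m) =
    cv (ev k ((P.G hS).obj M)) ((ract ((P.G hS).obj M)).toLinearMap ∘ₗ opLin ∘ₗ
      P.i.toLinearMap ∘ₗ α.on b ∘ₗ antipode k) (P.chi hS γ m) := by
  rw [chi, ηS_ract, chi]
  exact cv_assoc fun x y z => lact_ract _ _ _ _

lemma rho_lact (a : A) (m : M) (v : H) : P.rho hS γ (lact M a m) v =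
    lact ((P.G hS).obj M) (P.i a) (P.rho hS γ m v) := by
  refine Eq.symm (map_cv _ (fun x y => ?_) v)
  rw [chi_lact]
  exact lact_ract _ _ _ _

lemma rho_ract (b : A) (m : M) (v : H) : P.rho hS γ (ract M (op b) m) v =
    ract ((P.G hS).obj M) (op (P.i b)) (P.rho hS γ m v) := by
  rw [rho, chi_ract, ← cv_assoc (B' := LinearMap.mul k (Module.End k ((P.G hS).obj M)))
    (B := ev k ((P.G hS).obj M)) (fun x y z => rfl)]
  refine Eq.symm ((map_cv (B' := ev k ((P.G hS).obj M)) (g' := P.chi hS γ m)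
    (f' := LinearMap.mulLeft k (ract ((P.G hS).obj M) (op (P.i b))) ∘ₗ P.rS ((P.G hS).obj M))
    (ract ((P.G hS).obj M) (op (P.i b))) (fun x y => rfl) v).trans ?_)
  congr 2
  ext w : 1
  change ract _ (op (P.i b)) * ract _ (op (P.j (antipode k w))) = _
  rw [← map_mul, ← op_mul, ← antipode_mul]
  exact ract_cv_mul_flip ((P.G hS).obj M) _ _ w

/-- `m ↦ S²(v₃) (1 ⊗ S(v₂) m) S(v₁)`. -/
def rhoHom (v : H) : M →+ (P.G hS).obj M where
  toFun m := P.rho hS γ m v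
  map_zero' := by
    have : P.ηS hS γ (0 : M) = 0 := by ext v; simp [ηS]
    simp [rho, chi, this, cv_apply]
  map_add' m m' := by
    have h1 : P.ηS hS γ (m + m') = P.ηS hS γ m + P.ηS hS γ m' := by ext v; simp [ηS]
    have h2 : P.chi hS γ (m + m') = P.chi hS γ m + P.chi hS γ m' := by
      ext v; rw [chi, h1, cv_add_left]; rfl
    rw [rho, h2, cv_add_right]
    rfl

/-- The endomorphism `1 ⊗ m ↦ S²(v₃) (1 ⊗ S(v₂) m) S(v₁)` of the bimodule induced from an
equivariant bimodule. -/
def rhoMap (v : H) : (P.G hS).obj M ⟶ (P.G hS).obj M :=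
  (P.env hS).lift (P.rhoHom hS γ v) fun r m => by
    induction r using TensorProduct.induction_on with
    | zero =>
      refine ((congrArg (P.rhoHom hS γ v) (zero_smul (Env k A) (A := M) m)).trans (map_zero _)).trans ?_
      exact ((congrArg (fun r : Env k Λ => r • P.rhoHom hS γ v m) (map_zero (P.env hS).φ)).trans
        (zero_smul (Env k Λ) (A := (P.G hS).obj M) (P.rhoHom hS γ v m))).symm
    | add r s hr hs => rw [add_smul, map_add, hr, hs, map_add, add_smul]
    | tmul x y =>
      change P.rho hS γ ((x ⊗ₜ op y.unop : Env k A) • m) v =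
        (P.i x ⊗ₜ op (P.i y.unop) : Env k Λ) • P.rho hS γ m v
      rw [tmul_smul_eq, tmul_smul_eq, rho_lact, rho_ract]

lemma rhoMap_η (v : H) (m : M) : (P.rhoMap hS γ v).hom ((P.env hS).η M m) = P.rho hS γ m v :=
  (P.env hS).lift_η (P.rhoHom hS γ v) _ m

lemma map_rho {N : Bimod k Λ} (T : (P.G hS).obj M ⟶ N) (m : M) (v : H) :
    T.hom (P.rho hS γ m v) = cv (ev k N) (P.rS N)
      (cv (ev k N).flip (homLin k T ∘ₗ P.ηS hS γ m) (P.lSq N)) v := by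
  have h : ∀ v, homLin k T (P.chi hS γ m v) = cv (ev k N).flip (homLin k T ∘ₗ P.ηS hS γ m) (P.lSq N) v :=
    fun v => map_cv (homLin k T) (fun x y => homLin_lact _ _ _) v
  exact map_cv (homLin k T) (fun x y => (homLin_ract _ _ _).trans (congrArg _ (h y))) v

lemma rhoMap_natural {N : Bimod k A} (δ : EquivariantStr α LinearMap.id N) (f : M ⟶ N)
    (hf : ∀ h x, f.hom (γ.act h x) = δ.act h (f.hom x)) (v : H) :
    (P.G hS).map f ≫ P.rhoMap hS δ v = P.rhoMap hS γ v ≫ (P.G hS).map f := by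
  refine (P.env hS).hom_ext fun m => ?_
  change (P.rhoMap hS δ v).hom (((P.G hS).map f).hom ((P.env hS).η M m)) =
    ((P.G hS).map f).hom ((P.rhoMap hS γ v).hom ((P.env hS).η M m))
  rw [rhoMap_η, FreeExtension.map_η, rhoMap_η, map_rho]
  have : homLin k ((P.G hS).map f) ∘ₗ P.ηS hS γ m = P.ηS hS δ (f.hom m) := by
    ext v
    refine ((P.env hS).map_η f _).trans ?_
    change (P.env hS).η N (f.hom (γ.act _ m)) = _
    rw [hf]
    rfl
  rw [this]
  rfl

/-- The identity of `Λ ⊗ K`, as a linear map to `F(K)`. -/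
def toFLin {K : ModuleCat.{u} H} : Λ ⊗[k] K →ₗ[k] P.F.obj K :=
  (linOfMod (P.F.obj K) (P.toF K) fun c x => (P.toF_algebraMap_smul K c x).symm).toLinearMap

/-- `x, y ↦ x ⊗ y`, as a map to `F(H)`. -/
def toFBilin : Λ →ₗ[k] H →ₗ[k] P.F.obj (regular H) :=
  ((TensorProduct.mk k Λ (regular H)).compl₂ (toRegLin k H).toLinearMap).compr₂ P.toFLin

/-- On the bimodule induced from `A`, these endomorphisms are given by the right multiplications
of `H`. -/
lemma rhoMap_ζ (v : H) : P.rhoMap hS (selfStr α) v ≫ P.ζ hS =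
    P.ζ hS ≫ P.F.map (rMul (antipodeSq k H v)) := by
  refine (P.env hS).hom_ext fun a => ?_
  obtain ⟨a, rfl⟩ := (toSelf A).surjective a
  change (P.ζ hS).hom ((P.rhoMap hS (selfStr α) v).hom _) = (P.F.map _).hom ((P.ζ hS).hom _)
  rw [rhoMap_η, ζ_η, map_toF, map_rho]
  let tb : Λ →ₗ[k] H →ₗ[k] P.F.obj (regular H) := P.toFBilin
  have htb : ∀ x y, tb x y = P.toF (regular H) (x ⊗ₜ toRegLin k H y) := fun x y => rfl
  -- `S²(v₂) (i(S(v₁) a) ⊗ 1) = i(a) S²(v₁) ⊗ S²(v₂)`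
  have h1 : cv (ev k (P.F.obj (regular H))).flip
      (homLin k (P.ζ hS) ∘ₗ P.ηS hS (selfStr α) (toSelf A a)) (P.lSq (P.F.obj (regular H))) =
      cv tb (LinearMap.mulLeft k (P.i a) ∘ₗ P.j.toLinearMap ∘ₗ antipodeSq k H) (antipodeSq k H) := by
    have e1 : (LinearMap.mulLeft k (P.i a) ∘ₗ P.j.toLinearMap ∘ₗ antipodeSq k H) =
        cv (LinearMap.mul k Λ).flip (P.i.toLinearMap ∘ₗ α.on a ∘ₗ antipode k)
      (P.j.toLinearMap ∘ₗ antipodeSq k H) := by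
      ext w
      exact (P.mul_antipodeSq a w).symm
    rw [e1, cv_assoc (C := (LinearMap.id (R := k) (M := Λ →ₗ[k] P.F.obj (regular H))).flip)
      (C' := (LinearMap.llcomp k Λ Λ (P.F.obj (regular H))).flip.compl₁₂ (LinearMap.mul k Λ) tb.flip)
      (fun x y z => rfl)]
    refine cv_ext fun u v => ?_
    change lact _ (P.j (antipodeSq k H v)) ((P.ζ hS).hom ((P.env hS).η _
      (toSelf A (α.act (antipode k u) a)))) = _
    rw [ζ_η, lact_j_toF]
    refine (map_cv (B' := tb) (f' := LinearMap.mulRight k (P.i (α.act (antipode k u) a)) ∘ₗ P.j.toLinearMap)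
      (g' := LinearMap.id) P.toFLin (fun x y => ?_) _).trans ?_
    · exact congrArg (fun t => P.toF (regular H) (_ ⊗ₜ toRegLin k H t)) (mul_one y)
    · rw [cv_antipodeSq]
      exact (map_cv (LinearMap.applyₗ _) (fun x y => rfl) v).symm
  have h2 : cv (LinearMap.mul k Λ).flip (P.j.toLinearMap ∘ₗ antipode k)
      (LinearMap.mulLeft k (P.i a) ∘ₗ P.j.toLinearMap ∘ₗ antipodeSq k H) =
      LinearMap.toSpanSingleton k Λ (P.i a) ∘ₗ counit := by
    ext w
    refine (map_cv (B := (LinearMap.mul k Λ).flip) (f := P.j.toLinearMap ∘ₗ antipode k)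
      (g := P.j.toLinearMap ∘ₗ antipodeSq k H) (LinearMap.mulLeft k (P.i a))
      (fun x y => (mul_assoc _ _ _).symm) w).symm.trans ?_
    rw [antipode_mul_flip, cunit_apply]
    change P.i a * _ = counit (R := k) w • P.i a
    rw [mul_smul_comm, mul_one]
  rw [h1]
  have h3 : cv (ev k (P.F.obj (regular H))) (P.rS (P.F.obj (regular H)))
      (cv tb (LinearMap.mulLeft k (P.i a) ∘ₗ P.j.toLinearMap ∘ₗ antipodeSq k H) (antipodeSq k H)) =
      cv ((ract (P.F.obj (regular H))).toLinearMap ∘ₗ opLin) (P.j.toLinearMap ∘ₗ antipode k)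
      (cv tb (LinearMap.mulLeft k (P.i a) ∘ₗ P.j.toLinearMap ∘ₗ antipodeSq k H) (antipodeSq k H)) :=
    cv_ext fun u v => rfl
  rw [h3, ← cv_assoc (B := tb) (B' := (LinearMap.mul k Λ).flip)
    (fun x y z => (P.ract_toF (regular H) _ _ _).symm), h2, cv_counit_left, htb, rMul_toRegLin, one_mul]

end SmashPair
end InducedAction
end SmashDuality

/-! ### The action of `H` on cochains -/

namespace SmashDuality
section CochainAction
open MulOpposite HopfAlgebra
variable {k H A : Type u} [Field k] [Ring H] [HopfAlgebra k H] [Ring A] [Algebra k A]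
  {α : HopfAction k H A} {Λ : Type u} [Ring Λ] [Algebra k Λ] (P : SmashPair α Λ)
  (hS : Function.Bijective (HopfAlgebra.antipode k (A := H)))

lemma homAct_eq_cv {M : Bimod k A} (γ : EquivariantStr α LinearMap.id M) (f : M →ₗ[k] Env k A)
    (p : M) (u : H) : homAct γ u f p = cv (X := Module.End k (Env k A)) (ev k (Env k A)) (actSnd α)
      (cv (X := Env k A) (ev k (Env k A)).flip (f ∘ₗ γ.act.toLinearMap.flip p ∘ₗ antipode k)
        (Y := Module.End k (Env k A)) (LinearMap.comp (actFst α) (antipodeSq k H))) u := by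
  rw [homAct_eq, cv_apply]
  refine Finset.sum_congr rfl fun i _ => ?_
  rw [cv_apply, map_sum]
  rfl

lemma homAct_comp {M N : Bimod k A} (γ : EquivariantStr α LinearMap.id M)
    (δ : EquivariantStr α LinearMap.id N) (d : M →ₗ[k] N)
    (hd : ∀ h x, d (γ.act h x) = δ.act h (d x)) (f : N →ₗ[k] Env k A) (u : H) (p : M) :
    homAct γ u (f ∘ₗ d) p = homAct δ u f (d p) := by
  rw [homAct_eq_cv, homAct_eq_cv]
  congr 3
  ext v
  exact congrArg f (hd _ _)

variable (k) in
/-- Right multiplications on the left module `R`. -/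
def rMulLin (R : Type u) [Ring R] [Algebra k R] : R →ₗ[k] Module.End k (regular R) where
  toFun r := homLin k (rMul r)
  map_add' r s := by
    ext x
    obtain ⟨x, rfl⟩ := (toRegLin k R).surjective x
    exact congrArg (toRegLin k R) (mul_add x r s)
  map_smul' c r := by
    ext x
    obtain ⟨x, rfl⟩ := (toRegLin k R).surjective x
    exact (congrArg (toRegLin k R) (mul_smul_comm c x r)).trans (map_smul (toRegLin k R) c _)

lemma rMulLin_ract {B : Type u} [Ring B] [Algebra k B] (r : Env k B) (b : Bᵐᵒᵖ)
    (x : regular (Env k B)) :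
    rMulLin k _ r (ract (regular (Env k B)) b x) = ract _ b (rMulLin k _ r x) :=
  homLin_ract (rMul r) b x

namespace SmashPair

/-- Right multiplication on `Λ^e` by `1 ⊗ op(j(u))`. -/
def rOut : H →ₗ[k] Module.End k (regular (Env k Λ)) := rMulLin k (Env k Λ) ∘ₗ
  TensorProduct.mk k Λ Λᵐᵒᵖ 1 ∘ₗ opLin ∘ₗ P.j.toLinearMap

/-- Right multiplication on `Λ^e` by `j(S³(u)) ⊗ 1`. -/
def rIn : H →ₗ[k] Module.End k (regular (Env k Λ)) := rMulLin k (Env k Λ) ∘ₗ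
  (TensorProduct.mk k Λ Λᵐᵒᵖ).flip 1 ∘ₗ P.j.toLinearMap ∘ₗ antipode k ∘ₗ antipodeSq k H

/-- `φ` as a linear map. -/
def φLin : Env k A →ₗ[k] regular (Env k Λ) :=
  (toRegLin k (Env k Λ)).toLinearMap ∘ₗ (P.env hS).φ.toLinearMap

lemma φLin_injective : Function.Injective (P.φLin hS) :=
  (toRegLin k (Env k Λ)).injective.comp (P.φ_injective hS)

lemma φLin_tmul (a b : A) : P.φLin hS (a ⊗ₜ op b) = toRegLin k _ (P.i a ⊗ₜ op (P.i b)) := rfl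

/-- `(j(S²(v₁)) ⊗ 1) φ(z) (j(S³(v₂)) ⊗ 1) = φ(S²(v) z)`, with `S²(v)` acting on the left factor. -/
lemma rIn_lSq (v : H) (z : Env k A) : cv (LinearMap.mul k (Module.End k (regular (Env k Λ)))).flip
      (P.lSq (regular (Env k Λ))) P.rIn v (P.φLin hS z) =
    P.φLin hS (actFst α (antipodeSq k H v) z) := by
  induction z using TensorProduct.induction_on with
  | zero => simp only [map_zero]
  | add x y hx hy => simp only [map_add, hx, hy]
  | tmul a b =>
    change _ = P.φLin hS (actFst α _ (a ⊗ₜ op b.unop))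
    rw [actFst_tmul, φLin_tmul, ← P.conjugation, cv_antipodeSq]
    refine cv_congr (LinearMap.applyₗ (P.φLin hS (a ⊗ₜ b))) ((toRegLin k (Env k Λ)).toLinearMap ∘ₗ
      (TensorProduct.mk k Λ Λᵐᵒᵖ).flip (op (P.i b.unop))) (fun x y => ?_) v
    change toRegLin k (Env k Λ) (((P.j (antipodeSq k H x) ⊗ₜ 1 : Env k Λ) * (P.i a ⊗ₜ op (P.i b.unop))) *
      (P.j (antipode k (antipodeSq k H y)) ⊗ₜ 1)) = toRegLin k (Env k Λ) ((P.j (antipodeSq k H x) *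
        (P.i a * P.j (antipode k (antipodeSq k H y)))) ⊗ₜ op (P.i b.unop))
    rw [Algebra.TensorProduct.tmul_mul_tmul, Algebra.TensorProduct.tmul_mul_tmul, one_mul, mul_one,
      mul_assoc]

/-- `(1 ⊗ op(j(S(v₂)))) φ(z) (1 ⊗ op(j(v₁))) = φ(v z)`, with `v` acting on the right factor. -/
lemma rOut_rS (v : H) (z : Env k A) : cv (LinearMap.mul k (Module.End k (regular (Env k Λ))))
      P.rOut (P.rS (regular (Env k Λ))) v (P.φLin hS z) =
    P.φLin hS (actSnd α v z) := by
  induction z using TensorProduct.induction_on with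
  | zero => simp only [map_zero]
  | add x y hx hy => simp only [map_add, hx, hy]
  | tmul a b =>
    change _ = P.φLin hS (actSnd α _ (a ⊗ₜ op b.unop))
    rw [actSnd_tmul, φLin_tmul, ← P.conjugation]
    refine cv_congr (LinearMap.applyₗ (P.φLin hS (a ⊗ₜ b))) ((toRegLin k (Env k Λ)).toLinearMap ∘ₗ
      TensorProduct.mk k Λ Λᵐᵒᵖ (P.i a) ∘ₗ opLin) (fun x y => ?_) v
    change toRegLin k (Env k Λ) (((1 ⊗ₜ op (P.j (antipode k y)) : Env k Λ) *
      (P.i a ⊗ₜ op (P.i b.unop))) * (1 ⊗ₜ op (P.j x))) = toRegLin k (Env k Λ) (P.i a ⊗ₜ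
        op (P.j x * (P.i b.unop * P.j (antipode k y))))
    rw [Algebra.TensorProduct.tmul_mul_tmul, Algebra.TensorProduct.tmul_mul_tmul, one_mul, mul_one,
      ← op_mul, ← op_mul]

variable {M : Bimod k A} (γ : EquivariantStr α LinearMap.id M)

/-- The twist `Σ ρ_{u₂} ≫ T ≫ (· j(S³(u₃)) ⊗ op j(u₁))` of a morphism to `Λ^e` from an induced
bimodule. -/
def twistMor (u : H) (T : (P.G hS).obj M ⟶ regular (Env k Λ)) :
    (P.G hS).obj M ⟶ regular (Env k Λ) :=
  ∑ i ∈ (ℛ k u).index, ∑ j ∈ (ℛ k ((ℛ k u).right i)).index,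
    P.rhoMap hS γ ((ℛ k ((ℛ k u).right i)).left j) ≫ T ≫
      rMul (P.j (antipode k (antipodeSq k H ((ℛ k ((ℛ k u).right i)).right j))) ⊗ₜ 1) ≫
      rMul (1 ⊗ₜ op (P.j ((ℛ k u).left i)))

/-- The canonical map from the bimodule induced from `A^e` to `Λ^e`. -/
def κr : (P.G hS).obj (regular (Env k A)) ⟶ regular (Env k Λ) := P.κ hS

lemma κr_η (z : Env k A) :
    (P.κr hS).hom ((P.env hS).ηLin _ (toRegLin k _ z)) = P.φLin hS z :=
  P.κ_η hS z

/-- The extension of a morphism `f : M → A^e` to the induced bimodules. -/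
def extend (f : M ⟶ regular (Env k A)) : (P.G hS).obj M ⟶ regular (Env k Λ) :=
  (P.G hS).map f ≫ P.κr hS

lemma extend_η (f : M ⟶ regular (Env k A)) (m : M) :
    (P.extend hS f).hom ((P.env hS).ηLin _ m) = P.φLin hS (toLin f m) := by
  refine (congrArg (P.κr hS).hom ((P.env hS).map_η f m)).trans ?_
  exact P.κr_η hS (toLin f m)

lemma twistMor_extend (u : H) (f : M ⟶ regular (Env k A)) (m : M) :
    (P.twistMor hS γ u (P.extend hS f)).hom ((P.env hS).ηLin _ m) =
      P.φLin hS (homAct γ u (toLin f) m) := by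
  have h0 : (P.twistMor hS γ u (P.extend hS f)).hom ((P.env hS).ηLin _ m) =
      cv (ev k (regular (Env k Λ))) P.rOut (cv (ev k (regular (Env k Λ))).flip
        (homLin k (P.extend hS f) ∘ₗ P.rho hS γ m) P.rIn) u := by
    rw [cv_apply, twistMor, ModuleCat.hom_sum, LinearMap.sum_apply]
    refine Finset.sum_congr rfl fun i _ => ?_
    rw [cv_apply, map_sum, ModuleCat.hom_sum, LinearMap.sum_apply]
    refine Finset.sum_congr rfl fun j _ => ?_
    refine congrArg (fun x => (rMul _).hom ((rMul _).hom ((P.extend hS f).hom x))) ?_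
    exact P.rhoMap_η hS γ _ m
  let X : H →ₗ[k] Env k A := toLin f ∘ₗ γ.act.toLinearMap.flip m ∘ₗ antipode k
  have h1 : homLin k (P.extend hS f) ∘ₗ P.rho hS γ m = cv (ev k _) (P.rS _)
      (cv (ev k _).flip (P.φLin hS ∘ₗ X) (P.lSq _)) := by
    ext v
    refine (P.map_rho hS γ (P.extend hS f) m v).trans ?_
    have : homLin k (P.extend hS f) ∘ₗ P.ηS hS γ m = P.φLin hS ∘ₗ X :=
      LinearMap.ext fun w => P.extend_η hS f _
    rw [this]
  rw [h0, h1, homAct_eq_cv]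
  have h2 : cv (ev k (regular (Env k Λ))).flip (cv (ev k _) (P.rS _)
      (cv (ev k _).flip (P.φLin hS ∘ₗ X) (P.lSq _))) P.rIn = cv (ev k _) (P.rS _)
      (cv (ev k _).flip (cv (ev k _).flip (P.φLin hS ∘ₗ X) (P.lSq _)) P.rIn) :=
    cv_assoc fun x y z => rMulLin_ract _ _ _
  have h3 : cv (ev k (regular (Env k Λ))).flip
      (cv (ev k _).flip (P.φLin hS ∘ₗ X) (P.lSq _)) P.rIn = cv (ev k _).flip (P.φLin hS ∘ₗ X)
      (cv (LinearMap.mul k (Module.End k (regular (Env k Λ)))).flip (P.lSq _) P.rIn) :=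
    cv_assoc fun x y z => rfl
  have h4 : ∀ v, cv (ev k _).flip (P.φLin hS ∘ₗ X)
      (cv (LinearMap.mul k (Module.End k (regular (Env k Λ)))).flip (P.lSq _) P.rIn) v =
      P.φLin hS (cv (X := Env k A) (ev k (Env k A)).flip X
        (Y := Module.End k (Env k A)) (LinearMap.comp (actFst α) (antipodeSq k H)) v) :=
    fun v => (map_cv (P.φLin hS) (fun x y => (P.rIn_lSq hS y _).symm) v).symm
  rw [h2, h3, ← cv_assoc (B := ev k (regular (Env k Λ)))
    (B' := LinearMap.mul k (Module.End k (regular (Env k Λ)))) (fun x y z => rfl)]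
  refine Eq.symm (map_cv (P.φLin hS) (fun x y => ?_) u)
  rw [h4]
  exact (P.rOut_rS hS x _).symm

/-- The twist of an extended morphism is again extended from `A`: it is the extension of the image
under the action of `H` on `Hom(M, A^e)`. -/
lemma exists_twist (u : H) (f : M ⟶ regular (Env k A)) : ∃ g : M ⟶ regular (Env k A),
    toLin g = homAct γ u (toLin f) ∧ P.twistMor hS γ u (P.extend hS f) = P.extend hS g := by
  let g : M ⟶ regular (Env k A) := mkHom ((toRegLin k (Env k A)).toLinearMap ∘ₗ
    homAct γ u (toLin f)).toAddMonoidHom fun r m => by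
      apply P.φLin_injective hS
      refine (P.twistMor_extend hS γ u f (r • m)).symm.trans ?_
      refine (congrArg _ ((P.env hS).η_smul r m)).trans ?_
      refine (map_smul (P.twistMor hS γ u (P.extend hS f)).hom _ _).trans ?_
      refine (congrArg _ (P.twistMor_extend hS γ u f m)).trans ?_
      exact (map_mul (P.env hS).φ r _).symm
  have hg : toLin g = homAct γ u (toLin f) := rfl
  refine ⟨g, hg, (P.env hS).hom_ext fun m => ?_⟩
  exact (P.twistMor_extend hS γ u f m).trans ((congrArg (P.φLin hS ·) (by rw [hg])).trans (P.extend_η hS g m).symm)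

end SmashPair
end CochainAction
end SmashDuality

/-! ### The bimodules `Ext(M, B^e)` -/

namespace SmashDuality
section ExtBimodules
open MulOpposite HopfAlgebra Abelian
variable {k : Type u} [Field k]

lemma comp_central {R : Type u} [Ring R] [Algebra k R] {M N : ModuleCat.{u} R} (c : k) (f : M ⟶ M)
    (hf : ∀ x, f.hom x = algebraMap k R c • x) (g : N ⟶ N)
    (hg : ∀ x, g.hom x = algebraMap k R c • x) {q : ℕ} (x : Ext M N q) :
    (Ext.mk₀ f).comp x (zero_add q) = x.comp (Ext.mk₀ g) (add_zero q) := by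
  have hf' : f = c • 𝟙 M := by
    ext x
    rw [hf]
    exact algebraMap_smul R c x
  have hg' : g = c • 𝟙 N := by
    ext x
    rw [hg]
    exact algebraMap_smul R c x
  rw [hf', hg', Ext.mk₀_smul, Ext.mk₀_smul, Ext.smul_comp, Ext.comp_smul, Ext.mk₀_id_comp,
    Ext.comp_mk₀_id]

lemma rMul_mul {R : Type u} [Ring R] (r s : R) : rMul (r * s) = rMul r ≫ rMul s := by
  refine ModuleCat.hom_ext (LinearMap.ext fun x => ?_)
  exact (mul_assoc (show R from x) r s).symm

lemma rMul_add {R : Type u} [Ring R] (r s : R) : rMul (r + s) = rMul r + rMul s := by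
  refine ModuleCat.hom_ext (LinearMap.ext fun x => ?_)
  exact mul_add (show R from x) r s

lemma rMul_one {R : Type u} [Ring R] : rMul (1 : R) = 𝟙 (regular R) := by
  refine ModuleCat.hom_ext (LinearMap.ext fun x => ?_)
  exact mul_one (show R from x)

lemma rMul_zero {R : Type u} [Ring R] : rMul (0 : R) = 0 := by
  refine ModuleCat.hom_ext (LinearMap.ext fun x => ?_)
  exact mul_zero (show R from x)

variable {B : Type u} [Ring B] [Algebra k B]

/-- The bimodule `Ext^q(M, B^e)` for a `B`-bimodule `M`. -/
def XB (M : Bimod k B) (q : ℕ) : Bimod k B :=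
  letI : Module (Env k B) (RightExt M q) :=
    Module.compHom _ (envFlip k B).toAlgHom.toRingHom
  ModuleCat.of (Env k B) (RightExt M q)

/-- Classes in `Ext^q(M, B^e)` as elements of the bimodule. -/
def toXB {M : Bimod k B} {q : ℕ} : Ext M (regular (Env k B)) q ≃+ XB M q := AddEquiv.refl _

lemma smul_toXB {M : Bimod k B} {q : ℕ} (z : Env k B) (x : Ext M (regular (Env k B)) q) :
    z • toXB x = toXB (x.comp (Ext.mk₀ (rMul (envFlip k B z).unop)) (add_zero q)) := rfl

lemma lact_toXB {M : Bimod k B} {q : ℕ} (b : B) (x : Ext M (regular (Env k B)) q) :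
    lact (XB M q) b (toXB x) = toXB (x.comp (Ext.mk₀ (rMul (1 ⊗ₜ op b))) (add_zero q)) := by
  rw [lact_apply, smul_toXB, ← op_one, envFlip_tmul, unop_op]

lemma ract_toXB {M : Bimod k B} {q : ℕ} (b : B) (x : Ext M (regular (Env k B)) q) :
    ract (XB M q) (op b) (toXB x) = toXB (x.comp (Ext.mk₀ (rMul (b ⊗ₜ 1))) (add_zero q)) := by
  rw [ract_apply, smul_toXB, envFlip_tmul, unop_op, op_one]

/-- `Ext^q(-, B^e)` on morphisms. -/
def XB.map {M M' : Bimod k B} (g : M ⟶ M') (q : ℕ) : XB M' q ⟶ XB M q :=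
  mkHom (toXB.toAddMonoidHom.comp (((Ext.mk₀ g).precomp (regular (Env k B)) (zero_add q)).comp
    toXB.symm.toAddMonoidHom)) fun z x => by
      obtain ⟨x, rfl⟩ := toXB.surjective x
      exact congrArg toXB (Ext.comp_assoc (Ext.mk₀ g) x (Ext.mk₀ (rMul (envFlip k B z).unop))
        (zero_add q) (add_zero q) (by lia)).symm

lemma XB.map_toXB {M M' : Bimod k B} (g : M ⟶ M') {q : ℕ} (x : Ext M' (regular (Env k B)) q) :
    (XB.map g q).hom (toXB x) = toXB ((Ext.mk₀ g).comp x (zero_add q)) := rfl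

lemma XB.map_id (M : Bimod k B) (q : ℕ) : XB.map (𝟙 M) q = 𝟙 (XB M q) := by
  ext x
  obtain ⟨x, rfl⟩ := toXB.surjective x
  exact congrArg toXB (Ext.mk₀_id_comp x)

lemma XB.map_comp {M M' M'' : Bimod k B} (g : M ⟶ M') (g' : M' ⟶ M'') (q : ℕ) :
    XB.map (g ≫ g') q = XB.map g' q ≫ XB.map g q := by
  ext x
  obtain ⟨x, rfl⟩ := toXB.surjective x
  refine congrArg toXB ?_
  rw [← Ext.mk₀_comp_mk₀]
  exact Ext.comp_assoc (Ext.mk₀ g) (Ext.mk₀ g') x (add_zero 0) (zero_add q) (by lia)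

lemma XB.map_add {M M' : Bimod k B} (g g' : M ⟶ M') (q : ℕ) :
    XB.map (g + g') q = XB.map g q + XB.map g' q := by
  ext x
  obtain ⟨x, rfl⟩ := toXB.surjective x
  refine (congrArg toXB ?_).trans (_root_.map_add toXB _ _)
  refine Eq.trans ?_ (Ext.add_comp (Ext.mk₀ g) (Ext.mk₀ g') x (zero_add q))
  rw [← Ext.mk₀_add]
  rfl

lemma XB.map_central {M : Bimod k B} (c : k) (g : M ⟶ M)
    (hg : ∀ x, g.hom x = algebraMap k (Env k B) c • x) (q : ℕ) (x : XB M q) :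
    (XB.map g q).hom x = c • x := by
  obtain ⟨x, rfl⟩ := toXB.surjective x
  rw [map_toXB, ← algebraMap_smul (Env k B) c (toXB x), smul_toXB]
  refine congrArg toXB (comp_central c g hg _ (fun y => ?_) x)
  rw [AlgEquiv.commutes]
  exact (Algebra.commutes c (show Env k B from y)).symm

/-- `Ext^q(-, B^e)` on isomorphisms. -/
def XB.mapIso {M M' : Bimod k B} (g : M ≅ M') (q : ℕ) : XB M q ≅ XB M' q where
  hom := XB.map g.inv q
  inv := XB.map g.hom q
  hom_inv_id := by rw [← XB.map_comp, g.hom_inv_id, XB.map_id]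
  inv_hom_id := by rw [← XB.map_comp, g.inv_hom_id, XB.map_id]

namespace SmashPair
variable {H A : Type u} [Ring H] [HopfAlgebra k H] [Ring A] [Algebra k A]
  {α : HopfAction k H A} {Λ : Type u} [Ring Λ] [Algebra k Λ] (P : SmashPair α Λ)
  (hS : Function.Bijective (HopfAlgebra.antipode k (A := H)))

/-- The bimodule `Ext^q(F(H), Λ^e)`. -/
abbrev W (q : ℕ) : Bimod k Λ := XB (P.F.obj (regular H)) q

/-- The action of `H` on `Ext^q(F(H), Λ^e)` induced by the right multiplications of `H`. -/
def τ (q : ℕ) : H →ₐ[k] Module.End k (P.W q) :=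
    { toFun := fun h => homLin k (XB.map (P.F.map (rMul h)) q)
      map_one' := by
        rw [rMul_one, P.F.map_id, XB.map_id]
        rfl
      map_mul' := fun g h => by
        rw [rMul_mul, P.F.map_comp, XB.map_comp]
        rfl
      map_zero' := by
        have h : (P.F.map (0 : regular H ⟶ regular H)) = 0 := P.F.map_zero _ _
        rw [rMul_zero, h]
        ext x
        obtain ⟨x, rfl⟩ := toXB.surjective x
        refine (congrArg toXB ?_).trans (map_zero toXB)
        rw [Ext.mk₀_zero]
        exact Ext.zero_comp (h := zero_add q) ..
      map_add' := fun g h => by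
        rw [rMul_add, P.F.map_add, XB.map_add]
        rfl
      commutes' := fun c => by
        ext x
        refine XB.map_central c _ (fun y => ?_) q x
        obtain ⟨t, rfl⟩ := (P.toF (regular H)).surjective y
        refine Eq.trans ?_ (P.toF_algebraMap_smul (regular H) c t).symm
        induction t using TensorProduct.induction_on with
        | zero => rw [map_zero, map_zero, smul_zero, map_zero]
        | add x y hx hy => rw [map_add, map_add, hx, hy, smul_add, map_add]
        | tmul x y =>
          obtain ⟨y, rfl⟩ := (toRegLin k H).surjective y
          rw [map_toF, rMul_toRegLin, ← TensorProduct.tmul_smul, ← map_smul, Algebra.smul_def,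
            Algebra.commutes] }

lemma τ_lact (q : ℕ) (h : H) (l : Λ) : Commute (P.τ q h) (lact (P.W q) l) :=
  LinearMap.ext fun w => homLin_lact (XB.map (P.F.map (rMul h)) q) l w

lemma τ_ract (q : ℕ) (h : H) (l : Λᵐᵒᵖ) : Commute (P.τ q h) (ract (P.W q) l) :=
  LinearMap.ext fun w => homLin_ract (XB.map (P.F.map (rMul h)) q) l w

/-- Induction `Ext^q(A, A^e) → Ext^q(G(A), Λ^e)` followed by the isomorphism `G(A) ≃ F(H)`. -/
def Φ₀ (q : ℕ) : ExtBimod k A q →+ P.W q :=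
  (XB.map (inv (P.ζ hS)) q).hom.toAddMonoidHom.comp (toXB.toAddMonoidHom.comp
    (((Ext.mk₀ (P.κr hS)).postcomp ((P.G hS).obj (selfBimod k A)) (add_zero q)).comp
    (((P.G hS).mapExtAddHom (selfBimod k A) (regular (Env k A)) q).comp
      toXB.symm.toAddMonoidHom)))

lemma Φ₀_apply (q : ℕ) (x : Ext (selfBimod k A) (regular (Env k A)) q) :
    P.Φ₀ hS q (toXB x) = (XB.map (inv (P.ζ hS)) q).hom
      (toXB ((x.mapExactFunctor (P.G hS)).comp (Ext.mk₀ (P.κr hS)) (add_zero q))) := rfl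

lemma map_rMul_κr (z : Env k A) : (P.G hS).map (rMul z) ≫ P.κr hS =
    P.κr hS ≫ rMul ((P.env hS).φ z) := by
  refine (P.env hS).hom_ext fun y => ?_
  obtain ⟨y, rfl⟩ := (toRegLin k (Env k A)).surjective y
  refine (P.extend_η hS (rMul z) (toRegLin k (Env k A) y)).trans ?_
  refine Eq.trans ?_ (congrArg (rMul ((P.env hS).φ z)).hom (P.κr_η hS y).symm)
  exact map_mul (toRegLin k (Env k Λ) ∘ (P.env hS).φ |> fun _ => (P.env hS).φ) y z

lemma Φ₀_comp (q : ℕ) (x : Ext (selfBimod k A) (regular (Env k A)) q) (z : Env k A) :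
    P.Φ₀ hS q (toXB (x.comp (Ext.mk₀ (rMul z)) (add_zero q))) = (XB.map (inv (P.ζ hS)) q).hom
      (toXB (((x.mapExactFunctor (P.G hS)).comp (Ext.mk₀ (P.κr hS)) (add_zero q)).comp
        (Ext.mk₀ (rMul ((P.env hS).φ z))) (add_zero q))) := by
  rw [Φ₀_apply, Ext.mapExactFunctor_comp, Ext.mapExactFunctor_mk₀]
  rw [Ext.comp_assoc_of_third_deg_zero, Ext.comp_assoc_of_third_deg_zero, Ext.mk₀_comp_mk₀,
    Ext.mk₀_comp_mk₀, map_rMul_κr]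

lemma Φ₀_lact (q : ℕ) (a : A) (x : ExtBimod k A q) :
    P.Φ₀ hS q (lact _ a x) = lact _ (P.i a) (P.Φ₀ hS q x) := by
  obtain ⟨x, rfl⟩ := (toXB (M := selfBimod k A)).surjective x
  refine (congrArg (P.Φ₀ hS q) (lact_toXB a x)).trans ?_
  rw [Φ₀_comp, Φ₀_apply]
  refine Eq.trans ?_ (homLin_lact (k := k) (XB.map (inv (P.ζ hS)) q) (P.i a) _)
  rw [lact_toXB, φ_tmul, map_one]
  rfl

lemma Φ₀_ract (q : ℕ) (a : A) (x : ExtBimod k A q) :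
    P.Φ₀ hS q (ract _ (op a) x) = ract _ (op (P.i a)) (P.Φ₀ hS q x) := by
  obtain ⟨x, rfl⟩ := (toXB (M := selfBimod k A)).surjective x
  refine (congrArg (P.Φ₀ hS q) (ract_toXB a x)).trans ?_
  rw [Φ₀_comp, Φ₀_apply]
  refine Eq.trans ?_ (homLin_ract (k := k) (XB.map (inv (P.ζ hS)) q) (op (P.i a)) _)
  rw [ract_toXB, ← op_one, φ_tmul, map_one]
  rfl

/-- The map `Ext^q(A, A^e) → Ext^q(F(H), Λ^e)`. -/
def Φ (q : ℕ) : ExtBimod k A q →ₗ[k] P.W q :=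
  { P.Φ₀ hS q with
    map_smul' := fun c x => by
      have h1 := P.Φ₀_lact hS q (algebraMap k A c) x
      rw [AlgHom.commutes, AlgHom.commutes, AlgHom.commutes] at h1
      exact h1 }

end SmashPair
end ExtBimodules
end SmashDuality

/-! ### The action of `H` on classes induced from `A` -/

namespace SmashDuality
section StarAction
open MulOpposite HopfAlgebra Abelian
variable {k H : Type u} [Field k] [Ring H] [HopfAlgebra k H]

/-- The convolution of two commuting algebra homomorphisms. -/
def cvHom {E : Type u} [Ring E] [Algebra k E] (f g : H →ₐ[k] E) (hc : ∀ u v, Commute (f u) (g v)) :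
    H →ₐ[k] E := (Algebra.TensorProduct.lift f g hc).comp (Bialgebra.comulAlgHom k H)

lemma cvHom_toLinearMap {E : Type u} [Ring E] [Algebra k E] (f g : H →ₐ[k] E)
    (hc : ∀ u v, Commute (f u) (g v)) :
    (cvHom f g hc).toLinearMap = cv (LinearMap.mul k E) f.toLinearMap g.toLinearMap := by
  ext h
  rw [cv_apply]
  change Algebra.TensorProduct.lift f g hc (comul h) = _
  conv_lhs => rw [← (ℛ k h).eq]
  rw [map_sum]
  exact Finset.sum_congr rfl fun i _ => Algebra.TensorProduct.lift_tmul _ _ _ _ _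

lemma commute_cvHom {E : Type u} [Ring E] [Algebra k E] (f g : H →ₐ[k] E)
    (hc : ∀ u v, Commute (f u) (g v)) (x : E) (hf : ∀ u, Commute x (f u))
    (hg : ∀ u, Commute x (g u)) (u : H) : Commute x (cvHom f g hc u) := by
  rw [← AlgHom.toLinearMap_apply, cvHom_toLinearMap, cv_apply]
  exact Commute.sum_right _ _ _ fun i _ => (hf _).mul_right (hg _)

/-- `u ↦ op(S³(u))`, an algebra homomorphism. -/
def opAntipodeCube : H →ₐ[k] Hᵐᵒᵖ := AlgHom.ofLinearMap
  (opLin ∘ₗ antipode k ∘ₗ antipodeSq k H)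
  (by simp [antipodeSq, opLin])
  (fun x y => by simp [antipodeSq, opLin, antipode_mul_antidistrib])

namespace SmashPair
variable {A : Type u} [Ring A] [Algebra k A]
  {α : HopfAction k H A} {Λ : Type u} [Ring Λ] [Algebra k Λ] (P : SmashPair α Λ)
  (hS : Function.Bijective (HopfAlgebra.antipode k (A := H)))

section Star
variable (W : Bimod k Λ) (τ : H →ₐ[k] Module.End k W) (hl : ∀ h l, Commute (τ h) (lact W l))
  (hr : ∀ h l, Commute (τ h) (ract W l))

/-- The right multiplications by `j(S³(u))`. -/
def rCube : H →ₐ[k] Module.End k W := (ract W).comp ((AlgHom.op P.j).comp opAntipodeCube)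

lemma rCube_apply (u : H) : P.rCube W u = ract W (op (P.j (antipode k (antipodeSq k H u)))) := rfl

variable {W τ} in
include hr in
lemma commute_rCube (u v : H) : Commute ((τ.comp antipodeSqHom) u) (P.rCube W v) := by
  rw [rCube_apply]
  exact hr (antipodeSqHom u) _

variable {W τ} in
include hl in
lemma commute_inner (u v : H) : Commute (((lact W).comp P.j) u)
    (cvHom (τ.comp antipodeSqHom) (P.rCube W) (P.commute_rCube hr) v) := by
  refine commute_cvHom _ _ _ _ (fun v => (hl (antipodeSqHom v) (P.j u)).symm) (fun v => ?_) v
  rw [rCube_apply]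
  exact lact_ract_commute W _ _

/-- The action `u ⋆ w = j(u₁) (S²(u₂) w) j(S³(u₃))` on a `Λ`-bimodule with a commuting action `τ`
of `H`. -/
def star : H →ₐ[k] Module.End k W :=
  cvHom ((lact W).comp P.j) (cvHom (τ.comp antipodeSqHom) (P.rCube W) (P.commute_rCube hr))
    (P.commute_inner hl hr)

lemma star_apply (u : H) (w : W) : P.star W τ hl hr u w = ∑ i ∈ (ℛ k u).index,
    ∑ j ∈ (ℛ k ((ℛ k u).right i)).index, lact W (P.j ((ℛ k u).left i))
      (ract W (op (P.j (antipode k (antipodeSq k H ((ℛ k ((ℛ k u).right i)).right j)))))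
        (τ (antipodeSq k H ((ℛ k ((ℛ k u).right i)).left j)) w)) := by
  rw [← AlgHom.toLinearMap_apply, star, cvHom_toLinearMap, cv_apply, LinearMap.sum_apply]
  refine Finset.sum_congr rfl fun i _ => ?_
  rw [cvHom_toLinearMap, cv_apply, map_sum, LinearMap.sum_apply]
  refine Finset.sum_congr rfl fun j _ => ?_
  refine congrArg (lact W (P.j ((ℛ k u).left i))) ?_
  exact LinearMap.congr_fun (hr _ _).eq w
end Star

variable (R : EquivariantResolution α)

/-- The augmentation of a resolution of the bimodule `A`. -/
def augm (R : ProjectiveResolution (selfBimod k A)) : R.complex.X 0 ⟶ selfBimod k A :=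
  R.π.f 0 ≫ (HomologicalComplex.singleObjXSelf (ComplexShape.down ℕ) 0 (selfBimod k A)).hom

/-- The resolution induced from a resolution of `A`. -/
abbrev GR (R : ProjectiveResolution (selfBimod k A)) :
    ProjectiveResolution ((P.G hS).obj (selfBimod k A)) := (P.G hS).mapProjectiveResolution R

lemma rhoMap_augm (v : H) : (P.G hS).map (augm R.res) ≫ P.rhoMap hS (selfStr α) v =
    P.rhoMap hS (R.str 0) v ≫ (P.G hS).map (augm R.res) :=
  P.rhoMap_natural hS (R.str 0) (selfStr α) (augm R.res) (fun h x => R.aug_act h x) v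

lemma GR_π_f_zero (R : ProjectiveResolution (selfBimod k A)) : (P.GR hS R).π.f 0 =
    (P.G hS).map (augm R) ≫ (HomologicalComplex.singleObjXSelf (ComplexShape.down ℕ) 0
      ((P.G hS).obj (selfBimod k A))).inv := by
  change (P.G hS).map (R.π.f 0) ≫
    ((HomologicalComplex.singleMapHomologicalComplex (P.G hS) (ComplexShape.down ℕ) 0).hom.app
      (selfBimod k A)).f 0 = _
  rw [HomologicalComplex.singleMapHomologicalComplex_hom_app_self, augm, Functor.map_comp,
    Category.assoc]

/-- The chain map lifting the endomorphism `rhoMap` of the bimodule induced from `A`. -/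
def rhoHomRes (v : H) : ProjectiveResolution.Hom (P.GR hS R.res) (P.GR hS R.res)
    (P.rhoMap hS (selfStr α) v) where
  hom :=
    { f := fun n => P.rhoMap hS (R.str n) v
      comm' := fun i j _ => (P.rhoMap_natural hS (R.str i) (R.str j) (R.res.complex.d i j)
        (R.d_act i j) v).symm }
  hom_f_zero_comp_π_f_zero := by
    have h1 : ((ChainComplex.single₀ (Bimod k Λ)).map (P.rhoMap hS (selfStr α) v)).f 0 =
        (HomologicalComplex.singleObjXSelf (ComplexShape.down ℕ) 0 _).hom ≫
          P.rhoMap hS (selfStr α) v ≫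
          (HomologicalComplex.singleObjXSelf (ComplexShape.down ℕ) 0 _).inv :=
      HomologicalComplex.single_map_f_self _ _ _
    refine (congrArg (P.rhoMap hS (R.str 0) v ≫ ·) (P.GR_π_f_zero hS R.res)).trans ?_
    refine Eq.trans ?_ (congrArg₂ (· ≫ ·) (P.GR_π_f_zero hS R.res) h1).symm
    refine (Category.assoc _ _ _).symm.trans ?_
    refine (congrArg (· ≫ _) (P.rhoMap_augm hS R v).symm).trans ?_
    have aux : ∀ {X Y Z V : Bimod k Λ} (a : X ⟶ Y) (i : Z ≅ Y) (b : Y ⟶ V),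
        a ≫ b = (a ≫ i.inv) ≫ i.hom ≫ b := fun a i b => by simp
    exact (Category.assoc _ _ _).trans (aux _ _ _)

/-- The class `w` is represented by the cocycle `T`, through `G(A) ≃ F(H)`. -/
def IsClass {q : ℕ} (T : (P.GR hS R.res).complex.X q ⟶ regular (Env k Λ)) (w : P.W q) : Prop :=
  ∃ h : (P.GR hS R.res).complex.d (q + 1) q ≫ T = 0,
    w = (XB.map (inv (P.ζ hS)) q).hom (toXB ((P.GR hS R.res).extMk T (q + 1) rfl h))

variable {P hS R}

section IsClass
variable {q : ℕ} {T T' : (P.GR hS R.res).complex.X q ⟶ regular (Env k Λ)} {w w' : P.W q}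

lemma IsClass.unique (h : P.IsClass hS R T w) (h' : P.IsClass hS R T w') : w = w' := by
  obtain ⟨h, rfl⟩ := h
  obtain ⟨h', rfl⟩ := h'
  rfl

lemma IsClass.add (h : P.IsClass hS R T w) (h' : P.IsClass hS R T' w') :
    P.IsClass hS R (T + T') (w + w') := by
  obtain ⟨h, rfl⟩ := h
  obtain ⟨h', rfl⟩ := h'
  refine ⟨by rw [Preadditive.comp_add, h, h', add_zero], ?_⟩
  refine (map_add (XB.map (inv (P.ζ hS)) q).hom _ _).symm.trans
    (congrArg (XB.map (inv (P.ζ hS)) q).hom ((map_add toXB _ _).symm.trans (congrArg toXB ?_)))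
  exact ProjectiveResolution.add_extMk _ _ _ _ _ h h'

lemma IsClass.zero : P.IsClass hS R (0 : (P.GR hS R.res).complex.X q ⟶ _) 0 := by
  refine ⟨Limits.comp_zero, ?_⟩
  rw [ProjectiveResolution.extMk_zero, map_zero, map_zero]

lemma IsClass.sum {I : Type*} (s : Finset I)
    {T : I → ((P.GR hS R.res).complex.X q ⟶ regular (Env k Λ))} {w : I → P.W q}
    (h : ∀ i, P.IsClass hS R (T i) (w i)) : P.IsClass hS R (∑ i ∈ s, T i) (∑ i ∈ s, w i) := by
  classical
  induction s using Finset.induction_on with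
  | empty => exact IsClass.zero
  | insert a s ha ih => rw [Finset.sum_insert ha, Finset.sum_insert ha]; exact (h a).add ih

lemma IsClass.lact (h : P.IsClass hS R T w) (l : Λ) :
    P.IsClass hS R (T ≫ rMul (1 ⊗ₜ op l)) (lact (P.W q) l w) := by
  obtain ⟨h, rfl⟩ := h
  refine ⟨by rw [← Category.assoc, h, Limits.zero_comp], ?_⟩
  refine (homLin_lact (k := k) (XB.map (inv (P.ζ hS)) q) l _).symm.trans ?_
  rw [lact_toXB, ProjectiveResolution.extMk_comp_mk₀]
  rfl

lemma IsClass.ract (h : P.IsClass hS R T w) (l : Λ) :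
    P.IsClass hS R (T ≫ rMul (l ⊗ₜ 1)) (ract (P.W q) (op l) w) := by
  obtain ⟨h, rfl⟩ := h
  refine ⟨by rw [← Category.assoc, h, Limits.zero_comp], ?_⟩
  refine (homLin_ract (k := k) (XB.map (inv (P.ζ hS)) q) (op l) _).symm.trans ?_
  rw [ract_toXB, ProjectiveResolution.extMk_comp_mk₀]
  rfl

lemma inv_ζ_comp (v : H) : P.F.map (rMul (antipodeSq k H v)) ≫ inv (P.ζ hS) =
    inv (P.ζ hS) ≫ P.rhoMap hS (selfStr α) v := by
  rw [IsIso.comp_inv_eq, Category.assoc, IsIso.eq_inv_comp]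
  exact (P.rhoMap_ζ hS v).symm

lemma IsClass.tau (h : P.IsClass hS R T w) (v : H) :
    P.IsClass hS R ((P.rhoHomRes hS R v).hom.f q ≫ T) (P.τ q (antipodeSq k H v) w) := by
  obtain ⟨h, rfl⟩ := h
  have h' : (P.GR hS R.res).complex.d (q + 1) q ≫ (P.rhoHomRes hS R v).hom.f q ≫ T = 0 := by
    rw [← Category.assoc, ← (P.rhoHomRes hS R v).hom.comm (q + 1) q, Category.assoc, h,
      Limits.comp_zero]
  refine ⟨h', ?_⟩
  change (XB.map (inv (P.ζ hS)) q ≫ XB.map (P.F.map (rMul (antipodeSq k H v))) q).hom _ = _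
  rw [← XB.map_comp, inv_ζ_comp, XB.map_comp]
  refine congrArg (XB.map (inv (P.ζ hS)) q).hom ((XB.map_toXB _ _).trans (congrArg toXB ?_))
  exact ProjectiveResolution.mk₀_comp_extMk T (q + 1) rfl h (P.rhoHomRes hS R v)

end IsClass

lemma isClass_extend (R : EquivariantResolution α) {q : ℕ}
    (f : R.res.complex.X q ⟶ regular (Env k A)) (hf : R.res.complex.d (q + 1) q ≫ f = 0) :
    P.IsClass hS R (P.extend hS f) (P.Φ hS q (extClass R.res q f hf)) := by
  have h := CategoryTheory.ProjectiveResolution.map_cocycle (P.G hS) R.res f (q + 1) rfl hf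
  have h2 : (P.GR hS R.res).complex.d (q + 1) q ≫
      (show (P.GR hS R.res).complex.X q ⟶ _ from (P.G hS).map f) ≫ P.κr hS = 0 := by
    rw [← Category.assoc]
    exact (congrArg (· ≫ P.κr hS) h).trans Limits.zero_comp
  refine ⟨h2, ?_⟩
  refine congrArg (fun x => (XB.map (inv (P.ζ hS)) q).hom (toXB x)) ?_
  refine Eq.trans (congrArg (fun x : Ext _ _ q => x.comp (Ext.mk₀ (P.κr hS)) (add_zero q))
    (CategoryTheory.ProjectiveResolution.extMk_map (P.G hS) R.res f (q + 1) rfl hf)) ?_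
  exact ProjectiveResolution.extMk_comp_mk₀ (R := P.GR hS R.res)
    (show (P.GR hS R.res).complex.X q ⟶ _ from (P.G hS).map f) (q + 1) rfl h (P.κr hS)

variable (P hS)

/-- The `⋆`-action on `Ext^q(F(H), Λ^e)`. -/
abbrev starW (q : ℕ) : H →ₐ[k] Module.End k (P.W q) :=
  P.star (P.W q) (P.τ q) (P.τ_lact q) (P.τ_ract q)

/-- The `⋆`-action on classes coming from `A` is induced by the action on cochains. -/
lemma star_Φ_extClass (R : EquivariantResolution α) {q : ℕ} (u : H)
    (f : R.res.complex.X q ⟶ ModuleCat.of (Env k A) (Env k A))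
    (hf : R.res.complex.d (q + 1) q ≫ f = 0) :
    ∃ (g : R.res.complex.X q ⟶ ModuleCat.of (Env k A) (Env k A))
      (hg : R.res.complex.d (q + 1) q ≫ g = 0), toLin g = homAct (R.str q) u (toLin f) ∧
      P.starW q u (P.Φ hS q (extClass R.res q f hf)) = P.Φ hS q (extClass R.res q g hg) := by
  obtain ⟨g, hg, hgT⟩ := P.exists_twist hS (R.str q) u f
  have hg0 : R.res.complex.d (q + 1) q ≫ g = 0 := by
    refine ModuleCat.hom_ext (LinearMap.ext fun x => ?_)
    refine (LinearMap.congr_fun hg ((R.res.complex.d (q + 1) q).hom x)).trans ?_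
    have h1 := homAct_comp (R.str (q + 1)) (R.str q) (homLin k (R.res.complex.d (q + 1) q))
      (R.d_act (q + 1) q) (toLin f) u x
    have h2 : toLin f ∘ₗ homLin k (R.res.complex.d (q + 1) q) = 0 := by
      ext y
      exact ConcreteCategory.congr_hom hf y
    rw [h2, map_zero] at h1
    exact h1.symm
  refine ⟨g, hg0, hg, ?_⟩
  have h1 := isClass_extend (P := P) (hS := hS) R g hg0
  rw [← hgT] at h1
  refine IsClass.unique ?_ h1
  rw [star_apply, twistMor]
  refine IsClass.sum _ fun i => IsClass.sum _ fun j => ?_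
  have h2 := (((isClass_extend (P := P) (hS := hS) R f hf).tau
    ((ℛ k ((ℛ k u).right i)).left j)).ract (P.j (antipode k (antipodeSq k H
      ((ℛ k ((ℛ k u).right i)).right j))))).lact (P.j ((ℛ k u).left i))
  exact (congrArg (P.IsClass hS R · _) ((Category.assoc _ _ _).trans (Category.assoc _ _ _))).mp h2

end SmashPair
end StarAction
end SmashDuality

/-! ### Bases of cup products -/

namespace SmashDuality
section CupFamilies
open Abelian Limits TotExt

universe w w' v v' u'
variable {C : Type u} [Category.{v} C] [Abelian C] [HasExt.{w} C]
  {D : Type u'} [Category.{v'} D] [Abelian D] [HasExt.{w'} D]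

namespace TotExt
variable {J J' : Type*} [DecidableEq J] {M N : C}

/-- A family of classes of degree `p`, as a family of classes of all degrees. -/
def ofFinsupp (a : J' → J) (p : ℕ) : (J' →₀ Ext M N p) →+ TotExt J M N :=
  Finsupp.liftAddHom fun j => single (a j) p

lemma ofFinsupp_single (a : J' → J) (p : ℕ) (j : J') (x : Ext M N p) :
    ofFinsupp a p (Finsupp.single j x) = single (a j) p x :=
  Finsupp.liftAddHom_apply_single _ _ _

lemma ofFinsupp_apply {a : J' → J} (ha : Function.Injective a) (p : ℕ) (f : J' →₀ Ext M N p)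
    (j : J') : ofFinsupp a p f (a j, p) = f j := by
  have h : ((DFinsupp.evalAddMonoidHom (a j, p)).comp (ofFinsupp a p) :
      (J' →₀ Ext M N p) →+ Ext M N p) = Finsupp.applyAddHom j := by
    refine Finsupp.addHom_ext fun i x => ?_
    change ofFinsupp a p (Finsupp.single i x) (a j, p) = Finsupp.single i x j
    rw [ofFinsupp_single]
    by_cases hij : i = j
    · subst hij
      rw [single_apply_self, Finsupp.single_eq_same]
    · rw [single_apply_ne fun h => hij (ha (Prod.ext_iff.1 h).1), Finsupp.single_eq_of_ne' hij]
  exact DFunLike.congr_fun h f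

lemma ofFinsupp_injective {a : J' → J} (ha : Function.Injective a) (p : ℕ) :
    Function.Injective (ofFinsupp (M := M) (N := N) a p) := fun f g h => by
  ext j
  rw [← ofFinsupp_apply ha, h, ofFinsupp_apply ha]

lemma ofFinsupp_surjective (h : ∀ p, p ≠ 0 → Subsingleton (Ext M N p)) :
    Function.Surjective (ofFinsupp (M := M) (N := N) (id : J → J) 0) := fun x => by
  refine mem_of_components (ofFinsupp (M := M) (N := N) (id : J → J) 0).range x fun j p => ?_
  rcases eq_or_ne p 0 with rfl | hp
  · exact ⟨Finsupp.single j (x (j, 0)), ofFinsupp_single _ _ _ _⟩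
  · have := h p hp
    rw [Subsingleton.elim (x (j, p)) 0, map_zero]
    exact zero_mem _

end TotExt

variable (F : C ⥤ D) [F.Additive] [PreservesFiniteLimits F] [PreservesFiniteColimits F]
  {J J' : Type*} [DecidableEq J] {N : C} {N' : D} (q : J → ℕ) (w : ∀ j, Ext (F.obj N) N' (q j))

/-- The map `(x_j) ↦ ∑ F(x_j) w_{a(j)}` on families of classes of degree `p`, when all the cup
products have the same degree. -/
def cupFam (M : C) (a : J' → J) {p n : ℕ} (h : ∀ j, p + q (a j) = n) :
    (J' →₀ Ext M N p) →+ Ext (F.obj M) N' n :=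
  Finsupp.liftAddHom fun j =>
    ((w (a j)).postcomp (F.obj M) (h j)).comp (F.mapExtAddHom M N p)

lemma cupFam_single (M : C) (a : J' → J) {p n : ℕ} (h : ∀ j, p + q (a j) = n) (j : J')
    (x : Ext M N p) : cupFam F q w M a h (Finsupp.single j x) =
      (x.mapExactFunctor F).comp (w (a j)) (h j) :=
  Finsupp.liftAddHom_apply_single _ _ _

lemma cupTot_ofFinsupp (M : C) (a : J' → J) {p n : ℕ} (h : ∀ j, p + q (a j) = n)
    (f : J' →₀ Ext M N p) :
    cupTot F q w M (ofFinsupp a p f) = single () n (cupFam F q w M a h f) := by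
  refine DFunLike.congr_fun (f := (cupTot F q w M).comp (ofFinsupp a p))
    (g := (single () n).comp (cupFam F q w M a h)) (Finsupp.addHom_ext fun j x => ?_) f
  change cupTot F q w M (ofFinsupp a p (Finsupp.single j x)) = single () n (cupFam F q w M a h _)
  rw [ofFinsupp_single, cupFam_single, cupTot_single F q w M (a j) (h j)]

variable {F q w}

lemma cupFam_injective {M : C} (hM : Function.Injective (cupTot F q w M)) {a : J' → J}
    (ha : Function.Injective a) {p n : ℕ} (h : ∀ j, p + q (a j) = n) :
    Function.Injective (cupFam F q w M a h) := fun f g hfg => by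
  refine ofFinsupp_injective ha p (hM ?_)
  rw [cupTot_ofFinsupp F q w M a h, hfg, cupTot_ofFinsupp]

lemma closure_cup_eq_top {M : C} (hM : Function.Surjective (cupTot F q w M)) (n : ℕ) :
    AddSubgroup.closure {z : Ext (F.obj M) N' n | ∃ (j : J) (p : ℕ) (h : p + q j = n)
      (x : Ext M N p), (x.mapExactFunctor F).comp (w j) h = z} = ⊤ := by
  refine (AddSubgroup.eq_top_iff' _).2 fun z => ?_
  obtain ⟨x, hx⟩ := hM (single () n z)
  have h1 : z = cupTot F q w M x ((), n) := by rw [hx, single_apply_self]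
  rw [h1]
  clear h1 hx
  induction x using DirectSum.induction_on with
  | zero =>
    rw [map_zero]
    exact zero_mem _
  | add x y hx hy =>
    rw [map_add]
    exact add_mem hx hy
  | of t x =>
    obtain ⟨j, p⟩ := t
    change cupTot F q w M (single j p x) ((), n) ∈ _
    by_cases h : p + q j = n
    · rw [cupTot_single F q w M j h, single_apply_self]
      exact AddSubgroup.subset_closure ⟨j, p, h, x, rfl⟩
    · rw [cupTot_single F q w M j rfl, single_apply_ne fun h' => h (Prod.ext_iff.1 h').2]
      exact zero_mem _

lemma cupFam_bijective {M : C} (hM : Function.Bijective (cupTot F q w M)) {d p n : ℕ}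
    (hq : ∀ j, q j = d) (hn : p + d = n) :
    Function.Bijective (cupFam F q w M id (p := p) (n := n) fun j => by rw [id, hq, hn]) := by
  refine ⟨cupFam_injective hM.1 Function.injective_id _, fun z => ?_⟩
  have hz : z ∈ (⊤ : AddSubgroup (Ext (F.obj M) N' n)) := trivial
  rw [← closure_cup_eq_top hM.2 n] at hz
  refine (AddSubgroup.closure_le (cupFam F q w M id _).range).2 ?_ hz
  rintro _ ⟨j, p', h, x, rfl⟩
  obtain rfl : p' = p := by have := hq j; omega
  exact ⟨Finsupp.single j x, cupFam_single _ _ _ _ _ _ _ _⟩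

/-- The base case of `cupTot_bijective`, in one degree. -/
lemma cupTot_bijective_of_cupFam {G : C} (hG : ∀ p, p ≠ 0 → Subsingleton (Ext G N p)) {d : ℕ}
    (hq : ∀ j, q j = d) (hd : ∀ n, n ≠ d → Subsingleton (Ext (F.obj G) N' n))
    (h : Function.Bijective (cupFam F q w G id (p := 0) (n := d) fun j => by
      rw [id, hq, zero_add])) :
    Function.Bijective (cupTot F q w G) := by
  constructor
  · refine (injective_iff_map_eq_zero _).2 fun x hx => ?_
    obtain ⟨f, rfl⟩ := ofFinsupp_surjective hG x
    rw [cupTot_ofFinsupp F q w G id (n := d) fun j => by rw [id, hq, zero_add]] at hx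
    have hx' := congrArg (fun y => y ((), d)) hx
    dsimp only at hx'
    rw [single_apply_self] at hx'
    rw [(injective_iff_map_eq_zero _).1 h.1 f hx', map_zero]
  · refine fun y => mem_of_components (cupTot F q w G).range y fun _ n => ?_
    rcases eq_or_ne n d with rfl | hn
    · obtain ⟨f, hf⟩ := h.2 (y ((), n))
      refine ⟨ofFinsupp id 0 f, ?_⟩
      rw [cupTot_ofFinsupp F q w G id (n := n) fun j => by rw [id, hq, zero_add], hf]
    · have := hd n hn
      rw [Subsingleton.elim (y ((), n)) 0, map_zero]
      exact zero_mem _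

/-- The base case of `cupTot_bijective`, for families indexed by degree. -/
lemma cupTot_bijective_of_cupFam_sigma {I : ℕ → Type*} [∀ n, DecidableEq (I n)]
    {w : ∀ j : Σ n, I n, Ext (F.obj N) N' j.1} {G : C}
    (hG : ∀ p, p ≠ 0 → Subsingleton (Ext G N p))
    (h : ∀ n, Function.Bijective (cupFam F (Sigma.fst : (Σ n, I n) → ℕ) w G (Sigma.mk n)
      (p := 0) (n := n) fun _ => zero_add _)) :
    Function.Bijective (cupTot F Sigma.fst w G) := by
  constructor
  · refine (injective_iff_map_eq_zero _).2 fun x hx => ?_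
    obtain ⟨f, rfl⟩ := ofFinsupp_surjective hG x
    have key (n : ℕ) (f : (Σ n, I n) →₀ Ext G N 0) : cupTot F Sigma.fst w G (ofFinsupp id 0 f)
        ((), n) = cupFam F (Sigma.fst : (Σ n, I n) → ℕ) w G (Sigma.mk n)
          (p := 0) (n := n) (fun _ => zero_add _) (f.split n) := by
      induction f using Finsupp.induction_linear with
      | zero =>
        have : Finsupp.split (0 : (Σ n, I n) →₀ Ext G N 0) n = 0 := by ext; rfl
        rw [this, map_zero, map_zero, map_zero]
        rfl
      | add f g hf hg =>
        have : (f + g).split n = f.split n + g.split n := by ext; rfl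
        rw [this, map_add, map_add, map_add, ← hf, ← hg]
        rfl
      | single j x =>
        obtain ⟨m, i⟩ := j
        rw [ofFinsupp_single, id, cupTot_single F _ w G ⟨m, i⟩ (zero_add m)]
        rcases eq_or_ne m n with rfl | hm
        · have : Finsupp.split (Finsupp.single (⟨m, i⟩ : Σ n, I n) x) m = Finsupp.single i x := by
            ext i'
            rw [Finsupp.split_apply]
            simp only [Finsupp.single_apply, Sigma.mk.injEq, heq_eq_eq, true_and]
          rw [this, cupFam_single, single_apply_self]
        · have : Finsupp.split (Finsupp.single (⟨m, i⟩ : Σ n, I n) x) n = 0 := by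
            ext i'
            rw [Finsupp.split_apply, Finsupp.single_eq_of_ne]
            · rfl
            · rintro h
              exact hm (Sigma.mk.inj_iff.1 h).1.symm
          rw [this, map_zero, single_apply_ne]
          exact fun h' => hm (Prod.ext_iff.1 h').2
    have h0 (n : ℕ) : f.split n = 0 := by
      refine (injective_iff_map_eq_zero _).1 (h n).1 _ ?_
      rw [← key, hx]
      rfl
    have : f = 0 := by
      ext ⟨n, i⟩
      rw [← Finsupp.split_apply, h0]
      rfl
    rw [this, map_zero]
  · refine fun y => mem_of_components (cupTot F Sigma.fst w G).range y fun _ n => ?_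
    obtain ⟨f, hf⟩ := (h n).2 (y ((), n))
    refine ⟨ofFinsupp (Sigma.mk n) 0 f, ?_⟩
    rw [cupTot_ofFinsupp F Sigma.fst w G (Sigma.mk n) (n := n) fun _ => zero_add _, hf]

end CupFamilies
end SmashDuality

/-! ### Cup products as maps of tensor products -/

namespace SmashDuality
section CupLinear
open Abelian Limits MulOpposite
variable {k R Λ : Type u} [Field k] [Ring R] [Algebra k R] [Ring Λ] [Algebra k Λ]

/-- `Ext^p_R(M, R)` as a right `R`-module. -/
def RX (M : ModuleCat.{u} R) (p : ℕ) : ModuleCat.{u} Rᵐᵒᵖ := ModuleCat.of Rᵐᵒᵖ (RightExt M p)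

/-- Elements of `Ext^p(M, R)` as elements of `RX M p`. -/
def toRX {M : ModuleCat.{u} R} {p : ℕ} : Ext M (regular R) p ≃+ RX M p := AddEquiv.refl _

lemma smul_toRX {M : ModuleCat.{u} R} {p : ℕ} (r : R) (x : Ext M (regular R) p) :
    op r • toRX x = toRX (x.comp (Ext.mk₀ (rMul r)) (add_zero p)) := rfl

lemma algebra_smul_toRX {M : ModuleCat.{u} R} {p : ℕ} (c : k) (x : Ext M (regular R) p) :
    c • toRX x = toRX (x.comp (Ext.mk₀ (rMul (algebraMap k R c))) (add_zero p)) := rfl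

lemma algebra_smul_toXB {M : Bimod k Λ} {q : ℕ} (c : k) (x : Ext M (regular (Env k Λ)) q) :
    c • toXB x = toXB (x.comp (Ext.mk₀ (rMul (algebraMap k (Env k Λ) c))) (add_zero q)) := by
  rw [← algebraMap_smul (Env k Λ) c (toXB x), smul_toXB, AlgEquiv.commutes]
  rfl

variable (F : ModuleCat.{u} R ⥤ Bimod k Λ) [F.Additive] [PreservesFiniteLimits F]
  [PreservesFiniteColimits F]
  (hF : ∀ (c : k) (x : F.obj (regular R)), (F.map (rMul (algebraMap k R c))).hom x =
    algebraMap k (Env k Λ) c • x)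
  {M : ModuleCat.{u} R} {p d n : ℕ} (h : p + d = n)

/-- The product `x, y ↦ F(x) y`. -/
def cup (h : p + d = n) (x : RX M p) (y : XB (F.obj (regular R)) d) : XB (F.obj M) n :=
  toXB (((toRX.symm x).mapExactFunctor F).comp (toXB.symm y) h)

variable {F}

lemma cup_smul_right (x : RX M p) (z : Env k Λ) (y : XB (F.obj (regular R)) d) :
    cup F h x (z • y) = z • cup F h x y := by
  obtain ⟨x, rfl⟩ := toRX.surjective x
  obtain ⟨y, rfl⟩ := toXB.surjective y
  refine congrArg toXB ?_
  exact (Ext.comp_assoc_of_third_deg_zero _ _ _ _).symm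

lemma cup_add_right (x : RX M p) (y y' : XB (F.obj (regular R)) d) :
    cup F h x (y + y') = cup F h x y + cup F h x y' :=
  congrArg toXB (Ext.comp_add _ _ _ _)

lemma cup_add_left (x x' : RX M p) (y : XB (F.obj (regular R)) d) :
    cup F h (x + x') y = cup F h x y + cup F h x' y := by
  refine congrArg toXB ?_
  refine (congrArg (fun z : Ext (F.obj M) (F.obj (regular R)) p => z.comp (toXB.symm y) h)
    ((F.mapExtAddHom M (regular R) p).map_add (toRX.symm x) (toRX.symm x'))).trans (Ext.add_comp _ _ _ _)

lemma cup_op_smul (r : R) (x : RX M p) (y : XB (F.obj (regular R)) d) :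
    cup F h (op r • x) y = cup F h x ((XB.map (F.map (rMul r)) d).hom y) := by
  obtain ⟨x, rfl⟩ := toRX.surjective x
  obtain ⟨y, rfl⟩ := toXB.surjective y
  rw [smul_toRX, XB.map_toXB]
  refine congrArg toXB ?_
  change ((x.comp (Ext.mk₀ (rMul r)) (add_zero p)).mapExactFunctor F).comp y h =
    (x.mapExactFunctor F).comp ((Ext.mk₀ (F.map (rMul r))).comp y (zero_add d)) h
  rw [Ext.mapExactFunctor_comp, Ext.mapExactFunctor_mk₀, Ext.comp_assoc_of_second_deg_zero]

lemma cup_mk₀ (r : R) (y : XB (F.obj (regular R)) d) :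
    cup F (zero_add d) (toRX (Ext.mk₀ (rMul r))) y = (XB.map (F.map (rMul r)) d).hom y := by
  obtain ⟨y, rfl⟩ := toXB.surjective y
  refine congrArg toXB ?_
  change ((Ext.mk₀ (rMul r)).mapExactFunctor F).comp y (zero_add d) = _
  rw [Ext.mapExactFunctor_mk₀]
  rfl

/-- The product `x, y ↦ F(x) y` as a bilinear map. -/
def cupLin : RX M p →ₗ[k] XB (F.obj (regular R)) d →ₗ[k] XB (F.obj M) n :=
  LinearMap.mk₂ k (cup F h) (cup_add_left h)
    (fun c x y => by
      refine (cup_op_smul h (algebraMap k R c) x y).trans ?_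
      rw [XB.map_central c _ (hF c), ← algebraMap_smul (Env k Λ) c y, cup_smul_right,
        algebraMap_smul])
    (cup_add_right h)
    (fun c x y => by
      rw [← algebraMap_smul (Env k Λ) c y, cup_smul_right, algebraMap_smul])

lemma exists_rMul {R : Type u} [Ring R] (f : regular R ⟶ regular R) : ∃ r : R, f = rMul r := by
  refine ⟨f.hom (1 : R), ModuleCat.hom_ext (LinearMap.ext fun x => ?_)⟩
  exact (congrArg f.hom (mul_one (show R from x)).symm).trans (map_smul f.hom (show R from x) _)

lemma rMul_injective {R : Type u} [Ring R] : Function.Injective (rMul (R := R)) := fun r s h => by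
  have := ConcreteCategory.congr_hom h (1 : R)
  exact (one_mul r).symm.trans (this.trans (one_mul s))

/-- `Ext^0(R, R) ≃ R`. -/
def rMulEquiv : R ≃ₗ[k] RX (regular R) 0 :=
  LinearEquiv.ofBijective
    { toFun := fun r => toRX (Ext.mk₀ (rMul r))
      map_add' := fun r s => by rw [rMul_add, Ext.mk₀_add, map_add]
      map_smul' := fun c r => by
        rw [RingHom.id_apply, algebra_smul_toRX, Ext.mk₀_comp_mk₀, ← rMul_mul,
          ← Algebra.commutes, ← Algebra.smul_def] }
    ⟨fun r s h => rMul_injective ((Ext.mk₀_bijective _ _).1 (toRX.injective h)), fun x => by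
      obtain ⟨x, rfl⟩ := toRX.surjective x
      obtain ⟨f, rfl⟩ := (Ext.mk₀_bijective _ _).2 x
      obtain ⟨r, rfl⟩ := exists_rMul f
      exact ⟨r, rfl⟩⟩

lemma subsingleton_ext_regular {R : Type u} [Ring R] (N : ModuleCat.{u} R) (p : ℕ) (hp : p ≠ 0) :
    Subsingleton (Ext (regular R) N p) := by
  obtain ⟨p, rfl⟩ := Nat.exists_eq_succ_of_ne_zero hp
  have : Projective (regular R) := inferInstanceAs (Projective (ModuleCat.of R R))
  exact Ext.subsingleton_of_projective (regular R) N p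

section Tensor
variable {V : Type u} [AddCommGroup V] [Module k V] (w : V →ₗ[k] XB (F.obj (regular R)) d)

/-- The map `x ⊗ v ↦ F(x) w(v)`. -/
def cupTensor : RX M p ⊗[k] V →ₗ[k] XB (F.obj M) n :=
  TensorProduct.lift ((cupLin hF h).compl₂ w)

lemma cupTensor_tmul (x : RX M p) (v : V) : cupTensor hF h w (x ⊗ₜ v) = cup F h x (w v) := rfl

/-- In terms of a basis of `V`, the map `cupTensor` is a map of families of classes. -/
lemma cupTensor_eq_cupFam {J I : Type*} [DecidableEq J] [DecidableEq I]
    (b : Module.Basis I k V) (q : J → ℕ)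
    (w' : ∀ j, Ext (F.obj (regular R)) (regular (Env k Λ)) (q j)) (a : I → J)
    (hq : ∀ i, q (a i) = d) (hw : ∀ i, w (b i) = toXB (hq i ▸ w' (a i))) :
    ⇑(cupTensor hF h w (M := M)) = toXB ∘ cupFam F q w' M a (p := p) (n := n)
      (fun i => by rw [hq, h]) ∘ (Finsupp.mapRange.addEquiv toRX).symm ∘
        TensorProduct.equivFinsuppOfBasisRight b := by
  have key : (cupTensor hF h w (M := M)).toAddMonoidHom.comp
      ((TensorProduct.equivFinsuppOfBasisRight b).symm.toLinearMap.toAddMonoidHom.comp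
        (Finsupp.mapRange.addEquiv toRX).toAddMonoidHom) = toXB.toAddMonoidHom.comp
      (cupFam F q w' M a (p := p) (n := n) (fun i => by rw [hq, h])) := by
    refine Finsupp.addHom_ext fun i x => ?_
    change cupTensor hF h w ((TensorProduct.equivFinsuppOfBasisRight b).symm
      (Finsupp.mapRange toRX (map_zero toRX) (Finsupp.single i x))) = toXB (cupFam F q w' M a _ _)
    rw [cupFam_single, Finsupp.mapRange_single,
      TensorProduct.equivFinsuppOfBasisRight_symm_apply, Finsupp.sum_single_index
      (h := fun i (m : RX M p) => m ⊗ₜ[k] b i) (TensorProduct.zero_tmul _ _), cupTensor_tmul, hw]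
    have h2 : q (a i) = d := hq i
    subst h2
    rfl
  funext x
  have := DFunLike.congr_fun key ((Finsupp.mapRange.addEquiv toRX).symm
    (TensorProduct.equivFinsuppOfBasisRight b x))
  refine Eq.trans ?_ this
  refine congrArg (cupTensor hF h w (M := M)) ?_
  change x = (TensorProduct.equivFinsuppOfBasisRight b).symm ((Finsupp.mapRange.addEquiv toRX)
    ((Finsupp.mapRange.addEquiv toRX).symm (TensorProduct.equivFinsuppOfBasisRight b x)))
  rw [AddEquiv.apply_symm_apply, LinearEquiv.symm_apply_apply]

lemma bijective_comp_iff_cupFam {J I : Type*} [DecidableEq J] [DecidableEq I]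
    (b : Module.Basis I k V) (q : J → ℕ)
    (w' : ∀ j, Ext (F.obj (regular R)) (regular (Env k Λ)) (q j)) (a : I → J)
    (hq : ∀ i, q (a i) = d) (hw : ∀ i, w (b i) = toXB (hq i ▸ w' (a i))) :
    (Function.Injective (cupTensor hF h w (M := M)) ↔
      Function.Injective (cupFam F q w' M a (p := p) (n := n) (fun i => by rw [hq, h]))) ∧
    (Function.Bijective (cupTensor hF h w (M := M)) ↔
      Function.Bijective (cupFam F q w' M a (p := p) (n := n) (fun i => by rw [hq, h]))) := by
  rw [cupTensor_eq_cupFam hF h w b q w' a hq hw]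
  have e : Function.Bijective ((Finsupp.mapRange.addEquiv (ι := I) (toRX (M := M) (p := p))).symm ∘
      TensorProduct.equivFinsuppOfBasisRight (R := k) (M := RX M p) b) :=
    (AddEquiv.bijective _).comp (LinearEquiv.bijective _)
  rw [toXB.injective.of_comp_iff, Function.Injective.of_comp_iff' _ e,
    Function.Bijective.of_comp_iff' toXB.bijective, Function.Bijective.of_comp_iff _ e]
  exact ⟨Iff.rfl, Iff.rfl⟩

lemma cupTensor_regular_iff (B : R ⊗[k] V →ₗ[k] XB (F.obj (regular R)) d)
    (hB : ∀ r v, B (r ⊗ₜ v) = (XB.map (F.map (rMul r)) d).hom (w v)) (hB' : Function.Bijective B) :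
    Function.Bijective (cupTensor hF (zero_add d) w (M := regular R)) := by
  have : B = cupTensor hF (zero_add d) w ∘ₗ
      (TensorProduct.congr rMulEquiv (LinearEquiv.refl k V)).toLinearMap :=
    TensorProduct.ext' fun r v => (hB r v).trans (cup_mk₀ r (w v)).symm
  rw [this, LinearMap.coe_comp, LinearEquiv.coe_coe,
    Function.Bijective.of_comp_iff _ (LinearEquiv.bijective _)] at hB'
  exact hB'

/-- If the classes `w(v)` of degree `d` form a basis of `Ext^*(F(R), Λ^e)` over `R`, then
`Ext^p(M, R) ⊗ V ≃ Ext^{p+d}(F(M), Λ^e)` for all `M` in the thick closure of `R`. -/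
theorem cupTensor_bijective (B : R ⊗[k] V →ₗ[k] XB (F.obj (regular R)) d)
    (hB : ∀ r v, B (r ⊗ₜ v) = (XB.map (F.map (rMul r)) d).hom (w v)) (hB' : Function.Bijective B)
    (hd : ∀ n, n ≠ d → Subsingleton (XB (F.obj (regular R)) n))
    (hM : ThickClosure (ModuleCat.of R R) M) :
    Function.Bijective (cupTensor hF h w (M := M)) := by
  classical
  let b := Module.Basis.ofVectorSpace k V
  let w' : ∀ j : Module.Basis.ofVectorSpaceIndex k V,
    Ext (F.obj (regular R)) (regular (Env k Λ)) ((fun _ => d) j) := fun i => toXB.symm (w (b i))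
  refine (bijective_comp_iff_cupFam hF h w b (fun _ => d) w' id (fun _ => rfl)
    fun i => rfl).2.2 ?_
  refine cupFam_bijective ?_ (fun _ => rfl) h
  refine cupTot_bijective F _ w' (G := regular R) ?_ hM
  refine cupTot_bijective_of_cupFam (d := d) (subsingleton_ext_regular (regular R))
    (fun _ => rfl) hd ?_
  exact (bijective_comp_iff_cupFam hF (zero_add d) w b (fun _ => d) w' id (fun _ => rfl)
    fun i => rfl).2.1 (cupTensor_regular_iff hF w B hB hB')
end Tensor

section Graded
variable {V : ℕ → Type u} [∀ n, AddCommGroup (V n)] [∀ n, Module k (V n)]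
  (w : ∀ n, V n →ₗ[k] XB (F.obj (regular R)) n)
  (B : ∀ n, R ⊗[k] V n →ₗ[k] XB (F.obj (regular R)) n)
  (hB : ∀ n r v, B n (r ⊗ₜ v) = (XB.map (F.map (rMul r)) n).hom (w n v))
  (hB' : ∀ n, Function.Bijective (B n)) (hM : ThickClosure (ModuleCat.of R R) M)

include hB hB' hM

/-- The graded version of `cupTensor_bijective`: all the products are injective, and a nonzero
`Ext^n(F(M), Λ^e)` comes from nonzero factors. -/
theorem cupTensor_graded :
    (∀ {p d n : ℕ} (h : p + d = n), Function.Injective (cupTensor hF h (w d) (M := M))) ∧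
    ∀ n, Nontrivial (XB (F.obj M) n) →
      ∃ p d, p + d = n ∧ Nontrivial (RX M p) ∧ Nontrivial (V d) := by
  classical
  obtain ⟨I, ⟨b⟩⟩ : ∃ I : ℕ → Type u, Nonempty (∀ n, Module.Basis (I n) k (V n)) :=
    ⟨_, ⟨fun n => Module.Basis.ofVectorSpace k (V n)⟩⟩
  obtain ⟨w', hw'⟩ : ∃ w' : ∀ j : Σ n, I n, Ext (F.obj (regular R)) (regular (Env k Λ)) j.1,
      ∀ n i, w n (b n i) = toXB (w' ⟨n, i⟩) := ⟨fun j => toXB.symm (w j.1 (b j.1 j.2)), fun n i => rfl⟩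
  have h1 : Function.Bijective (cupTot F Sigma.fst w' M) := by
    refine cupTot_bijective F Sigma.fst w' (G := regular R) ?_ hM
    refine cupTot_bijective_of_cupFam_sigma (subsingleton_ext_regular (regular R)) fun n => ?_
    exact (bijective_comp_iff_cupFam hF (zero_add n) (w n) (b n) Sigma.fst w' (Sigma.mk n)
      (fun _ => rfl) (hw' _)).2.1 (cupTensor_regular_iff hF (w n) (B n) (hB n) (hB' n))
  constructor
  · intro p d n h
    exact (bijective_comp_iff_cupFam hF h (w d) (b d) Sigma.fst w' (Sigma.mk d)
      (fun _ => rfl) (hw' _)).1.2 (cupFam_injective h1.1 sigma_mk_injective _)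
  · intro n hn
    by_contra! hc
    have h2 := closure_cup_eq_top h1.2 n
    have h3 : AddSubgroup.closure {z : Ext (F.obj M) (regular (Env k Λ)) n |
        ∃ (j : Σ n, I n) (p : ℕ) (h : p + j.1 = n)
        (x : Ext M (regular R) p), (x.mapExactFunctor F).comp (w' j) h = z} ≤ ⊥ := by
      refine (AddSubgroup.closure_le _).2 ?_
      rintro _ ⟨⟨d, i⟩, p, h, x, rfl⟩
      change (x.mapExactFunctor F).comp (w' ⟨d, i⟩) h = 0
      by_cases hx : Nontrivial (RX M p)
      · have hV : Subsingleton (V d) := hc p d h hx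
        have : w' ⟨d, i⟩ = 0 := by
          refine toXB.injective ((hw' d i).symm.trans ?_)
          rw [Subsingleton.elim (b d i) 0, map_zero, map_zero]
        rw [this, Ext.comp_zero]
      · have hx' : Subsingleton (RX M p) := not_nontrivial_iff_subsingleton.1 hx
        have : x = 0 := toRX.injective (Subsingleton.elim _ _)
        rw [this, Ext.mapExactFunctor_zero, Ext.zero_comp]
    rw [h2] at h3
    obtain ⟨z, hz⟩ := exists_ne (0 : XB (F.obj M) n)
    exact hz (h3 (show toXB.symm z ∈ ⊤ from trivial))
end Graded

end CupLinear
end SmashDuality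

/-! ### The bimodule `Ext^q(F(H), Λ^e)` is induced from `Ext^q(A, A^e)` -/

namespace SmashDuality
section Induced
open Abelian Limits MulOpposite HopfAlgebra
variable {k H : Type u} [Field k] [Ring H] [HopfAlgebra k H]

namespace SmashPair
variable {A : Type u} [Ring A] [Algebra k A]
  {α : HopfAction k H A} {Λ : Type u} [Ring Λ] [Algebra k Λ] (P : SmashPair α Λ)
  (hS : Function.Bijective (HopfAlgebra.antipode k (A := H)))

lemma map_G_central (c : k) (M : Bimod k A) (f : M ⟶ M)
    (hf : ∀ m, f.hom m = algebraMap k (Env k A) c • m) (x : (P.G hS).obj M) :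
    ((P.G hS).map f).hom x = algebraMap k (Env k Λ) c • x := by
  refine (P.env hS).ind_induction (p := fun x => ((P.G hS).map f).hom x =
    algebraMap k (Env k Λ) c • x) x ?_ ?_ ?_
  · intro t m
    rw [map_smul, FreeExtension.map_η, hf, FreeExtension.η_smul, AlgHom.commutes, ← mul_smul,
      ← mul_smul, Algebra.commutes]
  · rw [map_zero, smul_zero]
  · intro x y hx hy
    rw [map_add, smul_add, hx, hy]

lemma map_G_rMul (c : k) (x : (P.G hS).obj (regular (Env k A))) :
    ((P.G hS).map (rMul (algebraMap k (Env k A) c))).hom x = algebraMap k (Env k Λ) c • x :=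
  P.map_G_central hS c _ _ (fun m => (Algebra.commutes c (show Env k A from m)).symm) x

instance : IsIso (P.κr hS) := by
  apply isIso_of_bijective
  refine (congrArg Function.Bijective ?_).mpr
    ((toMod ((P.env hS).tensorAction.act (regular (Env k A)))).symm.trans
      (((TensorProduct.congr (LinearEquiv.refl k (H ⊗[k] H))
        (toRegLin k (Env k A)).symm).trans ((P.env hS).μ.trans (toRegLin k (Env k Λ)))
        ).toAddEquiv)).bijective
  refine congrArg DFunLike.coe (a₁ := (P.κr hS).hom.toAddMonoidHom)
    (a₂ := ((toMod ((P.env hS).tensorAction.act (regular (Env k A)))).symm.trans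
      (((TensorProduct.congr (LinearEquiv.refl k (H ⊗[k] H))
        (toRegLin k (Env k A)).symm).trans ((P.env hS).μ.trans (toRegLin k (Env k Λ)))
        ).toAddEquiv)).toAddMonoidHom) ?_
  refine (P.env hS).addHom_ext fun t z => ?_
  obtain ⟨z, rfl⟩ := (toRegLin k (Env k A)).surjective z
  change (P.κr hS).hom ((P.env hS).u t • (P.env hS).ηLin _ (toRegLin k _ z)) =
    (toRegLin k (Env k Λ)) ((P.env hS).μ
    (TensorProduct.congr (LinearEquiv.refl k (H ⊗[k] H)) (toRegLin k (Env k A)).symm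
    ((toMod ((P.env hS).tensorAction.act (regular (Env k A)))).symm
      ((P.env hS).u t • (P.env hS).η _ (toRegLin k _ z)))))
  rw [map_smul, ← FreeExtension.toMod_tmul, AddEquiv.symm_apply_apply]
  refine (congrArg ((P.env hS).u t • ·) (P.κr_η hS z)).trans ?_
  rw [TensorProduct.congr_tmul, LinearEquiv.symm_apply_apply]
  rfl

/-- `Λ^e ≃ Ext^0(G(A^e), Λ^e)`. -/
def extZero : Env k Λ ≃ₗ[k] XB ((P.G hS).obj (regular (Env k A))) 0 :=
  LinearEquiv.ofBijective
    { toFun := fun s => toXB (Ext.mk₀ (P.κr hS ≫ rMul s))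
      map_add' := fun r s => by rw [rMul_add, Preadditive.comp_add, Ext.mk₀_add, map_add]
      map_smul' := fun c r => by
        rw [RingHom.id_apply, algebra_smul_toXB, Ext.mk₀_comp_mk₀, Category.assoc, ← rMul_mul,
          ← Algebra.commutes, ← Algebra.smul_def] }
    ⟨fun r s h => rMul_injective ((cancel_epi (P.κr hS)).1
      ((Ext.mk₀_bijective _ _).1 (toXB.injective h))), fun x => by
      obtain ⟨x, rfl⟩ := toXB.surjective x
      obtain ⟨f, rfl⟩ := (Ext.mk₀_bijective _ _).2 x
      obtain ⟨r, hr⟩ := exists_rMul (inv (P.κr hS) ≫ f)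
      refine ⟨r, ?_⟩
      change toXB (Ext.mk₀ (P.κr hS ≫ rMul r)) = _
      rw [← hr, IsIso.hom_inv_id_assoc]⟩

lemma extZero_apply (s : Env k Λ) : P.extZero hS s = toXB (Ext.mk₀ (P.κr hS ≫ rMul s)) := rfl

lemma envν_apply (z : Env k A) (t : H ⊗[k] H) :
    P.envν hS (z ⊗ₜ t) = (P.env hS).φ z * (P.env hS).u t := by
  induction t using TensorProduct.induction_on with
  | zero => simp
  | add x y hx hy => rw [TensorProduct.tmul_add, map_add, hx, hy, map_add, mul_add]
  | tmul x y => rw [envν_tmul, u_tmul]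

lemma cupTensor_G_bijective (hA : ThickClosure (ModuleCat.of (Env k A) (Env k A)) (selfBimod k A))
    (q : ℕ) : Function.Bijective (cupTensor (P.map_G_rMul hS) (add_zero q)
      ((P.extZero hS).toLinearMap ∘ₗ (P.env hS).u) (M := selfBimod k A)) := by
  refine cupTensor_bijective _ _ _ ((P.envν hS).trans (P.extZero hS)).toLinearMap (fun r v => ?_)
    (LinearEquiv.bijective _) (fun n hn => ?_) hA
  · change P.extZero hS (P.envν hS (r ⊗ₜ v)) = (XB.map _ 0).hom (P.extZero hS ((P.env hS).u v))
    rw [envν_apply, extZero_apply, extZero_apply, XB.map_toXB, Ext.mk₀_comp_mk₀, rMul_mul,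
      ← Category.assoc, ← Category.assoc, map_rMul_κr]
  · obtain ⟨n, rfl⟩ := Nat.exists_eq_succ_of_ne_zero hn
    have : Projective (regular (Env k A)) := inferInstanceAs (Projective (ModuleCat.of _ _))
    have : Projective ((P.G hS).obj (regular (Env k A))) :=
      (P.G hS).projective_obj_of_projective this
    have h := Ext.subsingleton_of_projective ((P.G hS).obj (regular (Env k A)))
      (regular (Env k Λ)) n
    exact (toXB (M := (P.G hS).obj (regular (Env k A)))).symm.injective.subsingleton

/-- `Ext^q(A, A^e)` as a right `A^e`-module and as a bimodule. -/
def extRX (q : ℕ) : ExtBimod k A q ≃ₗ[k] RX (selfBimod k A) q :=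
  { (toXB (M := selfBimod k A)).symm.trans toRX with
    map_smul' := fun c x => by
      obtain ⟨x, rfl⟩ := (toXB (M := selfBimod k A)).surjective x
      exact congrArg ((toXB (M := selfBimod k A)).symm.trans toRX)
        (algebra_smul_toXB (M := selfBimod k A) c x) }

section Actions
variable {W X : Type u} [AddCommGroup W] [Module k W] [AddCommGroup X] [Module k X]

/-- `h ⊗ x ↦ g(h) ψ(x)`. -/
def actMap (g : H →ₗ[k] Module.End k W) (ψ : X →ₗ[k] W) : H ⊗[k] X →ₗ[k] W :=
  TensorProduct.lift (LinearMap.lcomp k W ψ ∘ₗ g)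

lemma actMap_tmul (g : H →ₗ[k] Module.End k W) (ψ : X →ₗ[k] W) (h : H) (x : X) :
    actMap g ψ (h ⊗ₜ x) = g h (ψ x) := rfl

/-- Right multiplications by elements `j(l)`, as a linear map. -/
def rj (W : Bimod k Λ) : H →ₗ[k] Module.End k W :=
  (ract W).toLinearMap ∘ₗ opLin ∘ₗ P.j.toLinearMap

/-- Left multiplications by elements `j(l)`. -/
def lj (W : Bimod k Λ) : H →ₐ[k] Module.End k W := (lact W).comp P.j

lemma lj_apply (W : Bimod k Λ) (l : H) : P.lj W l = lact W (P.j l) := rfl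

/-- `x ⊗ l ↦ φ(x) j(l)`. -/
def rExt {W : Bimod k Λ} (φ : X →ₗ[k] W) : X ⊗[k] H →ₗ[k] W :=
  actMap (P.rj W) φ ∘ₗ (TensorProduct.comm k X H).toLinearMap

lemma rExt_tmul {W : Bimod k Λ} (φ : X →ₗ[k] W) (x : X) (l : H) :
    P.rExt φ (x ⊗ₜ l) = ract W (op (P.j l)) (φ x) := rfl
end Actions

/-- `H ⊗ Ext^q(A, A^e) ⊗ H ≃ Ext^q(F(H), Λ^e)`, `h ⊗ x ⊗ l ↦ j(h) Φ(x) j(l)`. -/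
theorem actMap_lj_bijective (hA : ThickClosure (ModuleCat.of (Env k A) (Env k A)) (selfBimod k A))
    (q : ℕ) : Function.Bijective
      (actMap (P.lj (P.W q)).toLinearMap (P.rExt (P.Φ hS q))) := by
  let e : H ⊗[k] (ExtBimod k A q ⊗[k] H) ≃ₗ[k] RX (selfBimod k A) q ⊗[k] (H ⊗[k] H) :=
    (TensorProduct.comm k _ _).trans ((TensorProduct.assoc k _ _ _).trans
      (TensorProduct.congr (extRX q) (LinearEquiv.refl k _)))
  have h1 : (actMap (P.lj (P.W q)).toLinearMap (P.rExt (P.Φ hS q))) =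
      homLin k (XB.map (inv (P.ζ hS)) q) ∘ₗ cupTensor (P.map_G_rMul hS) (add_zero q)
      ((P.extZero hS).toLinearMap ∘ₗ (P.env hS).u) (M := selfBimod k A) ∘ₗ e.toLinearMap := by
    refine TensorProduct.ext_threefold' fun h x l => ?_
    · obtain ⟨x, rfl⟩ := (toXB (M := selfBimod k A)).surjective x
      refine Eq.trans (b := lact (P.W q) (P.j h) (ract (P.W q) (op (P.j l))
        (P.Φ₀ hS q (toXB (M := selfBimod k A) x)))) rfl ?_
      refine Eq.trans ?_ (b := (XB.map (inv (P.ζ hS)) q).hom (cup (P.G hS) (add_zero q) (toRX x)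
          (P.extZero hS ((P.env hS).u (l ⊗ₜ h))))) rfl
      rw [u_tmul, Φ₀_apply]
      refine (congrArg (lact (P.W q) (P.j h))
        (homLin_ract (k := k) (XB.map (inv (P.ζ hS)) q) (op (P.j l)) _)).symm.trans ?_
      refine (homLin_lact (k := k) (XB.map (inv (P.ζ hS)) q) (P.j h) _).symm.trans ?_
      refine congrArg (XB.map (inv (P.ζ hS)) q).hom ?_
      rw [ract_toXB, lact_toXB]
      refine congrArg toXB ?_
      change _ = (x.mapExactFunctor (P.G hS)).comp (Ext.mk₀ (P.κr hS ≫ rMul _)) _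
      rw [Ext.comp_assoc_of_third_deg_zero, Ext.comp_assoc_of_third_deg_zero, Ext.mk₀_comp_mk₀,
        Ext.mk₀_comp_mk₀, ← rMul_mul, Algebra.TensorProduct.tmul_mul_tmul, mul_one,
        one_mul]
  have h2 : Function.Bijective (homLin k (XB.map (inv (P.ζ hS)) q)) :=
    ((XB.mapIso (asIso (P.ζ hS)) q).toLinearEquiv).bijective
  rw [h1, LinearMap.coe_comp, LinearMap.coe_comp]
  exact h2.comp ((P.cupTensor_G_bijective hS hA q).comp e.bijective)

end SmashPair
end Induced
end SmashDuality

/-! ### Consequences of the formula for the `⋆`-action -/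

namespace SmashDuality
section StarRelations
open MulOpposite HopfAlgebra
variable {k H : Type u} [Field k] [Ring H] [HopfAlgebra k H]

namespace SmashPair
variable {A : Type u} [Ring A] [Algebra k A]
  {α : HopfAction k H A} {Λ : Type u} [Ring Λ] [Algebra k Λ] (P : SmashPair α Λ)
  (hS : Function.Bijective (HopfAlgebra.antipode k (A := H)))
  (W : Bimod k Λ) (τ : H →ₐ[k] Module.End k W) (hl : ∀ h l, Commute (τ h) (lact W l))
  (hr : ∀ h l, Commute (τ h) (ract W l))

lemma star_toLinearMap : (P.star W τ hl hr).toLinearMap =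
    cv (LinearMap.mul k (Module.End k W)) (P.lj W).toLinearMap
      (cv (LinearMap.mul k (Module.End k W)) (τ.comp antipodeSqHom).toLinearMap
        (P.rCube W).toLinearMap) := by
  rw [star, cvHom_toLinearMap, cvHom_toLinearMap]
  rfl

lemma rCube_cancel : cv (LinearMap.mul k (Module.End k W)).flip (P.rCube W).toLinearMap
    (P.rj W ∘ₗ antipodeSq k H) = cunit (Module.End k W) := by
  ext u : 1
  have h := LinearMap.congr_fun (cv_antipode_mul (P.j.comp (antipodeSqHom (k := k) (H := H)))) u
  have h2 := congrArg ((ract W).toLinearMap ∘ₗ opLin) h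
  refine Eq.trans (map_cv ((ract W).toLinearMap ∘ₗ opLin) (fun u v => ?_) u).symm (h2.trans ?_)
  · exact (congrArg (ract W) (op_mul _ _)).trans (map_mul (ract W) _ _)
  · rw [cunit_apply, cunit_apply, map_smul]
    exact congrArg _ (map_one (ract W))

/-- `j(u₁) (S²(u₂) w) = (u₁ ⋆ w) j(S²(u₂))`. -/
lemma cv_star_rj : cv (LinearMap.mul k (Module.End k W)).flip (P.star W τ hl hr).toLinearMap
    (P.rj W ∘ₗ antipodeSq k H) = cv (LinearMap.mul k (Module.End k W)) (P.lj W).toLinearMap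
      (τ.comp antipodeSqHom).toLinearMap := by
  have h1 : ∀ (x : H) (y : Module.End k W) (z : H),
      P.rj W (antipodeSq k H z) * (P.lj W x * y) = P.lj W x * (P.rj W (antipodeSq k H z) * y) :=
    fun x y z => by
      rw [← mul_assoc, ← mul_assoc]
      exact congrArg (· * y) (lact_ract_commute W _ _).symm.eq
  have h2 : ∀ (x : H) (y : Module.End k W) (z : H),
      P.rj W (antipodeSq k H z) * ((τ.comp antipodeSqHom) x * y) =
        (τ.comp antipodeSqHom) x * (P.rj W (antipodeSq k H z) * y) := fun x y z => by
      rw [← mul_assoc, ← mul_assoc]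
      exact congrArg (· * y) (hr _ _).symm.eq
  rw [star_toLinearMap]
  rw [cv_assoc (C := LinearMap.mul k (Module.End k W)) (C' := (LinearMap.mul k _).flip)
    (fun x y z => h1 x _ z)]
  rw [cv_assoc (C := LinearMap.mul k (Module.End k W)) (C' := (LinearMap.mul k _).flip)
    (fun x y z => h2 x _ z), rCube_cancel]
  congr 1
  ext u : 1
  exact (cv_counit_right _ _ _ _).trans (mul_one _)

/-- `S²(u) w = j(S(u₁)) (u₂ ⋆ w) j(S²(u₃))`. -/
lemma tau_antipodeSq : (τ.comp antipodeSqHom).toLinearMap =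
    cv (LinearMap.mul k (Module.End k W)) ((P.lj W).toLinearMap ∘ₗ antipode k)
      (cv (LinearMap.mul k (Module.End k W)).flip (P.star W τ hl hr).toLinearMap
        (P.rj W ∘ₗ antipodeSq k H)) := by
  rw [cv_star_rj, ← cv_assoc (B := LinearMap.mul k _) (B' := LinearMap.mul k _)
    (fun x y z => mul_assoc _ _ _), cv_antipode_mul]
  ext u : 1
  exact ((cv_counit_left _ _ _ _).trans (one_mul _)).symm

include hS in
/-- `j(u) w = S(u₃) ((u₁ ⋆ w) j(S²(u₂)))`. -/
lemma lj_eq : (P.lj W).toLinearMap = cv (LinearMap.mul k (Module.End k W)).flip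
      (cv (LinearMap.mul k (Module.End k W)).flip (P.star W τ hl hr).toLinearMap
        (P.rj W ∘ₗ antipodeSq k H)) (τ.toLinearMap ∘ₗ antipode k) := by
  have h1 : τ.toLinearMap ∘ₗ antipode k =
      (τ.comp antipodeSqHom).toLinearMap ∘ₗ antipodeInv hS := by
    ext u : 1
    change τ (antipode k u) = τ (antipode k (antipode k (antipodeInv hS u)))
    rw [antipode_antipodeInv]
  have h2 : ∀ (x : H) (y : Module.End k W) (z : H), τ (antipode k z) * (P.lj W x * y) =
        P.lj W x * (τ (antipode k z) * y) := fun x y z => by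
      rw [← mul_assoc, ← mul_assoc]
      exact congrArg (· * y) (hl _ _).eq
  rw [cv_star_rj, cv_assoc (C := LinearMap.mul k _) (C' := (LinearMap.mul k _).flip)
    (fun x y z => h2 x _ z), h1, cv_antipodeInv_mul]
  ext u : 1
  exact ((cv_counit_right _ _ _ _).trans (mul_one _)).symm

section Equivariant
variable {D : Type u} [AddCommGroup D] [Module k D] (ρ : H →ₐ[k] Module.End k D) (φ : D →ₗ[k] W)
  (hφ : ∀ u x, P.star W τ hl hr u (φ x) = φ (ρ u x))

/-- The action `u (x ⊗ l) = u₁ x ⊗ S²(u₂) l`. -/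
def twistedDiag : H →ₐ[k] Module.End k (D ⊗[k] H) :=
  diagRep ρ ((Algebra.lmul k H).comp antipodeSqHom)

variable {W τ} {hl hr}
include hφ

lemma rExt_twistedDiag (u : H) (x : D) (l : H) : P.rExt φ (twistedDiag ρ u (x ⊗ₜ l)) =
    ract W (op (P.j l)) (cv (LinearMap.mul k (Module.End k W)).flip (P.star W τ hl hr).toLinearMap
        (P.rj W ∘ₗ antipodeSq k H) u (φ x)) := by
  rw [twistedDiag, diagRep_eq, LinearMap.sum_apply, map_sum, cv_apply, LinearMap.sum_apply, map_sum]
  refine Finset.sum_congr rfl fun i _ => ?_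
  refine Eq.trans (b := ract W (op (P.j (antipodeSq k H ((ℛ k u).right i) * l)))
    (φ (ρ ((ℛ k u).left i) x))) rfl ?_
  rw [← hφ, map_mul, op_mul, map_mul]
  rfl

lemma tau_rExt (u : H) (m : D ⊗[k] H) : τ (antipodeSq k H u) (P.rExt φ m) =
    cv (ev k W) ((P.lj W).toLinearMap ∘ₗ antipode k)
      (P.rExt φ ∘ₗ (twistedDiag ρ).toLinearMap.flip m) u := by
  induction m using TensorProduct.induction_on with
  | zero => simp [cv_apply]
  | add x y hx hy => simp only [map_add, hx, hy, cv_apply, LinearMap.comp_apply, Finset.sum_add_distrib, LinearMap.add_apply]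
  | tmul x l =>
    refine (LinearMap.congr_fun (hr (antipodeSq k H u) (op (P.j l))).eq (φ x)).trans ?_
    change ract W (op (P.j l)) ((τ.comp antipodeSqHom).toLinearMap u (φ x)) = _
    rw [tau_antipodeSq P W τ hl hr, cv_apply, cv_apply, LinearMap.sum_apply, map_sum]
    refine Finset.sum_congr rfl fun i _ => ?_
    refine (LinearMap.congr_fun (lact_ract_commute W _ (op (P.j l))).symm.eq _).trans ?_
    refine congrArg (P.lj W (antipode k ((ℛ k u).left i))) ?_
    exact (rExt_twistedDiag P ρ φ hφ _ x l).symm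

include hS in
lemma lj_rExt (u : H) (m : D ⊗[k] H) : P.lj W u (P.rExt φ m) =
    cv (ev k W).flip (P.rExt φ ∘ₗ (twistedDiag ρ).toLinearMap.flip m)
      (τ.toLinearMap ∘ₗ antipode k) u := by
  induction m using TensorProduct.induction_on with
  | zero => simp [cv_apply]
  | add x y hx hy => simp only [map_add, hx, hy, cv_apply, LinearMap.comp_apply, Finset.sum_add_distrib, LinearMap.add_apply]
  | tmul x l =>
    refine (LinearMap.congr_fun (lact_ract_commute W (P.j u) (op (P.j l))).eq (φ x)).trans ?_
    change ract W (op (P.j l)) ((P.lj W).toLinearMap u (φ x)) = _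
    rw [lj_eq P hS W τ hl hr, cv_apply, cv_apply, LinearMap.sum_apply, map_sum]
    refine Finset.sum_congr rfl fun i _ => ?_
    refine (LinearMap.congr_fun (hr _ (op (P.j l))).symm.eq _).trans ?_
    refine congrArg (τ (antipode k ((ℛ k u).right i))) ?_
    exact (rExt_twistedDiag P ρ φ hφ _ x l).symm

include hS in
/-- If the `j(h) φ(x) j(l)` form a basis of `W`, then so do the `h (φ(x) j(l))`. -/
theorem actMap_tau_bijective
    (hb : Function.Bijective (actMap (P.lj W).toLinearMap (P.rExt φ))) :
    Function.Bijective (actMap τ.toLinearMap (P.rExt φ)) := by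
  let s : H ≃ₗ[k] H := LinearEquiv.ofBijective (antipode k) hS
  let M := D ⊗[k] H
  have h1 : actMap τ.toLinearMap (P.rExt φ) ∘ₗ
      (TensorProduct.congr (s.trans s) (LinearEquiv.refl k M)).toLinearMap =
      actMap (P.lj W).toLinearMap (P.rExt φ) ∘ₗ
      (TensorProduct.congr s (LinearEquiv.refl k M)).toLinearMap ∘ₗ
      (TensorProduct.comm k M H).toLinearMap ∘ₗ twistR (twistedDiag ρ).toLinearMap ∘ₗ
      (TensorProduct.comm k H M).toLinearMap := by
    refine TensorProduct.ext' fun u m => ?_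
    refine (tau_rExt P ρ φ hφ u m).trans ?_
    exact (map_cv (actMap (P.lj W).toLinearMap (P.rExt φ) ∘ₗ
      (TensorProduct.congr s (LinearEquiv.refl k M)).toLinearMap ∘ₗ
      (TensorProduct.comm k M H).toLinearMap) (fun x y => rfl) u).symm
  have h2 : Function.Bijective (actMap τ.toLinearMap (P.rExt φ) ∘ₗ
      (TensorProduct.congr (s.trans s) (LinearEquiv.refl k M)).toLinearMap) := by
    rw [h1, LinearMap.coe_comp, LinearMap.coe_comp, LinearMap.coe_comp, LinearMap.coe_comp]
    exact hb.comp ((LinearEquiv.bijective _).comp ((LinearEquiv.bijective _).comp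
      ((twistR_bijective (twistedDiag ρ)).comp (LinearEquiv.bijective _))))
  exact (Function.Bijective.of_comp_iff _ (LinearEquiv.bijective _)).1 h2

end Equivariant

end SmashPair
end StarRelations
end SmashDuality

/-! ### The action of `H` on `Ext^q(A, A^e)` -/

namespace SmashDuality
section ExtAction
open MulOpposite HopfAlgebra Abelian
variable {k H : Type u} [Field k] [Ring H] [HopfAlgebra k H]

lemma mul'_map_comul {B : Type*} [Ring B] [Algebra k B] (f g : H →ₗ[k] B) (h : H) :
    LinearMap.mul' k B (TensorProduct.map f g (comul h)) = cv (LinearMap.mul k B) f g h := by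
  rw [cv_apply, ← (ℛ k h).eq, map_sum, map_sum]
  rfl

lemma mul'_map_comm_comul {B : Type*} [Ring B] [Algebra k B] (f g : H →ₗ[k] B) (h : H) :
    LinearMap.mul' k B (TensorProduct.map f g (TensorProduct.comm k H H (comul h))) =
      cv (LinearMap.mul k B).flip g f h := by
  rw [cv_apply, ← (ℛ k h).eq, map_sum, map_sum, map_sum]
  rfl

/-- The restriction of an action to a stable subspace, given as an injective map. -/
lemma exists_restrict {B W D : Type*} [Ring B] [Algebra k B] [AddCommGroup W] [Module k W]
    [AddCommGroup D] [Module k D] (s : B →ₐ[k] Module.End k W) (φ : D →ₗ[k] W)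
    (hφ : Function.Injective φ) (h : ∀ u x, ∃ y, s u (φ x) = φ y) :
    ∃ ρ : B →ₐ[k] Module.End k D, ∀ u x, s u (φ x) = φ (ρ u x) := by
  choose f hf using h
  refine ⟨AlgHom.ofLinearMap
    { toFun := fun u =>
        { toFun := f u
          map_add' := fun x y => hφ (by rw [map_add, ← hf, ← hf, ← hf, map_add, map_add])
          map_smul' := fun c x => hφ (by
            rw [map_smul, ← hf, ← hf, map_smul, map_smul, RingHom.id_apply]) }
      map_add' := fun u v => LinearMap.ext fun x => hφ ?_
      map_smul' := fun c u => LinearMap.ext fun x => hφ ?_ } (LinearMap.ext fun x => hφ ?_)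
    (fun u v => LinearMap.ext fun x => hφ ?_), fun u x => hf u x⟩
  · change φ (f (u + v) x) = φ (f u x + f v x)
    rw [map_add, ← hf, ← hf, ← hf, map_add, LinearMap.add_apply]
  · change φ (f (c • u) x) = φ (c • f u x)
    rw [map_smul, ← hf, ← hf, map_smul, LinearMap.smul_apply]
  · change φ (f 1 x) = φ x
    rw [← hf, map_one, Module.End.one_apply]
  · change φ (f (u * v) x) = φ (f u (f v x))
    rw [← hf, ← hf, ← hf, map_mul, Module.End.mul_apply]

namespace SmashPair
variable {A : Type u} [Ring A] [Algebra k A]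
  {α : HopfAction k H A} {Λ : Type u} [Ring Λ] [Algebra k Λ] (P : SmashPair α Λ)
  (hS : Function.Bijective (HopfAlgebra.antipode k (A := H)))

section
variable (W : Bimod k Λ) (τ : H →ₐ[k] Module.End k W) (hl : ∀ h l, Commute (τ h) (lact W l))
  (hr : ∀ h l, Commute (τ h) (ract W l))

/-- `u ⋆ (b w) = (u₁ b) (u₂ ⋆ w)`. -/
lemma star_lact (u : H) (b : A) : P.star W τ hl hr u * lact W (P.i b) =
    cv (LinearMap.mul k (Module.End k W)) ((lact W).toLinearMap ∘ₗ P.i.toLinearMap ∘ₗ α.on b)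
      (P.star W τ hl hr).toLinearMap u := by
  let E := Module.End k W
  let T : H →ₗ[k] E := (cvHom (τ.comp antipodeSqHom) (P.rCube W) (P.commute_rCube hr)).toLinearMap
  have hT : ∀ v l, Commute (T v) (lact W l) := fun v l =>
    (commute_cvHom _ _ (P.commute_rCube hr) _ (fun v => (hl (antipodeSqHom v) l).symm)
      (fun v => lact_ract_commute W l _) v).symm
  have h0 : (P.star W τ hl hr).toLinearMap = cv (LinearMap.mul k E) (P.lj W).toLinearMap T := by
    rw [star, cvHom_toLinearMap]
    rfl
  have h1 (v : H) : P.lj W v * lact W (P.i b) = cv (LinearMap.mul k E)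
      ((lact W).toLinearMap ∘ₗ P.i.toLinearMap ∘ₗ α.on b) (P.lj W).toLinearMap v := by
    rw [lj_apply, ← map_mul, P.comm]
    exact map_cv (lact W).toLinearMap (fun x y => map_mul (lact W) _ _) v
  rw [h0, ← cv_assoc (B := LinearMap.mul k E) (B' := LinearMap.mul k E)
    (fun x y z => mul_assoc _ _ _), ← AlgHom.toLinearMap_apply, h0]
  refine (map_cv (LinearMap.mulRight k (lact W (P.i b))) (fun x y => ?_) u)
  change P.lj W x * T y * lact W (P.i b) = cv _ _ _ x * T y
  rw [← h1, mul_assoc, mul_assoc, (hT y _).eq]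

/-- `u ⋆ (w b) = (u₁ ⋆ w) (S²(u₂) b)`. -/
lemma star_ract (u : H) (b : A) : P.star W τ hl hr u * ract W (op (P.i b)) =
    cv (LinearMap.mul k (Module.End k W)).flip (P.star W τ hl hr).toLinearMap
      ((ract W).toLinearMap ∘ₗ opLin ∘ₗ P.i.toLinearMap ∘ₗ α.on b ∘ₗ antipodeSq k H) u := by
  let E := Module.End k W
  let Z : H →ₗ[k] E :=
    (ract W).toLinearMap ∘ₗ opLin ∘ₗ P.i.toLinearMap ∘ₗ α.on b ∘ₗ antipodeSq k H
  have h3 (v : H) : P.rCube W v * ract W (op (P.i b)) =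
      cv (LinearMap.mul k E).flip (P.rCube W).toLinearMap Z v := by
    rw [rCube_apply, ← map_mul, ← op_mul, mul_antipode, cv_antipodeSq]
    refine map_cv ((ract W).toLinearMap ∘ₗ opLin) (fun x y => ?_) v
    exact (congrArg (ract W) (op_mul _ _)).trans (map_mul (ract W) _ _)
  have h1 : ∀ (x : H) (y : E) (z : H), Z z * (P.lj W x * y) = P.lj W x * (Z z * y) :=
    fun x y z => by
      rw [← mul_assoc, ← mul_assoc]
      exact congrArg (· * y) (lact_ract_commute W _ _).symm.eq
  have h2 : ∀ (x : H) (y : E) (z : H), Z z * ((τ.comp antipodeSqHom) x * y) =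
        (τ.comp antipodeSqHom) x * (Z z * y) := fun x y z => by
      rw [← mul_assoc, ← mul_assoc]
      exact congrArg (· * y) (hr _ _).symm.eq
  rw [← AlgHom.toLinearMap_apply, star_toLinearMap,
    cv_assoc (C := LinearMap.mul k E) (C' := (LinearMap.mul k E).flip) (fun x y z => h1 x _ z),
    cv_assoc (C := LinearMap.mul k E) (C' := (LinearMap.mul k E).flip) (fun x y z => h2 x _ z)]
  refine map_cv (LinearMap.mulRight k (ract W (op (P.i b)))) (fun x y => ?_) u
  refine (mul_assoc _ _ _).trans (congrArg (P.lj W x * ·) ?_)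
  refine map_cv (LinearMap.mulRight k (ract W (op (P.i b)))) (fun x y => ?_) y
  exact (mul_assoc _ _ _).trans (congrArg (_ * ·) (h3 y))

end

lemma Φ_injective (hA : ThickClosure (ModuleCat.of (Env k A) (Env k A)) (selfBimod k A)) (q : ℕ) :
    Function.Injective (P.Φ hS q) := fun x y hxy => by
  have h1 := (P.actMap_lj_bijective hS hA q).1 (a₁ := 1 ⊗ₜ (x ⊗ₜ 1)) (a₂ := 1 ⊗ₜ (y ⊗ₜ 1)) (by
    rw [actMap_tmul, actMap_tmul, rExt_tmul, rExt_tmul, hxy])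
  let T : H ⊗[k] (ExtBimod k A q ⊗[k] H) →ₗ[k] ExtBimod k A q :=
    (TensorProduct.lid k _).toLinearMap ∘ₗ TensorProduct.map counit
      ((TensorProduct.rid k _).toLinearMap ∘ₗ TensorProduct.map LinearMap.id counit)
  have hT : ∀ x, T (1 ⊗ₜ (x ⊗ₜ 1)) = x := fun x => by simp [T]
  rw [← hT x, h1, hT]

/-- The action on `Ext^q(A, A^e)` induced by the `⋆`-action; it is given on cocycles by `homAct`. -/
theorem exists_equivariantStr
    (hA : ThickClosure (ModuleCat.of (Env k A) (Env k A)) (selfBimod k A))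
    (hR : Nonempty (EquivariantResolution α)) (q : ℕ) :
    ∃ β : EquivariantStr α (antipodeSq k H) (ExtBimod k A q), β.IsCanonical ∧
      ∀ u x, P.starW q u (P.Φ hS q x) = P.Φ hS q (β.act u x) := by
  have hφ := P.Φ_injective hS hA q
  obtain ⟨R⟩ := hR
  obtain ⟨ρ, hρ⟩ := exists_restrict (P.starW q) (P.Φ hS q) hφ fun u x => by
    obtain ⟨f, hf, rfl⟩ := R.res.extMk_surjective x (q + 1) rfl
    obtain ⟨g, hg, _, h⟩ := P.star_Φ_extClass hS R u f hf
    exact ⟨_, h⟩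
  have hl (u : H) (a : A) (x : ExtBimod k A q) :
      P.Φ hS q (lact _ a x) = lact _ (P.i a) (P.Φ hS q x) := P.Φ₀_lact hS q a x
  have hr (u : H) (a : A) (x : ExtBimod k A q) :
      P.Φ hS q (ract _ (op a) x) = ract _ (op (P.i a)) (P.Φ hS q x) := P.Φ₀_ract hS q a x
  refine ⟨⟨ρ, fun u a => LinearMap.ext fun x => hφ ?_, fun u b => LinearMap.ext fun x => hφ ?_⟩,
    fun R u f hf => ?_, hρ⟩
  · rw [mul'_map_comul, Module.End.mul_apply, ← hρ, hl u]
    refine (LinearMap.congr_fun (P.star_lact _ _ _ _ u a) (P.Φ hS q x)).trans ?_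
    exact (cv_congr (LinearMap.applyₗ (P.Φ hS q x)) (P.Φ hS q ∘ₗ LinearMap.applyₗ x)
      (fun v w => (congrArg (lact _ _) (hρ w x)).trans (hl u _ _).symm) u)
  · rw [mul'_map_comm_comul, Module.End.mul_apply, ← hρ, hr u]
    refine (LinearMap.congr_fun (P.star_ract _ _ _ _ u b) (P.Φ hS q x)).trans ?_
    exact (cv_congr (LinearMap.applyₗ (P.Φ hS q x)) (P.Φ hS q ∘ₗ LinearMap.applyₗ x)
      (fun v w => (congrArg (ract _ _) (hρ v x)).trans (hr u _ _).symm) u)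
  · obtain ⟨g, hg, h1, h2⟩ := P.star_Φ_extClass hS R u f hf
    exact ⟨g, hg, h1, hφ ((hρ _ _).symm.trans h2)⟩

end SmashPair
end ExtAction
end SmashDuality

/-! ### Equivariant resolutions -/

namespace SmashDuality
section Augmentation
variable {C : Type*} [Category C] [Abelian C] {Z P : ℕ → C}

lemma SyzygySequence.resolution_aug (s : SyzygySequence Z P) : s.resolution.π.f 0 ≫
    (HomologicalComplex.singleObjXSelf (ComplexShape.down ℕ) 0 (Z 0)).hom = s.p 0 := by
  simp only [resolution, HomologicalComplex.singleObjXSelf, HomologicalComplex.singleObjXIsoOfEq]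
  exact (congrArg (· ≫ _) (ChainComplex.toSingle₀Equiv_symm_apply_f_zero _ _)).trans
    (Category.comp_id _)

end Augmentation

section EquivariantCovers
open MulOpposite
variable {k H A : Type u} [Field k] [Ring H] [HopfAlgebra k H] [Ring A] [Algebra k A]
  {α : HopfAction k H A}

lemma covariant_iff {V : Type u} [AddCommGroup V] [Module k V] {L : A →ₐ[k] Module.End k V}
    {ρ : H →ₐ[k] Module.End k V} : Covariant α L ρ ↔ ∀ h a, ρ h * L a =
      cv (LinearMap.mul k (Module.End k V)) (L.toLinearMap ∘ₗ α.on a) ρ.toLinearMap h :=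
  forall₂_congr fun h a => by rw [mul'_map_comul]

variable (α) in
/-- Right multiplications `R` by `A` and an action `ρ` of `H` satisfy `h (v b) = (h₁ v) (h₂ b)`. -/
def RightCovariant {V : Type u} [AddCommGroup V] [Module k V] (R : Aᵐᵒᵖ →ₐ[k] Module.End k V)
    (ρ : H →ₐ[k] Module.End k V) : Prop := ∀ h b, ρ h * R (op b) =
      cv (LinearMap.mul k (Module.End k V)).flip ρ.toLinearMap (R.toLinearMap ∘ₗ opLin ∘ₗ α.on b) h

lemma diagRep_toLinearMap {V W : Type u} [AddCommGroup V] [Module k V] [AddCommGroup W] [Module k W]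
    (ρ : H →ₐ[k] Module.End k V) (g : H →ₐ[k] Module.End k W) : (diagRep ρ g).toLinearMap =
      cv (TensorProduct.mapBilinear (RingHom.id k) V W V W) ρ.toLinearMap g.toLinearMap := by
  ext h : 1
  rw [AlgHom.toLinearMap_apply, diagRep_eq, cv_apply]
  rfl

lemma RightCovariant.diag {V W : Type u} [AddCommGroup V] [Module k V] [AddCommGroup W] [Module k W]
    {R : Aᵐᵒᵖ →ₐ[k] Module.End k W} {g : H →ₐ[k] Module.End k W} (hg : RightCovariant α R g)
    (ρ : H →ₐ[k] Module.End k V) :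
    RightCovariant α ((Module.End.lTensorAlgHom k W V).comp R) (diagRep ρ g) := by
  intro h b
  let B := TensorProduct.mapBilinear (RingHom.id k) V W V W
  let T : Module.End k W →ₗ[k] Module.End k (V ⊗[k] W) :=
    (Module.End.lTensorAlgHom k W V).toLinearMap
  have h1 : cv (LinearMap.mul k _).flip (cv B ρ.toLinearMap g.toLinearMap)
      (T ∘ₗ R.toLinearMap ∘ₗ opLin ∘ₗ α.on b) = cv B ρ.toLinearMap
        (cv (LinearMap.mul k (Module.End k W)).flip g.toLinearMap (R.toLinearMap ∘ₗ opLin ∘ₗ α.on b)) :=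
    (cv_ext (B' := (LinearMap.mul k (Module.End k (V ⊗[k] W))).flip.compl₂ T)
      (f' := cv B ρ.toLinearMap g.toLinearMap) (g' := R.toLinearMap ∘ₗ opLin ∘ₗ α.on b)
      fun u v => rfl).trans (cv_assoc fun x y z => TensorProduct.ext' fun v w => rfl)
  rw [← AlgHom.toLinearMap_apply, diagRep_toLinearMap]
  refine Eq.trans ?_ (LinearMap.congr_fun h1 h).symm
  refine map_cv (LinearMap.mulRight k (T (R (op b)))) (fun x y => ?_) h
  rw [← hg]
  exact TensorProduct.ext' fun v w => rfl

/-- The structure of an equivariant bimodule in terms of compatible actions on a space. -/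
def equivariantStrOf {V : Type u} [AddCommGroup V] [Module k V] {M : Bimod k A} (e : V ≃ₗ[k] M)
    {L : A →ₐ[k] Module.End k V} {R : Aᵐᵒᵖ →ₐ[k] Module.End k V} {ρ : H →ₐ[k] Module.End k V}
    (hL : ∀ a v, lact M a (e v) = e (L a v)) (hR : ∀ b v, ract M b (e v) = e (R b v))
    (h1 : Covariant α L ρ) (h2 : RightCovariant α R ρ) : EquivariantStr α LinearMap.id M where
  act := (LinearEquiv.conjAlgEquiv k e).toAlgHom.comp ρ
  act_left := covariant_iff.2 fun h a => by
    refine LinearMap.ext fun x => ?_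
    obtain ⟨v, rfl⟩ := e.surjective x
    have e2 : ∀ h y, (LinearEquiv.conjAlgEquiv k e) (ρ h) (e y) = e (ρ h y) := fun h y =>
      congrArg (fun y => e (ρ h y)) (e.symm_apply_apply y)
    refine (congrArg _ (hL a v)).trans ((e2 _ _).trans ?_)
    refine (congrArg e (LinearMap.congr_fun (covariant_iff.1 h1 h a) v)).trans ?_
    refine cv_congr (e.toLinearMap ∘ₗ LinearMap.applyₗ v) (LinearMap.applyₗ (e v)) (fun x y => ?_) h
    exact ((congrArg (lact M _) (e2 y v)).trans (hL _ _)).symm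
  act_right h b := by
    rw [mul'_map_comm_comul]
    refine LinearMap.ext fun x => ?_
    obtain ⟨v, rfl⟩ := e.surjective x
    have e2 : ∀ h y, (LinearEquiv.conjAlgEquiv k e) (ρ h) (e y) = e (ρ h y) := fun h y =>
      congrArg (fun y => e (ρ h y)) (e.symm_apply_apply y)
    refine (congrArg _ (hR _ v)).trans ((e2 _ _).trans ?_)
    refine (congrArg e (LinearMap.congr_fun (h2 h b) v)).trans ?_
    refine cv_congr (e.toLinearMap ∘ₗ LinearMap.applyₗ v) (LinearMap.applyₗ (e v)) (fun x y => ?_) h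
    exact ((congrArg (ract M _) (e2 x v)).trans (hR _ _)).symm

lemma equivariantStrOf_act {V : Type u} [AddCommGroup V] [Module k V] {M : Bimod k A} (e : V ≃ₗ[k] M)
    {L : A →ₐ[k] Module.End k V} {R : Aᵐᵒᵖ →ₐ[k] Module.End k V} {ρ : H →ₐ[k] Module.End k V}
    (hL : ∀ a v, lact M a (e v) = e (L a v)) (hR : ∀ b v, ract M b (e v) = e (R b v))
    (h1 : Covariant α L ρ) (h2 : RightCovariant α R ρ) (h : H) (v : V) :
    (equivariantStrOf e hL hR h1 h2).act h (e v) = e (ρ h v) :=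
  congrArg (fun y => e (ρ h y)) (e.symm_apply_apply v)

/-- The equivariant structure on a stable sub-bimodule, given as an injective morphism. -/
lemma exists_sub_equivariantStr {K M : Bimod k A} (γ : EquivariantStr α LinearMap.id M) (f : K ⟶ M)
    (hf : Function.Injective f.hom) (hs : ∀ h x, ∃ y, γ.act h (f.hom x) = f.hom y) :
    ∃ δ : EquivariantStr α LinearMap.id K, ∀ h x, f.hom (δ.act h x) = γ.act h (f.hom x) := by
  obtain ⟨ρ, hρ⟩ := exists_restrict γ.act (homLin k f) hf hs
  refine ⟨⟨ρ, fun u a => LinearMap.ext fun x => hf ?_, fun u b => LinearMap.ext fun x => hf ?_⟩,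
    fun h x => (hρ h x).symm⟩
  · rw [mul'_map_comul]
    refine (hρ u _).symm.trans ((congrArg (γ.act u) (homLin_lact f a x)).trans ?_)
    refine (γ.act_lact u a (f.hom x)).trans ?_
    exact cv_congr LinearMap.id (homLin k f ∘ₗ LinearMap.applyₗ x) (fun v w =>
      (congrArg (lact _ _) (hρ w x)).trans (homLin_lact f _ _).symm) u
  · rw [mul'_map_comm_comul]
    refine (hρ u _).symm.trans ((congrArg (γ.act u) (homLin_ract f (op b) x)).trans ?_)
    refine (γ.act_ract u b (f.hom x)).trans ?_
    exact cv_congr LinearMap.id (homLin k f ∘ₗ LinearMap.applyₗ x) (fun v w =>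
      (congrArg (ract _ _) (hρ v x)).trans (homLin_ract f _ _).symm) u

section Cover
variable (M : Bimod k A)

/-- Right multiplications on `A ⊗ M ⊗ A`. -/
def coverRight : Aᵐᵒᵖ →ₐ[k] Module.End k (A ⊗[k] (M ⊗[k] A)) :=
  (Module.End.lTensorAlgHom k (M ⊗[k] A) A).comp
    ((Module.End.lTensorAlgHom k A M).comp (Algebra.lsmul k k A))

lemma coverRight_commute (a : A) (b : Aᵐᵒᵖ) :
    Commute (leftRep (M ⊗[k] A) (Algebra.lmul k A) a) (coverRight M b) :=
  TensorProduct.ext' fun _ _ => rfl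

/-- The action of `A^e` on `A ⊗ M ⊗ A`. -/
def coverAct : Env k A →ₐ[k] Module.End k (A ⊗[k] (M ⊗[k] A)) :=
  Algebra.TensorProduct.lift (leftRep (M ⊗[k] A) (Algebra.lmul k A)) (coverRight M)
    (coverRight_commute M)

lemma coverAct_tmul (a b x y : A) (m : M) :
    coverAct M (a ⊗ₜ op b) (x ⊗ₜ (m ⊗ₜ y)) = (a * x) ⊗ₜ (m ⊗ₜ (y * b)) := by
  rw [coverAct, Algebra.TensorProduct.lift_tmul]
  rfl

/-- The free bimodule `A ⊗ M ⊗ A`. -/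
def cover : Bimod k A := mkMod (A ⊗[k] (M ⊗[k] A)) (coverAct M)

/-- Elements of `A ⊗ M ⊗ A`. -/
def toCover : A ⊗[k] (M ⊗[k] A) ≃ₗ[k] cover M :=
  linOfMod (cover M) (toMod (coverAct M)) fun c v => by
    rw [algebraMap_smul]; exact (algebraMap_smul_toMod (coverAct M) c v).symm

lemma smul_toCover (s : Env k A) (v : A ⊗[k] (M ⊗[k] A)) :
    s • toCover M v = toCover M (coverAct M s v) := rfl

instance : Projective (cover M) := by
  let e : (A ⊗[k] Aᵐᵒᵖ) ⊗[k] M ≃ₗ[k] A ⊗[k] (M ⊗[k] A) :=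
    (TensorProduct.assoc k A Aᵐᵒᵖ M).trans (TensorProduct.congr (LinearEquiv.refl k A)
      ((TensorProduct.comm k Aᵐᵒᵖ M).trans
        (TensorProduct.congr (LinearEquiv.refl k M) (opLinearEquiv k (M := A)).symm)))
  have he : ∀ s t : Env k A, ∀ m : M, e ((s * t) ⊗ₜ m) = coverAct M s (e (t ⊗ₜ m)) := by
    intro s t m
    induction s using TensorProduct.induction_on with
    | zero => simp
    | add x y hx hy => rw [add_mul, TensorProduct.add_tmul, map_add, map_add, hx, hy]; rfl
    | tmul a b =>
      induction t using TensorProduct.induction_on with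
      | zero => simp
      | add x y hx hy =>
        rw [mul_add, TensorProduct.add_tmul, TensorProduct.add_tmul, map_add, map_add, map_add,
          hx, hy]
      | tmul x y =>
        rw [Algebra.TensorProduct.tmul_mul_tmul]
        exact (coverAct_tmul M a b.unop x y.unop m).symm
  let e' : Env k A ⊗[k] M ≃ₗ[Env k A] cover M :=
    { e.toAddEquiv.trans (toCover M).toAddEquiv with
      map_smul' := fun s v => by
        refine congrArg (toCover M) ?_
        change e (s • v) = coverAct M s (e v)
        induction v using TensorProduct.induction_on with
        | zero => simp
        | add x y hx hy => rw [smul_add, map_add, map_add, map_add, hx, hy]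
        | tmul t m => exact he s t m }
  have : Module.Projective (Env k A) (cover M) := Module.Projective.of_equiv e'
  exact (IsProjective.iff_projective (cover M)).1 this

/-- `a ⊗ m ⊗ b ↦ a m b`. -/
def coverLin : A ⊗[k] (M ⊗[k] A) →ₗ[k] M :=
  TensorProduct.lift (LinearMap.lcomp k M
    (TensorProduct.lift ((ract M).toLinearMap ∘ₗ opLin).flip) ∘ₗ (lact M).toLinearMap)

lemma coverLin_tmul (a b : A) (m : M) :
    coverLin M (a ⊗ₜ (m ⊗ₜ b)) = lact M a (ract M (op b) m) := rfl

lemma coverLin_act (s : Env k A) (v : A ⊗[k] (M ⊗[k] A)) :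
    coverLin M (coverAct M s v) = s • coverLin M v := by
  induction s using TensorProduct.induction_on with
  | zero =>
    rw [map_zero, LinearMap.zero_apply, map_zero]
    exact (zero_smul (Env k A) (A := M) _).symm
  | add x y hx hy => rw [map_add, LinearMap.add_apply, map_add, hx, hy, add_smul]
  | tmul a b =>
    induction v using TensorProduct.induction_on with
    | zero => simp
    | add x y hx hy => rw [map_add, map_add, map_add, hx, hy, smul_add]
    | tmul x w =>
      induction w using TensorProduct.induction_on with
      | zero => simp
      | add w w' hw hw' => rw [TensorProduct.tmul_add, map_add, map_add, map_add, hw, hw', smul_add]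
      | tmul m y =>
        refine (congrArg (coverLin M) (coverAct_tmul M a b.unop x y m)).trans ?_
        rw [coverLin_tmul, coverLin_tmul, tmul_smul_eq, op_mul, map_mul, map_mul]
        exact congrArg (lact M a) (LinearMap.congr_fun (lact_ract_commute M x b).eq _)

/-- The covering `A ⊗ M ⊗ A → M`. -/
def coverMap : cover M ⟶ M :=
  mkHom ((coverLin M).toAddMonoidHom.comp (toCover M).symm.toLinearMap.toAddMonoidHom) fun s x => by
    obtain ⟨v, rfl⟩ := (toCover M).surjective x
    rw [smul_toCover]
    change coverLin M ((toCover M).symm _) = s • coverLin M ((toCover M).symm _)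
    rw [LinearEquiv.symm_apply_apply, LinearEquiv.symm_apply_apply, coverLin_act]

lemma coverMap_toCover (v : A ⊗[k] (M ⊗[k] A)) :
    (coverMap M).hom (toCover M v) = coverLin M v := rfl

lemma coverMap_surjective : Function.Surjective (coverMap M).hom := fun m =>
  ⟨toCover M (1 ⊗ₜ (m ⊗ₜ 1)), by
    rw [coverMap_toCover, coverLin_tmul, op_one, map_one, map_one]; rfl⟩

variable {M}

variable (α) in
lemma rightCovariant_self : RightCovariant α (Algebra.lsmul k k A) α.act := fun h b => by
  refine LinearMap.ext fun x => (α.act_mul h x b).trans ?_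
  rw [cv_apply, ← (ℛ k h).eq]
  simp only [map_sum, TensorProduct.map_tmul, LinearMap.mul'_apply, LinearMap.sum_apply]
  rfl

lemma rightCovariant_cover (γ : EquivariantStr α LinearMap.id M) :
    RightCovariant α (coverRight M) (diagRep α.act (diagRep γ.act α.act)) :=
  ((rightCovariant_self α).diag γ.act).diag α.act

/-- The diagonal structure on `A ⊗ M ⊗ A`. -/
def coverStr (γ : EquivariantStr α LinearMap.id M) : EquivariantStr α LinearMap.id (cover M) :=
  equivariantStrOf (toCover M) (L := leftRep (M ⊗[k] A) (Algebra.lmul k A)) (R := coverRight M)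
    (ρ := diagRep α.act (diagRep γ.act α.act))
    (fun a v => by
      rw [lact_apply, smul_toCover, coverAct, Algebra.TensorProduct.lift_tmul, map_one, mul_one])
    (fun b v => by
      rw [ract_apply, smul_toCover, coverAct, Algebra.TensorProduct.lift_tmul, map_one, one_mul])
    (covariant_diag α (covariant_self α) _) (rightCovariant_cover γ)

lemma coverMap_act (γ : EquivariantStr α LinearMap.id M) (h : H) (x : cover M) :
    (coverMap M).hom ((coverStr γ).act h x) = γ.act h ((coverMap M).hom x) := by
  obtain ⟨v, rfl⟩ := (toCover M).surjective x
  rw [coverStr, equivariantStrOf_act, coverMap_toCover, coverMap_toCover]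
  refine LinearMap.congr_fun (f := coverLin M ∘ₗ diagRep α.act (diagRep γ.act α.act) h)
    (g := γ.act h ∘ₗ coverLin M) (TensorProduct.ext_threefold' fun a m b => ?_) v
  let T1 : M ⊗[k] A →ₗ[k] M := TensorProduct.lift ((ract M).toLinearMap ∘ₗ opLin).flip
  have h1 (y : H) : T1 (diagRep γ.act α.act y (m ⊗ₜ b)) = γ.act y (ract M (op b) m) := by
    rw [γ.act_ract, ← AlgHom.toLinearMap_apply, diagRep_toLinearMap]
    exact map_cv (T1 ∘ₗ LinearMap.applyₗ (m ⊗ₜ[k] b)) (fun x y => rfl) y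
  let T2 : Module.End k (A ⊗[k] (M ⊗[k] A)) →ₗ[k] M :=
    { toFun := fun f => coverLin M (f (a ⊗ₜ (m ⊗ₜ b)))
      map_add' := fun f g => map_add (coverLin M) _ _
      map_smul' := fun c f => map_smul (coverLin M) _ _ }
  refine Eq.trans ?_ (γ.act_lact h a (ract M (op b) m)).symm
  refine (congrArg (fun f : Module.End k _ => coverLin M (f (a ⊗ₜ (m ⊗ₜ b))))
    (LinearMap.congr_fun (diagRep_toLinearMap α.act (diagRep γ.act α.act)) h)).trans ?_
  refine (congrArg T2 (cv_apply _ _ _ h)).trans (Eq.trans ?_ (cv_apply _ _ _ h).symm)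
  rw [map_sum]
  exact Finset.sum_congr rfl fun i _ => congrArg (lact M _) (h1 _)

end Cover

variable (α) in
/-- Equivariant bimodules. -/
structure EquivariantBimod where
  M : Bimod k A
  str : EquivariantStr α LinearMap.id M

namespace EquivariantBimod

/-- The kernel of the covering `A ⊗ M ⊗ A → M`. -/
def kernel (M : EquivariantBimod α) : Bimod k A :=
  ModuleCat.of (Env k A) (LinearMap.ker (coverMap M.M).hom)

/-- The inclusion of the kernel of the covering. -/
def kernelι (M : EquivariantBimod α) : M.kernel ⟶ cover M.M :=
  mkHom (M := M.kernel) (LinearMap.ker (coverMap M.M).hom).subtype.toAddMonoidHom fun _ _ => rfl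

lemma exists_kernelStr (M : EquivariantBimod α) : ∃ δ : EquivariantStr α LinearMap.id M.kernel,
    ∀ h x, M.kernelι.hom (δ.act h x) = (coverStr M.str).act h (M.kernelι.hom x) :=
  exists_sub_equivariantStr (coverStr M.str) M.kernelι Subtype.val_injective fun h x =>
    ⟨⟨(coverStr M.str).act h (M.kernelι.hom x), by
      have hx : (coverMap M.M).hom (M.kernelι.hom x) = 0 := x.2
      refine (coverMap_act M.str h _).trans ?_
      rw [hx, map_zero]⟩, rfl⟩

/-- The syzygy of an equivariant bimodule. -/
def next (M : EquivariantBimod α) : EquivariantBimod α := ⟨M.kernel, M.exists_kernelStr.choose⟩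

variable (α) in
/-- The iterated syzygies of `A`. -/
def syzygy : ℕ → EquivariantBimod α
  | 0 => ⟨selfBimod k A, selfStr α⟩
  | n + 1 => (syzygy n).next

variable (α) in
/-- The short exact sequences of syzygies of `A`. -/
def syzygySequence : SyzygySequence (fun n => (syzygy α n).M) (fun n => cover (syzygy α n).M) where
  ι n := (syzygy α n).kernelι
  p n := coverMap (syzygy α n).M
  w n := by
    ext x
    exact x.2
  shortExact n := LinearMap.shortExact_shortComplexKer (coverMap_surjective _)
  proj n := inferInstance

end EquivariantBimod

open EquivariantBimod in
variable (α) in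
/-- Equivariant resolutions of `A` exist. -/
theorem exists_equivariantResolution : Nonempty (EquivariantResolution α) := by
  let s := syzygySequence α
  have hd (i : ℕ) (h : H) (x : cover (syzygy α (i + 1)).M) :
      (s.complex.d (i + 1) i).hom ((coverStr (syzygy α (i + 1)).str).act h x) =
        (coverStr (syzygy α i).str).act h ((s.complex.d (i + 1) i).hom x) := by
    rw [s.complex_d]
    refine (congrArg (syzygy α i).kernelι.hom (coverMap_act (syzygy α (i + 1)).str h x)).trans ?_
    exact (syzygy α i).exists_kernelStr.choose_spec h _
  refine ⟨⟨s.resolution, fun i => coverStr (syzygy α i).str, fun i j h x => ?_, fun h x => ?_⟩⟩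
  · by_cases hij : i = j + 1
    · subst hij
      exact hd j h x
    · have h0 : s.complex.d i j = 0 := s.complex.shape i j fun h => hij h.symm
      have h1 (y : cover (syzygy α i).M) : (s.complex.d i j).hom y = (0 : cover (syzygy α j).M) :=
        ConcreteCategory.congr_hom h0 y
      refine (h1 _).trans (Eq.trans ?_ (congrArg ((coverStr (syzygy α j).str).act h) (h1 x)).symm)
      exact (map_zero ((coverStr (syzygy α j).str).act h)).symm
  · have h1 (y : cover (selfBimod k A)) : (s.resolution.π.f 0 ≫ (HomologicalComplex.singleObjXSelf
        (ComplexShape.down ℕ) 0 (syzygy α 0).M).hom).hom y = (coverMap (selfBimod k A)).hom y :=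
      ConcreteCategory.congr_hom s.resolution_aug y
    refine (congrArg (ofSelf k A) (h1 _)).trans (Eq.trans ?_
      (congrArg (fun y => α.act h (ofSelf k A y)) (h1 x)).symm)
    exact congrArg (ofSelf k A) (coverMap_act (selfStr α) h x)

end EquivariantCovers
end SmashDuality

/-! ### The products `Ext_H(k, H) ⊗ Ext_{A^e}(A, A^e) → Ext_{Λ^e}(Λ, Λ^e)` -/

namespace SmashDuality
section Products
open Abelian MulOpposite HopfAlgebra
variable {k H : Type u} [Field k] [Ring H] [HopfAlgebra k H]

namespace SmashPair
variable {A : Type u} [Ring A] [Algebra k A]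
  {α : HopfAction k H A} {Λ : Type u} [Ring Λ] [Algebra k Λ] (P : SmashPair α Λ)
  (hS : Function.Bijective (HopfAlgebra.antipode k (A := H))) {p q n : ℕ} (h : p + q = n)

lemma map_F_rMul (c : k) (x : P.F.obj (regular H)) :
    (P.F.map (rMul (algebraMap k H c))).hom x = algebraMap k (Env k Λ) c • x := by
  obtain ⟨x, rfl⟩ := (P.toF (regular H)).surjective x
  rw [toF_algebraMap_smul]
  induction x using TensorProduct.induction_on with
  | zero => rw [smul_zero, map_zero, map_zero]
  | add x y hx hy => rw [map_add, map_add, hx, hy, smul_add, map_add]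
  | tmul x y =>
    rw [map_toF, ← TensorProduct.tmul_smul]
    refine congrArg (fun z : regular H => P.toF (regular H) (x ⊗ₜ z)) ?_
    exact (Algebra.commutes c (show H from y)).symm

/-- The isomorphism `Ext^n(F(k), Λ^e) ≃ Ext^n(Λ, Λ^e)`. -/
def trivialExt (n : ℕ) : XB (P.F.obj (trivialModule k H)) n ≅ ExtBimod k Λ n :=
  XB.mapIso P.trivialIso n

/-- The product `Ext^p_H(k, H) × Ext^q(F(H), Λ^e) → Ext^{p+q}(Λ, Λ^e)`. -/
def prod : RX (trivialModule k H) p →ₗ[k] P.W q →ₗ[k] ExtBimod k Λ n :=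
  (cupLin P.map_F_rMul h).compr₂ (homLin k (P.trivialExt n).hom)

lemma prod_lact (e : RX (trivialModule k H) p) (l : Λ) (w : P.W q) :
    P.prod h e (lact _ l w) = lact _ l (P.prod h e w) := by
  refine Eq.trans (congrArg (homLin k (P.trivialExt n).hom) ?_)
    (homLin_lact (P.trivialExt n).hom l (cup P.F h e w))
  exact cup_smul_right h e _ w

lemma prod_ract (e : RX (trivialModule k H) p) (l : Λᵐᵒᵖ) (w : P.W q) :
    P.prod h e (ract _ l w) = ract _ l (P.prod h e w) := by
  refine Eq.trans (congrArg (homLin k (P.trivialExt n).hom) ?_)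
    (homLin_ract (P.trivialExt n).hom l (cup P.F h e w))
  exact cup_smul_right h e _ w

lemma prod_op_smul (e : RX (trivialModule k H) p) (r : H) (w : P.W q) :
    P.prod h (op r • e) w = P.prod h e (P.τ q r w) :=
  congrArg (homLin k (P.trivialExt n).hom) (cup_op_smul h r e w)

/-- `e ⊗ x ⊗ l ↦ e Φ(x) j(l)`. -/
def prodMap : RX (trivialModule k H) p ⊗[k] (ExtBimod k A q ⊗[k] H) →ₗ[k] ExtBimod k Λ n :=
  TensorProduct.lift ((P.prod h).compl₂ (P.rExt (P.Φ hS q)))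

lemma prodMap_tmul (e : RX (trivialModule k H) p) (m : ExtBimod k A q ⊗[k] H) :
    P.prodMap hS h (e ⊗ₜ m) = P.prod h e (P.rExt (P.Φ hS q) m) := rfl

lemma prodMap_eq : ⇑(P.prodMap hS h) = ⇑(P.trivialExt n).hom.hom ∘
    ⇑(cupTensor P.map_F_rMul h (P.rExt (P.Φ hS q)) (M := trivialModule k H)) := by
  have : P.prodMap hS h = homLin k (P.trivialExt n).hom ∘ₗ
      cupTensor P.map_F_rMul h (P.rExt (P.Φ hS q)) (M := trivialModule k H) :=
    TensorProduct.ext' fun e m => rfl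
  rw [this]
  rfl

lemma trivialExt_bijective (n : ℕ) : Function.Bijective (P.trivialExt n).hom.hom :=
  (P.trivialExt n).toLinearEquiv.bijective

variable (hA : ThickClosure (ModuleCat.of (Env k A) (Env k A)) (selfBimod k A))
  (hH : ThickClosure (ModuleCat.of H H) (trivialModule k H))
  (hR : Nonempty (EquivariantResolution α))
include hS hA P

lemma actMap_τ_bijective (hR : Nonempty (EquivariantResolution α)) (q : ℕ) : Function.Bijective
    (actMap (P.τ q).toLinearMap (P.rExt (P.Φ hS q))) := by
  obtain ⟨β, -, hβ⟩ := P.exists_equivariantStr hS hA hR q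
  exact P.actMap_tau_bijective hS (hl := P.τ_lact q) (hr := P.τ_ract q) β.act (P.Φ hS q) hβ
    (P.actMap_lj_bijective hS hA q)

lemma subsingleton_W (q : ℕ) (hq : Subsingleton (ExtBimod k A q)) : Subsingleton (P.W q) :=
  (P.actMap_lj_bijective hS hA q).2.subsingleton

include hH hR

lemma prodMap_injective : Function.Injective (P.prodMap hS h) := by
  rw [prodMap_eq]
  refine (P.trivialExt_bijective n).1.comp ?_
  exact (cupTensor_graded P.map_F_rMul (fun q => P.rExt (P.Φ hS q))
    (fun q => actMap (P.τ q).toLinearMap (P.rExt (P.Φ hS q))) (fun q r v => rfl)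
    (P.actMap_τ_bijective hS hA hR) hH).1 h

lemma exists_nontrivial (hn : Nontrivial (ExtBimod k Λ n)) : ∃ p q, p + q = n ∧
    Nontrivial (RX (trivialModule k H) p) ∧ Nontrivial (ExtBimod k A q) := by
  have : Nontrivial (XB (P.F.obj (trivialModule k H)) n) :=
    (P.trivialExt_bijective n).2.nontrivial
  obtain ⟨p, q, h, h1, h2⟩ := (cupTensor_graded P.map_F_rMul (fun q => P.rExt (P.Φ hS q))
    (fun q => actMap (P.τ q).toLinearMap (P.rExt (P.Φ hS q))) (fun q r v => rfl)
    (P.actMap_τ_bijective hS hA hR) hH).2 n this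
  refine ⟨p, q, h, h1, ?_⟩
  by_contra hn
  rw [not_nontrivial_iff_subsingleton] at hn
  have h0 (x : ExtBimod k A q ⊗[k] H) : x = 0 := by
    induction x using TensorProduct.induction_on with
    | zero => rfl
    | add x y hx hy => rw [hx, hy, add_zero]
    | tmul x y => rw [Subsingleton.elim x 0, TensorProduct.zero_tmul]
  exact not_subsingleton (ExtBimod k A q ⊗[k] H) ⟨fun x y => (h0 x).trans (h0 y).symm⟩

lemma prodMap_bijective (hd : ∀ m, m ≠ q → Subsingleton (ExtBimod k A m)) :
    Function.Bijective (P.prodMap hS h) := by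
  rw [prodMap_eq]
  refine (P.trivialExt_bijective n).comp ?_
  exact cupTensor_bijective P.map_F_rMul h (P.rExt (P.Φ hS q))
    (actMap (P.τ q).toLinearMap (P.rExt (P.Φ hS q))) (fun r v => rfl)
    (P.actMap_τ_bijective hS hA hR q) (fun m hm => P.subsingleton_W hS hA m (hd m hm)) hH

end SmashPair
end Products
end SmashDuality

/-! ### The trivial module of a homologically smooth Hopf algebra is perfect -/

namespace SmashDuality
section Coinvariants
open MulOpposite

/-- A linear map which commutes with the left and right multiplications, as a morphism of
bimodules. -/
def bimodHom {k B : Type u} [Field k] [Ring B] [Algebra k B] {M N : Bimod k B} (f : M →ₗ[k] N)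
    (hl : ∀ b x, f (lact M b x) = lact N b (f x))
    (hr : ∀ b x, f (ract M (op b) x) = ract N (op b) (f x)) : M ⟶ N :=
  mkHom f.toAddMonoidHom fun z x => by
    change f (z • x) = z • f x
    induction z using TensorProduct.induction_on with
    | zero => rw [zero_smul (Env k B) x, zero_smul (Env k B) (f x), map_zero]
    | add z w hz hw => rw [add_smul, add_smul, map_add, hz, hw]
    | tmul a b => rw [tmul_smul_eq, tmul_smul_eq, hl, ← op_unop b, hr]

variable {k H : Type u} [Field k] [Ring H] [HopfAlgebra k H]

/-- The right multiplication `M ⊗ H → M`. -/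
def rightAct (M : Bimod k H) : M ⊗[k] H →ₗ[k] M :=
  TensorProduct.lift ((ract M).toLinearMap ∘ₗ opLin).flip

lemma rightAct_tmul (M : Bimod k H) (m : M) (h : H) : rightAct M (m ⊗ₜ h) = ract M (op h) m := rfl

/-- The map `m ⊗ h ↦ m h - ε(h) m`. -/
def augMap (M : Bimod k H) : M ⊗[k] H →ₗ[k] M :=
  rightAct M - (TensorProduct.rid k M).toLinearMap ∘ₗ LinearMap.lTensor M counit

lemma augMap_tmul (M : Bimod k H) (m : M) (h : H) :
    augMap M (m ⊗ₜ h) = ract M (op h) m - counit (R := k) h • m := by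
  simp [augMap, rightAct_tmul]

lemma augMap_map {M N : Bimod k H} (f : M →ₗ[k] N)
    (hf : ∀ b x, f (ract M (op b) x) = ract N (op b) (f x)) (t : M ⊗[k] H) :
    f (augMap M t) = augMap N (LinearMap.rTensor H f t) := by
  refine LinearMap.congr_fun (f := f ∘ₗ augMap M) (g := augMap N ∘ₗ LinearMap.rTensor H f)
    (TensorProduct.ext' fun m h => ?_) t
  simp [augMap_tmul, hf]

/-- The `k`-module `M ⊗_H k`. -/
abbrev Coinv (M : Bimod k H) : Type u := M ⧸ LinearMap.range (augMap M)

/-- The map on coinvariants induced by a map which is linear for the right multiplications. -/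
def Coinv.map {M N : Bimod k H} (f : M →ₗ[k] N)
    (hf : ∀ b x, f (ract M (op b) x) = ract N (op b) (f x)) : Coinv M →ₗ[k] Coinv N :=
  Submodule.mapQ _ _ f (by
    rintro _ ⟨t, rfl⟩
    exact ⟨_, (augMap_map f hf t).symm⟩)

lemma Coinv.map_mk {M N : Bimod k H} (f : M →ₗ[k] N)
    (hf : ∀ b x, f (ract M (op b) x) = ract N (op b) (f x)) (m : M) :
    Coinv.map f hf (Submodule.Quotient.mk m) = Submodule.Quotient.mk (f m) := rfl

/-- The left multiplications on `M ⊗_H k`. -/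
def coinvAct (M : Bimod k H) : H →ₐ[k] Module.End k (Coinv M) :=
  AlgHom.ofLinearMap
    { toFun := fun a => Coinv.map (lact M a) fun b x => lact_ract M a (op b) x
      map_add' := fun a b => LinearMap.ext fun x => by
        obtain ⟨x, rfl⟩ := Submodule.Quotient.mk_surjective _ x
        simp only [Coinv.map_mk, LinearMap.add_apply, map_add, Submodule.Quotient.mk_add]
      map_smul' := fun c a => LinearMap.ext fun x => by
        obtain ⟨x, rfl⟩ := Submodule.Quotient.mk_surjective _ x
        simp only [Coinv.map_mk, LinearMap.smul_apply, map_smul, Submodule.Quotient.mk_smul,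
          RingHom.id_apply] }
    (LinearMap.ext fun x => by
      obtain ⟨x, rfl⟩ := Submodule.Quotient.mk_surjective _ x
      simp [Coinv.map_mk])
    (fun a b => LinearMap.ext fun x => by
      obtain ⟨x, rfl⟩ := Submodule.Quotient.mk_surjective _ x
      simp [Coinv.map_mk])

/-- The left `H`-module `M ⊗_H k`. -/
def coinv (M : Bimod k H) : ModuleCat.{u} H := mkMod (Coinv M) (coinvAct M)

/-- The quotient map `M → M ⊗_H k`. -/
def toCoinv (M : Bimod k H) : M →+ coinv M :=
  (toMod (coinvAct M)).toAddMonoidHom.comp (Submodule.mkQ (LinearMap.range (augMap M))).toAddMonoidHom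

lemma toCoinv_surjective (M : Bimod k H) : Function.Surjective (toCoinv M) :=
  (toMod (coinvAct M)).surjective.comp (Submodule.mkQ_surjective _)

lemma toCoinv_eq_zero {M : Bimod k H} {m : M} :
    toCoinv M m = 0 ↔ ∃ t, augMap M t = m :=
  (Submodule.Quotient.mk_eq_zero (LinearMap.range (augMap M)) (x := m))

lemma smul_toCoinv (M : Bimod k H) (a : H) (m : M) : a • toCoinv M m = toCoinv M (lact M a m) := rfl

lemma toCoinv_ract (M : Bimod k H) (b : H) (m : M) :
    toCoinv M (ract M (op b) m) = algebraMap k H (counit b) • toCoinv M m := by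
  rw [smul_toCoinv, ← sub_eq_zero, ← map_sub, toCoinv_eq_zero]
  refine ⟨m ⊗ₜ b, ?_⟩
  rw [augMap_tmul, AlgHom.commutes]
  rfl

/-- The homomorphism `a ⊗ b ↦ a ε(b)`. -/
def envAug : Env k H →ₐ[k] H :=
  Algebra.TensorProduct.lift (AlgHom.id k H)
    ((Algebra.ofId k H).comp ((AlgHom.fromOpposite (Bialgebra.counitAlgHom k H) fun _ _ =>
      Commute.all _ _)))
    (fun a b => (Algebra.commutes _ a).symm)

lemma envAug_tmul (a b : H) :
    envAug (a ⊗ₜ op b : Env k H) = a * algebraMap k H (counit (R := k) b) :=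
  Algebra.TensorProduct.lift_tmul _ _ _ _ _

lemma toCoinv_smul (M : Bimod k H) (z : Env k H) (m : M) :
    toCoinv M (z • m) = envAug z • toCoinv M m := by
  induction z using TensorProduct.induction_on with
  | zero => rw [zero_smul (Env k H) m, map_zero, map_zero, zero_smul H]
  | add z w hz hw => rw [add_smul, map_add, hz, hw, map_add, add_smul]
  | tmul a b => rw [← op_unop b, tmul_smul_eq, ← smul_toCoinv, toCoinv_ract, envAug_tmul, mul_smul]

/-- Maps out of `M ⊗_H k`. -/
def coinvLift {M : Bimod k H} {N : ModuleCat.{u} H} (f : M →+ N)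
    (hf : ∀ (z : Env k H) m, f (z • m) = envAug z • f m) : coinv M ⟶ N :=
  mkHom ((QuotientAddGroup.lift (LinearMap.range (augMap M)).toAddSubgroup f (by
    rintro _ ⟨t, rfl⟩
    induction t using TensorProduct.induction_on with
    | zero => rw [map_zero]; exact map_zero f
    | add x y hx hy => rw [map_add]; exact (map_add f _ _).trans (by rw [hx, hy, add_zero])
    | tmul m h =>
      change f (augMap M (m ⊗ₜ h)) = 0
      rw [augMap_tmul, ract_apply, ← algebraMap_smul (Env k H), map_sub, hf, hf, envAug_tmul,
        AlgHom.commutes, one_mul, sub_self])).comp (toMod (coinvAct M)).symm.toAddMonoidHom) fun a x => by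
    obtain ⟨x, rfl⟩ := toCoinv_surjective M x
    refine (hf (a ⊗ₜ op 1) x).trans ?_
    rw [envAug_tmul, Bialgebra.counit_one, map_one, mul_one]
    rfl

lemma coinv_finite (M : Bimod k H) [hM : Module.Finite (Env k H) M] : Module.Finite H (coinv M) := by
  obtain ⟨s, hs⟩ := hM.fg_top
  classical
  refine ⟨⟨s.image (toCoinv M), eq_top_iff.2 fun x _ => ?_⟩⟩
  obtain ⟨x, rfl⟩ := toCoinv_surjective M x
  have hx : x ∈ Submodule.span (Env k H) (s : Set M) := hs ▸ trivial
  induction hx using Submodule.span_induction with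
  | mem x hx => exact Submodule.subset_span (by simpa using ⟨x, hx, rfl⟩)
  | zero => rw [map_zero]; exact zero_mem _
  | add x y _ _ hx hy => rw [map_add]; exact add_mem (hx trivial) (hy trivial)
  | smul z x _ hx => rw [toCoinv_smul]; exact Submodule.smul_mem _ _ (hx trivial)

lemma coinv_projective (M : Bimod k H) [Projective M] : Projective (coinv M) := by
  refine ⟨fun {N N'} f e he => ?_⟩
  let ρ : Env k H →+* H := (envAug (k := k) (H := H)).toRingHom
  let g : M ⟶ (ModuleCat.restrictScalars ρ).obj N' :=
    mkHom (N := (ModuleCat.restrictScalars ρ).obj N') (f.hom.toAddMonoidHom.comp (toCoinv M))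
      fun z m => by
        change f.hom (toCoinv M (z • m)) = _
        rw [toCoinv_smul, map_smul]
        rfl
  have : Epi ((ModuleCat.restrictScalars ρ).map e) :=
    (ModuleCat.epi_iff_surjective _).2 ((ModuleCat.epi_iff_surjective e).1 he)
  refine ⟨coinvLift (Projective.factorThru g ((ModuleCat.restrictScalars ρ).map e)).hom.toAddMonoidHom
    (fun z m => map_smul (Projective.factorThru g ((ModuleCat.restrictScalars ρ).map e)).hom z m), ?_⟩
  refine ModuleCat.hom_ext (LinearMap.ext fun x => ?_)
  obtain ⟨x, rfl⟩ := toCoinv_surjective M x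
  exact ConcreteCategory.congr_hom (Projective.factorThru_comp g
    ((ModuleCat.restrictScalars ρ).map e)) x

/-- The bimodule `M` is projective as a right module, in the form of a splitting of the right
multiplication `M ⊗ H → M`. -/
def RightProjective (M : Bimod k H) : Prop :=
  ∃ s : M →ₗ[k] M ⊗[k] H, (∀ b m, s (ract M (op b) m) =
    LinearMap.lTensor M (LinearMap.mulRight k b) (s m)) ∧ ∀ m, rightAct M (s m) = m

lemma rightAct_map {M N : Bimod k H} (f : M →ₗ[k] N)
    (hf : ∀ b x, f (ract M (op b) x) = ract N (op b) (f x)) (t : M ⊗[k] H) :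
    rightAct N (LinearMap.rTensor H f t) = f (rightAct M t) :=
  LinearMap.congr_fun (f := rightAct N ∘ₗ LinearMap.rTensor H f) (g := f ∘ₗ rightAct M)
    (TensorProduct.ext' fun m h => (hf h m).symm) t

lemma rightAct_lTensor {M : Bimod k H} (b : H) (t : M ⊗[k] H) :
    rightAct M (LinearMap.lTensor M (LinearMap.mulRight k b) t) = ract M (op b) (rightAct M t) :=
  LinearMap.congr_fun (f := rightAct M ∘ₗ LinearMap.lTensor M (LinearMap.mulRight k b))
    (g := ract M (op b) ∘ₗ rightAct M) (TensorProduct.ext' fun m h => by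
      change ract M (op (h * b)) m = ract M (op b) (ract M (op h) m)
      rw [op_mul, map_mul, Module.End.mul_apply]) t

lemma rTensor_lTensor_mulRight {M N : Bimod k H} (f : M →ₗ[k] N) (b : H) (t : M ⊗[k] H) :
    LinearMap.rTensor H f (LinearMap.lTensor M (LinearMap.mulRight k b) t) =
      LinearMap.lTensor N (LinearMap.mulRight k b) (LinearMap.rTensor H f t) :=
  LinearMap.congr_fun (f := LinearMap.rTensor H f ∘ₗ LinearMap.lTensor M (LinearMap.mulRight k b))
    (g := LinearMap.lTensor N (LinearMap.mulRight k b) ∘ₗ LinearMap.rTensor H f)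
    (TensorProduct.ext' fun m h => rfl) t

lemma rightProjective_self : RightProjective (selfBimod k H) := by
  refine ⟨TensorProduct.mk k (selfBimod k H) H (toSelfLin k H 1) ∘ₗ (toSelfLin k H).symm.toLinearMap,
    fun b m => ?_, fun m => ?_⟩
  · obtain ⟨m, rfl⟩ := (toSelfLin k H).surjective m
    have : ract (selfBimod k H) (op b) (toSelfLin k H m) = toSelfLin k H (m * b) := by
      refine (smul_toSelf 1 b m).trans ?_
      rw [one_mul]
      rfl
    rw [this]
    rfl
  · obtain ⟨m, rfl⟩ := (toSelfLin k H).surjective m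
    refine (smul_toSelf 1 m 1).trans ?_
    rw [one_mul, one_mul]
    rfl

lemma rightProjective_of_projective (M : Bimod k H) [Projective M] : RightProjective M := by
  let L : H →ₐ[k] Module.End k (M ⊗[k] H) := leftRep H (lact M)
  let R : Hᵐᵒᵖ →ₐ[k] Module.End k (M ⊗[k] H) :=
    (Module.End.lTensorAlgHom k H M).comp (Algebra.lsmul k k H)
  have hc (a : H) (b : Hᵐᵒᵖ) : Commute (L a) (R b) := TensorProduct.ext' fun x y => rfl
  let N : Bimod k H := mkMod (M ⊗[k] H) (Algebra.TensorProduct.lift L R hc)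
  let e : M ⊗[k] H ≃+ N := toMod _
  have hl (a : H) (t : M ⊗[k] H) : lact N a (e t) = e (L a t) := by
    rw [lact_apply, smul_toMod, Algebra.TensorProduct.lift_tmul, map_one, mul_one]
  have hr (b : H) (t : M ⊗[k] H) : ract N (op b) (e t) = e (R (op b) t) := by
    rw [ract_apply, smul_toMod, Algebra.TensorProduct.lift_tmul, map_one, one_mul]
  let e' : M ⊗[k] H ≃ₗ[k] N := linOfMod N e fun c x => (algebraMap_smul_toMod _ c x).symm.trans
    (algebraMap_smul (Env k H) c (e x)).symm
  let f : N ⟶ M := bimodHom (rightAct M ∘ₗ e'.symm.toLinearMap)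
    (fun a x => by
      obtain ⟨t, rfl⟩ := e.surjective x
      rw [hl]
      exact LinearMap.congr_fun (f := rightAct M ∘ₗ L a) (g := lact M a ∘ₗ rightAct M)
        (TensorProduct.ext' fun m h => (lact_ract M a (op h) m).symm) t)
    (fun b x => by
      obtain ⟨t, rfl⟩ := e.surjective x
      rw [hr]
      exact rightAct_lTensor b t)
  have : Epi f := (ModuleCat.epi_iff_surjective f).2 fun m =>
    ⟨e (m ⊗ₜ 1), (LinearMap.congr_fun (map_one (ract M)) m :)⟩
  let s : M ⟶ N := Projective.factorThru (𝟙 M) f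
  refine ⟨e'.symm.toLinearMap ∘ₗ homLin k s, fun b m => ?_, fun m => ?_⟩
  · rw [LinearMap.comp_apply, homLin_ract]
    obtain ⟨t, ht⟩ := e.surjective (homLin k s m)
    rw [LinearMap.comp_apply, ← ht, hr]
    rfl
  · exact ConcreteCategory.congr_hom (Projective.factorThru_comp (𝟙 M) f) m

section Exact
variable {K P M : Bimod k H} {i : K ⟶ P} {p : P ⟶ M} {w : i ≫ p = 0}

lemma exists_retraction (hS : (ShortComplex.mk i p w).ShortExact) (hM : RightProjective M) :
    ∃ r : P →ₗ[k] K, (∀ b x, r (ract P (op b) x) = ract K (op b) (r x)) ∧ ∀ x, r (i.hom x) = x := by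
  obtain ⟨s, hs, hs'⟩ := hM
  have hi : Function.Injective i.hom := hS.moduleCat_injective_f
  have hp : Function.Surjective (homLin k p) := hS.moduleCat_surjective_g
  obtain ⟨σ, hσ⟩ := (homLin k p).exists_rightInverse_of_surjective (LinearMap.range_eq_top.2 hp)
  let t : M →ₗ[k] P := rightAct P ∘ₗ LinearMap.rTensor H σ ∘ₗ s
  have ht (x : M) : homLin k p (t x) = x := by
    change homLin k p (rightAct P (LinearMap.rTensor H σ (s x))) = x
    rw [← rightAct_map _ (fun b x => homLin_ract p (op b) x), ← LinearMap.rTensor_comp_apply, hσ,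
      LinearMap.rTensor_id, LinearMap.id_apply, hs']
  have ht' (b : H) (x : M) : t (ract M (op b) x) = ract P (op b) (t x) := by
    change rightAct P (LinearMap.rTensor H σ (s _)) = _
    rw [hs, rTensor_lTensor_mulRight, rightAct_lTensor]
    rfl
  have h1 (x : P) : ∃ y, homLin k i y = x - t (homLin k p x) := by
    refine (ShortComplex.moduleCat_exact_iff _).1 hS.exact (x - t (homLin k p x)) ?_
    refine (map_sub p.hom x _).trans (sub_eq_zero.2 (ht _).symm)
  choose r hr using h1
  refine ⟨⟨⟨r, fun x y => hi ?_⟩, fun c x => hi ?_⟩, fun b x => hi ?_, fun x => hi ?_⟩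
  · change homLin k i _ = homLin k i _
    rw [map_add, hr, hr, hr, map_add, map_add]
    abel
  · change homLin k i _ = homLin k i (c • r x)
    rw [map_smul, hr, hr, map_smul, map_smul, smul_sub]
  · change homLin k i (r _) = homLin k i (ract K (op b) (r x))
    rw [homLin_ract, hr, hr, homLin_ract, ht', map_sub]
  · change homLin k i (r (homLin k i x)) = homLin k i x
    have : homLin k p (homLin k i x) = 0 := ConcreteCategory.congr_hom w x
    rw [hr, this, map_zero, sub_zero]

lemma RightProjective.kernel (hS : (ShortComplex.mk i p w).ShortExact) (hM : RightProjective M)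
    (hP : RightProjective P) : RightProjective K := by
  obtain ⟨r, hr, hr'⟩ := exists_retraction hS hM
  obtain ⟨s, hs, hs'⟩ := hP
  refine ⟨LinearMap.rTensor H r ∘ₗ s ∘ₗ homLin k i, fun b m => ?_, fun m => ?_⟩
  · rw [LinearMap.comp_apply, LinearMap.comp_apply, homLin_ract, hs, rTensor_lTensor_mulRight]
    rfl
  · rw [LinearMap.comp_apply, LinearMap.comp_apply, rightAct_map r hr, hs']
    exact hr' m

/-- The functor `- ⊗_H k` on morphisms. -/
def coinvMap {M N : Bimod k H} (f : M ⟶ N) : coinv M ⟶ coinv N :=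
  coinvLift ((toCoinv N).comp f.hom.toAddMonoidHom) fun z m =>
    (congrArg (toCoinv N) (map_smul f.hom z m)).trans (toCoinv_smul N z _)

lemma coinvMap_comp_zero (w : i ≫ p = 0) : coinvMap i ≫ coinvMap p = 0 := by
  refine ModuleCat.hom_ext (LinearMap.ext fun x => ?_)
  obtain ⟨x, rfl⟩ := toCoinv_surjective K x
  refine (congrArg (toCoinv M) (ConcreteCategory.congr_hom w x)).trans (map_zero _)

lemma coinv_shortExact (hS : (ShortComplex.mk i p w).ShortExact) (hM : RightProjective M) :
    (ShortComplex.mk (coinvMap i) (coinvMap p) (coinvMap_comp_zero w)).ShortExact := by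
  obtain ⟨r, hr, hr'⟩ := exists_retraction hS hM
  have hp : Function.Surjective (homLin k p) := hS.moduleCat_surjective_g
  refine ModuleCat.shortComplex_shortExact _ (fun x => ⟨fun hx => ?_, ?_⟩) ?_ fun x => ?_
  · obtain ⟨x, rfl⟩ := toCoinv_surjective P x
    obtain ⟨t, ht⟩ := toCoinv_eq_zero.1 (show toCoinv M (homLin k p x) = 0 from hx)
    obtain ⟨t, rfl⟩ := LinearMap.rTensor_surjective H hp t
    rw [← augMap_map _ (fun b x => homLin_ract p (op b) x)] at ht
    obtain ⟨y, hy⟩ := (ShortComplex.moduleCat_exact_iff _).1 hS.exact (x - augMap P t)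
      ((map_sub (homLin k p) x _).trans (sub_eq_zero.2 ht.symm))
    refine ⟨toCoinv K y, (congrArg (toCoinv P) hy).trans ?_⟩
    rw [map_sub, toCoinv_eq_zero.2 ⟨t, rfl⟩, sub_zero]
  · rintro ⟨y, rfl⟩
    exact ConcreteCategory.congr_hom (coinvMap_comp_zero w) y
  · refine (injective_iff_map_eq_zero (coinvMap i).hom).2 fun x hx => ?_
    obtain ⟨x, rfl⟩ := toCoinv_surjective K x
    obtain ⟨t, ht⟩ := toCoinv_eq_zero.1 (show toCoinv P (i.hom x) = 0 from hx)
    rw [toCoinv_eq_zero, ← hr' x, ← ht, augMap_map r hr]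
    exact ⟨_, rfl⟩
  · obtain ⟨x, rfl⟩ := toCoinv_surjective M x
    obtain ⟨x, rfl⟩ := hp x
    exact ⟨toCoinv P x, rfl⟩
end Exact

lemma FiniteResolution.coinv {n : ℕ} {M : Bimod k H} (h : FiniteResolution n M)
    (hM : RightProjective M) : ThickClosure (ModuleCat.of H H) (coinv M) := by
  induction n generalizing M with
  | zero =>
    have : Subsingleton M := ModuleCat.subsingleton_of_isZero h
    have := (toCoinv_surjective M).subsingleton
    exact thickClosure_of_isZero (ModuleCat.isZero_of_subsingleton _)
  | succ n ih =>
    obtain ⟨K, P, i, p, w, hS, h1, h2, h3⟩ := h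
    have := coinv_finite P
    have := coinv_projective P
    exact .ext₃ (coinv_shortExact hS hM)
      (ih h3 (hM.kernel hS (rightProjective_of_projective P))) (thickClosure_of_finite_projective _)

/-- The counit, as a map of modules. -/
def counitSelf : selfBimod k H →+ trivialModule k H :=
  ((toTrivLin k H).toLinearMap ∘ₗ counit ∘ₗ (toSelfLin k H).symm.toLinearMap).toAddMonoidHom

/-- `H ⊗_H k` is the trivial module. -/
def coinvSelf : coinv (selfBimod k H) ⟶ trivialModule k H :=
  coinvLift counitSelf fun z m => by
      obtain ⟨m, rfl⟩ := (toSelfLin k H).surjective m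
      induction z using TensorProduct.induction_on with
      | zero =>
        rw [map_zero, zero_smul H (A := trivialModule k H)]
        exact (congrArg counitSelf (zero_smul (Env k H) (A := selfBimod k H) _)).trans (map_zero _)
      | add z w hz hw =>
        refine (congrArg counitSelf (add_smul z w (toSelfLin k H m))).trans
          ((map_add counitSelf _ _).trans ?_)
        rw [hz, hw, map_add, add_smul]
      | tmul a b =>
        rw [← op_unop b]
        refine (congrArg counitSelf (smul_toSelf a b.unop m)).trans ?_
        change toTrivLin k H (counit (a * m * b.unop)) = envAug _ • toTrivLin k H (counit m)
        rw [envAug_tmul, smul_toTrivLin, Bialgebra.counit_mul, Bialgebra.counit_mul,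
          Bialgebra.counit_mul, Bialgebra.counit_algebraMap]
        ring_nf

lemma coinvSelf_toCoinv (h : H) : (coinvSelf (k := k) (H := H)).hom (toCoinv _ (toSelfLin k H h)) =
    toTrivLin k H (counit h) := rfl

instance : IsIso (coinvSelf (k := k) (H := H)) := by
  apply isIso_of_bijective
  constructor
  · refine (injective_iff_map_eq_zero _).2 fun x hx => ?_
    obtain ⟨x, rfl⟩ := toCoinv_surjective _ x
    obtain ⟨x, rfl⟩ := (toSelfLin k H).surjective x
    rw [coinvSelf_toCoinv] at hx
    have hx' : counit (R := k) x = 0 := (map_eq_zero_iff _ (toTrivLin k H).injective).1 hx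
    rw [toCoinv_eq_zero]
    refine ⟨toSelfLin k H 1 ⊗ₜ x, ?_⟩
    rw [augMap_tmul, hx', zero_smul, sub_zero]
    refine (smul_toSelf 1 x 1).trans ?_
    rw [one_mul, one_mul]
    rfl
  · intro x
    obtain ⟨c, rfl⟩ := (toTrivLin k H).surjective x
    refine ⟨toCoinv _ (toSelfLin k H (algebraMap k H c)), ?_⟩
    rw [coinvSelf_toCoinv, Bialgebra.counit_algebraMap]

/-- If `H` is homologically smooth, the trivial module has a finite resolution by finitely generated
projective modules. -/
theorem thickClosure_trivialModule (hH : HomologicallySmooth k H) :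
    ThickClosure (ModuleCat.of H H) (trivialModule k H) := by
  have h := homologicallySmooth_iff.1 hH
  obtain ⟨n, hn⟩ := h.exists_hasProjectiveDimensionLT
  have h1 : FiniteResolution (n + 1) (selfBimod k H) :=
    (h.finitelyPresentedUpTo n).finiteResolution (hasProjectiveDimensionLT_of_ge _ n _ (by lia))
  exact thickClosure_of_iso (asIso coinvSelf) (h1.coinv rightProjective_self)

end Coinvariants
end SmashDuality

/-! ### The twist attached to a character -/

namespace SmashDuality
section Twist
open MulOpposite HopfAlgebra
variable {k H : Type u} [Field k] [Ring H] [HopfAlgebra k H] (π : H →ₐ[k] k)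

/-- The convolution inverse `π ∘ S` of a character. -/
def charInv : H →ₐ[k] k := AlgHom.ofLinearMap (π.toLinearMap ∘ₗ antipode k) (by simp)
  (fun x y => by simp [antipode_mul_antidistrib, mul_comm])

lemma charInv_toLinearMap : (charInv π).toLinearMap = π.toLinearMap ∘ₗ antipode k := rfl

lemma charInv_charInv : charInv (charInv π) = π :=
  AlgHom.toLinearMap_injective (WithConv.toConv_injective
    (left_inv_eq_right_inv (conv_antipode_left (charInv π)) (conv_antipode_left π)))

lemma rightWinding_toLinearMap : (rightWinding π).toLinearMap =
    cv (LinearMap.lsmul k H).flip LinearMap.id π.toLinearMap := by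
  ext h
  rw [cv_apply]
  exact rightWinding_eq π h

lemma rightWinding_charInv (h : H) : rightWinding π (rightWinding (charInv π) h) = h := by
  have h1 : (rightWinding π).toLinearMap ∘ₗ (rightWinding (charInv π)).toLinearMap =
      LinearMap.id := by
    have h2 : (rightWinding π).toLinearMap ∘ₗ (rightWinding (charInv π)).toLinearMap =
        cv (LinearMap.lsmul k H).flip (rightWinding π).toLinearMap
          (charInv π).toLinearMap := by
      ext h
      rw [LinearMap.comp_apply, rightWinding_toLinearMap (charInv π)]
      exact map_cv _ (fun u v => map_smul (rightWinding π) _ _) h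
    rw [h2, rightWinding_toLinearMap, cv_assoc (C := (LinearMap.lsmul k H).flip)
      (C' := LinearMap.mul k k) (fun x y z => by simp [smul_smul, mul_comm]), charInv_toLinearMap,
      cv_mul_antipode]
    ext h
    exact (cv_counit_right _ _ _ _).trans (one_smul k h)
  exact LinearMap.congr_fun h1 h

/-- The winding automorphism of a character. -/
def windingEquiv : H ≃ₐ[k] H :=
  AlgEquiv.ofAlgHom (rightWinding π) (rightWinding (charInv π))
    (AlgHom.ext fun h => rightWinding_charInv π h)
    (AlgHom.ext fun h => by
      have := rightWinding_charInv (charInv π) h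
      rwa [charInv_charInv] at this)

lemma comul_eq_cv (h : H) :
    comul (R := k) h = cv (TensorProduct.mk k H H) LinearMap.id LinearMap.id h := by
  rw [cv_apply, ← (ℛ k h).eq]
  rfl

lemma map_comul {V W : Type*} [AddCommGroup V] [Module k V] [AddCommGroup W] [Module k W]
    (f : H →ₗ[k] V) (g : H →ₗ[k] W) (h : H) :
    TensorProduct.map f g (comul h) = cv (TensorProduct.mk k V W) f g h := by
  rw [comul_eq_cv]
  exact map_cv _ (fun u v => rfl) h

lemma comul_rightWinding (h : H) : comul (rightWinding π h) =
    TensorProduct.map LinearMap.id (rightWinding π).toLinearMap (comul h) := by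
  rw [map_comul, rightWinding_toLinearMap, ← AlgHom.toLinearMap_apply, rightWinding_toLinearMap,
    ← cv_assoc (B := (LinearMap.lsmul k (H ⊗[k] H)).flip) (B' := TensorProduct.mk k H H)
      (fun x y z => by simp)]
  refine map_cv _ (fun u v => ?_) h
  rw [← comul_eq_cv]
  exact map_smul comul _ _

lemma rightWinding_antipodeSq (h : H) :
    rightWinding π (antipodeSq k H h) = antipodeSq k H (rightWinding π h) := by
  have h1 : π.toLinearMap ∘ₗ antipodeSq k H = π.toLinearMap :=
    congrArg AlgHom.toLinearMap (charInv_charInv π)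
  rw [← AlgHom.toLinearMap_apply, rightWinding_toLinearMap, cv_antipodeSq, h1,
    ← AlgHom.toLinearMap_apply, rightWinding_toLinearMap]
  exact (map_cv _ (fun u v => map_smul (antipodeSq k H) _ _) h).symm

variable (hS : Function.Bijective (antipode k (A := H)))

/-- The automorphism `h ↦ S²(h₁) π(S(h₂))`. -/
def twistAut : H ≃ₐ[k] H := (windingEquiv (charInv π)).trans
  (AlgEquiv.ofBijective antipodeSqHom (hS.comp hS))

lemma twistAut_apply (h : H) : twistAut π hS h = antipodeSq k H (rightWinding (charInv π) h) := rfl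

lemma twistAut_toLinearMap : (twistAut π hS).toLinearMap =
    cv (LinearMap.lsmul k H).flip (antipodeSq k H) (π.toLinearMap ∘ₗ antipode k) := by
  ext h
  change antipodeSq k H ((rightWinding (charInv π)).toLinearMap h) = _
  rw [rightWinding_toLinearMap]
  exact map_cv _ (fun u v => map_smul (antipodeSq k H) _ _) h

lemma isTwist_twistAut : IsTwist (twistAut π hS) := fun h => by
  rw [twistAut_apply, comul_antipodeSq, comul_rightWinding, ← LinearMap.comp_apply,
    ← TensorProduct.map_comp]
  rfl

lemma antipodeSq_twistAut_symm (h : H) :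
    antipodeSq k H ((twistAut π hS).symm h) = rightWinding π h := by
  obtain ⟨h, rfl⟩ := (twistAut π hS).surjective h
  rw [AlgEquiv.symm_apply_apply, twistAut_apply, rightWinding_antipodeSq, rightWinding_charInv]

end Twist

section Perfect
open Abelian Limits

lemma ThickClosure.map_functor {R S : Type u} [Ring R] [Ring S] {G X : ModuleCat.{u} R}
    {G' : ModuleCat.{u} S} (F : ModuleCat.{u} R ⥤ ModuleCat.{u} S) [F.Additive]
    [PreservesFiniteLimits F] [PreservesFiniteColimits F] (hG : ThickClosure G' (F.obj G))
    (h : ThickClosure G X) : ThickClosure G' (F.obj X) := by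
  induction h with
  | base => exact hG
  | retract r _ ih => exact .retract (r.map F) ih
  | ext₂ hS _ _ h₁ h₃ => exact .ext₂ (hS.map_of_exact F) h₁ h₃
  | ext₃ hS _ _ h₁ h₂ => exact .ext₃ (hS.map_of_exact F) h₁ h₂

variable {k H A : Type u} [Field k] [Ring H] [HopfAlgebra k H] [Ring A] [Algebra k A]
  {α : HopfAction k H A} {Λ : Type u} [Ring Λ] [Algebra k Λ] (P : SmashPair α Λ)

include P in
/-- `Λ` is homologically smooth: `F(H) ≃ G(A)` is perfect since `A` is, and hence so is
`Λ ≃ F(k)`. -/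
theorem SmashPair.homologicallySmooth (hS : Function.Bijective (HopfAlgebra.antipode k (A := H)))
    (hA : HomologicallySmooth k A) (hH : HomologicallySmooth k H) : HomologicallySmooth k Λ := by
  rw [homologicallySmooth_iff] at hA ⊢
  have h1 : ThickClosure (ModuleCat.of (Env k Λ) (Env k Λ)) ((P.G hS).obj (selfBimod k A)) :=
    ThickClosure.map_functor (G := regular (Env k A)) (P.G hS)
      (thickClosure_of_iso (X := regular (Env k Λ)) (asIso (P.κr hS)).symm .base) hA
  have h2 : ThickClosure (ModuleCat.of (Env k Λ) (Env k Λ)) (P.F.obj (regular H)) :=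
    thickClosure_of_iso (asIso (P.ζ hS)) h1
  exact thickClosure_of_iso P.trivialIso
    (ThickClosure.map_functor (G := regular H) P.F h2 (thickClosure_trivialModule hH))

end Perfect
end SmashDuality

/-! ### The bimodule `D ♯ ^σH` -/

namespace SmashDuality
section TwistedInduction
open Abelian MulOpposite HopfAlgebra
variable {k H A : Type u} [Field k] [Ring H] [HopfAlgebra k H] [Ring A] [Algebra k A]
  {α : HopfAction k H A} {Λ : Type u} [Ring Λ] [Algebra k Λ] (P : SmashPair α Λ)

/-- The `Λ`-bimodule `X` is `D ♯ ^σH`, by means of the map `ψ : D → X`: the `ψ(d) j(l)` give a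
bijection from `D ⊗ H`, and `j(u) ψ(d) = ψ(u₁ d) j(σ(u₂))`. -/
structure IsTwistedInduction {D : Bimod k A} {X : Bimod k Λ}
    (β : EquivariantStr α (antipodeSq k H) D) (σ : H ≃ₐ[k] H) (ψ : D →ₗ[k] X) : Prop where
  map_lact : ∀ a d, ψ (lact D a d) = lact X (P.i a) (ψ d)
  map_ract : ∀ a d, ψ (ract D (op a) d) = ract X (op (P.i a)) (ψ d)
  bijective : Function.Bijective (P.rExt ψ)
  map_lj : ∀ u m, P.lj X u (P.rExt ψ m) =
    P.rExt ψ (diagRep β.act ((Algebra.lmul k H).comp σ.toAlgHom) u m)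

namespace SmashPair

lemma rExt_pushRight {D : Bimod k A} {X : Bimod k Λ} {ψ : D →ₗ[k] X}
    (hψ : ∀ a d, ψ (ract D (op a) d) = ract X (op (P.i a)) (ψ d)) (d : D) (v : A ⊗[k] H) :
    P.rExt ψ (pushRight H D d v) = ract X (op (P.μ v)) (ψ d) := by
  induction v using TensorProduct.induction_on with
  | zero => simp
  | add x y hx hy =>
    rw [map_add, map_add, hx, hy, map_add]
    exact (LinearMap.congr_fun (map_add (ract X) (op _) (op _)) _).symm
  | tmul a l =>
    rw [pushRight_tmul, rExt_tmul, hψ, μ_tmul, op_mul, map_mul]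
    rfl

lemma lact_i_rExt {D : Bimod k A} {X : Bimod k Λ} {ψ : D →ₗ[k] X}
    (hψ : ∀ a d, ψ (lact D a d) = lact X (P.i a) (ψ d)) (a : A) (m : D ⊗[k] H) :
    lact X (P.i a) (P.rExt ψ m) = P.rExt ψ (leftRep H (lact D) a m) := by
  refine LinearMap.congr_fun (f := lact X (P.i a) ∘ₗ P.rExt ψ)
    (g := P.rExt ψ ∘ₗ leftRep H (lact D) a) (TensorProduct.ext' fun d l => ?_) m
  change lact X (P.i a) (P.rExt ψ (d ⊗ₜ l)) = P.rExt ψ (leftRep H (lact D) a (d ⊗ₜ l))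
  rw [leftRep_tmul, rExt_tmul, rExt_tmul, hψ, lact_ract]

section Prod
variable (hS : Function.Bijective (antipode k (A := H))) {p q n : ℕ} (h : p + q = n)

lemma prod_rExt (e : RX (trivialModule k H) p) {V : Type u} [AddCommGroup V] [Module k V]
    (φ : V →ₗ[k] P.W q) (m : V ⊗[k] H) :
    P.prod h e (P.rExt φ m) = P.rExt (P.prod h e ∘ₗ φ) m :=
  LinearMap.congr_fun (f := P.prod h e ∘ₗ P.rExt φ) (g := P.rExt (P.prod h e ∘ₗ φ))
    (TensorProduct.ext' fun x l => P.prod_ract h e (op (P.j l)) (φ x)) m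

/-- `h ↦ e · h`. -/
def opAct {M : ModuleCat.{u} H} {p : ℕ} (e : RX M p) : H →ₗ[k] RX M p :=
  (LinearMap.toSpanSingleton Hᵐᵒᵖ (RX M p) e).restrictScalars k ∘ₗ opLin

/-- The formula `j(u) (e Φ(x) j(l)) = (e · S(u₃)) Φ(u₁ x) j(S²(u₂) l)`. -/
lemma lj_prodMap (β : EquivariantStr α (antipodeSq k H) (ExtBimod k A q))
    (hβ : ∀ u x, P.starW q u (P.Φ hS q x) = P.Φ hS q (β.act u x)) (u : H)
    (e : RX (trivialModule k H) p) (m : ExtBimod k A q ⊗[k] H) :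
    P.lj (ExtBimod k Λ n) u (P.prodMap hS h (e ⊗ₜ m)) = P.prodMap hS h
      (cv (TensorProduct.mk k (RX (trivialModule k H) p) (ExtBimod k A q ⊗[k] H)).flip
        ((twistedDiag β.act).toLinearMap.flip m) (opAct e ∘ₗ antipode k) u) := by
  rw [prodMap_tmul, lj_apply, ← prod_lact, ← lj_apply,
    P.lj_rExt hS (hl := P.τ_lact q) (hr := P.τ_ract q) β.act (P.Φ hS q) hβ]
  rw [cv_apply, cv_apply, map_sum, map_sum]
  exact Finset.sum_congr rfl fun i _ => (P.prod_op_smul h e _ (P.rExt (P.Φ hS q) _)).symm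

lemma diagRep_tmul {V W : Type u} [AddCommGroup V] [Module k V] [AddCommGroup W] [Module k W]
    (ρ : H →ₐ[k] Module.End k V) (g : H →ₐ[k] Module.End k W) (u : H) (v : V) (w : W) :
    diagRep ρ g u (v ⊗ₜ w) =
      cv (TensorProduct.mk k V W) (ρ.toLinearMap.flip v) (g.toLinearMap.flip w) u := by
  rw [diagRep_eq, LinearMap.sum_apply, cv_apply]
  rfl

lemma diagRep_twistAut {D : Type u} [AddCommGroup D] [Module k D] (ρ : H →ₐ[k] Module.End k D)
    (π : H →ₐ[k] k) (u : H) (m : D ⊗[k] H) :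
    diagRep ρ ((Algebra.lmul k H).comp (twistAut π hS).toAlgHom) u m =
      cv (LinearMap.lsmul k (D ⊗[k] H)).flip ((twistedDiag ρ).toLinearMap.flip m)
        (π.toLinearMap ∘ₗ antipode k) u := by
  induction m using TensorProduct.induction_on with
  | zero => simp [cv_apply]
  | add x y hx hy => simp only [map_add, hx, hy, cv_apply, Finset.sum_add_distrib, LinearMap.add_apply]
  | tmul x l =>
    have h1 : (twistedDiag ρ).toLinearMap.flip (x ⊗ₜ l) = cv (TensorProduct.mk k D H)
        (ρ.toLinearMap.flip x) (LinearMap.mulRight k l ∘ₗ antipodeSq k H) :=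
      LinearMap.ext fun u => diagRep_tmul _ _ u x l
    have h2 : (((Algebra.lmul k H).comp (twistAut π hS).toAlgHom)).toLinearMap.flip l =
        cv (LinearMap.lsmul k H).flip (LinearMap.mulRight k l ∘ₗ antipodeSq k H)
          (π.toLinearMap ∘ₗ antipode k) := by
      refine LinearMap.ext fun u => ?_
      change LinearMap.mulRight k l ((twistAut π hS).toLinearMap u) = _
      rw [twistAut_toLinearMap]
      exact map_cv _ (fun u v => map_smul (LinearMap.mulRight k l) _ _) u
    rw [diagRep_tmul, h1, h2, cv_assoc (C := TensorProduct.mk k D H)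
      (C' := (LinearMap.lsmul k H).flip) (fun x y z => ((TensorProduct.mk k D H _).map_smul _ _).symm)]

lemma op_smul_eq {d : ℕ} {π : H →ₐ[k] k} (hπ : IsLeftHomologicalIntegral d π)
    (e : RX (trivialModule k H) d) (u : H) : op u • e = π u • e :=
  (hπ.character u e).trans (algebraMap_smul Hᵐᵒᵖ (π u) e)

include h in
/-- If the classes of `Ext_{A^e}(A, A^e)` lie in degree `q` and `e` spans `Ext_H(k, H)`, then
`Ext_{Λ^e}(Λ, Λ^e)` is a twisted induction of `Ext^q_{A^e}(A, A^e)`. -/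
theorem isTwistedInduction
    (hA : ThickClosure (ModuleCat.of (Env k A) (Env k A)) (selfBimod k A))
    (hH : ThickClosure (ModuleCat.of H H) (trivialModule k H))
    (hR : Nonempty (EquivariantResolution α))
    (hd : ∀ m, m ≠ q → Subsingleton (ExtBimod k A m))
    (β : EquivariantStr α (antipodeSq k H) (ExtBimod k A q))
    (hβ : ∀ u x, P.starW q u (P.Φ hS q x) = P.Φ hS q (β.act u x))
    {π : H →ₐ[k] k} (hπ : IsLeftHomologicalIntegral p π) :
    ∃ ψ : ExtBimod k A q →ₗ[k] ExtBimod k Λ n, IsTwistedInduction P β (twistAut π hS) ψ := by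
  obtain ⟨e, he0, he⟩ : ∃ e : RX (trivialModule k H) p, e ≠ 0 ∧ ∀ x, ∃ c : k, x = c • e := by
    obtain ⟨e, he0, he⟩ := hπ.one_dim
    exact ⟨e, he0, fun x => (he x).imp fun c hc => hc.trans (algebraMap_smul Hᵐᵒᵖ c (M := RX _ p) e)⟩
  refine ⟨P.prod h e ∘ₗ P.Φ hS q, fun a x => ?_, fun a x => ?_, ?_, fun u m => ?_⟩
  · exact (congrArg (P.prod h e) (P.Φ₀_lact hS q a x)).trans (P.prod_lact h e _ _)
  · exact (congrArg (P.prod h e) (P.Φ₀_ract hS q a x)).trans (P.prod_ract h e _ _)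
  · have h1 := P.prodMap_bijective hS h hA hH hR hd
    have h2 : P.rExt (P.prod h e ∘ₗ P.Φ hS q) = P.prodMap hS h ∘ₗ
        TensorProduct.mk k (RX (trivialModule k H) p) (ExtBimod k A q ⊗[k] H) e :=
      LinearMap.ext fun m => (P.prod_rExt h e _ m).symm
    rw [h2, LinearMap.coe_comp]
    refine h1.comp ?_
    let E : k ≃ₗ[k] RX (trivialModule k H) p := LinearEquiv.ofBijective
      (LinearMap.toSpanSingleton k _ e) ⟨smul_left_injective k he0, fun x =>
        (he x).imp fun c hc => hc.symm⟩
    have h3 : TensorProduct.mk k (RX (trivialModule k H) p) (ExtBimod k A q ⊗[k] H) e =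
        ((TensorProduct.lid k _).symm.trans
          (TensorProduct.congr E (LinearEquiv.refl k (ExtBimod k A q ⊗[k] H)))).toLinearMap := by
      refine LinearMap.ext fun m => ?_
      change _ = (LinearMap.toSpanSingleton k (RX (trivialModule k H) p) e 1) ⊗ₜ m
      rw [LinearMap.toSpanSingleton_apply, one_smul]
      rfl
    rw [h3]
    exact LinearEquiv.bijective _
  · rw [← P.prod_rExt, ← P.prod_rExt, diagRep_twistAut]
    refine (P.lj_prodMap hS h β hβ u e m).trans ?_
    rw [cv_apply, cv_apply, map_sum, map_sum, map_sum]
    refine Finset.sum_congr rfl fun i _ => ?_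
    change P.prodMap hS h ((op (antipode k ((ℛ k u).right i)) • e) ⊗ₜ _) =
      P.prod h e (P.rExt (P.Φ hS q) (π (antipode k ((ℛ k u).right i)) • _))
    rw [op_smul_eq hπ, TensorProduct.smul_tmul, prodMap_tmul]

end Prod
end SmashPair

namespace IsTwistedInduction
variable {P} {D : Bimod k A} {X : Bimod k Λ} {β : EquivariantStr α (antipodeSq k H) D}
  {σ : H ≃ₐ[k] H} {ψ : D →ₗ[k] X} (hψ : IsTwistedInduction P β σ ψ)
include hψ

lemma rExt_pushRight (d : D) (v : A ⊗[k] H) :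
    P.rExt ψ (pushRight H D d v) = ract X (op (P.μ v)) (ψ d) :=
  P.rExt_pushRight hψ.map_ract d v

lemma lact_i (a : A) (m : D ⊗[k] H) : lact X (P.i a) (P.rExt ψ m) =
    P.rExt ψ (leftRep H (lact D) a m) :=
  P.lact_i_rExt hψ.map_lact a m
end IsTwistedInduction

lemma SmashPair.smash_μ (t : A ⊗[k] H) : (SmashPair.smash α).μ t = (Smash.equiv α).symm t := by
  refine LinearMap.congr_fun (f := (SmashPair.smash α).μ.toLinearMap)
    (g := (Smash.equiv α).symm.toLinearMap)
    (TensorProduct.ext' fun a h => (smashMul_tmul α a 1 1 h).trans ?_) t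
  rw [Bialgebra.comul_one]
  simp [Algebra.TensorProduct.one_def]
  rfl

/-- For `Λ = A ♯ H`, a twisted induction of `D` is isomorphic to `smashTwist`. -/
theorem IsTwistedInduction.nonempty_iso {D : Bimod k A} {X : Bimod k (Smash α)}
    {β : EquivariantStr α (antipodeSq k H) D} {σ : H ≃ₐ[k] H} (hσ : IsTwist σ) {ψ : D →ₗ[k] X}
    (hψ : IsTwistedInduction (SmashPair.smash α) β σ ψ) : Nonempty (X ≅ smashTwist β σ hσ) := by
  let P := SmashPair.smash α
  let L := Smash.rep α (leftRep H (lact D)) (diagRep β.act ((Algebra.lmul k H).comp σ.toAlgHom))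
      (covariant_diag α β.act_left _)
  have hL (x : Smash α) (m : D ⊗[k] H) : P.rExt ψ (L x m) = lact X x (P.rExt ψ m) := by
    refine P.induction (p := fun x => ∀ m, P.rExt ψ (L x m) = lact X x (P.rExt ψ m)) x
      (fun a h m => ?_) (fun m => by simp) (fun x y hx hy m => by
        rw [map_add, map_add, LinearMap.add_apply, map_add, hx, hy, LinearMap.add_apply]) m
    have h1 : L (P.i a * P.j h) = leftRep H (lact D) a *
        diagRep β.act ((Algebra.lmul k H).comp σ.toAlgHom) h := by
      rw [← SmashPair.μ_tmul, SmashPair.smash_μ]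
      rfl
    rw [h1, Module.End.mul_apply, ← hψ.lact_i, ← hψ.map_lj, map_mul]
    rfl
  have hR (x : Smash α) (m : D ⊗[k] H) :
      P.rExt ψ (twistRight α D (op x) m) = ract X (op x) (P.rExt ψ m) := by
    refine LinearMap.congr_fun (f := P.rExt ψ ∘ₗ twistRight α D (op x))
      (g := ract X (op x) ∘ₗ P.rExt ψ) (TensorProduct.ext' fun d l => ?_) m
    refine (hψ.rExt_pushRight d _).trans ?_
    rw [SmashPair.smash_μ]
    change ract X (op (P.j l * x)) (ψ d) = _
    rw [op_mul, map_mul]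
    rfl
  have hc (x : Smash α) (y : (Smash α)ᵐᵒᵖ) : Commute (L x) (twistRight α D y) :=
    smashRep_twistRightFun β σ hσ x (Smash.equiv α y.unop)
  have key (z : Env k (Smash α)) (m : D ⊗[k] H) :
      P.rExt ψ (Algebra.TensorProduct.lift L (twistRight α D) hc z m) = z • P.rExt ψ m := by
    induction z using TensorProduct.induction_on with
    | zero => rw [map_zero, zero_smul (Env k (Smash α)) (P.rExt ψ m), LinearMap.zero_apply, map_zero]
    | add z w hz hw => rw [map_add, add_smul, LinearMap.add_apply, map_add, hz, hw]
    | tmul x y =>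
      rw [Algebra.TensorProduct.lift_tmul, Module.End.mul_apply, hL, ← op_unop y, hR, tmul_smul_eq]
  exact ⟨(mkIso (M := smashTwist β σ hσ) (N := X)
    (LinearEquiv.ofBijective _ hψ.bijective).toAddEquiv key).symm⟩

end TwistedInduction
end SmashDuality

/-! ### Invertible bimodules -/

namespace SmashDuality
section Invertible
open MulOpposite
variable {k A : Type u} [Field k] [Ring A] [Algebra k A]

section TensorBimod
variable (D D' : Bimod k A)

/-- `d ⊗ d'` as an element of `outerTensor D D'`. -/
def toOuter : D ⊗[k] D' ≃+ outerTensor D D' := AddEquiv.refl _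

/-- The quotient map `D ⊗_k D' → D ⊗_A D'`. -/
def tmk : D ⊗[k] D' →+ tensorBimod D D' :=
  (Submodule.mkQ (balancing D D')).toAddMonoidHom.comp (toOuter D D').toAddMonoidHom

lemma tmk_surjective : Function.Surjective (tmk D D') := Submodule.mkQ_surjective (balancing D D')

variable {D D'}

lemma smul_toOuter (a b : A) (d : D) (d' : D') : (a ⊗ₜ op b : Env k A) • toOuter D D' (d ⊗ₜ d') =
    toOuter D D' (lact D a d ⊗ₜ ract D' (op b) d') :=
  LinearMap.congr_fun (Algebra.TensorProduct.lift_tmul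
    ((Module.End.rTensorAlgHom k D D').comp (lact D)) ((Module.End.lTensorAlgHom k D' D).comp (ract D'))
    (fun a b => TensorProduct.ext' fun x y => rfl) a (op b)) (d ⊗ₜ[k] d')

lemma smul_tmk (a b : A) (d : D) (d' : D') : (a ⊗ₜ op b : Env k A) • tmk D D' (d ⊗ₜ d') =
    tmk D D' (lact D a d ⊗ₜ ract D' (op b) d') :=
  congrArg (Submodule.mkQ (balancing D D')) (smul_toOuter a b d d')

lemma tmk_eq_zero {z : D ⊗[k] D'} : tmk D D' z = 0 ↔ toOuter D D' z ∈ balancing D D' :=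
  Submodule.Quotient.mk_eq_zero (balancing D D')

lemma tmk_balanced (d : D) (a : A) (d' : D') :
    tmk D D' (ract D (op a) d ⊗ₜ d') = tmk D D' (d ⊗ₜ lact D' a d') := by
  rw [← sub_eq_zero, ← map_sub, tmk_eq_zero]
  exact Submodule.subset_span ⟨(d, a, d'), rfl⟩

/-- A balanced map on `D ⊗_k D'` factors through `D ⊗_A D'`. -/
lemma eq_zero_of_tmk {V : Type*} [AddCommGroup V] (g : D ⊗[k] D' →+ V)
    (hg : ∀ d a d', g (ract D (op a) d ⊗ₜ d') = g (d ⊗ₜ lact D' a d')) {z : D ⊗[k] D'}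
    (hz : tmk D D' z = 0) : g z = 0 := by
  obtain ⟨f, hf⟩ : ∃ f : outerTensor D D' →+ V, ∀ z, f (toOuter D D' z) = g z :=
    ⟨g.comp (toOuter D D').symm.toAddMonoidHom, fun z => rfl⟩
  have h1 (z : outerTensor D D') (hz : z ∈ balancing D D') (c : Env k A) : f (c • z) = 0 := by
    induction hz using Submodule.span_induction generalizing c with
    | mem x hx =>
      obtain ⟨⟨d, a, d'⟩, rfl⟩ := hx
      change f (c • toOuter D D' (ract D (op a) d ⊗ₜ[k] d' - d ⊗ₜ[k] lact D' a d')) = 0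
      rw [map_sub, smul_sub, map_sub]
      induction c using TensorProduct.induction_on with
      | zero =>
        rw [zero_smul (Env k A) (toOuter D D' _), zero_smul (Env k A) (toOuter D D' _), sub_self]
      | add c c' h h' =>
        rw [add_smul, add_smul, map_add, map_add, add_sub_add_comm, h, h', add_zero]
      | tmul b b' =>
        rw [← op_unop b', smul_toOuter, smul_toOuter, lact_ract, ← lact_ract D', hf, hf, hg, sub_self]
    | zero => rw [smul_zero, map_zero]
    | add x y _ _ hx hy => rw [smul_add, map_add, hx, hy, add_zero]
    | smul c' x _ hx => rw [smul_smul]; exact hx _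
  rw [← hf, ← one_smul (Env k A) (toOuter D D' z)]
  exact h1 _ (tmk_eq_zero.1 hz) 1

variable (D D') in
/-- An isomorphism `D ⊗_A D' ≃ A`, as a pairing. -/
structure PerfectPairing where
  g : D ⊗[k] D' →ₗ[k] A
  balanced : ∀ d a d', g (ract D (op a) d ⊗ₜ d') = g (d ⊗ₜ lact D' a d')
  left : ∀ a d d', g (lact D a d ⊗ₜ d') = a * g (d ⊗ₜ d')
  right : ∀ b d d', g (d ⊗ₜ ract D' (op b) d') = g (d ⊗ₜ d') * b
  injective : ∀ z, g z = 0 → tmk D D' z = 0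
  surjective : ∃ z, g z = 1

lemma nonempty_iso_iff :
    Nonempty (tensorBimod D D' ≅ selfBimod k A) ↔ Nonempty (PerfectPairing D D') := by
  constructor
  · rintro ⟨e⟩
    have he : Function.Bijective e.hom.hom := e.toLinearEquiv.bijective
    let g : D ⊗[k] D' →+ A :=
      (toSelf (k := k) A).symm.toAddMonoidHom.comp (e.hom.hom.toAddMonoidHom.comp (tmk D D'))
    have hs (a b : A) (d : D) (d' : D') : g (lact D a d ⊗ₜ ract D' (op b) d') = a * g (d ⊗ₜ d') * b := by
      refine (congrArg (fun x => (toSelf (k := k) A).symm (e.hom.hom x)) (smul_tmk a b d d').symm).trans ?_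
      exact (congrArg _ (map_smul e.hom.hom _ _)).trans (smul_toSelf (k := k) a b (g (d ⊗ₜ d')))
    refine ⟨⟨g, fun c z => ?_⟩, fun d a d' => congrArg (fun x => (toSelf (k := k) A).symm (e.hom.hom x))
      (tmk_balanced d a d'), fun a d d' => ?_, fun b d d' => ?_, fun z hz => ?_, ?_⟩
    · change g (c • z) = c • g z
      induction z using TensorProduct.induction_on with
      | zero => simp
      | add x y hx hy => rw [smul_add, map_add, hx, hy, ← smul_add, ← map_add]
      | tmul d d' =>
        have := hs (algebraMap k A c) 1 d d'
        rwa [AlgHom.commutes, op_one, map_one, mul_one, ← Algebra.smul_def] at this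
    · simpa using hs a 1 d d'
    · simpa using hs 1 b d d'
    · exact he.1 (hz.trans (map_zero e.hom.hom).symm)
    · obtain ⟨x, hx⟩ := he.2 (toSelf A 1)
      obtain ⟨z, rfl⟩ := tmk_surjective D D' x
      exact ⟨z, hx⟩
  · rintro ⟨θ⟩
    let f : tensorBimod D D' →+ selfBimod k A := QuotientAddGroup.lift
      (balancing D D').toAddSubgroup ((toSelf A).toAddMonoidHom.comp θ.g.toAddMonoidHom)
      (fun z hz => eq_zero_of_tmk θ.g.toAddMonoidHom θ.balanced (tmk_eq_zero.2 hz))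
    have hf (z) : f (tmk D D' z) = toSelf A (θ.g z) := rfl
    have hs (r : Env k A) (x : tensorBimod D D') : f (r • x) = r • f x := by
      obtain ⟨z, rfl⟩ := tmk_surjective D D' x
      induction z using TensorProduct.induction_on with
      | zero => rw [map_zero, smul_zero, map_zero, smul_zero]
      | add x y hx hy => rw [map_add, smul_add, map_add, map_add, smul_add, hx, hy]
      | tmul d d' =>
        induction r using TensorProduct.induction_on with
        | zero =>
          rw [zero_smul (Env k A) (tmk D D' _), map_zero]
          exact (zero_smul (Env k A) (A := selfBimod k A) _).symm
        | add r s hr hs =>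
          rw [add_smul, map_add, hr, hs]
          exact (add_smul r s (f _)).symm
        | tmul a b =>
          rw [← op_unop b, smul_tmk, hf, hf, θ.left, θ.right, ← mul_assoc]
          exact (smul_toSelf a b.unop _).symm
    have hb : Function.Bijective f := by
      constructor
      · refine (injective_iff_map_eq_zero f).2 fun x hx => ?_
        obtain ⟨z, rfl⟩ := tmk_surjective D D' x
        exact θ.injective z hx
      · intro a
        obtain ⟨z, hz⟩ := θ.surjective
        obtain ⟨a, rfl⟩ := (toSelf (k := k) A).surjective a
        refine ⟨(a ⊗ₜ op 1 : Env k A) • tmk D D' z, ?_⟩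
        rw [hs, hf, hz, smul_toSelf, mul_one, mul_one]
    exact ⟨mkIso (AddEquiv.ofBijective f hb) hs⟩
end TensorBimod

/-- `D` is a progenerator as a right `A`-module, with endomorphism ring `A`: there are a finite dual
basis and a finite family exhibiting `1` as a sum of values of functionals. -/
structure IsMorita (D : Bimod k A) : Prop where
  dualBasis : ∃ (ι : Type u) (_ : Fintype ι) (x : ι → D) (φ : ι → D →ₗ[k] A),
    (∀ i b d, φ i (ract D (op b) d) = φ i d * b) ∧ ∀ d, ∑ i, ract D (op (φ i d)) (x i) = d
  generator : ∃ (ι : Type u) (_ : Fintype ι) (y : ι → D) (ψ : ι → D →ₗ[k] A),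
    (∀ i b d, ψ i (ract D (op b) d) = ψ i d * b) ∧ ∑ i, ψ i (y i) = 1
  faithful : ∀ a, (∀ d, lact D a d = 0) → a = 0
  full : ∀ u : D →ₗ[k] D, (∀ b d, u (ract D (op b) d) = ract D (op b) (u d)) →
    ∃ a, ∀ d, u d = lact D a d

lemma exists_fintype_sum {M N : Type u} [AddCommGroup M] [Module k M] [AddCommGroup N] [Module k N]
    (z : M ⊗[k] N) : ∃ (ι : Type u) (_ : Fintype ι) (x : ι → M) (y : ι → N), z = ∑ i, x i ⊗ₜ y i := by
  obtain ⟨S, hS⟩ := TensorProduct.exists_finset z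
  refine ⟨S, inferInstance, fun i => i.1.1, fun i => i.1.2, hS.trans ?_⟩
  exact (Finset.sum_coe_sort S fun i => i.1 ⊗ₜ[k] i.2).symm

lemma ract_algebraMap (D : Bimod k A) (c : k) (d : D) : ract D (op (algebraMap k A c)) d = c • d :=
  LinearMap.congr_fun ((ract D).commutes c) d

section ToMorita
variable {D D' : Bimod k A} (θ : PerfectPairing D D') (θ' : PerfectPairing D' D)

/-- The map `d ⊗ d' ↦ d ⟨d', e⟩`. -/
def contractR (e : D) : D ⊗[k] D' →ₗ[k] D :=
  TensorProduct.lift (((ract D).toLinearMap ∘ₗ opLin).flip.compl₂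
    (θ'.g ∘ₗ (TensorProduct.mk k D' D).flip e))

lemma contractR_tmul (e d : D) (d' : D') :
    contractR θ' e (d ⊗ₜ d') = ract D (op (θ'.g (d' ⊗ₜ e))) d := rfl

/-- The map `d' ⊗ y ↦ ⟨d, d'⟩ y`. -/
def contractL (d : D) : D' ⊗[k] D →ₗ[k] D :=
  TensorProduct.lift ((lact D).toLinearMap ∘ₗ θ.g ∘ₗ TensorProduct.mk k D D' d)

lemma contractL_tmul (d y : D) (d' : D') :
    contractL θ d (d' ⊗ₜ y) = lact D (θ.g (d ⊗ₜ d')) y := rfl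

lemma PerfectPairing.map_lact (a : A) (z : D ⊗[k] D') :
    θ.g (LinearMap.rTensor D' (lact D a) z) = a * θ.g z :=
  LinearMap.congr_fun (f := θ.g ∘ₗ LinearMap.rTensor D' (lact D a))
    (g := LinearMap.mulLeft k a ∘ₗ θ.g) (TensorProduct.ext' fun d d' => θ.left a d d') z

lemma PerfectPairing.map_ract (a : A) (z : D ⊗[k] D') :
    θ.g (LinearMap.lTensor D (ract D' (op a)) z) = θ.g z * a :=
  LinearMap.congr_fun (f := θ.g ∘ₗ LinearMap.lTensor D (ract D' (op a)))
    (g := LinearMap.mulRight k a ∘ₗ θ.g) (TensorProduct.ext' fun d d' => θ.right a d d') z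

lemma PerfectPairing.eq_of_eq {V : Type*} [AddCommGroup V] [Module k V] (f : D ⊗[k] D' →ₗ[k] V)
    (hf : ∀ d a d', f (ract D (op a) d ⊗ₜ d') = f (d ⊗ₜ lact D' a d')) {z w : D ⊗[k] D'}
    (h : θ.g z = θ.g w) : f z = f w := by
  rw [← sub_eq_zero, ← map_sub] at h ⊢
  exact eq_zero_of_tmk f.toAddMonoidHom hf (θ.injective _ h)

lemma contractR_balanced (e d : D) (a : A) (d' : D') : contractR θ' e (ract D (op a) d ⊗ₜ d') =
    contractR θ' e (d ⊗ₜ lact D' a d') := by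
  rw [contractR_tmul, contractR_tmul, θ'.left, op_mul, map_mul]
  rfl

lemma contractL_balanced (d y : D) (a : A) (d' : D') : contractL θ d (ract D' (op a) d' ⊗ₜ y) =
    contractL θ d (d' ⊗ₜ lact D a y) := by
  rw [contractL_tmul, contractL_tmul, θ.right, map_mul]
  rfl

lemma contractR_rTensor (e : D) (a : A) (z : D ⊗[k] D') :
    contractR θ' e (LinearMap.rTensor D' (lact D a) z) = lact D a (contractR θ' e z) :=
  LinearMap.congr_fun (f := contractR θ' e ∘ₗ LinearMap.rTensor D' (lact D a))
    (g := lact D a ∘ₗ contractR θ' e)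
    (TensorProduct.ext' fun d d' => (lact_ract D a (op (θ'.g (d' ⊗ₜ e))) d).symm) z

include θ θ' in
/-- If `1 = Σ ⟨x, p⟩`, then `⟨d, d'⟩ Σ x ⟨p, e⟩ = d ⟨d', e⟩`. -/
lemma lact_contractR (e : D) {X : D ⊗[k] D'} (hX : θ.g X = 1) (z : D ⊗[k] D') :
    lact D (θ.g z) (contractR θ' e X) = contractR θ' e z := by
  rw [← contractR_rTensor]
  refine θ.eq_of_eq _ (contractR_balanced θ' e) ?_
  rw [θ.map_lact, hX, mul_one]

lemma contractR_lact (e : D) (a : A) (z : D ⊗[k] D') : contractR θ' (lact D a e) z =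
    contractR θ' e (LinearMap.lTensor D (ract D' (op a)) z) :=
  LinearMap.congr_fun (f := contractR θ' (lact D a e))
    (g := contractR θ' e ∘ₗ LinearMap.lTensor D (ract D' (op a))) (TensorProduct.ext' fun d d' =>
      congrArg (fun b => ract D (op b) d) (θ'.balanced d' a e).symm) z

include θ θ' in
/-- A bimodule with an inverse is a progenerator on the right, with endomorphism ring `A`. -/
theorem isMorita_of_perfectPairing : IsMorita D := by
  obtain ⟨X, hX⟩ := θ.surjective
  obtain ⟨Y, hY⟩ := θ'.surjective
  let f (e : D) : D := contractR θ' e X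
  have hf (a : A) (e : D) : f (lact D a e) = lact D a (f e) := by
    change contractR θ' _ X = lact D a (contractR θ' e X)
    rw [contractR_lact, ← lact_contractR θ θ' e hX, θ.map_ract, hX, one_mul]
  have hfadd (d e : D) : f (d + e) = f d + f e := by
    have : contractR θ' (d + e) = contractR θ' d + contractR θ' e :=
      TensorProduct.ext' fun x y => by
        change ract D (op (θ'.g (y ⊗ₜ (d + e)))) x = ract D (op (θ'.g (y ⊗ₜ d))) x + ract D (op (θ'.g (y ⊗ₜ e))) x
        rw [TensorProduct.tmul_add, map_add]
        exact LinearMap.congr_fun (map_add (ract D) (op _) (op _)) x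
    exact LinearMap.congr_fun this X
  let g : D →ₗ[k] D :=
    { toFun := fun d => contractL θ d Y
      map_add' := fun d e => LinearMap.congr_fun (f := contractL θ (d + e))
        (g := contractL θ d + contractL θ e) (TensorProduct.ext' fun x y => by
          simp [contractL_tmul, TensorProduct.add_tmul]) Y
      map_smul' := fun c d => LinearMap.congr_fun (f := contractL θ (c • d))
        (g := c • contractL θ d) (TensorProduct.ext' fun x y => by
          rw [LinearMap.smul_apply, contractL_tmul, contractL_tmul, ← TensorProduct.smul_tmul',
            map_smul, map_smul, LinearMap.smul_apply]) Y }
  have hfg (d : D) : f (g d) = d := by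
    have h1 (z : D' ⊗[k] D) : f (contractL θ d z) = ract D (op (θ'.g z)) d := by
      induction z using TensorProduct.induction_on with
      | zero =>
        rw [map_zero, map_zero, op_zero, map_zero]
        simpa using hfadd 0 0
      | add x y hx hy =>
        rw [map_add, hfadd, hx, hy, map_add]
        exact (LinearMap.congr_fun (map_add (ract D) (op _) (op _)) d).symm
      | tmul d' y => rw [contractL_tmul, hf, lact_contractR θ θ' y hX, contractR_tmul]
    exact (h1 Y).trans (by rw [hY, op_one, map_one]; rfl)
  have hg (b : A) (d : D) : g (ract D (op b) d) = ract D (op b) (g d) := by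
    have h1 : contractL θ (ract D (op b) d) =
        contractL θ d ∘ₗ LinearMap.rTensor D (lact D' b) :=
      TensorProduct.ext' fun x y => congrArg (fun a => lact D a y) (θ.balanced d b x)
    have h2 : ract D (op b) ∘ₗ contractL θ d =
        contractL θ d ∘ₗ LinearMap.lTensor D' (ract D (op b)) :=
      TensorProduct.ext' fun x y => (lact_ract D _ (op b) y).symm
    refine (LinearMap.congr_fun h1 Y).trans (Eq.trans ?_ (LinearMap.congr_fun h2 Y).symm)
    refine θ'.eq_of_eq _ (fun x a y => contractL_balanced θ d y a x) ?_
    rw [θ'.map_lact, θ'.map_ract, hY, one_mul, mul_one]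
  refine ⟨?_, ?_, fun a ha => ?_, fun u hu => ?_⟩
  · obtain ⟨ι, hι, x, p, h⟩ := exists_fintype_sum X
    refine ⟨ι, hι, x, fun i => θ'.g ∘ₗ TensorProduct.mk k D' D (p i) ∘ₗ g, fun i b d => ?_,
      fun d => ?_⟩
    · exact (congrArg (fun y => θ'.g (p i ⊗ₜ y)) (hg b d)).trans (θ'.right b (p i) (g d))
    · refine Eq.trans ?_ (hfg d)
      change _ = contractR θ' (g d) X
      rw [h, map_sum]
      rfl
  · obtain ⟨ι, hι, q, y, h⟩ := exists_fintype_sum Y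
    refine ⟨ι, hι, y, fun i => θ'.g ∘ₗ TensorProduct.mk k D' D (q i), fun i b d =>
      θ'.right b (q i) d, ?_⟩
    rw [← hY, h, map_sum]
    rfl
  · have h1 : lact D a = 0 := LinearMap.ext ha
    rw [← mul_one a, ← hX, ← θ.map_lact, h1, LinearMap.rTensor_zero, LinearMap.zero_apply, map_zero]
  · refine ⟨θ.g (LinearMap.rTensor D' u X), fun d => ?_⟩
    rw [← hfg d]
    change _ = lact D _ (contractR θ' (g d) X)
    rw [lact_contractR θ θ' (g d) hX]
    exact LinearMap.congr_fun (f := u ∘ₗ contractR θ' (g d))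
      (g := contractR θ' (g d) ∘ₗ LinearMap.rTensor D' u) (TensorProduct.ext' fun x y => hu _ x) X

end ToMorita

section OfMorita
variable (D : Bimod k A)

/-- The right `A`-linear maps `D → A`. -/
def rightDual : Submodule k (D →ₗ[k] A) where
  carrier := {φ | ∀ b d, φ (ract D (op b) d) = φ d * b}
  add_mem' := fun hφ hψ b d => by
    rw [LinearMap.add_apply, LinearMap.add_apply, hφ b d, hψ b d, add_mul]
  zero_mem' := fun b d => by simp
  smul_mem' := fun c φ hφ b d => by
    rw [LinearMap.smul_apply, LinearMap.smul_apply, hφ b d, smul_mul_assoc]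

/-- Left multiplication on `Hom_A(D, A)`: `(a φ) d = a φ(d)`. -/
def dualLeft : A →ₐ[k] Module.End k (rightDual D) :=
  AlgHom.ofLinearMap
    { toFun := fun a => (LinearMap.llcomp k D A A (LinearMap.mulLeft k a)).restrict
        fun (φ : D →ₗ[k] A) (hφ : φ ∈ rightDual D) b d =>
          (congrArg (a * ·) (hφ b d)).trans (mul_assoc _ _ _).symm
      map_add' := fun a b => LinearMap.ext fun φ => Subtype.ext (LinearMap.ext fun d =>
        add_mul a b (φ.1 d))
      map_smul' := fun c a => LinearMap.ext fun φ => Subtype.ext (LinearMap.ext fun d =>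
        smul_mul_assoc c a (φ.1 d)) }
    (LinearMap.ext fun φ => Subtype.ext (LinearMap.ext fun d => one_mul (φ.1 d)))
    fun a b => LinearMap.ext fun φ => Subtype.ext (LinearMap.ext fun d => mul_assoc a b (φ.1 d))

/-- Right multiplication on `Hom_A(D, A)`: `(φ b) d = φ(b d)`. -/
def dualRight : Aᵐᵒᵖ →ₐ[k] Module.End k (rightDual D) :=
  AlgHom.ofLinearMap
    { toFun := fun b => ((LinearMap.llcomp k D D A).flip (lact D b.unop)).restrict
        fun (φ : D →ₗ[k] A) (hφ : φ ∈ rightDual D) c d =>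
          (congrArg φ (lact_ract D b.unop (op c) d)).trans (hφ c _)
      map_add' := fun a b => LinearMap.ext fun φ => Subtype.ext (LinearMap.ext fun d =>
        (congrArg (fun f : Module.End k D => φ.1 (f d)) (map_add (lact D) a.unop b.unop)).trans
          (map_add φ.1 _ _))
      map_smul' := fun c a => LinearMap.ext fun φ => Subtype.ext (LinearMap.ext fun d =>
        (congrArg (fun f : Module.End k D => φ.1 (f d)) (map_smul (lact D) c a.unop)).trans
          (map_smul φ.1 _ _)) }
    (LinearMap.ext fun φ => Subtype.ext (LinearMap.ext fun d =>
      congrArg (fun f : Module.End k D => φ.1 (f d)) (map_one (lact D))))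
    fun a b => LinearMap.ext fun φ => Subtype.ext (LinearMap.ext fun d =>
      congrArg (fun f : Module.End k D => φ.1 (f d)) (map_mul (lact D) b.unop a.unop))

lemma dual_commute (a : A) (b : Aᵐᵒᵖ) : Commute (dualLeft D a) (dualRight D b) :=
  LinearMap.ext fun _ => rfl

/-- The bimodule `Hom_A(D, A)`, with `(a φ b) d = a φ(b d)`. -/
def dualBimod : Bimod k A :=
  mkBimod (rightDual D) (dualLeft D) (dualRight D) (dual_commute D)

/-- A functional, as an element of the dual bimodule. -/
def toDual : rightDual D ≃ₗ[k] dualBimod D where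
  toFun := fun φ => φ
  invFun := fun φ => φ
  map_add' := fun _ _ => rfl
  map_smul' := fun c φ => (LinearMap.congr_fun
    ((Algebra.TensorProduct.lift (dualLeft D) (dualRight D) (dual_commute D)).commutes c) φ).symm

lemma lact_toDual (a : A) (φ : rightDual D) :
    lact (dualBimod D) a (toDual D φ) = toDual D (dualLeft D a φ) :=
  LinearMap.congr_fun (congrArg (fun f => f) (show _ = dualLeft D a * dualRight D 1 from
    Algebra.TensorProduct.lift_tmul (dualLeft D) (dualRight D) (dual_commute D) a 1)) φ |>.trans (by
      rw [map_one]; rfl)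

lemma ract_toDual (b : A) (φ : rightDual D) :
    ract (dualBimod D) (op b) (toDual D φ) = toDual D (dualRight D (op b) φ) :=
  LinearMap.congr_fun (congrArg (fun f => f) (show _ = dualLeft D 1 * dualRight D (op b) from
    Algebra.TensorProduct.lift_tmul (dualLeft D) (dualRight D) (dual_commute D) 1 (op b))) φ |>.trans (by
      rw [map_one]; rfl)

variable {D}

/-- Evaluation `Hom_A(D, A) ⊗_A D → A` is an isomorphism. -/
theorem IsMorita.evalPairing (hD : IsMorita D) : Nonempty (PerfectPairing (dualBimod D) D) := by
  obtain ⟨ι, hι, y, ψ, hψ, h1⟩ := hD.generator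
  let g : dualBimod D ⊗[k] D →ₗ[k] A := TensorProduct.lift
    ((rightDual D).subtype ∘ₗ (toDual D).symm.toLinearMap)
  have hg (φ : rightDual D) (d : D) : g (toDual D φ ⊗ₜ d) = φ.1 d := rfl
  let ψ' (i : ι) : rightDual D := ⟨ψ i, hψ i⟩
  have key (z : dualBimod D ⊗[k] D) :
      tmk _ _ z = ∑ i, tmk _ _ (toDual D (ψ' i) ⊗ₜ[k] ract D (op (g z)) (y i)) := by
    induction z using TensorProduct.induction_on with
    | zero => simp
    | add z w hz hw =>
      rw [map_add, hz, hw, ← Finset.sum_add_distrib]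
      refine Finset.sum_congr rfl fun i _ => ?_
      rw [map_add g, ← map_add, ← TensorProduct.tmul_add]
      refine congrArg (fun x => tmk _ _ (toDual D (ψ' i) ⊗ₜ[k] x)) ?_
      exact (LinearMap.congr_fun (map_add (ract D) (op _) (op _)) (y i)).symm
    | tmul φ d =>
      obtain ⟨φ, rfl⟩ := (toDual D).surjective φ
      have hu (i : ι) := hD.full ((ract D).toLinearMap.flip (y i) ∘ₗ opLin ∘ₗ φ.1) fun b e => by
        change ract D (op (φ.1 _)) (y i) = ract D (op b) (ract D (op (φ.1 e)) (y i))
        rw [φ.2 b e, op_mul, map_mul]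
        rfl
      choose a ha using hu
      replace ha (i : ι) (e : D) : ract D (op (φ.1 e)) (y i) = lact D (a i) e := ha i e
      have hφ : φ = ∑ i, dualRight D (op (a i)) (ψ' i) := by
        refine Subtype.ext (LinearMap.ext fun e => ?_)
        rw [AddSubmonoidClass.coe_finsetSum, LinearMap.sum_apply]
        change φ.1 e = ∑ i, ψ i (lact D (a i) e)
        simp_rw [← ha, hψ, ← Finset.sum_mul, h1, one_mul]
      rw [hg]
      simp_rw [ha, ← tmk_balanced, ract_toDual]
      rw [← map_sum, ← TensorProduct.sum_tmul, ← map_sum, ← hφ]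
  refine ⟨⟨g, fun φ a d => ?_, fun a φ d => ?_, fun b φ d => φ.2 b d, fun z hz => ?_,
    ∑ i, toDual D (ψ' i) ⊗ₜ y i, ?_⟩⟩
  · obtain ⟨φ, rfl⟩ := (toDual D).surjective φ
    rw [ract_toDual]
    rfl
  · obtain ⟨φ, rfl⟩ := (toDual D).surjective φ
    rw [lact_toDual]
    rfl
  · rw [key, hz]
    simp
  · rw [map_sum]
    exact h1

/-- `D ⊗_A Hom_A(D, A)` is `End_A(D) = A`. -/
theorem IsMorita.endPairing (hD : IsMorita D) : Nonempty (PerfectPairing D (dualBimod D)) := by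
  obtain ⟨ι, hι, x, p, hp, h1⟩ := hD.dualBasis
  have hinj : Function.Injective (lact D).toLinearMap :=
    (injective_iff_map_eq_zero _).2 fun a ha => hD.faithful a (LinearMap.congr_fun ha)
  have inj (a b : A) (h : ∀ e, lact D a e = lact D b e) : a = b := hinj (LinearMap.ext h)
  let m : D ⊗[k] dualBimod D →ₗ[k] Module.End k D := TensorProduct.lift
    (LinearMap.mk₂ k (fun d φ => (ract D).toLinearMap.flip d ∘ₗ opLin ∘ₗ ((toDual D).symm φ).1)
      (fun d d' φ => LinearMap.ext fun e => map_add (ract D (op (((toDual D).symm φ).1 e))) d d')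
      (fun c d φ => LinearMap.ext fun e => map_smul (ract D (op (((toDual D).symm φ).1 e))) c d)
      (fun d φ φ' => LinearMap.ext fun e =>
        LinearMap.congr_fun (map_add (ract D) (op (((toDual D).symm φ).1 e)) (op _)) d)
      (fun c d φ => LinearMap.ext fun e => by
        rw [map_smul]
        exact LinearMap.congr_fun (map_smul (ract D) c (op (((toDual D).symm φ).1 e))) d))
  have hm (d : D) (φ : rightDual D) (e : D) :
      m (d ⊗ₜ toDual D φ) e = ract D (op (φ.1 e)) d := rfl
  have hmem (z) : m z ∈ LinearMap.range (lact D).toLinearMap := by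
    induction z using TensorProduct.induction_on with
    | zero => rw [map_zero]; exact zero_mem _
    | add z w hz hw => rw [map_add]; exact add_mem hz hw
    | tmul d φ =>
      obtain ⟨φ, rfl⟩ := (toDual D).surjective φ
      obtain ⟨a, ha⟩ := hD.full (m (d ⊗ₜ toDual D φ)) fun b e => by
        rw [hm, hm, φ.2 b e, op_mul, map_mul]
        rfl
      exact ⟨a, (LinearMap.ext ha).symm⟩
  let g : D ⊗[k] dualBimod D →ₗ[k] A :=
    (LinearEquiv.ofInjective _ hinj).symm.toLinearMap ∘ₗ m.codRestrict _ hmem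
  have hgm (z) (e : D) : lact D (g z) e = m z e :=
    LinearMap.congr_fun (congrArg Subtype.val
      ((LinearEquiv.ofInjective _ hinj).apply_symm_apply (m.codRestrict _ hmem z))) e
  have hg (d : D) (φ : rightDual D) (e : D) :
      lact D (g (d ⊗ₜ toDual D φ)) e = ract D (op (φ.1 e)) d := hgm _ _
  let p' (i : ι) : rightDual D := ⟨p i, hp i⟩
  have key (z : D ⊗[k] dualBimod D) :
      tmk _ _ z = ∑ i, tmk _ _ (lact D (g z) (x i) ⊗ₜ[k] toDual D (p' i)) := by
    induction z using TensorProduct.induction_on with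
    | zero => simp
    | add z w hz hw =>
      rw [map_add, hz, hw, ← Finset.sum_add_distrib]
      refine Finset.sum_congr rfl fun i _ => ?_
      rw [map_add g, map_add (lact D), LinearMap.add_apply, TensorProduct.add_tmul, map_add]
    | tmul d φ =>
      obtain ⟨φ, rfl⟩ := (toDual D).surjective φ
      have hφ : φ = ∑ i, dualLeft D (φ.1 (x i)) (p' i) := by
        refine Subtype.ext (LinearMap.ext fun e => ?_)
        rw [AddSubmonoidClass.coe_finsetSum, LinearMap.sum_apply]
        change φ.1 e = ∑ i, φ.1 (x i) * p i e
        simp_rw [← φ.2 _ _, ← map_sum, h1]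
      simp_rw [hg, tmk_balanced, lact_toDual]
      rw [← map_sum, ← TensorProduct.tmul_sum, ← map_sum, ← hφ]
  refine ⟨⟨g, fun d a φ => inj _ _ fun e => ?_, fun a d φ => inj _ _ fun e => ?_,
    fun b d φ => inj _ _ fun e => ?_, fun z hz => ?_,
    ∑ i, x i ⊗ₜ toDual D (p' i), inj _ _ fun e => ?_⟩⟩
  · obtain ⟨φ, rfl⟩ := (toDual D).surjective φ
    rw [lact_toDual, hg, hg]
    change _ = ract D (op (a * φ.1 e)) d
    rw [op_mul, map_mul]
    rfl
  · obtain ⟨φ, rfl⟩ := (toDual D).surjective φ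
    rw [hg, map_mul, Module.End.mul_apply, hg, lact_ract]
  · obtain ⟨φ, rfl⟩ := (toDual D).surjective φ
    rw [ract_toDual, hg, map_mul, Module.End.mul_apply, hg]
    rfl
  · rw [key, hz]
    simp
  · rw [hgm, map_sum, LinearMap.sum_apply, map_one]
    exact h1 e

/-- The inverse of `D` is `Hom_A(D, A)`. -/
theorem isInvertible_iff_isMorita : IsInvertible D ↔ IsMorita D := by
  constructor
  · rintro ⟨D', h, h'⟩
    exact isMorita_of_perfectPairing (nonempty_iso_iff.1 h).some (nonempty_iso_iff.1 h').some
  · intro hD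
    exact ⟨dualBimod D, nonempty_iso_iff.2 hD.endPairing, nonempty_iso_iff.2 hD.evalPairing⟩

end OfMorita
end Invertible
end SmashDuality

/-! ### Twisted inductions and invertibility -/

namespace SmashDuality
section Transfer
open MulOpposite HopfAlgebra
variable {k H A : Type u} [Field k] [Ring H] [HopfAlgebra k H] [Ring A] [Algebra k A]
  {α : HopfAction k H A} {Λ : Type u} [Ring Λ] [Algebra k Λ] {P : SmashPair α Λ}

lemma ract_mul (D : Bimod k A) (a b : A) (d : D) :
    ract D (op (a * b)) d = ract D (op b) (ract D (op a) d) := by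
  rw [op_mul, map_mul]
  rfl

lemma ract_add (D : Bimod k A) (a b : A) (d : D) :
    ract D (op (a + b)) d = ract D (op a) d + ract D (op b) d :=
  LinearMap.congr_fun (map_add (ract D) (op a) (op b)) d

lemma ract_sum (D : Bimod k A) {ι : Type*} (s : Finset ι) (a : ι → A) (d : D) :
    ract D (op (∑ i ∈ s, a i)) d = ∑ i ∈ s, ract D (op (a i)) d :=
  map_sum ((ract D).toLinearMap.flip d ∘ₗ opLin) a s

namespace SmashPair
variable (P)

/-- The map `i(a) j(h) ↦ ε(h) a`. -/
def counitRight : Λ →ₗ[k] A :=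
  (TensorProduct.rid k A).toLinearMap ∘ₗ LinearMap.lTensor A counit ∘ₗ P.μ.symm.toLinearMap

lemma counitRight_μ (a : A) (h : H) : P.counitRight (P.μ (a ⊗ₜ h)) = counit (R := k) h • a := by
  simp [counitRight]

lemma counitRight_i (a : A) : P.counitRight (P.i a) = a := by
  have := P.counitRight_μ a 1
  rwa [μ_tmul, map_one, mul_one, Bialgebra.counit_one, one_smul] at this

variable (hS : Function.Bijective (antipode k (A := H)))

/-- The map `j(h) i(a) ↦ ε(h) a`. -/
def counitLeft : Λ →ₗ[k] A :=
  (TensorProduct.lid k A).toLinearMap ∘ₗ LinearMap.rTensor A counit ∘ₗ (P.ν hS).symm.toLinearMap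

lemma counitLeft_ν (h : H) (a : A) :
    P.counitLeft hS (P.ν hS (h ⊗ₜ a)) = counit (R := k) h • a := by
  simp [counitLeft]

lemma counitLeft_one : P.counitLeft hS 1 = 1 := by
  have := P.counitLeft_ν hS 1 1
  rwa [ν_tmul, map_one, map_one, mul_one, Bialgebra.counit_one, one_smul] at this

lemma ν_mul_i (t : H ⊗[k] A) (b : A) :
    P.ν hS t * P.i b = P.ν hS (LinearMap.lTensor H (LinearMap.mulRight k b) t) := by
  refine LinearMap.congr_fun (f := LinearMap.mulRight k (P.i b) ∘ₗ (P.ν hS).toLinearMap)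
    (g := (P.ν hS).toLinearMap ∘ₗ LinearMap.lTensor H (LinearMap.mulRight k b))
    (TensorProduct.ext' fun h a => ?_) t
  change P.ν hS (h ⊗ₜ a) * P.i b = P.ν hS (h ⊗ₜ (a * b))
  rw [ν_tmul, ν_tmul, map_mul, mul_assoc]

lemma counitLeft_mul_i (x : Λ) (b : A) :
    P.counitLeft hS (x * P.i b) = P.counitLeft hS x * b := by
  obtain ⟨t, rfl⟩ := (P.ν hS).surjective x
  induction t using TensorProduct.induction_on with
  | zero => simp
  | add x y hx hy => rw [map_add, add_mul, map_add, hx, hy, map_add, add_mul]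
  | tmul h a =>
    rw [ν_mul_i, LinearMap.lTensor_tmul, counitLeft_ν, counitLeft_ν, LinearMap.mulRight_apply,
      smul_mul_assoc]

/-- The index type of a basis of `H`. -/
abbrev BasisIndex (k H : Type u) [Field k] [Ring H] [Algebra k H] : Type u :=
  Module.Basis.ofVectorSpaceIndex k H

/-- A basis of `H`. -/
abbrev basis (k H : Type u) [Field k] [Ring H] [Algebra k H] : Module.Basis (BasisIndex k H) k H :=
  Module.Basis.ofVectorSpace k H

/-- The coordinates of the elements of `H ⊗ M`. -/
def coord (k H : Type u) [Field k] [Ring H] [Algebra k H] (M : Type u) [AddCommGroup M]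
    [Module k M] (s : BasisIndex k H) : H ⊗[k] M →ₗ[k] M :=
  (TensorProduct.lid k M).toLinearMap ∘ₗ LinearMap.rTensor M ((basis k H).coord s)

lemma coord_tmul {M : Type u} [AddCommGroup M] [Module k M] (s : BasisIndex k H) (h : H) (m : M) :
    coord k H M s (h ⊗ₜ m) = (basis k H).coord s h • m := rfl

lemma coord_lTensor {M N : Type u} [AddCommGroup M] [Module k M] [AddCommGroup N] [Module k N]
    (f : M →ₗ[k] N) (s : BasisIndex k H) (t : H ⊗[k] M) :
    coord k H N s (LinearMap.lTensor H f t) = f (coord k H M s t) :=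
  LinearMap.congr_fun (f := coord k H N s ∘ₗ LinearMap.lTensor H f) (g := f ∘ₗ coord k H M s)
    (TensorProduct.ext' fun h m => (map_smul f _ m).symm) t

lemma exists_coord_support {M : Type u} [AddCommGroup M] [Module k M] (t : H ⊗[k] M) :
    ∃ T : Finset (BasisIndex k H), ∀ s ∉ T, coord k H M s t = 0 := by
  classical
  induction t using TensorProduct.induction_on with
  | zero => exact ⟨∅, by simp⟩
  | add x y hx hy =>
    obtain ⟨T, hT⟩ := hx
    obtain ⟨T', hT'⟩ := hy
    refine ⟨T ∪ T', fun s hs => ?_⟩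
    rw [Finset.mem_union, not_or] at hs
    rw [map_add, hT s hs.1, hT' s hs.2, add_zero]
  | tmul h m =>
    refine ⟨((basis k H).repr h).support, fun s hs => ?_⟩
    rw [coord_tmul, Module.Basis.coord_apply, Finsupp.notMem_support_iff.1 hs, zero_smul]

lemma eq_sum_coord {M : Type u} [AddCommGroup M] [Module k M] {T : Finset (BasisIndex k H)}
    {t : H ⊗[k] M} (hT : ∀ s ∉ T, coord k H M s t = 0) :
    t = ∑ s ∈ T, basis k H s ⊗ₜ coord k H M s t := by
  classical
  have h1 (t : H ⊗[k] M) (s) : TensorProduct.equivFinsuppOfBasisLeft (basis k H) t s =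
      coord k H M s t := by
    induction t using TensorProduct.induction_on with
    | zero => simp
    | add x y hx hy => rw [map_add, map_add, Finsupp.add_apply, hx, hy]
    | tmul h m => rw [TensorProduct.equivFinsuppOfBasisLeft_apply_tmul_apply, coord_tmul]; rfl
  have h2 := (TensorProduct.equivFinsuppOfBasisLeft (N := M) (basis k H)).symm_apply_apply t
  rw [TensorProduct.equivFinsuppOfBasisLeft_symm_apply] at h2
  rw [← h2]
  refine (Finset.sum_subset (fun s hs => ?_) fun s _ hs => ?_).trans
    (Finset.sum_congr rfl fun s _ => by rw [h2, h1])
  · by_contra h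
    exact Finsupp.mem_support_iff.1 hs ((h1 t s).trans (hT s h))
  · rw [Finsupp.notMem_support_iff.1 hs]
    exact TensorProduct.tmul_zero _ _

lemma eq_zero_of_coord {M : Type u} [AddCommGroup M] [Module k M]
    {t : H ⊗[k] M} (ht : ∀ s, coord k H M s t = 0) : t = 0 := by
  rw [eq_sum_coord (T := ∅) fun s _ => ht s, Finset.sum_empty]

end SmashPair
open SmashPair

namespace IsTwistedInduction
variable {D : Bimod k A} {X : Bimod k Λ} {β : EquivariantStr α (antipodeSq k H) D}
  {σ : H ≃ₐ[k] H} {ψ : D →ₗ[k] X} (hψ : IsTwistedInduction P β σ ψ)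
  (hS : Function.Bijective (antipode k (A := H)))

section Right
include hψ
lemma induction {p : X → Prop} (x : X) (h : ∀ d l, p (ract X (op l) (ψ d)))
    (h0 : p 0) (hadd : ∀ x y, p x → p y → p (x + y)) : p x := by
  obtain ⟨t, rfl⟩ := hψ.bijective.2 x
  induction t using TensorProduct.induction_on with
  | zero => rwa [map_zero]
  | add x y hx hy => rw [map_add]; exact hadd _ _ hx hy
  | tmul d l => exact h _ _

/-- The extension of a map on `D` to a map on `D ⊗ H`. -/
def equivTensor : D ⊗[k] H ≃ₗ[k] X := LinearEquiv.ofBijective _ hψ.bijective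

/-- The map `X → Λ`, `ψ(d) λ ↦ i(φ(d)) λ`. -/
def extendDual (φ : D →ₗ[k] A) : X →ₗ[k] Λ :=
  P.μ.toLinearMap ∘ₗ LinearMap.rTensor H φ ∘ₗ hψ.equivTensor.symm.toLinearMap

/-- The map `X → X`, `ψ(d) λ ↦ ψ(u(d)) λ`. -/
def extendEnd (u : D →ₗ[k] D) : X →ₗ[k] X :=
  hψ.equivTensor.toLinearMap ∘ₗ LinearMap.rTensor H u ∘ₗ hψ.equivTensor.symm.toLinearMap

/-- The map `X → D`, `ψ(d) j(l) ↦ ε(l) d`. -/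
def counitRight : X →ₗ[k] D :=
  (TensorProduct.rid k D).toLinearMap ∘ₗ LinearMap.lTensor D counit ∘ₗ
    hψ.equivTensor.symm.toLinearMap

lemma equivTensor_symm (d : D) (v : A ⊗[k] H) :
    hψ.equivTensor.symm (ract X (op (P.μ v)) (ψ d)) = pushRight H D d v := by
  rw [LinearEquiv.symm_apply_eq]
  exact (hψ.rExt_pushRight d v).symm

lemma extendDual_apply {φ : D →ₗ[k] A} (hφ : ∀ b d, φ (ract D (op b) d) = φ d * b) (d : D) (l : Λ) :
    hψ.extendDual φ (ract X (op l) (ψ d)) = P.i (φ d) * l := by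
  obtain ⟨v, rfl⟩ := P.μ.surjective l
  change P.μ (LinearMap.rTensor H φ (hψ.equivTensor.symm _)) = _
  rw [equivTensor_symm]
  induction v using TensorProduct.induction_on with
  | zero => simp
  | add x y hx hy => rw [map_add, map_add, map_add, map_add, mul_add, hx, hy]
  | tmul a h =>
    rw [pushRight_tmul, LinearMap.rTensor_tmul, hφ, μ_tmul, μ_tmul, map_mul, mul_assoc]

lemma extendEnd_apply {u : D →ₗ[k] D} (hu : ∀ b d, u (ract D (op b) d) = ract D (op b) (u d))
    (d : D) (l : Λ) : hψ.extendEnd u (ract X (op l) (ψ d)) = ract X (op l) (ψ (u d)) := by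
  obtain ⟨v, rfl⟩ := P.μ.surjective l
  change hψ.equivTensor (LinearMap.rTensor H u (hψ.equivTensor.symm _)) = _
  rw [equivTensor_symm, ← LinearEquiv.eq_symm_apply, equivTensor_symm]
  induction v using TensorProduct.induction_on with
  | zero => simp
  | add x y hx hy => rw [map_add, map_add, map_add, hx, hy]
  | tmul a h => rw [pushRight_tmul, LinearMap.rTensor_tmul, hu, pushRight_tmul]

lemma counitRight_apply (d : D) (l : Λ) :
    hψ.counitRight (ract X (op l) (ψ d)) = ract D (op (P.counitRight l)) d := by
  obtain ⟨v, rfl⟩ := P.μ.surjective l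
  change TensorProduct.rid k D (LinearMap.lTensor D counit (hψ.equivTensor.symm _)) = _
  rw [equivTensor_symm]
  induction v using TensorProduct.induction_on with
  | zero => simp
  | add x y hx hy =>
    rw [map_add, map_add, map_add, map_add, map_add, hx, hy]
    exact (LinearMap.congr_fun (map_add (ract D) (op _) (op _)) d).symm
  | tmul a h =>
    rw [pushRight_tmul, LinearMap.lTensor_tmul, TensorProduct.rid_tmul, counitRight_μ]
    exact (LinearMap.congr_fun (map_smul (ract D) (counit (R := k) h) (op a)) d).symm

lemma eq_of_eq {V : Type*} [AddCommGroup V] {f g : X →+ V}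
    (h : ∀ d l, f (ract X (op l) (ψ d)) = g (ract X (op l) (ψ d))) : f = g := by
  refine AddMonoidHom.ext fun x => hψ.induction (p := fun x => f x = g x) x h ?_ fun x y hx hy => ?_
  · rw [map_zero, map_zero]
  · rw [map_add, map_add, hx, hy]
end Right

section Left
include hψ

include hS in
lemma actMap_bijective : Function.Bijective (actMap (P.lj X).toLinearMap ψ) := by
  have h1 : actMap (P.lj X).toLinearMap ψ = P.rExt ψ ∘ₗ
      (TensorProduct.congr (LinearEquiv.refl k D) σ.toLinearEquiv).toLinearMap ∘ₗ
        twistL β.act.toLinearMap ∘ₗ (TensorProduct.comm k H D).toLinearMap := by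
    refine TensorProduct.ext' fun h d => ?_
    have h2 := hψ.map_lj h (d ⊗ₜ 1)
    rw [rExt_tmul, map_one, op_one, map_one, Module.End.one_apply] at h2
    refine h2.trans (congrArg (P.rExt ψ) ?_)
    rw [diagRep_tmul]
    refine Eq.trans ?_ (congrArg (TensorProduct.congr (LinearEquiv.refl k D) σ.toLinearEquiv)
      (twistL_tmul β.act.toLinearMap d h)).symm
    rw [cv_apply, cv_apply, map_sum]
    refine Finset.sum_congr rfl fun i _ => ?_
    exact congrArg (fun x => _ ⊗ₜ[k] x) (mul_one _)
  rw [h1, LinearMap.coe_comp, LinearMap.coe_comp, LinearMap.coe_comp]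
  exact hψ.bijective.comp ((LinearEquiv.bijective _).comp
    ((twistL_bijective hS β.act).comp (LinearEquiv.bijective _)))

/-- The bijection `h ⊗ d ↦ j(h) ψ(d)`. -/
def leftEquiv : H ⊗[k] D ≃ₗ[k] X := LinearEquiv.ofBijective _ (hψ.actMap_bijective hS)

lemma leftEquiv_tmul (h : H) (d : D) : hψ.leftEquiv hS (h ⊗ₜ d) = lact X (P.j h) (ψ d) := rfl

lemma leftEquiv_ract (b : A) (t : H ⊗[k] D) : ract X (op (P.i b)) (hψ.leftEquiv hS t) =
    hψ.leftEquiv hS (LinearMap.lTensor H (ract D (op b)) t) := by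
  refine LinearMap.congr_fun (f := ract X (op (P.i b)) ∘ₗ (hψ.leftEquiv hS).toLinearMap)
    (g := (hψ.leftEquiv hS).toLinearMap ∘ₗ LinearMap.lTensor H (ract D (op b)))
    (TensorProduct.ext' fun h d => ?_) t
  change ract X (op (P.i b)) (lact X (P.j h) (ψ d)) = lact X (P.j h) (ψ (ract D (op b) d))
  rw [hψ.map_ract, lact_ract]

lemma leftEquiv_symm_ract (b : A) (x : X) : (hψ.leftEquiv hS).symm (ract X (op (P.i b)) x) =
    LinearMap.lTensor H (ract D (op b)) ((hψ.leftEquiv hS).symm x) := by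
  rw [LinearEquiv.symm_apply_eq, ← leftEquiv_ract, LinearEquiv.apply_symm_apply]

lemma lact_ν (t : H ⊗[k] A) (d : D) : lact X (P.ν hS t) (ψ d) =
    hψ.leftEquiv hS (LinearMap.lTensor H ((lact D).toLinearMap.flip d) t) := by
  refine LinearMap.congr_fun (f := (lact X).toLinearMap.flip (ψ d) ∘ₗ (P.ν hS).toLinearMap)
    (g := (hψ.leftEquiv hS).toLinearMap ∘ₗ LinearMap.lTensor H ((lact D).toLinearMap.flip d))
    (TensorProduct.ext' fun h a => ?_) t
  change lact X (P.ν hS (h ⊗ₜ a)) (ψ d) = lact X (P.j h) (ψ (lact D a d))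
  rw [P.ν_tmul, map_mul, hψ.map_lact]
  rfl

/-- The map `X → D`, `j(h) ψ(d) ↦ ε(h) d`. -/
def counitLeft : X →ₗ[k] D :=
  (TensorProduct.lid k D).toLinearMap ∘ₗ LinearMap.rTensor D counit ∘ₗ
    (hψ.leftEquiv hS).symm.toLinearMap

lemma counitLeft_leftEquiv (t : H ⊗[k] D) : hψ.counitLeft hS (hψ.leftEquiv hS t) =
    TensorProduct.lid k D (LinearMap.rTensor D counit t) := by
  simp [counitLeft]

lemma counitLeft_ψ (d : D) : hψ.counitLeft hS (ψ d) = d := by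
  have := hψ.counitLeft_leftEquiv hS (1 ⊗ₜ d)
  rw [leftEquiv_tmul, map_one, map_one, Module.End.one_apply] at this
  rw [this]
  simp

lemma counitLeft_ract (b : A) (x : X) : hψ.counitLeft hS (ract X (op (P.i b)) x) =
    ract D (op b) (hψ.counitLeft hS x) := by
  obtain ⟨t, rfl⟩ := (hψ.leftEquiv hS).surjective x
  rw [leftEquiv_ract, counitLeft_leftEquiv, counitLeft_leftEquiv]
  refine LinearMap.congr_fun (f := (TensorProduct.lid k D).toLinearMap ∘ₗ LinearMap.rTensor D counit ∘ₗ
      LinearMap.lTensor H (ract D (op b)))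
    (g := ract D (op b) ∘ₗ (TensorProduct.lid k D).toLinearMap ∘ₗ LinearMap.rTensor D counit)
    (TensorProduct.ext' fun h d => ?_) t
  exact (map_smul (ract D (op b)) (counit (R := k) h) d).symm

include hS in
/-- If `D` is a progenerator with endomorphism ring `A`, then `D ♯ ^σH` is one with endomorphism ring
`Λ`. -/
theorem isMorita (hD : IsMorita D) : IsMorita X := by
  classical
  obtain ⟨ι, hι, x, φ, hφ, h1⟩ := hD.dualBasis
  refine ⟨⟨ι, hι, fun i => ψ (x i), fun i => hψ.extendDual (φ i), fun i l y => ?_, fun y => ?_⟩,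
    ?_, fun l hl => ?_, fun u hu => ?_⟩
  · refine DFunLike.congr_fun (hψ.eq_of_eq (f := (hψ.extendDual (φ i) ∘ₗ ract X (op l)).toAddMonoidHom)
      (g := (LinearMap.mulRight k l ∘ₗ hψ.extendDual (φ i)).toAddMonoidHom) fun d l' => ?_) y
    change hψ.extendDual (φ i) (ract X (op l) (ract X (op l') (ψ d))) = hψ.extendDual (φ i) _ * l
    rw [← ract_mul, hψ.extendDual_apply (hφ i), hψ.extendDual_apply (hφ i), mul_assoc]
  · refine hψ.induction (p := fun y => ∑ i, ract X (op (hψ.extendDual (φ i) y)) (ψ (x i)) = y) y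
      (fun d l => ?_) ?_ fun y z hy hz => ?_
    · simp_rw [fun i => hψ.extendDual_apply (hφ i) d l, ract_mul, ← hψ.map_ract]
      rw [← map_sum, ← map_sum, h1]
    · simp
    · simp_rw [map_add, ract_add, Finset.sum_add_distrib, hy, hz]
  · obtain ⟨ι', hι', y, χ, hχ, h2⟩ := hD.generator
    refine ⟨ι', hι', fun i => ψ (y i), fun i => hψ.extendDual (χ i), fun i l y => ?_, ?_⟩
    · refine DFunLike.congr_fun (hψ.eq_of_eq (f := (hψ.extendDual (χ i) ∘ₗ ract X (op l)).toAddMonoidHom)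
        (g := (LinearMap.mulRight k l ∘ₗ hψ.extendDual (χ i)).toAddMonoidHom) fun d l' => ?_) y
      change hψ.extendDual (χ i) (ract X (op l) (ract X (op l') (ψ d))) = hψ.extendDual (χ i) _ * l
      rw [← ract_mul, hψ.extendDual_apply (hχ i), hψ.extendDual_apply (hχ i), mul_assoc]
    · have h3 (i : ι') : hψ.extendDual (χ i) (ψ (y i)) = P.i (χ i (y i)) := by
        have := hψ.extendDual_apply (hχ i) (y i) 1
        rwa [op_one, map_one, mul_one] at this
      simp_rw [h3]
      rw [← map_sum, h2, map_one]
  · -- `X = H ⊗ D`, and `Σ h ⊗ a` in `H ⊗ A = Λ` takes `ψ(d)` to `Σ h ⊗ a d`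
    obtain ⟨t, rfl⟩ := (P.ν hS).surjective l
    rw [eq_zero_of_coord (t := t), map_zero]
    refine fun s => hD.faithful _ fun d => ?_
    have h4 := hl (ψ d)
    rw [hψ.lact_ν hS, LinearEquiv.map_eq_zero_iff] at h4
    have h5 := congrArg (coord k H D s) h4
    rwa [coord_lTensor, map_zero] at h5
  · -- the coordinates of `d ↦ u(ψ(d))` in `H ⊗ D` are endomorphisms of `D`, hence multiplications by
    -- elements `a s` of `A`; finitely many of them are nonzero because `D` is finitely generated
    have hu' (s : BasisIndex k H) : ∃ a, ∀ d,
        coord k H D s ((hψ.leftEquiv hS).symm (u (ψ d))) = lact D a d :=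
      hD.full (coord k H D s ∘ₗ (hψ.leftEquiv hS).symm.toLinearMap ∘ₗ u ∘ₗ ψ) fun b d => by
        change coord k H D s ((hψ.leftEquiv hS).symm (u (ψ _))) =
          ract D (op b) (coord k H D s ((hψ.leftEquiv hS).symm (u (ψ d))))
        rw [hψ.map_ract, hu, leftEquiv_symm_ract, coord_lTensor]
    choose a ha using hu'
    choose T hT using fun i => exists_coord_support ((hψ.leftEquiv hS).symm (u (ψ (x i))))
    have ha0 (s) (hs : s ∉ Finset.univ.biUnion T) : a s = 0 := by
      refine hD.faithful _ fun d => ?_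
      rw [← h1 d, map_sum]
      refine Finset.sum_eq_zero fun i _ => ?_
      rw [lact_ract, ← ha, hT i s fun h => hs (Finset.mem_biUnion.2 ⟨i, Finset.mem_univ i, h⟩),
        map_zero]
    refine ⟨P.ν hS (∑ s ∈ Finset.univ.biUnion T, basis k H s ⊗ₜ a s), fun y => ?_⟩
    refine DFunLike.congr_fun (hψ.eq_of_eq (f := u.toAddMonoidHom)
      (g := (lact X _).toAddMonoidHom) fun d l => ?_) y
    change u (ract X (op l) (ψ d)) = lact X _ (ract X (op l) (ψ d))
    rw [hu, lact_ract, hψ.lact_ν hS]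
    congr 1
    rw [← LinearEquiv.symm_apply_eq,
      eq_sum_coord (T := Finset.univ.biUnion T) (t := (hψ.leftEquiv hS).symm (u (ψ d)))
        (fun s hs => by rw [ha, ha0 s hs, map_zero, LinearMap.zero_apply]), map_sum]
    exact Finset.sum_congr rfl fun s _ => congrArg _ (ha s d)

include hS in
/-- Conversely, the properties descend from `D ♯ ^σH` to `D`. -/
theorem isMorita_of_isMorita (hX : IsMorita X) : IsMorita D := by
  classical
  obtain ⟨ι, hι, x, φ, hφ, h1⟩ := hX.dualBasis
  refine ⟨?_, ?_, fun a ha => ?_, fun u hu => ?_⟩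
  · -- `D` is finitely generated over `A`
    obtain ⟨κ, hκ, y, hy⟩ : ∃ (κ : Type u) (_ : Fintype κ) (y : κ → D),
        ∀ d, ∃ a : κ → A, d = ∑ i, ract D (op (a i)) (y i) := by
      choose t ht using fun i => hψ.bijective.2 (x i)
      choose κ hκ y l hl using fun i => exists_fintype_sum (t i)
      refine ⟨Σ i, κ i, inferInstance, fun p => y p.1 p.2, fun d =>
        ⟨fun p => P.counitRight (P.j (l p.1 p.2) * φ p.1 (ψ d)), ?_⟩⟩
      have h2 := congrArg hψ.counitRight (h1 (ψ d))
      have h3 := hψ.counitRight_apply d 1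
      have h4 : P.counitRight 1 = 1 := by rw [← map_one P.i, P.counitRight_i]
      rw [op_one, map_one, h4, op_one, map_one] at h3
      refine h3.symm.trans (h2.symm.trans ?_)
      rw [map_sum, Fintype.sum_sigma]
      refine Finset.sum_congr rfl fun i _ => ?_
      rw [← ht i, hl i, map_sum, map_sum, map_sum]
      refine Finset.sum_congr rfl fun j _ => ?_
      rw [rExt_tmul, ← ract_mul, hψ.counitRight_apply]
    -- a functional `X → Λ = H ⊗ A` restricts to functionals `D → A`, its coordinates; together they
    -- have finite support on a finite set of generators
    choose T hT using fun p : ι × κ => exists_coord_support ((P.ν hS).symm (φ p.1 (ψ (y p.2))))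
    let T' := Finset.univ.biUnion T
    let f (i : ι) (s : BasisIndex k H) : D →ₗ[k] A :=
      coord k H A s ∘ₗ (P.ν hS).symm.toLinearMap ∘ₗ φ i ∘ₗ ψ
    have hf (i : ι) (s : BasisIndex k H) (b : A) (d : D) : f i s (ract D (op b) d) = f i s d * b := by
      change coord k H A s ((P.ν hS).symm (φ i (ψ _))) = coord k H A s ((P.ν hS).symm (φ i (ψ d))) * b
      have h2 (l : Λ) : (P.ν hS).symm (l * P.i b) =
          LinearMap.lTensor H (LinearMap.mulRight k b) ((P.ν hS).symm l) := by
        rw [LinearEquiv.symm_apply_eq, ← ν_mul_i, LinearEquiv.apply_symm_apply]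
      rw [hψ.map_ract, hφ, h2, coord_lTensor, LinearMap.mulRight_apply]
    have hf0 (i : ι) (s) (hs : s ∉ T') (d : D) : f i s d = 0 := by
      obtain ⟨a, rfl⟩ := hy d
      rw [map_sum]
      refine Finset.sum_eq_zero fun j _ => ?_
      rw [hf, show f i s (y j) = 0 from hT (i, j) s fun h =>
        hs (Finset.mem_biUnion.2 ⟨(i, j), Finset.mem_univ _, h⟩), zero_mul]
    refine ⟨ι × T', inferInstance, fun p =>
      hψ.counitLeft hS (ract X (op (P.j (basis k H p.2))) (x p.1)), fun p => f p.1 p.2,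
      fun p => hf p.1 p.2, fun d => ?_⟩
    refine Eq.trans ?_ (hψ.counitLeft_ψ hS d)
    refine Eq.trans ?_ (congrArg (hψ.counitLeft hS) (h1 (ψ d)))
    rw [map_sum, Fintype.sum_prod_type]
    refine Finset.sum_congr rfl fun i _ => ?_
    have h2 : φ i (ψ d) = ∑ s ∈ T', P.j (basis k H s) * P.i (f i s d) := by
      rw [← (P.ν hS).apply_symm_apply (φ i (ψ d)),
        eq_sum_coord (T := T') (t := (P.ν hS).symm (φ i (ψ d))) fun s hs => hf0 i s hs d, map_sum]
      exact Finset.sum_congr rfl fun s _ => P.ν_tmul hS _ _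
    rw [h2, ract_sum, map_sum, ← Finset.sum_coe_sort T']
    refine Finset.sum_congr rfl fun s _ => ?_
    rw [ract_mul, counitLeft_ract]
  · obtain ⟨ι', hι', z, χ, hχ, h2⟩ := hX.generator
    choose t ht using fun i => (hψ.leftEquiv hS).surjective (z i)
    choose κ hκ l y hl using fun i => exists_fintype_sum (t i)
    refine ⟨Σ i, κ i, inferInstance, fun p => y p.1 p.2, fun p =>
      P.counitLeft hS ∘ₗ χ p.1 ∘ₗ lact X (P.j (l p.1 p.2)) ∘ₗ ψ, fun p b d => ?_, ?_⟩
    · change P.counitLeft hS (χ _ (lact X _ (ψ (ract D (op b) d)))) =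
        P.counitLeft hS (χ _ (lact X _ (ψ d))) * b
      rw [hψ.map_ract, lact_ract, hχ, counitLeft_mul_i]
    · rw [← P.counitLeft_one hS, ← h2, map_sum, Fintype.sum_sigma]
      refine Finset.sum_congr rfl fun i _ => ?_
      rw [← ht i, hl i, map_sum, map_sum, map_sum]
      rfl
  · have h2 : P.i a = 0 := hX.faithful _ fun y => by
      refine hψ.induction (p := fun y => lact X (P.i a) y = 0) y (fun d l => ?_) (map_zero _) fun y z hy hz => ?_
      · rw [lact_ract, ← hψ.map_lact, ha, map_zero, map_zero]
      · rw [map_add, hy, hz, add_zero]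
    rw [← P.counitRight_i a, h2, map_zero]
  · obtain ⟨l, hl⟩ := hX.full (hψ.extendEnd u) fun l y => by
      refine DFunLike.congr_fun (hψ.eq_of_eq (f := (hψ.extendEnd u ∘ₗ ract X (op l)).toAddMonoidHom)
        (g := (ract X (op l) ∘ₗ hψ.extendEnd u).toAddMonoidHom) fun d l' => ?_) y
      change hψ.extendEnd u (ract X (op l) (ract X (op l') (ψ d))) =
        ract X (op l) (hψ.extendEnd u (ract X (op l') (ψ d)))
      rw [← ract_mul, hψ.extendEnd_apply hu, hψ.extendEnd_apply hu, ract_mul]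
    obtain ⟨t, rfl⟩ := (P.ν hS).surjective l
    refine ⟨P.counitLeft hS (P.ν hS t), fun d => ?_⟩
    have h2 := hψ.extendEnd_apply hu d 1
    rw [op_one, map_one] at h2
    have h3 : ψ (u d) = lact X (P.ν hS t) (ψ d) := h2.symm.trans (hl (ψ d))
    rw [← hψ.counitLeft_ψ hS (u d), h3, hψ.lact_ν hS, counitLeft_leftEquiv]
    refine LinearMap.congr_fun (f := (TensorProduct.lid k D).toLinearMap ∘ₗ LinearMap.rTensor D counit ∘ₗ
      LinearMap.lTensor H ((lact D).toLinearMap.flip d))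
      (g := (lact D).toLinearMap.flip d ∘ₗ P.counitLeft hS ∘ₗ (P.ν hS).toLinearMap)
      (TensorProduct.ext' fun h a => ?_) t
    change counit (R := k) h • lact D a d = lact D (P.counitLeft hS (P.ν hS (h ⊗ₜ a))) d
    rw [counitLeft_ν, map_smul]
    rfl
end Left

end IsTwistedInduction
end Transfer
end SmashDuality

/-! ### Duality for `Λ`, for `A` and for `H` -/

namespace SmashDuality
section Duality
open MulOpposite HopfAlgebra Abelian
variable {k H A : Type u} [Field k] [Ring H] [HopfAlgebra k H] [Ring A] [Algebra k A]
  {α : HopfAction k H A} {Λ : Type u} [Ring Λ] [Algebra k Λ] (P : SmashPair α Λ)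

lemma IsMorita.nontrivial [Nontrivial A] {D : Bimod k A} (hD : IsMorita D) : Nontrivial D := by
  obtain ⟨ι, hι, y, ψ, -, h⟩ := hD.generator
  by_contra hn
  rw [not_nontrivial_iff_subsingleton] at hn
  refine one_ne_zero (α := A) (h.symm.trans (Finset.sum_eq_zero fun i _ => ?_))
  rw [Subsingleton.elim (y i) 0, map_zero]

include k in
variable (k H) in
lemma nontrivial_of_hopfAlgebra : Nontrivial H :=
  ⟨1, 0, fun h => one_ne_zero (α := k) (by rw [← Bialgebra.counit_one (R := k) (A := H), h, map_zero])⟩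

lemma nontrivial_tensor {V W : Type u} [AddCommGroup V] [Module k V] [AddCommGroup W] [Module k W]
    (hV : Nontrivial V) (hW : Nontrivial W) : Nontrivial (V ⊗[k] W) := inferInstance

namespace SmashPair
variable (hS : Function.Bijective (HopfAlgebra.antipode k (A := H))) {p q n : ℕ} (h : p + q = n)

/-- Right multiplication by `λ` on the elements `e Φ(x) j(l)` does not involve `e`. -/
lemma exists_ract_prodMap (l : Λ) (m : ExtBimod k A q ⊗[k] H) :
    ∃ m', ∀ e : RX (trivialModule k H) p, ract (ExtBimod k Λ n) (op l) (P.prodMap hS h (e ⊗ₜ m)) =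
      P.prodMap hS h (e ⊗ₜ m') := by
  obtain ⟨m', hm'⟩ : ∃ m', ract (P.W q) (op l) (P.rExt (P.Φ hS q) m) = P.rExt (P.Φ hS q) m' := by
    induction m using TensorProduct.induction_on with
    | zero => exact ⟨0, by simp⟩
    | add x y hx hy =>
      obtain ⟨x', hx⟩ := hx
      obtain ⟨y', hy⟩ := hy
      exact ⟨x' + y', by rw [map_add, map_add, map_add, hx, hy]⟩
    | tmul d h =>
      obtain ⟨v, hv⟩ := P.μ.surjective (P.j h * l)
      refine ⟨pushRight H _ d v, ?_⟩
      rw [rExt_tmul, ← ract_mul, ← hv]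
      exact (P.rExt_pushRight (P.Φ₀_ract hS q) d v).symm
  refine ⟨m', fun e => ?_⟩
  rw [prodMap_tmul, prodMap_tmul, ← hm', prod_ract]

lemma lact_i_prodMap (a : A) (z : RX (trivialModule k H) p ⊗[k] (ExtBimod k A q ⊗[k] H)) :
    lact (ExtBimod k Λ n) (P.i a) (P.prodMap hS h z) =
      P.prodMap hS h (LinearMap.lTensor _ (leftRep H (lact (ExtBimod k A q)) a) z) := by
  refine LinearMap.congr_fun (f := lact (ExtBimod k Λ n) (P.i a) ∘ₗ P.prodMap hS h)
    (g := P.prodMap hS h ∘ₗ LinearMap.lTensor _ (leftRep H (lact (ExtBimod k A q)) a))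
    (TensorProduct.ext' fun e m => ?_) z
  change lact _ (P.i a) (P.prodMap hS h (e ⊗ₜ m)) = P.prodMap hS h (e ⊗ₜ leftRep H _ a m)
  rw [prodMap_tmul, prodMap_tmul, ← prod_lact]
  exact congrArg (P.prod h e) (P.lact_i_rExt (P.Φ₀_lact hS q) a m)

/-- The map `e ⊗ (x ⊗ l) ↦ e l ⊗ x`. -/
def absorb (E : Type u) [AddCommGroup E] [Module k E] (R : E →ₗ[k] H →ₗ[k] E)
    (V : Type u) [AddCommGroup V] [Module k V] : E ⊗[k] (V ⊗[k] H) →ₗ[k] E ⊗[k] V :=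
  LinearMap.rTensor V (TensorProduct.lift R) ∘ₗ (TensorProduct.assoc k E H V).symm.toLinearMap ∘ₗ
    LinearMap.lTensor E (TensorProduct.comm k V H).toLinearMap

lemma absorb_tmul (E : Type u) [AddCommGroup E] [Module k E] (R : E →ₗ[k] H →ₗ[k] E)
    (V : Type u) [AddCommGroup V] [Module k V] (e : E) (x : V) (l : H) :
    absorb E R V (e ⊗ₜ (x ⊗ₜ l)) = R e l ⊗ₜ x := rfl

/-- The right action of `H` on `Ext_H(k, H)`. -/
def opActLin (M : ModuleCat.{u} H) (p : ℕ) : RX M p →ₗ[k] H →ₗ[k] RX M p :=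
  ((Algebra.lsmul k k (RX M p)).toLinearMap ∘ₗ opLin).flip

lemma opActLin_apply {M : ModuleCat.{u} H} {p : ℕ} (e : RX M p) (h : H) :
    opActLin (k := k) M p e h = op h • e := rfl

lemma cv_op_smul (e : RX (trivialModule k H) p) (u : H) :
    cv (opActLin (k := k) (trivialModule k H) p).flip (antipodeSq k H) (opAct e ∘ₗ antipode k) u =
      counit (R := k) u • e := by
  have h1 := LinearMap.congr_fun (cv_antipode_mul (AlgHom.id k H)) u
  have h2 := congrArg (fun x => op (antipode k x) • e) h1
  rw [cunit_apply] at h2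
  refine Eq.trans ?_ (h2.trans ?_)
  · refine (map_cv (B' := (opActLin (k := k) (trivialModule k H) p).flip) (f' := antipodeSq k H)
      (g' := opAct e ∘ₗ antipode k) (opAct e ∘ₗ antipode k) (fun x y => ?_) u).symm
    change op (antipode k (antipode k x * y)) • e =
      op (antipode k (antipode k x)) • op (antipode k y) • e
    rw [antipode_mul_antidistrib, op_mul, mul_smul]
  · rw [map_smul, antipode_one, op_smul, op_one, smul_assoc, one_smul]

variable (hb : Function.Bijective (P.prodMap hS h))
include hb

/-- Left multiplication by an element of `Λ`, followed by `e ⊗ x ⊗ l ↦ e l ⊗ x`, takes `e ⊗ x ⊗ 1`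
to some `e ⊗ y`: the elements of `H` that act on `e` collapse to the counit. -/
lemma exists_absorb (β : EquivariantStr α (antipodeSq k H) (ExtBimod k A q))
    (hβ : ∀ u x, P.starW q u (P.Φ hS q x) = P.Φ hS q (β.act u x)) (l : Λ)
    (e : RX (trivialModule k H) p) (x : ExtBimod k A q) : ∃ y : ExtBimod k A q,
      ∀ z, P.prodMap hS h z = lact (ExtBimod k Λ n) l (P.prodMap hS h (e ⊗ₜ (x ⊗ₜ 1))) →
        absorb _ (opActLin (k := k) _ p) _ z = e ⊗ₜ[k] y := by
  refine P.induction (p := fun l => ∃ y : ExtBimod k A q,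
      ∀ z, P.prodMap hS h z = lact (ExtBimod k Λ n) l (P.prodMap hS h (e ⊗ₜ (x ⊗ₜ 1))) →
        absorb _ (opActLin (k := k) _ p) _ z = e ⊗ₜ[k] y) l (fun a u => ?_) ?_ fun l l' hl hl' => ?_
  · refine ⟨lact _ a (β.act u x), fun z hz => ?_⟩
    rw [map_mul, Module.End.mul_apply, ← lj_apply, P.lj_prodMap hS h β hβ, lact_i_prodMap] at hz
    rw [hb.1 hz]
    let T := absorb _ (opActLin (k := k) (trivialModule k H) p) (ExtBimod k A q) ∘ₗ
      LinearMap.lTensor _ (leftRep H (lact (ExtBimod k A q)) a)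
    have h1 : (twistedDiag β.act).toLinearMap.flip (x ⊗ₜ (1 : H)) =
        cv (TensorProduct.mk k _ H) (β.act.toLinearMap.flip x) (antipodeSq k H) := by
      refine LinearMap.ext fun u => (diagRep_tmul _ _ u x 1).trans ?_
      rw [cv_apply, cv_apply]
      exact Finset.sum_congr rfl fun i _ => congrArg (_ ⊗ₜ[k] ·) (mul_one _)
    have h2 : cv (opActLin (k := k) (trivialModule k H) p).flip (antipodeSq k H)
        (opAct e ∘ₗ antipode k) = LinearMap.toSpanSingleton k _ e ∘ₗ counit :=
      LinearMap.ext fun u => cv_op_smul e u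
    have h3 := map_cv (B := (TensorProduct.mk k (RX (trivialModule k H) p) _).flip)
      (f := (twistedDiag β.act).toLinearMap.flip (x ⊗ₜ (1 : H))) (g := opAct e ∘ₗ antipode k)
      (B' := (TensorProduct.mk k _ _).flip.compr₂ T) T (fun x y => rfl) u
    refine h3.trans ?_
    rw [h1, cv_assoc (C := (TensorProduct.mk k (RX (trivialModule k H) p) (ExtBimod k A q)).flip ∘ₗ
      lact _ a) (C' := (opActLin (k := k) (trivialModule k H) p).flip) (fun x y z => rfl), h2,
      cv_counit_right]
    rfl
  · refine ⟨0, fun z hz => ?_⟩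
    rw [map_zero, LinearMap.zero_apply, ← map_zero (P.prodMap hS h)] at hz
    rw [hb.1 hz, map_zero, TensorProduct.tmul_zero]
  · obtain ⟨y, hy⟩ := hl
    obtain ⟨y', hy'⟩ := hl'
    refine ⟨y + y', fun z hz => ?_⟩
    obtain ⟨w, hw⟩ := hb.2 (lact (ExtBimod k Λ n) l (P.prodMap hS h (e ⊗ₜ (x ⊗ₜ 1))))
    obtain ⟨w', hw'⟩ := hb.2 (lact (ExtBimod k Λ n) l' (P.prodMap hS h (e ⊗ₜ (x ⊗ₜ 1))))
    rw [map_add, LinearMap.add_apply, ← hw, ← hw', ← map_add] at hz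
    rw [hb.1 hz, map_add, hy w hw, hy' w' hw', TensorProduct.tmul_add]

/-- If left multiplications exhaust the right `Λ`-linear endomorphisms of
`Ext_{Λ^e}(Λ, Λ^e) ≃ E ⊗ D ⊗ H`, where `E = Ext_H(k, H)`, then every vector of `E` is an
eigenvector of every `f ∈ End(E)`, by comparison of `f ⊗ id` with a left multiplication. -/
lemma exists_eq_smul (β : EquivariantStr α (antipodeSq k H) (ExtBimod k A q))
    (hβ : ∀ u x, P.starW q u (P.Φ hS q x) = P.Φ hS q (β.act u x))
    (hX : IsMorita (ExtBimod k Λ n)) (hD : Nontrivial (ExtBimod k A q))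
    {e : RX (trivialModule k H) p} (he : e ≠ 0) (e' : RX (trivialModule k H) p) :
    ∃ c : k, e' = c • e := by
  obtain ⟨x, hx⟩ := exists_ne (0 : ExtBimod k A q)
  have dual {V : Type u} [AddCommGroup V] [Module k V] {v : V} (hv : v ≠ 0) :
      ∃ ξ : V →ₗ[k] k, ξ v = 1 := by
    obtain ⟨ξ, hξ⟩ := not_forall.1 (mt (Module.forall_dual_apply_eq_zero_iff k v).1 hv)
    exact ⟨(ξ v)⁻¹ • ξ, inv_mul_cancel₀ hξ⟩
  obtain ⟨ζ, hζ⟩ := dual he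
  obtain ⟨ξ, hξ⟩ := dual hx
  let f : RX (trivialModule k H) p →ₗ[k] RX (trivialModule k H) p := ζ.smulRight e'
  have hf : f e = e' := by simp [f, hζ]
  let E := LinearEquiv.ofBijective _ hb
  let F : ExtBimod k Λ n →ₗ[k] ExtBimod k Λ n :=
    E.toLinearMap ∘ₗ LinearMap.rTensor _ f ∘ₗ E.symm.toLinearMap
  have hF (e m) : F (P.prodMap hS h (e ⊗ₜ m)) = P.prodMap hS h (f e ⊗ₜ m) := by
    change E (LinearMap.rTensor _ f (E.symm (E (e ⊗ₜ m)))) = _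
    rw [E.symm_apply_apply]
    rfl
  obtain ⟨l, hl⟩ := hX.full F fun b y => by
    obtain ⟨z, rfl⟩ := hb.2 y
    refine LinearMap.congr_fun (f := F ∘ₗ ract (ExtBimod k Λ n) (op b) ∘ₗ P.prodMap hS h)
      (g := ract (ExtBimod k Λ n) (op b) ∘ₗ F ∘ₗ P.prodMap hS h)
      (TensorProduct.ext' fun e m => ?_) z
    obtain ⟨m', hm'⟩ := P.exists_ract_prodMap hS h b m
    change F (ract _ (op b) (P.prodMap hS h (e ⊗ₜ m))) =
      ract (ExtBimod k Λ n) (op b) (F (P.prodMap hS h (e ⊗ₜ m)))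
    rw [hF, hm', hm', hF]
  obtain ⟨y, hy⟩ := P.exists_absorb hS h hb β hβ l e x
  have h1 := hy (f e ⊗ₜ (x ⊗ₜ 1)) ((hF e _).symm.trans (hl _))
  rw [absorb_tmul, opActLin_apply, op_one, one_smul, hf] at h1
  have h2 := congrArg ((TensorProduct.rid k (RX (trivialModule k H) p)).toLinearMap ∘ₗ
    LinearMap.lTensor _ ξ) h1
  refine ⟨ξ y, ?_⟩
  change ξ x • e' = ξ y • e at h2
  rwa [hξ, one_smul] at h2

end SmashPair

/-- If `Ext^d_H(k, H)` is spanned by a nonzero `e`, then `e h = π(h) e` for a character `π`. -/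
lemma exists_isLeftHomologicalIntegral {d : ℕ}
    (hv : ∀ i, i ≠ d → Subsingleton (RX (trivialModule k H) i)) {e : RX (trivialModule k H) d}
    (he : e ≠ 0) (hs : ∀ x : RX (trivialModule k H) d, ∃ c : k, x = c • e) :
    ∃ π : H →ₐ[k] k, IsLeftHomologicalIntegral d π := by
  choose c hc using hs
  have inj {a b : k} (h : a • e = b • e) : a = b := smul_left_injective k he h
  let π₀ : H →ₗ[k] k :=
    { toFun := fun h => c (op h • e)
      map_add' := fun a b => inj (by
        rw [← hc, add_smul, ← hc, ← hc, MulOpposite.op_add, add_smul])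
      map_smul' := fun a b => inj (by
        rw [← hc, RingHom.id_apply, smul_eq_mul, mul_smul, ← hc, op_smul, smul_assoc]) }
  have hπ (h : H) : op h • e = π₀ h • e := hc _
  let π : H →ₐ[k] k := AlgHom.ofLinearMap π₀
    (inj (by rw [← hπ, op_one, one_smul, one_smul]))
    (fun a b => inj (by rw [← hπ, op_mul, mul_smul, hπ, smul_comm, hπ, smul_smul]))
  refine ⟨π, hv, ⟨e, he, fun x => ⟨c x, (hc x).trans (algebraMap_smul Hᵐᵒᵖ (c x) e).symm⟩⟩,
    fun h x => ?_⟩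
  refine Eq.trans ?_ (algebraMap_smul Hᵐᵒᵖ (π h) (M := RX (trivialModule k H) d) x).symm
  change op h • (show RX (trivialModule k H) d from x) = π h • (show RX (trivialModule k H) d from x)
  rw [hc x, smul_comm, hπ, smul_comm]
  rfl

namespace SmashPair
variable (hS : Function.Bijective (HopfAlgebra.antipode k (A := H)))
  (hA : HomologicallySmooth k A) (hH : HomologicallySmooth k H)
include hS hA hH P

/-- Duality for `Λ` from duality for `A` and the one-dimensionality of `Ext_H(k, H)`. -/
theorem hasVanDenBerghDuality {p q : ℕ} (hd : ∀ m, m ≠ q → Subsingleton (ExtBimod k A m))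
    (hM : IsMorita (ExtBimod k A q)) {π : H →ₐ[k] k} (hπ : IsLeftHomologicalIntegral p π) :
    HasVanDenBerghDuality k Λ (p + q) := by
  have hA' := homologicallySmooth_iff.1 hA
  have hH' := thickClosure_trivialModule hH
  have hR := exists_equivariantResolution α
  refine ⟨P.homologicallySmooth hS hA hH, fun i hi => ?_, ?_⟩
  · by_contra hn
    rw [not_subsingleton_iff_nontrivial] at hn
    obtain ⟨p', q', h, h1, h2⟩ := P.exists_nontrivial hS hA' hH' hR hn
    have hp : p' = p := by
      by_contra hp
      exact not_subsingleton_iff_nontrivial.2 h1 (hπ.vanishing p' hp)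
    have hq : q' = q := by
      by_contra hq
      exact not_subsingleton_iff_nontrivial.2 h2 (hd q' hq)
    exact hi (by rw [← h, hp, hq])
  · obtain ⟨β, -, hβ⟩ := P.exists_equivariantStr hS hA' hR q
    obtain ⟨ψ, hψ⟩ := P.isTwistedInduction hS rfl hA' hH' hR hd β hβ hπ
    exact isInvertible_iff_isMorita.2 (hψ.isMorita hS hM)

/-- Duality for `Λ` splits into duality for `A` and the one-dimensionality of `Ext_H(k, H)`. -/
theorem exists_of_hasVanDenBerghDuality [Nontrivial A] {m : ℕ}
    (hV : HasVanDenBerghDuality k Λ m) :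
    ∃ p q, p + q = m ∧ HasVanDenBerghDuality k A q ∧
      ∃ π : H →ₐ[k] k, IsLeftHomologicalIntegral p π := by
  have hA' := homologicallySmooth_iff.1 hA
  have hH' := thickClosure_trivialModule hH
  have hR := exists_equivariantResolution α
  have hX := isInvertible_iff_isMorita.1 hV.invertible
  have hΛ : Nontrivial Λ := (show Function.Injective P.i from
    Function.LeftInverse.injective P.counitRight_i).nontrivial
  have hHn := nontrivial_of_hopfAlgebra k H
  obtain ⟨p, q, h, hE, hD⟩ := P.exists_nontrivial hS hA' hH' hR hX.nontrivial
  -- the product of two nonzero groups in degrees `p'` and `q'` forces `p' + q' = m`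
  have key (p' q' : ℕ) (hE : Nontrivial (RX (trivialModule k H) p'))
      (hD : Nontrivial (ExtBimod k A q')) : p' + q' = m := by
    by_contra hn
    have := nontrivial_tensor (k := k) hE (nontrivial_tensor (k := k) hD hHn)
    have h1 := (P.prodMap_injective hS (n := p' + q') rfl hA' hH' hR).nontrivial
    exact not_subsingleton_iff_nontrivial.2 h1 (hV.vanishing _ hn)
  have hd (q') (hq : q' ≠ q) : Subsingleton (ExtBimod k A q') := by
    by_contra hn
    rw [not_subsingleton_iff_nontrivial] at hn
    exact hq (by have := key p q' hE hn; lia)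
  have hv (p') (hp : p' ≠ p) : Subsingleton (RX (trivialModule k H) p') := by
    by_contra hn
    rw [not_subsingleton_iff_nontrivial] at hn
    exact hp (by have := key p' q hn hD; lia)
  obtain ⟨β, -, hβ⟩ := P.exists_equivariantStr hS hA' hR q
  obtain ⟨e, he⟩ := exists_ne (0 : RX (trivialModule k H) p)
  obtain ⟨π, hπ⟩ := exists_isLeftHomologicalIntegral hv he
    (P.exists_eq_smul hS h (P.prodMap_bijective hS h hA' hH' hR hd) β hβ hX hD he)
  obtain ⟨ψ, hψ⟩ := P.isTwistedInduction hS h hA' hH' hR hd β hβ hπ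
  exact ⟨p, q, h, ⟨hA, hd, isInvertible_iff_isMorita.2 (hψ.isMorita_of_isMorita hS hX)⟩, π, hπ⟩
end SmashPair

section Trivial
variable (k)

/-- `k`, as a bimodule over itself, is the regular module of `k ⊗ k^op`. -/
def selfIso : selfBimod k k ≅ regular (Env k k) := by
  refine (mkIso (M := regular (Env k k)) (N := selfBimod k k)
    (((TensorProduct.congr (LinearEquiv.refl k k) (MulOpposite.opLinearEquiv k).symm).trans
      (TensorProduct.lid k k)).toAddEquiv.trans (toSelf (k := k) k)) fun r x => ?_).symm
  let f : Env k k →ₗ[k] k := ((TensorProduct.congr (LinearEquiv.refl k k)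
    (MulOpposite.opLinearEquiv k).symm).trans (TensorProduct.lid k k)).toLinearMap
  suffices h : ∀ y : Env k k, toSelf (k := k) k (f (r * y)) = r • toSelf (k := k) k (f y) from h x
  intro y
  induction r using TensorProduct.induction_on with
  | zero =>
    rw [zero_mul, map_zero, map_zero]
    exact (zero_smul (Env k k) (A := selfBimod k k) _).symm
  | add r s hr hs =>
    rw [add_mul, map_add, map_add, hr, hs]
    exact (add_smul r s (toSelf (k := k) k (f y))).symm
  | tmul a b =>
    refine Eq.trans (congrArg (toSelf k) ?_) (smul_toSelf (k := k) a b.unop (f y)).symm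
    induction y using TensorProduct.induction_on with
    | zero => simp
    | add y z hy hz => rw [mul_add, map_add, hy, hz, map_add, mul_add, add_mul]
    | tmul c d =>
      rw [Algebra.TensorProduct.tmul_mul_tmul]
      change (a * c) * (d.unop * b.unop) = a * (c * d.unop) * b.unop
      ring

lemma homologicallySmooth_self : HomologicallySmooth k k :=
  homologicallySmooth_iff.2 (thickClosure_of_iso (selfIso k).symm .base)

lemma subsingleton_extBimod_self {q : ℕ} (hq : q ≠ 0) : Subsingleton (ExtBimod k k q) := by
  obtain ⟨n, rfl⟩ := Nat.exists_eq_succ_of_ne_zero hq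
  have : Projective (regular (Env k k)) := inferInstanceAs (Projective (ModuleCat.of _ _))
  have : Projective (selfBimod k k) := Projective.of_iso (selfIso k).symm this
  have h := Ext.subsingleton_of_projective (selfBimod k k) (regular (Env k k)) n
  exact (toXB (M := selfBimod k k)).symm.injective.subsingleton

lemma exists_algebraMap_env (r : Env k k) : ∃ c : k, r = algebraMap k (Env k k) c := by
  induction r using TensorProduct.induction_on with
  | zero => exact ⟨0, (map_zero _).symm⟩
  | add x y hx hy =>
    obtain ⟨c, rfl⟩ := hx
    obtain ⟨d, rfl⟩ := hy
    exact ⟨c + d, (map_add _ c d).symm⟩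
  | tmul a b =>
    refine ⟨a * b.unop, ?_⟩
    rw [Algebra.TensorProduct.algebraMap_apply, Algebra.algebraMap_self, RingHom.id_apply,
      mul_comm, ← smul_eq_mul, ← TensorProduct.smul_tmul', ← TensorProduct.tmul_smul]
    congr 1
    exact congrArg op (mul_one b.unop).symm

lemma exists_extBimod_self : ∃ e : ExtBimod k k 0, e ≠ 0 ∧ ∀ x, ∃ c : k, x = c • e := by
  refine ⟨toXB (M := selfBimod k k) (Ext.mk₀ (selfIso k).hom), fun h => ?_, fun x => ?_⟩
  · have h1 : Ext.mk₀ (selfIso k).hom = 0 :=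
      (toXB (M := selfBimod k k)).injective (h.trans (map_zero toXB).symm)
    have h2 : (selfIso k).hom = 0 := (Ext.mk₀_bijective _ _).1 (h1.trans (Ext.mk₀_zero _ _).symm)
    have h3 : 𝟙 (regular (Env k k)) = 0 := by rw [← (selfIso k).inv_hom_id, h2, Limits.comp_zero]
    exact one_ne_zero (α := Env k k)
      (LinearMap.congr_fun (congrArg ModuleCat.Hom.hom h3) (1 : Env k k))
  · obtain ⟨x, rfl⟩ := (toXB (M := selfBimod k k)).surjective x
    obtain ⟨f, rfl⟩ := (Ext.mk₀_bijective _ _).2 x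
    obtain ⟨r, hr⟩ := exists_rMul ((selfIso k).inv ≫ f)
    obtain ⟨c, rfl⟩ := exists_algebraMap_env k r
    refine ⟨c, ?_⟩
    rw [(Iso.inv_comp_eq _).1 hr, ← Ext.mk₀_comp_mk₀]
    exact (algebra_smul_toXB (M := selfBimod k k) c _).symm

variable {k}

/-- A one-dimensional `k`-bimodule is invertible. -/
lemma isMorita_of_span_singleton {D : Bimod k k} {e : D} (he : e ≠ 0)
    (hs : ∀ x : D, ∃ c : k, x = c • e) : IsMorita D := by
  have hr (a : k) (d : D) : ract D (op a) d = a • d := ract_algebraMap D a d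
  have hl (a : k) (d : D) : lact D a d = a • d := LinearMap.congr_fun ((lact D).commutes a) d
  have inj {a b : k} (h : a • e = b • e) : a = b := smul_left_injective k he h
  choose c hc using hs
  let φ : D →ₗ[k] k :=
    { toFun := c
      map_add' := fun x y => inj (by rw [← hc, add_smul, ← hc, ← hc])
      map_smul' := fun a x => inj (by rw [← hc, RingHom.id_apply, smul_eq_mul, mul_smul, ← hc]) }
  have hφ (b : k) (d : D) : φ (ract D (op b) d) = φ d * b := by
    rw [hr, map_smul, smul_eq_mul, mul_comm]
  refine ⟨⟨PUnit, inferInstance, fun _ => e, fun _ => φ, fun _ => hφ, fun d => ?_⟩,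
    ⟨PUnit, inferInstance, fun _ => e, fun _ => φ, fun _ => hφ, ?_⟩, fun a ha => ?_, fun u _ => ?_⟩
  · rw [Fintype.sum_unique, hr]
    exact (hc d).symm
  · rw [Fintype.sum_unique]
    exact inj (by rw [one_smul]; exact (hc e).symm)
  · exact inj (by rw [← hl, ha, zero_smul])
  · refine ⟨φ (u e), fun d => ?_⟩
    rw [hl, hc d, map_smul, smul_comm]
    exact congrArg _ (hc (u e))

/-- `H` has Van den Bergh duality of dimension `d` if and only if `Ext_H(k, H)` is one-dimensional,
in degree `d`. This is the case `A = k` of the duality for smash products. -/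
theorem hasVanDenBerghDuality_iff_integral (hS : Function.Bijective (antipode k (A := H)))
    (hH : HomologicallySmooth k H) {d : ℕ} :
    HasVanDenBerghDuality k H d ↔ ∃ π : H →ₐ[k] k, IsLeftHomologicalIntegral d π := by
  have hk := homologicallySmooth_self k
  obtain ⟨e, he, hs⟩ := exists_extBimod_self k
  constructor
  · intro hV
    obtain ⟨p, q, h, hq, π, hπ⟩ :=
      (SmashPair.trivial k H).exists_of_hasVanDenBerghDuality hS hk hH hV
    have hn := (isInvertible_iff_isMorita.1 hq.invertible).nontrivial
    have hq0 : q = 0 := by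
      by_contra hq0
      exact not_subsingleton_iff_nontrivial.2 hn (subsingleton_extBimod_self k hq0)
    subst hq0
    rw [add_zero] at h
    exact ⟨π, h ▸ hπ⟩
  · rintro ⟨π, hπ⟩
    exact (SmashPair.trivial k H).hasVanDenBerghDuality hS hk hH
      (fun m hm => subsingleton_extBimod_self k hm) (isMorita_of_span_singleton he hs) hπ

end Trivial
end Duality
end SmashDuality

end

theorem theorem3 {k H A : Type u} [Field k] [Ring H] [HopfAlgebra k H]
    [Ring A] [Algebra k A] [Nontrivial A] (α : HopfAction k H A)
    (hS : Function.Bijective (HopfAlgebra.antipode k (A := H)))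
    (hA : HomologicallySmooth k A) (hH : HomologicallySmooth k H) :
    (((∃ n, HasVanDenBerghDuality k A n) ∧ (∃ d, HasVanDenBerghDuality k H d)) ↔
      ∃ m, HasVanDenBerghDuality k (Smash α) m) ∧
    ∀ n d, HasVanDenBerghDuality k A n → HasVanDenBerghDuality k H d →
      HasVanDenBerghDuality k (Smash α) (n + d) ∧
      Nonempty (EquivariantResolution α) ∧
      ∃ β : EquivariantStr α (antipodeSq k H) (ExtBimod k A n), β.IsCanonical ∧
      ∃ π : H →ₐ[k] k, IsLeftHomologicalIntegral d π ∧
      ∃ (σ : H ≃ₐ[k] H) (hσ : IsTwist σ),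
        (∀ h, antipodeSq k H (σ.symm h) = rightWinding π h) ∧
        Nonempty (ExtBimod k (Smash α) (n + d) ≅ smashTwist β σ hσ) := by
  have main (n d : ℕ) (hn : HasVanDenBerghDuality k A n) {π : H →ₐ[k] k}
      (hπ : IsLeftHomologicalIntegral d π) : HasVanDenBerghDuality k (Smash α) (n + d) := by
    rw [add_comm]
    exact (SmashPair.smash α).hasVanDenBerghDuality hS hA hH hn.vanishing
      (isInvertible_iff_isMorita.1 hn.invertible) hπ
  refine ⟨⟨?_, ?_⟩, fun n d hn hd => ?_⟩
  · rintro ⟨⟨n, hn⟩, d, hd⟩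
    obtain ⟨π, hπ⟩ := (hasVanDenBerghDuality_iff_integral hS hH).1 hd
    exact ⟨n + d, main n d hn hπ⟩
  · rintro ⟨m, hm⟩
    obtain ⟨p, q, -, hq, hp⟩ :=
      (SmashPair.smash α).exists_of_hasVanDenBerghDuality hS hA hH hm
    exact ⟨⟨q, hq⟩, p, (hasVanDenBerghDuality_iff_integral hS hH).2 hp⟩
  · obtain ⟨π, hπ⟩ := (hasVanDenBerghDuality_iff_integral hS hH).1 hd
    have hA' := homologicallySmooth_iff.1 hA
    have hR := exists_equivariantResolution α
    obtain ⟨β, hβ, hβ'⟩ := (SmashPair.smash α).exists_equivariantStr hS hA' hR n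
    obtain ⟨ψ, hψ⟩ := (SmashPair.smash α).isTwistedInduction hS (add_comm d n) hA'
      (thickClosure_trivialModule hH) hR hn.vanishing β hβ' hπ
    exact ⟨main n d hn hπ, hR, β, hβ, π, hπ, twistAut π hS, isTwist_twistAut π hS,
      antipodeSq_twistAut_symm π hS, hψ.nonempty_iso (isTwist_twistAut π hS)⟩
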